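/- **Conventions.** Let $\mathbb{k}\in\{\mathbb{R},\mathbb{C}\}$ be the field of values of functions ($\mathbb{k}=\mathbb{C}$ for complex valued functions). A manifold $X$ is a ($C^\infty$, real analytic or complex) manifold, and $\mathcal{O}_X$ is its sheaf of $\mathbb{k}$-valued ($C^\infty$, analytic or holomorphic) functions. A *DG manifold* $\mathfrak{X}=(X,\mathcal{O}_{\mathfrak{X}})$ is a manifold $X$ with a sheaf $\mathcal{O}_{\mathfrak{X}}$ of $\mathbb{Z}$-graded commutative differential graded $\mathbb{k}$-algebras which is, as a sheaf of graded algebras, locally isomorphic to $\mathcal{O}_X\otimes\mathrm{Sym}(E)$ with $E$ a finite-dimensional graded vector space. A map $\phi\colon\mathfrak{Y}\to\mathfrak{X}$ of DG manifolds is a map $\phi\colon Y\to X$ of manifolds with a morphism of sheaves of differential graded algebras $\phi^{-1}\mathcal{O}_{\mathfrak{X}}\to\mathcal{O}_{\mathfrak{Y}}$ which is compatible (modulo nilpotents) with $f\mapsto f\circ\phi$ on functions. $\mathcal{T}_{\mathfrak{X}}$ is the sheaf of graded $\mathbb{k}$-linear derivations of $\mathcal{O}_{\mathfrak{X}}$.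 An $\mathcal{O}_{\mathfrak{X}}$-*Lie algebroid* is a DG $\mathcal{O}_{\mathfrak{X}}$-module $\mathcal{A}$ with a DG Lie bracket and an anchor $\mathcal{A}\to\mathcal{T}_{\mathfrak{X}}$, a morphism of DG modules and of Lie algebras, satisfying the Leibniz rule. **Extensions.** For a Lie algebroid $\mathcal{B}$ on $\mathfrak{X}$ and $n\in\mathbb{Z}$, an $\mathcal{O}[n]$-*extension* of $\mathcal{B}$ is a Lie algebroid $\mathcal{A}$ with a closed central section $\mathfrak{c}$ of degree $-n$ (the marking) and a morphism of Lie algebroids $\mathcal{A}\to\mathcal{B}$ such that $$0\to\mathcal{O}_{\mathfrak{X}}[n]\xrightarrow{\ \cdot\mathfrak{c}\ }\mathcal{A}\to\mathcal{B}\to 0$$ is exact. Morphisms of extensions are the morphisms of Lie algebroids which preserve the markings and the maps to $\mathcal{B}$. This gives a category $\mathcal{O}\mathrm{Ext}_n(\mathcal{B})$. For extensions $\mathcal{A}_1,\dots,\mathcal{A}_m$ of $\mathcal{B}$ and $\lambda_1,\dots,\lambda_m\in\mathbb{k}$ ($m\ge 0$), the linear combination $\lambda_1\mathcal{A}_1\dotplus\cdots\dotplus\lambda_m\mathcal{A}_m$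 is the push-out of $\mathcal{O}_{\mathfrak{X}}[n]^m\to\mathcal{A}_1\times_{\mathcal{B}}\cdots\times_{\mathcal{B}}\mathcal{A}_m$ along $(\alpha_i)\mapsto\sum_i\lambda_i\alpha_i\colon\mathcal{O}_{\mathfrak{X}}[n]^m\to\mathcal{O}_{\mathfrak{X}}[n]$, with the bracket for which the map from the fibre product is a morphism of Lie algebras. **Vector spaces in categories.** A $\mathbb{k}$-*vector space in categories* is a groupoid $\mathcal{C}$ with functors $(X_1,\dots,X_m)\mapsto\lambda_1X_1\dotplus\cdots\dotplus\lambda_mX_m$ ($m\ge0$, $\lambda_i\in\mathbb{k}$) and natural isomorphisms $0X_1\dotplus\cdots\dotplus1X_i\dotplus\cdots\dotplus0X_m\cong X_i$ and $\dot\sum_i\lambda_i\bigl(\dot\sum_j\mu_{ij}X_j\bigr)\cong\dot\sum_j\bigl(\sum_i\lambda_i\mu_{ij}\bigr)X_j$ which are coherent (associativity of substitution, and unit laws). A *morphism* is a functor $F$ with natural isomorphisms $\dot\sum_i\lambda_iF(X_i)\cong F\bigl(\dot\sum_i\lambda_iX_i\bigr)$ compatible with these. The operation $X+Y=1X\dotplus1Y$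 makes $\mathcal{C}$ a Picard groupoid (a symmetric monoidal groupoid all of whose objects are invertible). A morphism of Picard groupoids is a symmetric monoidal functor. **Inverse image.** For a map $\phi\colon\mathfrak{Y}\to\mathfrak{X}$ of DG manifolds, $\phi^+\mathcal{A}=\mathcal{T}_{\mathfrak{Y}}\times_{\phi^*\mathcal{T}_{\mathfrak{X}}}\phi^*\mathcal{A}$, the Lie algebroid on $\mathfrak{Y}$ of pairs $(u,\xi)$ with anchor $(u,\xi)\mapsto\xi$ and bracket $$[(f\otimes a,\xi),(g\otimes b,\eta)]=\bigl((-1)^{ag}fg\otimes[a,b]+\xi(g)\otimes b-(-1)^{\eta\xi}\eta(f)\otimes a,\ [\xi,\eta]\bigr).$$ A marking $\mathfrak{c}$ of $\mathcal{A}$ is sent to the marking $(1\otimes\mathfrak{c},0)$ of $\phi^+\mathcal{A}$. **Proposition.** Let $\phi\colon\mathfrak{Y}\to\mathfrak{X}$ be a map of DG manifolds, $\mathcal{B}$ an $\mathcal{O}_{\mathfrak{X}}$-Lie algebroid and $n\in\mathbb{Z}$. 1. $\mathcal{O}\mathrm{Ext}_n(\mathcal{B})$ and $\mathcal{O}\mathrm{Ext}_n(\phi^+\mathcal{B})$,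 with the linear combinations above and the structure isomorphisms induced by their universal properties, are $\mathbb{k}$-vector spaces in categories. 2. If $\mathcal{B}$ is locally free over $\mathcal{O}_{\mathfrak{X}}$ (of finite or infinite rank), then $\phi^+$ takes $\mathcal{O}[n]$-extensions of $\mathcal{B}$ to $\mathcal{O}[n]$-extensions of $\phi^+\mathcal{B}$. 3. Whenever $\phi^+$ takes $\mathcal{O}[n]$-extensions of $\mathcal{B}$ to $\mathcal{O}[n]$-extensions of $\phi^+\mathcal{B}$ (in particular if $\mathcal{B}$ is locally free), the inverse image functor $$\phi^+\colon\mathcal{O}\mathrm{Ext}_n(\mathcal{B})\to\mathcal{O}\mathrm{Ext}_n(\phi^+\mathcal{B})$$ is a morphism of $\mathbb{k}$-vector spaces in categories: there is a unique such structure on $\phi^+$ whose isomorphisms $$\lambda_1\phi^+\mathcal{A}_1\dotplus\cdots\dotplus\lambda_m\phi^+\mathcal{A}_m\cong\phi^+(\lambda_1\mathcal{A}_1\dotplus\cdots\dotplus\lambda_m\mathcal{A}_m)$$ are compatible with the canonical map $\phi^+(\mathcal{A}_1\times_{\mathcal{B}}\cdots\times_{\mathcal{B}}\mathcal{A}_m)\to\phi^+\mathcal{A}_1\times_{\phi^+\mathcal{B}}\cdots\times_{\phi^+\mathcal{B}}\phi^+\mathcal{A}_m$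 and the push-out maps. In particular, with the isomorphisms $\phi^+\mathcal{A}_1+\phi^+\mathcal{A}_2\cong\phi^+(\mathcal{A}_1+\mathcal{A}_2)$, $\phi^+$ is a morphism of Picard groupoids. -/

import Mathlib

open scoped TensorProduct DirectSum Topology ContDiff Manifold
open CategoryTheory

universe u v w

namespace DGLie

noncomputable section

/-! ### Graded algebra -/

/-- The Koszul sign `(-1)^n` as a scalar. -/
def sg (K : Type w) [Field K] (n : ℤ) : K := (-1) ^ n

section sign
variable {K : Type w} [Field K]

theorem sg_add (m n : ℤ) : sg K (m + n) = sg K m * sg K n :=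
  zpow_add₀ (neg_ne_zero.2 one_ne_zero) m n

theorem sg_zero : sg K 0 = 1 := zpow_zero _

theorem sg_one : sg K 1 = -1 := zpow_one _

theorem sg_cases (n : ℤ) : sg K n = 1 ∨ sg K n = -1 := by
  rcases Int.even_or_odd n with h | h
  · exact Or.inl h.neg_one_zpow
  · exact Or.inr h.neg_one_zpow

theorem sg_sq (n : ℤ) : sg K n * sg K n = 1 := by
  rcases sg_cases (K := K) n with h | h <;> simp [h]

theorem sg_neg (n : ℤ) : sg K (-n) = sg K n := by
  have h := sg_add (K := K) n (-n)
  rw [add_neg_cancel, sg_zero] at h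
  rcases sg_cases (K := K) n with h1 | h1 <;> rw [h1] at h ⊢
  · simpa using h.symm
  · linear_combination h

end sign

/-- A commutative differential graded `K`-algebra. Operations are indexed by degrees together with
an equation between degrees, e.g. `mul h a b` has degree `k` for `h : i + j = k`. -/
structure CDGA (K : Type w) [Field K] where
  C : ℤ → Type u
  [acg : ∀ i, AddCommGroup (C i)]
  [mod : ∀ i, Module K (C i)]
  one : C 0
  mul : ∀ {i j k : ℤ}, i + j = k → C i →ₗ[K] C j →ₗ[K] C k
  d : ∀ {i j : ℤ}, i + 1 = j → C i →ₗ[K] C j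
  one_mul : ∀ {i : ℤ} (h : 0 + i = i) (a : C i), mul h one a = a
  mul_assoc : ∀ {i j k ij jk n : ℤ} (h1 : i + j = ij) (h2 : ij + k = n) (h3 : j + k = jk)
    (h4 : i + jk = n) (a : C i) (b : C j) (c : C k),
    mul h2 (mul h1 a b) c = mul h4 a (mul h3 b c)
  mul_comm : ∀ {i j k : ℤ} (h : i + j = k) (h' : j + i = k) (a : C i) (b : C j),
    mul h a b = sg K (i * j) • mul h' b a
  d_d : ∀ {i j k : ℤ} (h : i + 1 = j) (h' : j + 1 = k) (a : C i), d h' (d h a) = 0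
  d_mul : ∀ {i j k i' j' k' : ℤ} (h : i + j = k) (hk : k + 1 = k') (hi : i + 1 = i')
    (hj : j + 1 = j') (h1 : i' + j = k') (h2 : i + j' = k') (a : C i) (b : C j),
    d hk (mul h a b) = mul h1 (d hi a) b + sg K i • mul h2 a (d hj b)

attribute [instance] CDGA.acg CDGA.mod

variable {K : Type w} [Field K]

/-- A morphism of commutative differential graded algebras. -/
structure CDGAHom (R S : CDGA.{u} K) where
  map : ∀ i : ℤ, R.C i →ₗ[K] S.C i
  map_one : map 0 R.one = S.one
  map_mul : ∀ {i j k : ℤ} (h : i + j = k) (a : R.C i) (b : R.C j),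
    map k (R.mul h a b) = S.mul h (map i a) (map j b)
  map_d : ∀ {i j : ℤ} (h : i + 1 = j) (a : R.C i), map j (R.d h a) = S.d h (map i a)

/-- A differential graded module over a commutative differential graded algebra. -/
structure DGMod (R : CDGA.{u} K) where
  C : ℤ → Type u
  [acg : ∀ i, AddCommGroup (C i)]
  [mod : ∀ i, Module K (C i)]
  smul : ∀ {i j k : ℤ}, i + j = k → R.C i →ₗ[K] C j →ₗ[K] C k
  d : ∀ {i j : ℤ}, i + 1 = j → C i →ₗ[K] C j
  one_smul : ∀ {i : ℤ} (h : 0 + i = i) (a : C i), smul h R.one a = a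
  mul_smul : ∀ {i j k ij jk n : ℤ} (h1 : i + j = ij) (h2 : ij + k = n) (h3 : j + k = jk)
    (h4 : i + jk = n) (f : R.C i) (g : R.C j) (a : C k),
    smul h2 (R.mul h1 f g) a = smul h4 f (smul h3 g a)
  d_d : ∀ {i j k : ℤ} (h : i + 1 = j) (h' : j + 1 = k) (a : C i), d h' (d h a) = 0
  d_smul : ∀ {i j k i' j' k' : ℤ} (h : i + j = k) (hk : k + 1 = k') (hi : i + 1 = i')
    (hj : j + 1 = j') (h1 : i' + j = k') (h2 : i + j' = k') (f : R.C i) (a : C j),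
    d hk (smul h f a) = smul h1 (R.d hi f) a + sg K i • smul h2 f (d hj a)

attribute [instance] DGMod.acg DGMod.mod

/-- A differential graded Lie-Rinehart algebra over `R` (a Lie algebroid at the level of stalks):
a DG module with a graded Lie bracket and an anchor, given by its action on `R`. -/
structure LR (R : CDGA.{u} K) extends DGMod R where
  br : ∀ {i j k : ℤ}, i + j = k → C i →ₗ[K] C j →ₗ[K] C k
  anch : ∀ {i j k : ℤ}, i + j = k → C i →ₗ[K] R.C j →ₗ[K] R.C k
  skew : ∀ {i j k : ℤ} (h : i + j = k) (h' : j + i = k) (a : C i) (b : C j),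
    br h a b = -(sg K (i * j) • br h' b a)
  jacobi : ∀ {i j k ij ik jk n : ℤ} (hij : i + j = ij) (hik : i + k = ik) (hjk : j + k = jk)
    (h1 : i + jk = n) (h2 : ij + k = n) (h3 : j + ik = n) (a : C i) (b : C j) (c : C k),
    br h1 a (br hjk b c) = br h2 (br hij a b) c + sg K (i * j) • br h3 b (br hik a c)
  d_br : ∀ {i j k i' j' k' : ℤ} (h : i + j = k) (hk : k + 1 = k') (hi : i + 1 = i')
    (hj : j + 1 = j') (h1 : i' + j = k') (h2 : i + j' = k') (a : C i) (b : C j),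
    d hk (br h a b) = br h1 (d hi a) b + sg K i • br h2 a (d hj b)
  anch_mul : ∀ {i j k ij ik jk n : ℤ} (hij : i + j = ij) (hik : i + k = ik) (hjk : j + k = jk)
    (h1 : i + jk = n) (h2 : ij + k = n) (h3 : j + ik = n) (a : C i) (f : R.C j) (g : R.C k),
    anch h1 a (R.mul hjk f g) =
      R.mul h2 (anch hij a f) g + sg K (i * j) • R.mul h3 f (anch hik a g)
  anch_smul : ∀ {i j k ij jk n : ℤ} (h1 : i + j = ij) (h2 : ij + k = n) (h3 : j + k = jk)
    (h4 : i + jk = n) (f : R.C i) (a : C j) (g : R.C k),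
    anch h2 (smul h1 f a) g = R.mul h4 f (anch h3 a g)
  anch_br : ∀ {i j k ij ik jk n : ℤ} (hij : i + j = ij) (hik : i + k = ik) (hjk : j + k = jk)
    (h1 : i + jk = n) (h2 : ij + k = n) (h3 : j + ik = n) (a : C i) (b : C j) (f : R.C k),
    anch h2 (br hij a b) f = anch h1 a (anch hjk b f) - sg K (i * j) • anch h3 b (anch hik a f)
  anch_d : ∀ {i j k i' j' k' : ℤ} (h : i + j = k) (hk : k + 1 = k') (hi : i + 1 = i')
    (hj : j + 1 = j') (h1 : i' + j = k') (h2 : i + j' = k') (a : C i) (f : R.C j),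
    anch h1 (d hi a) f = R.d hk (anch h a f) - sg K i • anch h2 a (R.d hj f)
  leibniz : ∀ {i j k ij ik jk n : ℤ} (hij : i + j = ij) (hik : i + k = ik) (hjk : j + k = jk)
    (h1 : i + jk = n) (h2 : ij + k = n) (h3 : j + ik = n) (a : C i) (f : R.C j) (b : C k),
    br h1 a (smul hjk f b) = smul h2 (anch hij a f) b + sg K (i * j) • smul h3 f (br hik a b)

/-- A morphism of differential graded Lie-Rinehart algebras over `R`. -/
structure LRHom {R : CDGA.{u} K} (A B : LR R) where
  map : ∀ i : ℤ, A.C i →ₗ[K] B.C i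
  map_smul : ∀ {i j k : ℤ} (h : i + j = k) (f : R.C i) (a : A.C j),
    map k (A.smul h f a) = B.smul h f (map j a)
  map_d : ∀ {i j : ℤ} (h : i + 1 = j) (a : A.C i), map j (A.d h a) = B.d h (map i a)
  map_br : ∀ {i j k : ℤ} (h : i + j = k) (a : A.C i) (b : A.C j),
    map k (A.br h a b) = B.br h (map i a) (map j b)
  map_anch : ∀ {i j k : ℤ} (h : i + j = k) (a : A.C i) (f : R.C j),
    B.anch h (map i a) f = A.anch h a f

/-! ### Derivations -/

/-- The submodule of `K`-linear derivations of degree `n` of the graded algebra `S`. -/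
def derSub (S : CDGA.{u} K) (n : ℤ) :
    Submodule K (∀ p : {p : ℤ × ℤ // n + p.1 = p.2}, S.C p.1.1 →ₗ[K] S.C p.1.2) where
  carrier := {D | ∀ {i j k ni nj nk : ℤ} (h : i + j = k) (hi : n + i = ni) (hj : n + j = nj)
    (hk : n + k = nk) (h1 : ni + j = nk) (h2 : i + nj = nk) (f : S.C i) (g : S.C j),
    D ⟨(k, nk), hk⟩ (S.mul h f g) = S.mul h1 (D ⟨(i, ni), hi⟩ f) g +
      sg K (n * i) • S.mul h2 f (D ⟨(j, nj), hj⟩ g)}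
  zero_mem' := by
    intro i j k ni nj nk h hi hj hk h1 h2 f g
    simp only [Pi.zero_apply, LinearMap.zero_apply, map_zero, smul_zero, add_zero]
  add_mem' := by
    intro D E hD hE i j k ni nj nk h hi hj hk h1 h2 f g
    simp only [Pi.add_apply, LinearMap.add_apply, map_add, hD h hi hj hk h1 h2,
      hE h hi hj hk h1 h2, smul_add]
    abel
  smul_mem' := by
    intro c D hD i j k ni nj nk h hi hj hk h1 h2 f g
    simp only [Pi.smul_apply, LinearMap.smul_apply, map_smul, hD h hi hj hk h1 h2, smul_add,
      smul_comm c]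

/-- The `K`-linear derivations of degree `n` of the graded algebra `S`. -/
def Der (S : CDGA.{u} K) (n : ℤ) : Type u := derSub S n

instance instAddCommGroupDer (S : CDGA.{u} K) (n : ℤ) : AddCommGroup (Der S n) :=
  inferInstanceAs (AddCommGroup (derSub S n))

instance instModuleDer (S : CDGA.{u} K) (n : ℤ) : Module K (Der S n) :=
  inferInstanceAs (Module K (derSub S n))

/-- The action of a derivation. -/
def Der.ap {S : CDGA.{u} K} {n i j : ℤ} (h : n + i = j) : Der S n →ₗ[K] S.C i →ₗ[K] S.C j :=
  LinearMap.mk₂ K (fun D f => D.1 ⟨(i, j), h⟩ f) (fun _ _ _ => rfl) (fun _ _ _ => rfl)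
    (fun D f g => map_add (D.1 ⟨(i, j), h⟩) f g) (fun c D f => map_smul (D.1 ⟨(i, j), h⟩) c f)

theorem Der.ext {S : CDGA.{u} K} {n : ℤ} {D E : Der S n}
    (h : ∀ (i j : ℤ) (h : n + i = j) (f : S.C i), Der.ap h D f = Der.ap h E f) : D = E := by
  apply Subtype.ext
  funext p
  ext f
  exact h p.1.1 p.1.2 p.2 f

theorem Der.ap_mul {S : CDGA.{u} K} {n : ℤ} (D : Der S n) {i j k ni nj nk : ℤ} (h : i + j = k)
    (hi : n + i = ni) (hj : n + j = nj)
    (hk : n + k = nk) (h1 : ni + j = nk) (h2 : i + nj = nk) (f : S.C i) (g : S.C j) :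
    ap hk D (S.mul h f g) = S.mul h1 (ap hi D f) g + sg K (n * i) • S.mul h2 f (ap hj D g) :=
  D.2 h hi hj hk h1 h2 f g

/-- Constructor for derivations. -/
def Der.mk {S : CDGA.{u} K} {n : ℤ} (D : ∀ i j : ℤ, n + i = j → S.C i →ₗ[K] S.C j)
    (hD : ∀ {i j k ni nj nk : ℤ} (h : i + j = k) (hi : n + i = ni) (hj : n + j = nj)
    (hk : n + k = nk) (h1 : ni + j = nk) (h2 : i + nj = nk) (f : S.C i) (g : S.C j),
    D k nk hk (S.mul h f g) = S.mul h1 (D i ni hi f) g +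
      sg K (n * i) • S.mul h2 f (D j nj hj g)) : Der S n :=
  ⟨fun p => D p.1.1 p.1.2 p.2, fun h hi hj hk h1 h2 f g => hD h hi hj hk h1 h2 f g⟩

@[simp] theorem Der.ap_mk {S : CDGA.{u} K} {n : ℤ}
    (D : ∀ i j : ℤ, n + i = j → S.C i →ₗ[K] S.C j) (hD) {i j : ℤ} (h : n + i = j) (f : S.C i) :
    Der.ap h (Der.mk D hD) f = D i j h f := rfl

/-- Multiplication of a derivation by an element of the algebra. -/
def Der.smul {S : CDGA.{u} K} {i j k : ℤ} (h : i + j = k) : S.C i →ₗ[K] Der S j →ₗ[K] Der S k :=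
  LinearMap.mk₂ K (fun s D => Der.mk
      (fun l m hm => (S.mul (show i + (j + l) = m by omega) s).comp (ap rfl D)) (by
        intro a b c na nb nc h0 ha hb hc h1 h2 f g
        simp only [LinearMap.comp_apply]
        rw [ap_mul D h0 rfl rfl rfl (show (j + a) + b = j + c by omega)
          (show a + (j + b) = j + c by omega), map_add, map_smul,
          S.mul_assoc (show i + (j + a) = na by omega) h1 (show (j + a) + b = j + c by omega)
            (show i + (j + c) = nc by omega),
          ← S.mul_assoc (show i + a = a + i by omega) (show (a + i) + (j + b) = nc by omega)
            _ _ s f, S.mul_comm (show i + a = a + i by omega) rfl s f, map_smul,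
          LinearMap.smul_apply, S.mul_assoc rfl _ (show i + (j + b) = nb by omega) h2, smul_smul,
          ← sg_add]
        congr 3
        subst h
        ring))
    (by intros; apply Der.ext; intros; simp) (by intros; apply Der.ext; intros; simp)
    (by intros; apply Der.ext; intros; simp) (by intros; apply Der.ext; intros; simp)

theorem Der.ap_smul {S : CDGA.{u} K} {i j k l jl m : ℤ} (h : i + j = k) (s : S.C i)
    (D : Der S j) (hm : k + l = m) (h1 : j + l = jl) (h2 : i + jl = m) (f : S.C l) :
    ap hm (smul h s D) f = S.mul h2 s (ap h1 D f) := by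
  subst h1; rfl

/-- The graded commutator of derivations. -/
def Der.br {S : CDGA.{u} K} {i j k : ℤ} (h : i + j = k) :
    Der S i →ₗ[K] Der S j →ₗ[K] Der S k :=
  LinearMap.mk₂ K (fun D E => Der.mk
      (fun l m hm => (ap (show i + (j + l) = m by omega) D).comp (ap rfl E) -
        sg K (i * j) • (ap (show j + (i + l) = m by omega) E).comp (ap rfl D)) (by
        intro a b c na nb nc h0 ha hb hc h1 h2 f g
        simp only [LinearMap.comp_apply, LinearMap.sub_apply, LinearMap.smul_apply]
        rw [ap_mul E h0 rfl rfl rfl (show (j + a) + b = j + c by omega)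
            (show a + (j + b) = j + c by omega),
          ap_mul D h0 rfl rfl rfl (show (i + a) + b = i + c by omega)
            (show a + (i + b) = i + c by omega), map_add, map_add, map_smul, map_smul,
          ap_mul D (show (j + a) + b = j + c by omega) (show i + (j + a) = na by omega) rfl _ h1
            (show (j + a) + (i + b) = nc by omega),
          ap_mul D (show a + (j + b) = j + c by omega) rfl (show i + (j + b) = nb by omega) _
            (show (i + a) + (j + b) = nc by omega) h2,
          ap_mul E (show (i + a) + b = i + c by omega) (show j + (i + a) = na by omega) rfl _ h1
            (show (i + a) + (j + b) = nc by omega),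
          ap_mul E (show a + (i + b) = i + c by omega) rfl (show j + (i + b) = nb by omega) _
            (show (j + a) + (i + b) = nc by omega) h2]
        subst h
        simp only [mul_add, add_mul, sg_add, map_sub, map_smul, LinearMap.sub_apply,
          LinearMap.smul_apply, mul_comm j i]
        rcases sg_cases (K := K) (i * j) with h3 | h3 <;> rw [h3] <;> module))
    (by intros; apply Der.ext; intros; simp; module)
    (by intros; apply Der.ext; intros; simp; module)
    (by intros; apply Der.ext; intros; simp; module)
    (by intros; apply Der.ext; intros; simp; module)

theorem Der.ap_br {S : CDGA.{u} K} {i j k l il jl m : ℤ} (h : i + j = k) (D : Der S i)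
    (E : Der S j) (hm : k + l = m) (h1 : j + l = jl) (h2 : i + jl = m) (h3 : i + l = il)
    (h4 : j + il = m) (f : S.C l) :
    ap hm (br h D E) f = ap h2 D (ap h1 E f) - sg K (i * j) • ap h4 E (ap h3 D f) := by
  subst h1 h3; rfl

/-- The differential on derivations: the graded commutator with the differential of `S`. -/
def Der.d {S : CDGA.{u} K} {i j : ℤ} (h : i + 1 = j) : Der S i →ₗ[K] Der S j where
  toFun D := Der.mk (fun l m hm => (S.d (show (i + l) + 1 = m by omega)).comp (ap rfl D) -
        sg K i • (ap (show i + (l + 1) = m by omega) D).comp (S.d rfl)) (by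
        intro a b c na nb nc h0 ha hb hc h1 h2 f g
        simp only [LinearMap.comp_apply, LinearMap.sub_apply, LinearMap.smul_apply]
        rw [ap_mul D h0 rfl rfl rfl (show (i + a) + b = i + c by omega)
            (show a + (i + b) = i + c by omega), map_add, map_smul,
          S.d_mul (show (i + a) + b = i + c by omega) _ (show (i + a) + 1 = na by omega) rfl h1
            (show (i + a) + (b + 1) = nc by omega),
          S.d_mul (show a + (i + b) = i + c by omega) _ rfl (show (i + b) + 1 = nb by omega)
            (show (a + 1) + (i + b) = nc by omega) h2,
          S.d_mul h0 rfl rfl rfl (show (a + 1) + b = c + 1 by omega)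
            (show a + (b + 1) = c + 1 by omega), map_add, map_smul,
          ap_mul D (show (a + 1) + b = c + 1 by omega) (show i + (a + 1) = na by omega) rfl _ h1
            (show (a + 1) + (i + b) = nc by omega),
          ap_mul D (show a + (b + 1) = c + 1 by omega) rfl (show i + (b + 1) = nb by omega) _
            (show (i + a) + (b + 1) = nc by omega) h2]
        subst h
        simp only [mul_add, add_mul, sg_add, map_sub, map_smul, LinearMap.sub_apply,
          LinearMap.smul_apply, mul_one, one_mul]
        rcases sg_cases (K := K) i with h3 | h3 <;> rw [h3] <;> module)
  map_add' := by intros; apply Der.ext; intros; simp; module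
  map_smul' := by intros; apply Der.ext; intros; simp; module

theorem Der.ap_d {S : CDGA.{u} K} {i j l l' m' m : ℤ} (h : i + 1 = j) (D : Der S i)
    (hm : j + l = m) (h1 : i + l = m') (h2 : m' + 1 = m) (h3 : l + 1 = l') (h4 : i + l' = m)
    (f : S.C l) :
    ap hm (d h D) f = S.d h2 (ap h1 D f) - sg K i • ap h4 D (S.d h3 f) := by
  subst h1 h3; rfl

theorem Der.one_smul {S : CDGA.{u} K} {i : ℤ} (h : 0 + i = i) (D : Der S i) : Der.smul h S.one D = D := by
  apply Der.ext; intro l m hm f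
  rw [Der.ap_smul h _ _ hm hm (zero_add m), S.one_mul]

theorem Der.mul_smul {S : CDGA.{u} K} {i j k ij jk n : ℤ} (h1 : i + j = ij) (h2 : ij + k = n) (h3 : j + k = jk)
    (h4 : i + jk = n) (f : S.C i) (g : S.C j) (D : Der S k) :
    Der.smul h2 (S.mul h1 f g) D = Der.smul h4 f (Der.smul h3 g D) := by
  apply Der.ext; intro l m hm x
  rw [Der.ap_smul h2 _ _ hm rfl (by omega),
    Der.ap_smul h4 _ _ hm rfl (by omega), Der.ap_smul h3 _ _ _ rfl (by omega), S.mul_assoc]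

theorem Der.d_d {S : CDGA.{u} K} {i j k : ℤ} (h : i + 1 = j) (h' : j + 1 = k) (D : Der S i) :
    Der.d h' (Der.d h D) = 0 := by
  apply Der.ext; intro l m hm f
  rw [Der.ap_d h' _ hm rfl (by omega) rfl (by omega), Der.ap_d h _ _ rfl (by omega) rfl (by omega),
    Der.ap_d h _ _ (show i + (l + 1) = j + l by omega) (by omega) rfl (by omega)]
  simp only [map_sub, map_smul, S.d_d]
  subst h; simp [sg_add, sg_one]

theorem Der.d_smul {S : CDGA.{u} K} {i j k i' j' k' : ℤ} (h : i + j = k) (hk : k + 1 = k') (hi : i + 1 = i')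
    (hj : j + 1 = j') (h1 : i' + j = k') (h2 : i + j' = k') (s : S.C i) (D : Der S j) :
    Der.d hk (Der.smul h s D) = Der.smul h1 (S.d hi s) D + sg K i • Der.smul h2 s (Der.d hj D) := by
  apply Der.ext; intro l m hm f
  rw [Der.ap_d hk _ hm rfl (by omega) rfl (by omega), Der.ap_smul h _ _ _ rfl (by omega),
    Der.ap_smul h _ _ _ (show j + (l + 1) = j' + l by omega) (by omega),
    S.d_mul _ _ hi (show (j + l) + 1 = j' + l by omega) (by omega) (by omega)]
  simp only [map_add, LinearMap.add_apply, map_smul, LinearMap.smul_apply]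
  rw [Der.ap_smul h1 _ _ _ rfl (by omega), Der.ap_smul h2 _ _ _ rfl (by omega),
    Der.ap_d hj _ _ rfl (by omega) rfl (by omega)]
  subst h
  simp only [map_sub, map_smul, sg_add]
  module

theorem Der.skew {S : CDGA.{u} K} {i j k : ℤ} (h : i + j = k) (h' : j + i = k) (D : Der S i) (E : Der S j) :
    Der.br h D E = -(sg K (i * j) • Der.br h' E D) := by
  apply Der.ext; intro l m hm f
  simp only [map_neg, map_smul, LinearMap.neg_apply, LinearMap.smul_apply]
  rw [Der.ap_br h _ _ hm rfl (by omega) rfl (by omega),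
    Der.ap_br h' _ _ hm rfl (by omega) rfl (by omega), mul_comm j i]
  rcases sg_cases (K := K) (i * j) with h3 | h3 <;> rw [h3] <;> module

set_option maxHeartbeats 1000000 in
theorem Der.jacobi {S : CDGA.{u} K} {i j k ij ik jk n : ℤ} (hij : i + j = ij) (hik : i + k = ik) (hjk : j + k = jk)
    (h1 : i + jk = n) (h2 : ij + k = n) (h3 : j + ik = n) (D : Der S i) (E : Der S j)
    (F : Der S k) : Der.br h1 D (Der.br hjk E F) =
      Der.br h2 (Der.br hij D E) F + sg K (i * j) • Der.br h3 E (Der.br hik D F) := by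
  apply Der.ext; intro l m hm f
  simp only [map_add, map_smul, LinearMap.add_apply, LinearMap.smul_apply]
  obtain ⟨il, hil⟩ : ∃ x, i + l = x := ⟨_, rfl⟩
  obtain ⟨jl, hjl⟩ : ∃ x, j + l = x := ⟨_, rfl⟩
  obtain ⟨kl, hkl⟩ : ∃ x, k + l = x := ⟨_, rfl⟩
  obtain ⟨ijl, hijl⟩ : ∃ x, ij + l = x := ⟨_, rfl⟩
  obtain ⟨ikl, hikl⟩ : ∃ x, ik + l = x := ⟨_, rfl⟩
  obtain ⟨jkl, hjkl⟩ : ∃ x, jk + l = x := ⟨_, rfl⟩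
  rw [Der.ap_br h1 _ _ hm hjkl (by omega) hil (by omega),
    Der.ap_br h2 _ _ hm hkl (by omega) hijl (by omega),
    Der.ap_br h3 _ _ hm hikl (by omega) hjl (by omega),
    Der.ap_br hjk _ _ hjkl hkl (by omega) hjl (by omega),
    Der.ap_br hij _ _ hijl hjl (by omega) hil (by omega),
    Der.ap_br hik _ _ hikl hkl (by omega) hil (by omega),
    Der.ap_br hjk _ _ _ (show k + il = ikl by omega) (by omega) (show j + il = ijl by omega)
      (by omega),
    Der.ap_br hij _ _ _ (show j + kl = jkl by omega) (by omega) (show i + kl = ikl by omega)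
      (by omega),
    Der.ap_br hik _ _ _ (show k + jl = jkl by omega) (by omega) (show i + jl = ijl by omega)
      (by omega)]
  subst hij hik hjk
  simp only [map_sub, map_smul, mul_add, add_mul, sg_add, mul_comm j i]
  rcases sg_cases (K := K) (i * j) with h3 | h3 <;> rw [h3] <;> module

theorem Der.d_br {S : CDGA.{u} K} {i j k i' j' k' : ℤ} (h : i + j = k) (hk : k + 1 = k') (hi : i + 1 = i')
    (hj : j + 1 = j') (h1 : i' + j = k') (h2 : i + j' = k') (D : Der S i) (E : Der S j) :
    Der.d hk (Der.br h D E) = Der.br h1 (Der.d hi D) E + sg K i • Der.br h2 D (Der.d hj E) := by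
  apply Der.ext; intro l m hm f
  simp only [map_add, map_smul, LinearMap.add_apply, LinearMap.smul_apply]
  obtain ⟨il, hil⟩ : ∃ x, i + l = x := ⟨_, rfl⟩
  obtain ⟨jl, hjl⟩ : ∃ x, j + l = x := ⟨_, rfl⟩
  obtain ⟨kl, hkl⟩ : ∃ x, k + l = x := ⟨_, rfl⟩
  obtain ⟨l', hl'⟩ : ∃ x, l + 1 = x := ⟨_, rfl⟩
  obtain ⟨il', hil'⟩ : ∃ x, i + l' = x := ⟨_, rfl⟩
  obtain ⟨jl', hjl'⟩ : ∃ x, j + l' = x := ⟨_, rfl⟩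
  rw [Der.ap_d hk _ hm hkl (by omega) hl' (by omega),
    Der.ap_br h _ _ hkl hjl (by omega) hil (by omega),
    Der.ap_br h _ _ _ hjl' (by omega) hil' (by omega),
    Der.ap_br h1 _ _ hm hjl (by omega) (show i' + l = il' by omega) (by omega),
    Der.ap_br h2 _ _ hm (show j' + l = jl' by omega) (by omega) hil (by omega),
    Der.ap_d hi _ _ (show i + jl = kl by omega) (by omega) (show jl + 1 = jl' by omega)
      (by omega),
    Der.ap_d hi _ _ hil (by omega) hl' (by omega),
    Der.ap_d hj _ _ hjl (by omega) hl' (by omega),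
    Der.ap_d hj _ _ (show j + il = kl by omega) (by omega) (show il + 1 = il' by omega)
      (by omega)]
  subst hi hj h
  simp only [map_sub, map_smul, mul_add, add_mul, sg_add, mul_one, one_mul]
  rcases sg_cases (K := K) i with h3 | h3 <;>
  rcases sg_cases (K := K) j with h4 | h4 <;> rw [h3, h4] <;> module

theorem Der.leibniz {S : CDGA.{u} K} {i j k ij ik jk n : ℤ} (hij : i + j = ij) (hik : i + k = ik) (hjk : j + k = jk)
    (h1 : i + jk = n) (h2 : ij + k = n) (h3 : j + ik = n) (D : Der S i) (s : S.C j)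
    (E : Der S k) : Der.br h1 D (Der.smul hjk s E) =
      Der.smul h2 (Der.ap hij D s) E + sg K (i * j) • Der.smul h3 s (Der.br hik D E) := by
  apply Der.ext; intro l m hm f
  simp only [map_add, map_smul, LinearMap.add_apply, LinearMap.smul_apply]
  obtain ⟨il, hil⟩ : ∃ x, i + l = x := ⟨_, rfl⟩
  obtain ⟨kl, hkl⟩ : ∃ x, k + l = x := ⟨_, rfl⟩
  obtain ⟨ikl, hikl⟩ : ∃ x, ik + l = x := ⟨_, rfl⟩
  obtain ⟨jkl, hjkl⟩ : ∃ x, jk + l = x := ⟨_, rfl⟩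
  rw [Der.ap_br h1 _ _ hm hjkl (by omega) hil (by omega),
    Der.ap_smul hjk _ _ hjkl hkl (by omega), Der.ap_smul hjk _ _ _ (show k + il = ikl by omega)
      (by omega),
    Der.ap_smul h2 _ _ hm hkl (by omega), Der.ap_smul h3 _ _ hm hikl (by omega),
    Der.ap_br hik _ _ hikl hkl (by omega) hil (by omega),
    Der.ap_mul D (show j + kl = jkl by omega) hij (show i + kl = ikl by omega) (by omega)
      (by omega) (by omega)]
  subst hij hik hjk
  simp only [map_sub, map_smul, mul_add, sg_add]
  module

/-- The Lie-Rinehart algebra of derivations of `S`. -/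
def derLR (S : CDGA.{u} K) : LR S where
  C n := Der S n
  smul := Der.smul
  d := Der.d
  br := Der.br
  anch := Der.ap
  one_smul := Der.one_smul
  mul_smul := Der.mul_smul
  d_d := Der.d_d
  d_smul := Der.d_smul
  skew := Der.skew
  jacobi := Der.jacobi
  d_br := Der.d_br
  anch_mul := by
    intro i j k ij ik jk n hij hik hjk h1 h2 h3 D f g
    exact Der.ap_mul D hjk hij hik h1 h2 h3 f g
  anch_smul := by
    intro i j k ij jk n h1 h2 h3 h4 s D f
    exact Der.ap_smul h1 s D h2 h3 h4 f
  anch_br := by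
    intro i j k ij ik jk n hij hik hjk h1 h2 h3 D E f
    exact Der.ap_br hij D E h2 hjk h1 hik h3 f
  anch_d := by
    intro i j k i' j' k' h hk hi hj h1 h2 D f
    exact Der.ap_d hi D h1 h hk hj h2 f
  leibniz := Der.leibniz
set_option linter.unusedSimpArgs false

/-! ### Inverse image of Lie-Rinehart algebras along a morphism of algebras -/

/-- The degree `k` part of the graded tensor product `F ⊗ G` over `K`. -/
def W (F G : ℤ → Type u) [∀ i, AddCommGroup (F i)] [∀ i, Module K (F i)]
    [∀ i, AddCommGroup (G i)] [∀ i, Module K (G i)] (k : ℤ) : Type u :=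
  ⨁ p : {p : ℤ × ℤ // p.1 + p.2 = k}, (F p.1.1 ⊗[K] G p.1.2)

section W
variable {F G : ℤ → Type u} [∀ i, AddCommGroup (F i)] [∀ i, Module K (F i)]
    [∀ i, AddCommGroup (G i)] [∀ i, Module K (G i)]

instance instAddCommGroupW (k : ℤ) : AddCommGroup (W (K := K) F G k) :=
  inferInstanceAs (AddCommGroup (⨁ p : {p : ℤ × ℤ // p.1 + p.2 = k}, (F p.1.1 ⊗[K] G p.1.2)))

instance instModuleW (k : ℤ) : Module K (W (K := K) F G k) :=
  inferInstanceAs (Module K (⨁ p : {p : ℤ × ℤ // p.1 + p.2 = k}, (F p.1.1 ⊗[K] G p.1.2)))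

/-- The pure tensor `f ⊗ a`. -/
def tm {i j k : ℤ} (h : i + j = k) : F i →ₗ[K] G j →ₗ[K] W (K := K) F G k :=
  (TensorProduct.mk K (F i) (G j)).compr₂
    (DirectSum.lof K {p : ℤ × ℤ // p.1 + p.2 = k} (fun p => F p.1.1 ⊗[K] G p.1.2) ⟨(i, j), h⟩)

/-- Linear maps out of `F ⊗ G` are families of bilinear maps. -/
def liftW {k : ℤ} {Q : Type v} [AddCommGroup Q] [Module K Q]
    (β : ∀ i j : ℤ, i + j = k → F i →ₗ[K] G j →ₗ[K] Q) : W (K := K) F G k →ₗ[K] Q :=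
  DirectSum.toModule K _ Q fun p => TensorProduct.lift (β p.1.1 p.1.2 p.2)

@[simp] theorem liftW_tm {k : ℤ} {Q : Type v} [AddCommGroup Q] [Module K Q]
    (β : ∀ i j : ℤ, i + j = k → F i →ₗ[K] G j →ₗ[K] Q) {i j : ℤ} (h : i + j = k) (f : F i)
    (a : G j) : liftW β (tm h f a) = β i j h f a := by
  have := DirectSum.toModule_lof (R := K) (ι := {p : ℤ × ℤ // p.1 + p.2 = k})
    (M := fun p => F p.1.1 ⊗[K] G p.1.2)
    (φ := fun p => TensorProduct.lift (β p.1.1 p.1.2 p.2)) ⟨(i, j), h⟩ (f ⊗ₜ[K] a)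
  exact this.trans (by simp)

theorem W_induction {k : ℤ} {p : W (K := K) F G k → Prop} (u : W (K := K) F G k) (h0 : p 0)
    (ha : ∀ u v, p u → p v → p (u + v))
    (ht : ∀ {i j : ℤ} (h : i + j = k) (f : F i) (a : G j), p (tm (K := K) h f a)) : p u := by
  refine DirectSum.induction_on (motive := p) u h0 ?_ ha
  intro q x
  induction x using TensorProduct.induction_on with
  | zero => rw [map_zero]; exact h0
  | add u v hu hv => rw [map_add]; exact ha _ _ hu hv
  | tmul f a => exact ht q.2 f a

theorem W_hom_ext {k : ℤ} {Q : Type v} [AddCommGroup Q] [Module K Q]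
    {α β : W (K := K) F G k →ₗ[K] Q}
    (h : ∀ {i j : ℤ} (h : i + j = k) (f : F i) (a : G j),
      α (tm (K := K) h f a) = β (tm h f a)) : α = β := by
  refine LinearMap.ext fun u => ?_
  induction u using W_induction with
  | h0 => rw [map_zero, map_zero]
  | ha u v hu hv => rw [map_add, map_add, hu, hv]
  | ht hpq f a => exact h hpq f a

end W

namespace Pull

variable {R S : CDGA.{u} K} (ψ : CDGAHom R S) (A : LR R)

/-- `S ⊗ A` over `K`, in degree `k`. -/
abbrev T (S : CDGA.{u} K) {R : CDGA.{u} K} (A : LR R) (k : ℤ) : Type u := W (K := K) S.C A.C k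

variable {A}

/-- `s (g ⊗ b) = (s g) ⊗ b` -/
def smulT {i k l : ℤ} (h : i + k = l) : S.C i →ₗ[K] T S A k →ₗ[K] T S A l :=
  LinearMap.mk₂ K (fun s u => liftW (k := k) (F := S.C) (G := A.C) (Q := T S A l) (fun p q hpq =>
      (tm (show (i + p) + q = l by omega)).comp (S.mul rfl s)) u)
    (by
      intro s t u
      induction u using W_induction with
      | h0 => simp
      | ha u v hu hv => rw [map_add, hu, hv, map_add, map_add]; abel
      | ht h f a => simp)
    (by
      intro c s u
      induction u using W_induction with
      | h0 => simp
      | ha u v hu hv => simp only [map_add, hu, hv, smul_add]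
      | ht h f a => simp)
    (by intros; simp) (by intros; simp)

theorem smulT_tm {i k l p q ip : ℤ} (h : i + k = l) (hpq : p + q = k) (h1 : i + p = ip)
    (h2 : ip + q = l) (s : S.C i) (g : S.C p) (b : A.C q) :
    smulT h s (tm hpq g b) = tm (K := K) h2 (S.mul h1 s g) b := by
  subst h1; simp [smulT]

/-- `d (f ⊗ a) = d f ⊗ a + (-1)^f f ⊗ d a` -/
def dT {k l : ℤ} (h : k + 1 = l) : T S A k →ₗ[K] T S A l :=
  liftW fun p q hpq => (tm (show (p + 1) + q = l by omega)).comp (S.d rfl) +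
    sg K p • (tm (show p + (q + 1) = l by omega)).compl₂ (A.d rfl)

theorem dT_tm {k l p q p' q' : ℤ} (h : k + 1 = l) (hpq : p + q = k) (hp : p + 1 = p')
    (hq : q + 1 = q') (h1 : p' + q = l) (h2 : p + q' = l) (f : S.C p) (a : A.C q) :
    dT h (tm (K := K) hpq f a) = tm h1 (S.d hp f) a + sg K p • tm h2 f (A.d hq a) := by
  subst hp hq; simp [dT]

/-- A derivation `ξ` of `S` acts by `ξ (f ⊗ a) = ξ f ⊗ a`. -/
def actT {n k l : ℤ} (h : n + k = l) : Der S n →ₗ[K] T S A k →ₗ[K] T S A l :=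
  LinearMap.mk₂ K (fun ξ u => liftW (k := k) (F := S.C) (G := A.C) (Q := T S A l) (fun p q hpq =>
      (tm (show (n + p) + q = l by omega)).comp (Der.ap rfl ξ)) u)
    (by
      intro s t u
      induction u using W_induction with
      | h0 => simp
      | ha u v hu hv => rw [map_add, hu, hv, map_add, map_add]; abel
      | ht h f a => simp)
    (by
      intro c s u
      induction u using W_induction with
      | h0 => simp
      | ha u v hu hv => simp only [map_add, hu, hv, smul_add]
      | ht h f a => simp)
    (by intros; simp) (by intros; simp)

theorem actT_tm {n k l p q np : ℤ} (h : n + k = l) (hpq : p + q = k) (h1 : n + p = np)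
    (h2 : np + q = l) (ξ : Der S n) (f : S.C p) (a : A.C q) :
    actT h ξ (tm hpq f a) = tm (K := K) h2 (Der.ap h1 ξ f) a := by
  subst h1; simp [actT]

/-- The bracket with a pure tensor. -/
def brTaux {p q k l m : ℤ} (hpq : p + q = k) (h : k + l = m) (f : S.C p) (a : A.C q) :
    T S A l →ₗ[K] T S A m :=
  liftW fun p' q' hpq' => sg K (q * p') • ((tm (show (p + p') + (q + q') = m by omega)).comp
    (S.mul rfl f)).compl₂ (A.br rfl a)

/-- `{f ⊗ a, g ⊗ b} = (-1)^{a g} f g ⊗ [a, b]` -/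
def brT {k l m : ℤ} (h : k + l = m) : T S A k →ₗ[K] T S A l →ₗ[K] T S A m :=
  liftW fun p q hpq => LinearMap.mk₂ K (fun f a => brTaux hpq h f a)
    (by
      intro f f' a; apply W_hom_ext; intro p' q' e g b
      simp [brTaux])
    (by
      intro c f a; apply W_hom_ext; intro p' q' e g b
      simp [brTaux, smul_comm c])
    (by
      intro f a a'; apply W_hom_ext; intro p' q' e g b
      simp [brTaux])
    (by
      intro c f a; apply W_hom_ext; intro p' q' e g b
      simp [brTaux, smul_comm c])

theorem brT_tm {k l m p q p' q' pp qq : ℤ} (h : k + l = m) (hpq : p + q = k)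
    (hpq' : p' + q' = l) (hp : p + p' = pp) (hq : q + q' = qq) (h1 : pp + qq = m) (f : S.C p)
    (a : A.C q) (g : S.C p') (b : A.C q') :
    brT h (tm (K := K) hpq f a) (tm hpq' g b) =
      sg K (q * p') • tm h1 (S.mul hp f g) (A.br hq a b) := by
  subst hp hq; simp [brT, brTaux]

/-- `S ⊗ A` acts on `R` with values in `S`: `(f ⊗ a)(r) = f ψ(σ(a)(r))`. -/
def anchT {k l m : ℤ} (h : k + l = m) : T S A k →ₗ[K] R.C l →ₗ[K] S.C m :=
  liftW fun p q hpq => LinearMap.mk₂ K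
    (fun f a => (S.mul (show p + (q + l) = m by omega) f).comp
      ((ψ.map _).comp (A.anch rfl a)))
    (by intros; ext; simp) (by intros; ext; simp) (by intros; ext; simp) (by intros; ext; simp)

theorem anchT_tm {k l m p q ql : ℤ} (h : k + l = m) (hpq : p + q = k) (hq : q + l = ql)
    (h1 : p + ql = m) (f : S.C p) (a : A.C q) (r : R.C l) :
    anchT ψ h (tm (K := K) hpq f a) r = S.mul h1 f (ψ.map ql (A.anch hq a r)) := by
  subst hq; simp [anchT]

/-! Identities in `S ⊗ A`. -/

theorem one_smulT {k : ℤ} (h : 0 + k = k) (u : T S A k) : smulT h S.one u = u := by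
  induction u using W_induction with
  | h0 => simp
  | ha u v hu hv => simp only [map_add, hu, hv]
  | ht hpq f a => rw [smulT_tm h hpq (zero_add _) hpq, S.one_mul]

theorem mul_smulT {i j k ij jk n : ℤ} (h1 : i + j = ij) (h2 : ij + k = n) (h3 : j + k = jk)
    (h4 : i + jk = n) (s : S.C i) (t : S.C j) (u : T S A k) :
    smulT h2 (S.mul h1 s t) u = smulT h4 s (smulT h3 t u) := by
  induction u using W_induction with
  | h0 => simp
  | ha u v hu hv => simp only [map_add, hu, hv]
  | @ht p q hpq f a =>
    obtain ⟨jp, hjp⟩ : ∃ x, j + p = x := ⟨_, rfl⟩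
    obtain ⟨ijp, hijp⟩ : ∃ x, ij + p = x := ⟨_, rfl⟩
    rw [smulT_tm h2 hpq hijp (by omega), smulT_tm h3 hpq hjp (by omega),
      smulT_tm h4 _ (show i + jp = ijp by omega) (by omega), S.mul_assoc]

theorem d_dT {i j k : ℤ} (h : i + 1 = j) (h' : j + 1 = k) (u : T S A i) :
    dT h' (dT h u) = 0 := by
  induction u using W_induction with
  | h0 => simp
  | ha u v hu hv => simp only [map_add, hu, hv, add_zero]
  | @ht p q hpq f a =>
    rw [dT_tm h hpq rfl rfl (by omega) (by omega), map_add, map_smul,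
      dT_tm h' _ rfl rfl (by omega) (by omega), dT_tm h' _ rfl rfl (by omega) (by omega),
      S.d_d, A.d_d]
    simp only [map_zero, LinearMap.zero_apply, sg_add, sg_one]
    module

theorem d_smulT {i j k i' j' k' : ℤ} (h : i + j = k) (hk : k + 1 = k') (hi : i + 1 = i')
    (hj : j + 1 = j') (h1 : i' + j = k') (h2 : i + j' = k') (s : S.C i) (u : T S A j) :
    dT hk (smulT h s u) = smulT h1 (S.d hi s) u + sg K i • smulT h2 s (dT hj u) := by
  induction u using W_induction with
  | h0 => simp
  | ha u v hu hv => simp only [map_add, hu, hv, smul_add]; abel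
  | @ht p q hpq f a =>
    obtain ⟨ip, hip⟩ : ∃ x, i + p = x := ⟨_, rfl⟩
    obtain ⟨ip', hip'⟩ : ∃ x, ip + 1 = x := ⟨_, rfl⟩
    rw [smulT_tm h hpq hip (by omega), smulT_tm h1 hpq (show i' + p = ip' by omega) (by omega),
      dT_tm hj hpq rfl rfl (by omega) (by omega), dT_tm hk _ hip' rfl (by omega) (by omega),
      S.d_mul hip hip' hi rfl (by omega) (by omega)]
    simp only [map_add, map_smul, LinearMap.add_apply, LinearMap.smul_apply]
    rw [smulT_tm h2 _ (show i + (p + 1) = ip' by omega) (by omega),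
      smulT_tm h2 _ hip (by omega)]
    subst hip
    simp only [sg_add]
    module

theorem skewT {i j k : ℤ} (h : i + j = k) (h' : j + i = k) (u : T S A i) (v : T S A j) :
    brT h u v = -(sg K (i * j) • brT h' v u) := by
  induction u using W_induction with
  | h0 => simp
  | ha u u' hu hv => simp only [map_add, LinearMap.add_apply, hu, hv, smul_add]; abel
  | @ht p q hpq f a =>
  induction v using W_induction with
  | h0 => simp
  | ha v v' hu hv => simp only [map_add, LinearMap.add_apply, hu, hv, smul_add]; abel
  | @ht p' q' hpq' g b =>
    obtain ⟨pp, hp⟩ : ∃ x, p + p' = x := ⟨_, rfl⟩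
    obtain ⟨qq, hq⟩ : ∃ x, q + q' = x := ⟨_, rfl⟩
    rw [brT_tm h hpq hpq' hp hq (by omega), brT_tm h' hpq' hpq (show p' + p = pp by omega)
      (show q' + q = qq by omega) (by omega), S.mul_comm hp (show p' + p = pp by omega),
      A.skew hq (show q' + q = qq by omega)]
    simp only [← hpq, ← hpq', map_neg, map_smul, LinearMap.smul_apply, mul_add, add_mul, sg_add, mul_comm q' p,
      mul_comm q p', mul_comm q' q]
    rcases sg_cases (K := K) (p * q') with h3 | h3 <;> rw [h3] <;> module

set_option maxHeartbeats 1000000 in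
theorem jacobiT {i j k ij ik jk n : ℤ} (hij : i + j = ij) (hik : i + k = ik) (hjk : j + k = jk)
    (h1 : i + jk = n) (h2 : ij + k = n) (h3 : j + ik = n) (u : T S A i) (v : T S A j)
    (x : T S A k) : brT h1 u (brT hjk v x) =
      brT h2 (brT hij u v) x + sg K (i * j) • brT h3 v (brT hik u x) := by
  induction u using W_induction with
  | h0 => simp
  | ha u u' hu hv => simp only [map_add, LinearMap.add_apply, hu, hv, smul_add]; abel
  | @ht p₁ q₁ e₁ f₁ a₁ =>
  induction v using W_induction with
  | h0 => simp
  | ha u u' hu hv => simp only [map_add, LinearMap.add_apply, hu, hv, smul_add]; abel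
  | @ht p₂ q₂ e₂ f₂ a₂ =>
  induction x using W_induction with
  | h0 => simp
  | ha u u' hu hv => simp only [map_add, LinearMap.add_apply, hu, hv, smul_add]; abel
  | @ht p₃ q₃ e₃ f₃ a₃ =>
    obtain ⟨p12, hp12⟩ : ∃ x, p₁ + p₂ = x := ⟨_, rfl⟩
    obtain ⟨p13, hp13⟩ : ∃ x, p₁ + p₃ = x := ⟨_, rfl⟩
    obtain ⟨p23, hp23⟩ : ∃ x, p₂ + p₃ = x := ⟨_, rfl⟩
    obtain ⟨p, hp⟩ : ∃ x, p₁ + p23 = x := ⟨_, rfl⟩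
    obtain ⟨q12, hq12⟩ : ∃ x, q₁ + q₂ = x := ⟨_, rfl⟩
    obtain ⟨q13, hq13⟩ : ∃ x, q₁ + q₃ = x := ⟨_, rfl⟩
    obtain ⟨q23, hq23⟩ : ∃ x, q₂ + q₃ = x := ⟨_, rfl⟩
    obtain ⟨q, hq⟩ : ∃ x, q₁ + q23 = x := ⟨_, rfl⟩
    rw [brT_tm hjk e₂ e₃ hp23 hq23 (by omega), brT_tm hij e₁ e₂ hp12 hq12 (by omega),
      brT_tm hik e₁ e₃ hp13 hq13 (by omega)]
    simp only [map_smul, LinearMap.smul_apply]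
    rw [brT_tm h1 e₁ _ hp hq (by omega),
      brT_tm h2 _ e₃ (show p12 + p₃ = p by omega) (show q12 + q₃ = q by omega) (by omega),
      brT_tm h3 e₂ _ (show p₂ + p13 = p by omega) (show q₂ + q13 = q by omega) (by omega),
      A.jacobi hq12 hq13 hq23 hq (show q12 + q₃ = q by omega) (show q₂ + q13 = q by omega),
      S.mul_assoc hp12 (show p12 + p₃ = p by omega) hp23 hp,
      ← S.mul_assoc (show p₂ + p₁ = p12 by omega) (show p12 + p₃ = p by omega) hp13
        (show p₂ + p13 = p by omega), S.mul_comm (show p₂ + p₁ = p12 by omega) hp12]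
    simp only [map_smul, LinearMap.smul_apply, map_add]
    rw [S.mul_assoc hp12 (show p12 + p₃ = p by omega) hp23 hp]
    subst hp12 hp13 hp23 hq12 hq13 hq23
    simp only [← e₁, ← e₂, ← e₃, mul_add, add_mul, sg_add, mul_comm p₂ p₁, mul_comm q₂ p₁, mul_comm q₂ q₁]
    rcases sg_cases (K := K) (p₁ * p₂) with h4 | h4 <;>
    rcases sg_cases (K := K) (p₁ * q₂) with h5 | h5 <;>
    rcases sg_cases (K := K) (q₁ * p₂) with h6 | h6 <;> rw [h4, h5] <;> module

theorem d_brT {i j k i' j' k' : ℤ} (h : i + j = k) (hk : k + 1 = k') (hi : i + 1 = i')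
    (hj : j + 1 = j') (h1 : i' + j = k') (h2 : i + j' = k') (u : T S A i) (v : T S A j) :
    dT hk (brT h u v) = brT h1 (dT hi u) v + sg K i • brT h2 u (dT hj v) := by
  induction u using W_induction with
  | h0 => simp
  | ha u u' hu hv => simp only [map_add, LinearMap.add_apply, hu, hv, smul_add]; abel
  | @ht p q hpq f a =>
  induction v using W_induction with
  | h0 => simp
  | ha v v' hu hv => simp only [map_add, LinearMap.add_apply, hu, hv, smul_add]; abel
  | @ht p' q' hpq' g b =>
    obtain ⟨pp, hp⟩ : ∃ x, p + p' = x := ⟨_, rfl⟩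
    obtain ⟨qq, hq⟩ : ∃ x, q + q' = x := ⟨_, rfl⟩
    obtain ⟨pp', hp'⟩ : ∃ x, pp + 1 = x := ⟨_, rfl⟩
    obtain ⟨qq', hq'⟩ : ∃ x, qq + 1 = x := ⟨_, rfl⟩
    rw [brT_tm h hpq hpq' hp hq (by omega), map_smul, dT_tm hk _ hp' hq' (by omega) (by omega),
      dT_tm hi hpq rfl rfl (by omega) (by omega), dT_tm hj hpq' rfl rfl (by omega) (by omega)]
    simp only [map_smul, LinearMap.smul_apply, map_add, LinearMap.add_apply]
    rw [brT_tm h1 _ hpq' (show p + 1 + p' = pp' by omega) hq (by omega),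
      brT_tm h1 _ hpq' hp (show q + 1 + q' = qq' by omega) (by omega),
      brT_tm h2 hpq _ (show p + (p' + 1) = pp' by omega) hq (by omega),
      brT_tm h2 hpq _ hp (show q + (q' + 1) = qq' by omega) (by omega),
      S.d_mul hp hp' rfl rfl (by omega) (by omega), A.d_br hq hq' rfl rfl (by omega) (by omega)]
    subst hp hq
    simp only [← hpq, ← hpq', mul_add, add_mul, sg_add, mul_one, one_mul, map_add, map_smul,
      LinearMap.add_apply, LinearMap.smul_apply]
    rcases sg_cases (K := K) q with h4 | h4 <;>
    rcases sg_cases (K := K) p' with h5 | h5 <;> rw [h4, h5] <;> module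

theorem act_brT {i j k ij ik jk n : ℤ} (hij : i + j = ij) (hik : i + k = ik) (hjk : j + k = jk)
    (h1 : i + jk = n) (h2 : ij + k = n) (h3 : j + ik = n) (ξ : Der S i) (v : T S A j)
    (x : T S A k) : actT h1 ξ (brT hjk v x) =
      brT h2 (actT hij ξ v) x + sg K (i * j) • brT h3 v (actT hik ξ x) := by
  induction v using W_induction with
  | h0 => simp
  | ha u u' hu hv => simp only [map_add, LinearMap.add_apply, hu, hv, smul_add]; abel
  | @ht p q hpq f a =>
  induction x using W_induction with
  | h0 => simp
  | ha v v' hu hv => simp only [map_add, LinearMap.add_apply, hu, hv, smul_add]; abel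
  | @ht p' q' hpq' g b =>
    obtain ⟨pp, hp⟩ : ∃ x, p + p' = x := ⟨_, rfl⟩
    obtain ⟨qq, hq⟩ : ∃ x, q + q' = x := ⟨_, rfl⟩
    obtain ⟨ipp, hip⟩ : ∃ x, i + pp = x := ⟨_, rfl⟩
    rw [brT_tm hjk hpq hpq' hp hq (by omega), map_smul, actT_tm h1 _ hip (by omega),
      actT_tm hij hpq rfl (by omega), actT_tm hik hpq' rfl (by omega),
      brT_tm h2 _ hpq' (show i + p + p' = ipp by omega) hq (by omega),
      brT_tm h3 hpq _ (show p + (i + p') = ipp by omega) hq (by omega),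
      Der.ap_mul ξ hp rfl rfl hip (by omega) (by omega)]
    simp only [← hpq, ← hpq', mul_add, add_mul, sg_add, map_add, map_smul,
      LinearMap.add_apply, LinearMap.smul_apply, mul_comm q i]
    rcases sg_cases (K := K) (i * q) with h4 | h4 <;> rw [h4] <;> module

theorem br_actT {i j k ij ik jk n : ℤ} (hij : i + j = ij) (hik : i + k = ik) (hjk : j + k = jk)
    (h1 : i + jk = n) (h2 : ij + k = n) (h3 : j + ik = n) (ξ : Der S i) (η : Der S j)
    (x : T S A k) : actT h2 (Der.br hij ξ η) x =
      actT h1 ξ (actT hjk η x) - sg K (i * j) • actT h3 η (actT hik ξ x) := by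
  induction x using W_induction with
  | h0 => simp
  | ha u u' hu hv => simp only [map_add, hu, hv, smul_add]; abel
  | @ht p q hpq f a =>
    obtain ⟨r, hr⟩ : ∃ x, ij + p = x := ⟨_, rfl⟩
    rw [actT_tm h2 hpq hr (by omega), actT_tm hjk hpq rfl (by omega),
      actT_tm hik hpq rfl (by omega),
      actT_tm h1 _ (show i + (j + p) = r by omega) (by omega),
      actT_tm h3 _ (show j + (i + p) = r by omega) (by omega),
      Der.ap_br hij ξ η hr rfl (by omega) rfl (by omega)]
    simp

theorem smul_actT {i j k ij jk n : ℤ} (h1 : i + j = ij) (h2 : ij + k = n) (h3 : j + k = jk)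
    (h4 : i + jk = n) (s : S.C i) (η : Der S j) (u : T S A k) :
    actT h2 (Der.smul h1 s η) u = smulT h4 s (actT h3 η u) := by
  induction u using W_induction with
  | h0 => simp
  | ha u v hu hv => simp only [map_add, hu, hv]
  | @ht p q hpq f a =>
    obtain ⟨r, hr⟩ : ∃ x, ij + p = x := ⟨_, rfl⟩
    rw [actT_tm h2 hpq hr (by omega), actT_tm h3 hpq rfl (by omega),
      smulT_tm h4 _ (show i + (j + p) = r by omega) (by omega),
      Der.ap_smul h1 s η hr rfl (by omega)]

theorem d_actT {i j k i' j' k' : ℤ} (h : i + j = k) (hk : k + 1 = k') (hi : i + 1 = i')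
    (hj : j + 1 = j') (h1 : i' + j = k') (h2 : i + j' = k') (ξ : Der S i) (u : T S A j) :
    actT h1 (Der.d hi ξ) u = dT hk (actT h ξ u) - sg K i • actT h2 ξ (dT hj u) := by
  induction u using W_induction with
  | h0 => simp
  | ha u u' hu hv => simp only [map_add, hu, hv, smul_add]; abel
  | @ht p q hpq f a =>
    obtain ⟨r, hr⟩ : ∃ x, i + p = x := ⟨_, rfl⟩
    obtain ⟨r', hr'⟩ : ∃ x, r + 1 = x := ⟨_, rfl⟩
    rw [actT_tm h1 hpq (show i' + p = r' by omega) (by omega), actT_tm h hpq hr (by omega),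
      dT_tm hk _ hr' rfl (by omega) (by omega), dT_tm hj hpq rfl rfl (by omega) (by omega)]
    simp only [map_add, map_smul, LinearMap.add_apply, LinearMap.smul_apply]
    rw [actT_tm h2 _ (show i + (p + 1) = r' by omega) (by omega), actT_tm h2 _ hr (by omega),
      Der.ap_d hi ξ (show i' + p = r' by omega) hr hr' rfl (by omega)]
    subst hr
    simp only [map_sub, map_smul, LinearMap.sub_apply, LinearMap.smul_apply, sg_add]
    module

theorem act_smulT {i j k ij ik jk n : ℤ} (hij : i + j = ij) (hik : i + k = ik)
    (hjk : j + k = jk) (h1 : i + jk = n) (h2 : ij + k = n) (h3 : j + ik = n) (ξ : Der S i)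
    (s : S.C j) (u : T S A k) : actT h1 ξ (smulT hjk s u) =
      smulT h2 (Der.ap hij ξ s) u + sg K (i * j) • smulT h3 s (actT hik ξ u) := by
  induction u using W_induction with
  | h0 => simp
  | ha u u' hu hv => simp only [map_add, hu, hv, smul_add]; abel
  | @ht p q hpq f a =>
    obtain ⟨r, hr⟩ : ∃ x, j + p = x := ⟨_, rfl⟩
    obtain ⟨r', hr'⟩ : ∃ x, i + r = x := ⟨_, rfl⟩
    rw [smulT_tm hjk hpq hr (by omega), actT_tm h1 _ hr' (by omega),
      smulT_tm h2 hpq (show ij + p = r' by omega) (by omega), actT_tm hik hpq rfl (by omega),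
      smulT_tm h3 _ (show j + (i + p) = r' by omega) (by omega),
      Der.ap_mul ξ hr hij rfl hr' (by omega) (by omega)]
    simp

theorem br_smulT {i j k ik jk n : ℤ} (hik : i + k = ik) (hjk : j + k = jk)
    (h1 : i + jk = n) (h3 : j + ik = n) (u : T S A i)
    (s : S.C j) (v : T S A k) : brT h1 u (smulT hjk s v) =
      sg K (i * j) • smulT h3 s (brT hik u v) := by
  induction u using W_induction with
  | h0 => simp
  | ha u u' hu hv => simp only [map_add, LinearMap.add_apply, hu, hv, smul_add]
  | @ht p q hpq f a =>
  induction v using W_induction with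
  | h0 => simp
  | ha v v' hu hv => simp only [map_add, hu, hv, smul_add]
  | @ht p' q' hpq' g b =>
    obtain ⟨pp, hp⟩ : ∃ x, p + p' = x := ⟨_, rfl⟩
    obtain ⟨qq, hq⟩ : ∃ x, q + q' = x := ⟨_, rfl⟩
    obtain ⟨jp, hjp⟩ : ∃ x, j + p' = x := ⟨_, rfl⟩
    obtain ⟨r, hr⟩ : ∃ x, p + jp = x := ⟨_, rfl⟩
    rw [smulT_tm hjk hpq' hjp (by omega), brT_tm h1 hpq _ hr hq (by omega),
      brT_tm hik hpq hpq' hp hq (by omega), map_smul,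
      smulT_tm h3 _ (show j + pp = r by omega) (by omega),
      ← S.mul_assoc (show p + j = j + p by omega) (show j + p + p' = r by omega),
      S.mul_comm (show p + j = j + p by omega) rfl, map_smul, LinearMap.smul_apply,
      S.mul_assoc rfl _ hp (by omega)]
    subst hjp
    simp only [← hpq, mul_add, add_mul, sg_add, map_smul, LinearMap.smul_apply]
    module

theorem anch_smulT {i j k ij jk n : ℤ} (h1 : i + j = ij) (h2 : ij + k = n) (h3 : j + k = jk)
    (h4 : i + jk = n) (s : S.C i) (u : T S A j) (r : R.C k) :
    anchT ψ h2 (smulT h1 s u) r = S.mul h4 s (anchT ψ h3 u r) := by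
  induction u using W_induction with
  | h0 => simp
  | ha u u' hu hv => simp only [map_add, LinearMap.add_apply, hu, hv]
  | @ht p q hpq f a =>
    rw [smulT_tm h1 hpq rfl (by omega), anchT_tm ψ h2 _ rfl (by omega),
      anchT_tm ψ h3 hpq rfl (by omega), S.mul_assoc]

theorem anch_dT {i j k i' j' k' : ℤ} (h : i + j = k) (hk : k + 1 = k') (hi : i + 1 = i')
    (hj : j + 1 = j') (h1 : i' + j = k') (h2 : i + j' = k') (u : T S A i) (r : R.C j) :
    anchT ψ h1 (dT hi u) r = S.d hk (anchT ψ h u r) - sg K i • anchT ψ h2 u (R.d hj r) := by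
  induction u using W_induction with
  | h0 => simp
  | ha u u' hu hv => simp only [map_add, LinearMap.add_apply, hu, hv, smul_add]; abel
  | @ht p q hpq f a =>
    obtain ⟨x, hx⟩ : ∃ x, q + j = x := ⟨_, rfl⟩
    obtain ⟨y, hy⟩ : ∃ y, q + j' = y := ⟨_, rfl⟩
    rw [dT_tm hi hpq rfl rfl (by omega) (by omega), map_add, map_smul, LinearMap.add_apply,
      LinearMap.smul_apply, anchT_tm ψ h1 _ hx (by omega),
      anchT_tm ψ h1 _ (show q + 1 + j = y by omega) (by omega),
      anchT_tm ψ h hpq hx (by omega), anchT_tm ψ h2 hpq hy (by omega),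
      S.d_mul (show p + x = k by omega) hk rfl (show x + 1 = y by omega) (by omega) (by omega),
      ← ψ.map_d, A.anch_d hx (show x + 1 = y by omega) rfl hj (by omega) hy]
    simp only [← hpq, map_sub, map_smul, sg_add]
    module

/-- The map `(u, v, r) ↦ (-1)^{u g} g u(σ(b)(r))` for `v = g ⊗ b`. -/
def thetaT {k l c m n : ℤ} (h : k + l = m) (hn : m + c = n) (u : T S A k) (r : R.C c) :
    T S A l →ₗ[K] S.C n :=
  liftW fun p q hpq => sg K (k * p) • (S.mul (show p + (k + (q + c)) = n by omega)).compl₂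
    ((anchT ψ rfl u).comp ((A.anch rfl).flip r))

theorem thetaT_tm {k l c m n p q x y : ℤ} (h : k + l = m) (hn : m + c = n) (u : T S A k)
    (r : R.C c) (hpq : p + q = l) (hx : q + c = x) (hy : k + x = y) (h1 : p + y = n) (g : S.C p)
    (b : A.C q) : thetaT ψ h hn u r (tm (K := K) hpq g b) =
      sg K (k * p) • S.mul h1 g (anchT ψ hy u (A.anch hx b r)) := by
  subst hx hy; simp [thetaT]

theorem thetaT_add {k l c m n : ℤ} (h : k + l = m) (hn : m + c = n) (u u' : T S A k)
    (r : R.C c) (v : T S A l) :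
    thetaT ψ h hn (u + u') r v = thetaT ψ h hn u r v + thetaT ψ h hn u' r v := by
  induction v using W_induction with
  | h0 => simp
  | ha v v' hu hv => simp only [map_add, hu, hv]; abel
  | @ht p q hpq f a => simp [thetaT]

theorem thetaT_zero {k l c m n : ℤ} (h : k + l = m) (hn : m + c = n)
    (r : R.C c) (v : T S A l) :
    thetaT ψ h hn (0 : T S A k) r v = 0 := by
  induction v using W_induction with
  | h0 => simp
  | ha v v' hu hv => simp only [map_add, hu, hv]; abel
  | @ht p q hpq f a => simp [thetaT]

theorem anch_brT {i j k l n : ℤ} (h : i + j = k) (h' : j + i = k) (hn : k + l = n)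
    (u : T S A i) (v : T S A j) (r : R.C l) : anchT ψ hn (brT h u v) r =
      thetaT ψ h hn u r v - sg K (i * j) • thetaT ψ h' hn v r u := by
  induction u using W_induction with
  | h0 => simp [thetaT_zero]
  | ha u u' hu hv =>
    simp only [map_add, LinearMap.add_apply, hu, hv, smul_add, thetaT_add]; abel
  | @ht p q hpq f a =>
  induction v using W_induction with
  | h0 => simp [thetaT_zero]
  | ha u u' hu hv =>
    simp only [map_add, LinearMap.add_apply, hu, hv, smul_add, thetaT_add]; abel
  | @ht p' q' hpq' g b =>
    obtain ⟨pp, hp⟩ : ∃ x, p + p' = x := ⟨_, rfl⟩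
    obtain ⟨qq, hq⟩ : ∃ x, q + q' = x := ⟨_, rfl⟩
    obtain ⟨ql, hql⟩ : ∃ x, q + l = x := ⟨_, rfl⟩
    obtain ⟨ql', hql'⟩ : ∃ x, q' + l = x := ⟨_, rfl⟩
    obtain ⟨qql, hqql⟩ : ∃ x, qq + l = x := ⟨_, rfl⟩
    obtain ⟨x, hx⟩ : ∃ x, i + ql' = x := ⟨_, rfl⟩
    obtain ⟨y, hy⟩ : ∃ x, j + ql = x := ⟨_, rfl⟩
    rw [brT_tm h hpq hpq' hp hq (by omega), map_smul, LinearMap.smul_apply,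
      anchT_tm ψ hn _ hqql (by omega), thetaT_tm ψ h hn _ r hpq' hql' hx (by omega),
      thetaT_tm ψ h' hn _ r hpq hql hy (by omega),
      anchT_tm ψ hx hpq (show q + ql' = qql by omega) (by omega),
      anchT_tm ψ hy hpq' (show q' + ql = qql by omega) (by omega),
      A.anch_br hq hql hql' (show q + ql' = qql by omega) hqql (show q' + ql = qql by omega),
      ← S.mul_assoc hp (show pp + qql = n by omega),
      ← S.mul_assoc (show p' + p = pp by omega) (show pp + qql = n by omega),
      S.mul_comm (show p' + p = pp by omega) hp]
    simp only [← hpq, ← hpq', mul_add, add_mul, sg_add, map_smul, map_sub, LinearMap.smul_apply,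
      mul_comm q' p, mul_comm p' p, mul_comm q' q]
    rcases sg_cases (K := K) (p * p') with h4 | h4 <;>
    rcases sg_cases (K := K) (p * q') with h5 | h5 <;> rw [h4, h5] <;> module

theorem act_anchT {i j k l n jl : ℤ} (h : i + j = k) (hn : k + l = n) (hjl : j + l = jl)
    (h2 : i + jl = n) (u : T S A i) (ξ : Der S i)
    (hu : ∀ {p q : ℤ} (h : i + p = q) (r : R.C p), anchT ψ h u r = Der.ap h ξ (ψ.map p r))
    (v : T S A j) (r : R.C l) : Der.ap h2 ξ (anchT ψ hjl v r) =
      anchT ψ hn (actT h ξ v) r + thetaT ψ h hn u r v := by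
  induction v using W_induction with
  | h0 => simp
  | ha u u' hu hv => simp only [map_add, LinearMap.add_apply, hu, hv]; abel
  | @ht p q hpq g b =>
    obtain ⟨ql, hql⟩ : ∃ x, q + l = x := ⟨_, rfl⟩
    rw [anchT_tm ψ hjl hpq hql (by omega), actT_tm h hpq rfl (by omega),
      anchT_tm ψ hn _ hql (by omega), thetaT_tm ψ h hn u r hpq hql rfl (by omega), hu,
      Der.ap_mul ξ _ rfl rfl h2]

end Pull

/-! Sub- and quotient Lie-Rinehart algebras. -/

/-- Restriction of a bilinear map to submodules. -/
def restr₂ {M₁ : Type u} {M₂ M₃ : Type v} [AddCommGroup M₁] [AddCommGroup M₂] [AddCommGroup M₃]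
    [Module K M₁] [Module K M₂] [Module K M₃] (β : M₁ →ₗ[K] M₂ →ₗ[K] M₃) (P₁ : Submodule K M₁)
    (P₂ : Submodule K M₂) (P₃ : Submodule K M₃) (h : ∀ a ∈ P₁, ∀ b ∈ P₂, β a b ∈ P₃) :
    P₁ →ₗ[K] P₂ →ₗ[K] P₃ :=
  LinearMap.mk₂ K (fun a b => ⟨β a b, h a a.2 b b.2⟩) (by intros; ext; simp)
    (by intros; ext; simp) (by intros; ext; simp) (by intros; ext; simp)

/-- Descent of a bilinear map to quotients. -/
def desc₂ {M₁ M₂ M₃ : Type*} [AddCommGroup M₁] [AddCommGroup M₂] [AddCommGroup M₃]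
    [Module K M₁] [Module K M₂] [Module K M₃] (β : M₁ →ₗ[K] M₂ →ₗ[K] M₃) (I₁ : Submodule K M₁)
    (I₂ : Submodule K M₂) (I₃ : Submodule K M₃) (h₁ : ∀ a ∈ I₁, ∀ b, β a b ∈ I₃)
    (h₂ : ∀ a, ∀ b ∈ I₂, β a b ∈ I₃) : (M₁ ⧸ I₁) →ₗ[K] (M₂ ⧸ I₂) →ₗ[K] (M₃ ⧸ I₃) :=
  I₁.liftQ
    { toFun := fun a => I₂.mapQ I₃ (β a) (fun b hb => h₂ a b hb)
      map_add' := by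
        intro a a'; ext b; simp
      map_smul' := by
        intro c a; ext b; simp }
    (by
      intro a ha
      rw [LinearMap.mem_ker]
      ext b
      simpa using (Submodule.Quotient.mk_eq_zero I₃).2 (h₁ a ha b))

@[simp] theorem desc₂_mk {M₁ M₂ M₃ : Type*} [AddCommGroup M₁] [AddCommGroup M₂] [AddCommGroup M₃]
    [Module K M₁] [Module K M₂] [Module K M₃] (β : M₁ →ₗ[K] M₂ →ₗ[K] M₃) (I₁ : Submodule K M₁)
    (I₂ : Submodule K M₂) (I₃ : Submodule K M₃) (h₁) (h₂) (a : M₁) (b : M₂) :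
    desc₂ β I₁ I₂ I₃ h₁ h₂ (Submodule.Quotient.mk a) (Submodule.Quotient.mk b) =
      Submodule.Quotient.mk (β a b) := rfl

/-- The sub-Lie-Rinehart algebra given by a graded submodule closed under all operations. -/
def subLR {S : CDGA.{u} K} (Q : LR S) (P : ∀ k, Submodule K (Q.C k))
    (hs : ∀ {i j k : ℤ} (h : i + j = k) (s : S.C i), ∀ a ∈ P j, Q.smul h s a ∈ P k)
    (hd : ∀ {i j : ℤ} (h : i + 1 = j), ∀ a ∈ P i, Q.d h a ∈ P j)
    (hb : ∀ {i j k : ℤ} (h : i + j = k), ∀ a ∈ P i, ∀ b ∈ P j, Q.br h a b ∈ P k) : LR S where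
  C k := P k
  smul {i j k} h := LinearMap.mk₂ K (fun s (a : P j) => (⟨Q.smul h s a, hs h s a a.2⟩ : P k))
    (by intros; ext; simp) (by intros; ext; simp) (by intros; ext; simp) (by intros; ext; simp)
  d h := (Q.d h).restrict (hd h)
  br h := restr₂ (Q.br h) _ _ _ (hb h)
  anch h := (Q.anch h).comp (P _).subtype
  one_smul h a := Subtype.ext (Q.one_smul h a)
  mul_smul h1 h2 h3 h4 f g a := Subtype.ext (Q.mul_smul h1 h2 h3 h4 f g a)
  d_d h h' a := Subtype.ext (Q.d_d h h' a)
  d_smul h hk hi hj h1 h2 f a := Subtype.ext (Q.d_smul h hk hi hj h1 h2 f a)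
  skew h h' a b := Subtype.ext (Q.skew h h' a b)
  jacobi hij hik hjk h1 h2 h3 a b c := Subtype.ext (Q.jacobi hij hik hjk h1 h2 h3 a b c)
  d_br h hk hi hj h1 h2 a b := Subtype.ext (Q.d_br h hk hi hj h1 h2 a b)
  anch_mul hij hik hjk h1 h2 h3 a f g := Q.anch_mul hij hik hjk h1 h2 h3 a f g
  anch_smul h1 h2 h3 h4 f a g := Q.anch_smul h1 h2 h3 h4 f a g
  anch_br hij hik hjk h1 h2 h3 a b f := Q.anch_br hij hik hjk h1 h2 h3 a b f
  anch_d h hk hi hj h1 h2 a f := Q.anch_d h hk hi hj h1 h2 a f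
  leibniz hij hik hjk h1 h2 h3 a f b := Subtype.ext (Q.leibniz hij hik hjk h1 h2 h3 a f b)

/-- The quotient of a Lie-Rinehart algebra by a graded ideal. -/
def quotLR {S : CDGA.{u} K} (Q : LR S) (I : ∀ k, Submodule K (Q.C k))
    (hs : ∀ {i j k : ℤ} (h : i + j = k) (s : S.C i), ∀ a ∈ I j, Q.smul h s a ∈ I k)
    (hd : ∀ {i j : ℤ} (h : i + 1 = j), ∀ a ∈ I i, Q.d h a ∈ I j)
    (hb : ∀ {i j k : ℤ} (h : i + j = k) (a : Q.C i), ∀ b ∈ I j, Q.br h a b ∈ I k)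
    (ha : ∀ {i j k : ℤ} (h : i + j = k), ∀ a ∈ I i, ∀ f : S.C j, Q.anch h a f = 0) : LR S where
  C k := Q.C k ⧸ I k
  smul {i j k} h :=
    { toFun := fun s => (I j).mapQ (I k) (Q.smul h s) (fun a => hs h s a)
      map_add' := by intros; ext; simp
      map_smul' := by intros; ext; simp }
  d {i j} h := (I i).mapQ (I j) (Q.d h) (fun a => hd h a)
  br {i j k} h := desc₂ (Q.br h) _ _ _ (fun a ha b => by
      rw [Q.skew h (show j + i = k by omega)]
      exact neg_mem (Submodule.smul_mem _ _ (hb _ b a ha))) (fun a b => hb h a b)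
  anch {i j k} h := (I i).liftQ (Q.anch h) (fun a h' => by ext f; exact ha h a h' f)
  one_smul h a := by
    obtain ⟨a, rfl⟩ := Submodule.Quotient.mk_surjective _ a
    exact congrArg Submodule.Quotient.mk (Q.one_smul h a)
  mul_smul h1 h2 h3 h4 f g a := by
    obtain ⟨a, rfl⟩ := Submodule.Quotient.mk_surjective _ a
    exact congrArg Submodule.Quotient.mk (Q.mul_smul h1 h2 h3 h4 f g a)
  d_d h h' a := by
    obtain ⟨a, rfl⟩ := Submodule.Quotient.mk_surjective _ a
    exact congrArg Submodule.Quotient.mk (Q.d_d h h' a)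
  d_smul h hk hi hj h1 h2 f a := by
    obtain ⟨a, rfl⟩ := Submodule.Quotient.mk_surjective _ a
    exact congrArg Submodule.Quotient.mk (Q.d_smul h hk hi hj h1 h2 f a)
  skew h h' a b := by
    obtain ⟨a, rfl⟩ := Submodule.Quotient.mk_surjective _ a
    obtain ⟨b, rfl⟩ := Submodule.Quotient.mk_surjective _ b
    exact congrArg Submodule.Quotient.mk (Q.skew h h' a b)
  jacobi hij hik hjk h1 h2 h3 a b c := by
    obtain ⟨a, rfl⟩ := Submodule.Quotient.mk_surjective _ a
    obtain ⟨b, rfl⟩ := Submodule.Quotient.mk_surjective _ b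
    obtain ⟨c, rfl⟩ := Submodule.Quotient.mk_surjective _ c
    exact congrArg Submodule.Quotient.mk (Q.jacobi hij hik hjk h1 h2 h3 a b c)
  d_br h hk hi hj h1 h2 a b := by
    obtain ⟨a, rfl⟩ := Submodule.Quotient.mk_surjective _ a
    obtain ⟨b, rfl⟩ := Submodule.Quotient.mk_surjective _ b
    exact congrArg Submodule.Quotient.mk (Q.d_br h hk hi hj h1 h2 a b)
  anch_mul hij hik hjk h1 h2 h3 a f g := by
    obtain ⟨a, rfl⟩ := Submodule.Quotient.mk_surjective _ a
    exact Q.anch_mul hij hik hjk h1 h2 h3 a f g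
  anch_smul h1 h2 h3 h4 f a g := by
    obtain ⟨a, rfl⟩ := Submodule.Quotient.mk_surjective _ a
    exact Q.anch_smul h1 h2 h3 h4 f a g
  anch_br hij hik hjk h1 h2 h3 a b f := by
    obtain ⟨a, rfl⟩ := Submodule.Quotient.mk_surjective _ a
    obtain ⟨b, rfl⟩ := Submodule.Quotient.mk_surjective _ b
    exact Q.anch_br hij hik hjk h1 h2 h3 a b f
  anch_d h hk hi hj h1 h2 a f := by
    obtain ⟨a, rfl⟩ := Submodule.Quotient.mk_surjective _ a
    exact Q.anch_d h hk hi hj h1 h2 a f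
  leibniz hij hik hjk h1 h2 h3 a f b := by
    obtain ⟨a, rfl⟩ := Submodule.Quotient.mk_surjective _ a
    obtain ⟨b, rfl⟩ := Submodule.Quotient.mk_surjective _ b
    exact congrArg Submodule.Quotient.mk (Q.leibniz hij hik hjk h1 h2 h3 a f b)

namespace Pull

variable {R S : CDGA.{u} K} (ψ : CDGAHom R S) (A : LR R)

variable {A}

/-- The first component of the bracket of `(S ⊗ A) ⋊ Der S`. -/
def sbr {i j k : ℤ} (h : i + j = k) (u : T S A i) (ξ : Der S i) (v : T S A j) (η : Der S j) :
    T S A k :=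
  brT h u v + actT h ξ v - sg K (i * j) • actT (show j + i = k by omega) η u

theorem sbr_skew {i j k : ℤ} (h : i + j = k) (h' : j + i = k) (u : T S A i) (ξ : Der S i)
    (v : T S A j) (η : Der S j) : sbr h u ξ v η = -(sg K (i * j) • sbr h' v η u ξ) := by
  unfold sbr
  rw [skewT h h', mul_comm j i]
  rcases sg_cases (K := K) (i * j) with h3 | h3 <;> rw [h3] <;> module

set_option maxHeartbeats 2000000 in
theorem sbr_jacobi {i j k ij ik jk n : ℤ} (hij : i + j = ij) (hik : i + k = ik)
    (hjk : j + k = jk) (h1 : i + jk = n) (h2 : ij + k = n) (h3 : j + ik = n)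
    (u : T S A i) (ξ : Der S i) (v : T S A j) (η : Der S j) (x : T S A k) (ζ : Der S k) :
    sbr h1 u ξ (sbr hjk v η x ζ) (Der.br hjk η ζ) =
      sbr h2 (sbr hij u ξ v η) (Der.br hij ξ η) x ζ +
        sg K (i * j) • sbr h3 v η (sbr hik u ξ x ζ) (Der.br hik ξ ζ) := by
  unfold sbr
  simp only [map_add, map_sub, map_smul, LinearMap.add_apply, LinearMap.sub_apply,
    LinearMap.smul_apply]
  rw [jacobiT hij hik hjk h1 h2 h3, act_brT hij hik hjk h1 h2 h3,
    act_brT (show j + i = ij by omega) hjk hik h3 (show ij + k = n by omega) h1 η,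
    act_brT (show k + i = ik by omega) (show k + j = jk by omega) hij
      (show k + ij = n by omega) (show ik + j = n by omega) h1 ζ,
    br_actT hij hik hjk h1 h2 h3,
    br_actT hjk (show j + i = ij by omega) (show k + i = ik by omega)
      (show j + ik = n by omega) _ (show k + ij = n by omega),
    br_actT hik (show i + j = ij by omega) (show k + j = jk by omega)
      (show i + jk = n by omega) _ (show k + ij = n by omega),
    skewT h3 (show ik + j = n by omega) v (actT _ ζ u)]
  subst hij hik hjk
  simp only [mul_add, add_mul, sg_add, mul_comm j i, mul_comm k i]
  have e4 := sg_sq (K := K) (i * j)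
  have e5 := sg_sq (K := K) (i * k)
  generalize sg K (i * j) = s at e4 ⊢
  generalize sg K (i * k) = t at e5 ⊢
  generalize sg K (j * k) = r
  match_scalars
  all_goals first
    | ring1
    | linear_combination (-1 : K) * e4
    | linear_combination r * e5
    | linear_combination r * e4
    | linear_combination -(t * r * e4)

theorem sbr_d {i j k i' j' k' : ℤ} (h : i + j = k) (hk : k + 1 = k') (hi : i + 1 = i')
    (hj : j + 1 = j') (h1 : i' + j = k') (h2 : i + j' = k') (u : T S A i) (ξ : Der S i)
    (v : T S A j) (η : Der S j) : dT hk (sbr h u ξ v η) =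
      sbr h1 (dT hi u) (Der.d hi ξ) v η + sg K i • sbr h2 u ξ (dT hj v) (Der.d hj η) := by
  unfold sbr
  simp only [map_add, map_sub, map_smul]
  rw [d_brT h hk hi hj h1 h2, d_actT h hk hi hj h1 h2,
    d_actT (show j + i = k by omega) hk hj hi (show j' + i = k' by omega)
      (show j + i' = k' by omega)]
  subst hi hj
  simp only [mul_add, add_mul, sg_add, mul_one, one_mul]
  rcases sg_cases (K := K) i with h4 | h4 <;>
  rcases sg_cases (K := K) j with h5 | h5 <;> rw [h4, h5] <;> module

theorem sbr_leibniz {i j k ij ik jk n : ℤ} (hij : i + j = ij) (hik : i + k = ik)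
    (hjk : j + k = jk) (h1 : i + jk = n) (h2 : ij + k = n) (h3 : j + ik = n)
    (u : T S A i) (ξ : Der S i) (s : S.C j) (v : T S A k) (η : Der S k) :
    sbr h1 u ξ (smulT hjk s v) (Der.smul hjk s η) =
      smulT h2 (Der.ap hij ξ s) v + sg K (i * j) • smulT h3 s (sbr hik u ξ v η) := by
  unfold sbr
  rw [br_smulT hik hjk h1 h3, act_smulT hij hik hjk h1 h2 h3,
    smul_actT hjk (show jk + i = n by omega) (show k + i = ik by omega) h3]
  subst hjk
  simp only [map_add, map_sub, map_smul, mul_add, sg_add]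
  module

/-- The bracket of `(S ⊗ A) ⋊ Der S`. -/
def semiBr {i j k : ℤ} (h : i + j = k) :
    (T S A i × Der S i) →ₗ[K] (T S A j × Der S j) →ₗ[K] (T S A k × Der S k) :=
  LinearMap.mk₂ K (fun x y => (sbr h x.1 x.2 y.1 y.2, Der.br h x.2 y.2))
    (by
      intro x x' y
      refine Prod.ext ?_ (by simp)
      simp only [sbr, Prod.fst_add, Prod.snd_add, map_add, LinearMap.add_apply]
      module)
    (by
      intro c x y
      refine Prod.ext ?_ (by simp)
      simp only [sbr, Prod.smul_fst, Prod.smul_snd, map_smul, LinearMap.smul_apply]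
      module)
    (by
      intro x y y'
      refine Prod.ext ?_ (by simp)
      simp only [sbr, Prod.fst_add, Prod.snd_add, map_add, LinearMap.add_apply]
      module)
    (by
      intro c x y
      refine Prod.ext ?_ (by simp)
      simp only [sbr, Prod.smul_fst, Prod.smul_snd, map_smul, LinearMap.smul_apply]
      module)

/-- The action of `S` on `(S ⊗ A) ⋊ Der S`. -/
def semiSmul {i j k : ℤ} (h : i + j = k) :
    S.C i →ₗ[K] (T S A j × Der S j) →ₗ[K] (T S A k × Der S k) :=
  LinearMap.mk₂ K (fun s x => (smulT h s x.1, Der.smul h s x.2))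
    (by intros; exact Prod.ext (by simp) (by simp))
    (by intros; exact Prod.ext (by simp) (by simp))
    (by intros; exact Prod.ext (by simp) (by simp))
    (by intros; exact Prod.ext (by simp) (by simp))

variable (A)

/-- The Lie-Rinehart algebra `(S ⊗ A) ⋊ Der S` with the bracket
`[(f ⊗ a, ξ), (g ⊗ b, η)] =
  ((-1)^{a g} f g ⊗ [a, b] + ξ(g) ⊗ b - (-1)^{ξ η} η(f) ⊗ a, [ξ, η])`. -/
def semiLR : LR S where
  C k := T S A k × Der S k
  smul := semiSmul
  d h := (dT h).prodMap (Der.d h)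
  br := semiBr
  anch h := (Der.ap h).comp (LinearMap.snd K _ _)
  one_smul h x := Prod.ext (one_smulT h x.1) (Der.one_smul h x.2)
  mul_smul h1 h2 h3 h4 s t x :=
    Prod.ext (mul_smulT h1 h2 h3 h4 s t x.1) (Der.mul_smul h1 h2 h3 h4 s t x.2)
  d_d h h' x := Prod.ext (d_dT h h' x.1) (Der.d_d h h' x.2)
  d_smul h hk hi hj h1 h2 s x :=
    Prod.ext (d_smulT h hk hi hj h1 h2 s x.1) (Der.d_smul h hk hi hj h1 h2 s x.2)
  skew h h' x y := Prod.ext (sbr_skew h h' x.1 x.2 y.1 y.2) (Der.skew h h' x.2 y.2)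
  jacobi hij hik hjk h1 h2 h3 x y z :=
    Prod.ext (sbr_jacobi hij hik hjk h1 h2 h3 x.1 x.2 y.1 y.2 z.1 z.2)
      (Der.jacobi hij hik hjk h1 h2 h3 x.2 y.2 z.2)
  d_br h hk hi hj h1 h2 x y :=
    Prod.ext (sbr_d h hk hi hj h1 h2 x.1 x.2 y.1 y.2) (Der.d_br h hk hi hj h1 h2 x.2 y.2)
  anch_mul hij hik hjk h1 h2 h3 x f g := Der.ap_mul x.2 hjk hij hik h1 h2 h3 f g
  anch_smul h1 h2 h3 h4 s x f := Der.ap_smul h1 s x.2 h2 h3 h4 f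
  anch_br hij hik hjk h1 h2 h3 x y f := Der.ap_br hij x.2 y.2 h2 hjk h1 hik h3 f
  anch_d h hk hi hj h1 h2 x f := Der.ap_d hi x.2 h1 h hk hj h2 f
  leibniz hij hik hjk h1 h2 h3 x s y :=
    Prod.ext (sbr_leibniz hij hik hjk h1 h2 h3 x.1 x.2 s y.1 y.2)
      (Der.leibniz hij hik hjk h1 h2 h3 x.2 s y.2)

/-- The relations `f ψ(r) ⊗ a = f ⊗ r a` defining `S ⊗_R A` as a quotient of `S ⊗_K A`. -/
def relT (k : ℤ) : Submodule K (T S A k) :=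
  Submodule.span K {u | ∃ (p q s pq qs : ℤ) (hpq : p + q = pq) (hqs : q + s = qs)
    (h1 : pq + s = k) (h2 : p + qs = k) (f : S.C p) (r : R.C q) (a : A.C s),
    u = tm (K := K) h1 (S.mul hpq f (ψ.map q r)) a - tm h2 f (A.smul hqs r a)}

variable {A}

theorem rel_mem {k p q s pq qs : ℤ} (hpq : p + q = pq) (hqs : q + s = qs)
    (h1 : pq + s = k) (h2 : p + qs = k) (f : S.C p) (r : R.C q) (a : A.C s) :
    tm (K := K) h1 (S.mul hpq f (ψ.map q r)) a - tm h2 f (A.smul hqs r a) ∈ relT ψ A k :=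
  Submodule.subset_span ⟨p, q, s, pq, qs, hpq, hqs, h1, h2, f, r, a, rfl⟩

theorem smul_rel {i j k : ℤ} (h : i + j = k) (s : S.C i) (u : T S A j) (hu : u ∈ relT ψ A j) :
    smulT h s u ∈ relT ψ A k := by
  induction hu using Submodule.span_induction with
  | zero => simp
  | add u v _ _ hu hv => rw [map_add]; exact add_mem hu hv
  | smul c u _ hu => rw [map_smul]; exact Submodule.smul_mem _ _ hu
  | mem u hu =>
    obtain ⟨p, q, t, pq, qt, hpq, hqt, h1, h2, f, r, a, rfl⟩ := hu
    rw [map_sub, smulT_tm h h1 rfl (by omega), smulT_tm h h2 rfl (by omega),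
      ← S.mul_assoc rfl (show i + p + q = i + pq by omega)]
    exact rel_mem ψ _ _ _ _ _ _ _

theorem d_rel {i j : ℤ} (h : i + 1 = j) (u : T S A i) (hu : u ∈ relT ψ A i) :
    dT h u ∈ relT ψ A j := by
  induction hu using Submodule.span_induction with
  | zero => simp
  | add u v _ _ hu hv => rw [map_add]; exact add_mem hu hv
  | smul c u _ hu => rw [map_smul]; exact Submodule.smul_mem _ _ hu
  | mem u hu =>
    obtain ⟨p, q, t, pq, qt, hpq, hqt, h1, h2, f, r, a, rfl⟩ := hu
    obtain ⟨pq', hpq'⟩ : ∃ x, pq + 1 = x := ⟨_, rfl⟩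
    obtain ⟨qt', hqt'⟩ : ∃ x, qt + 1 = x := ⟨_, rfl⟩
    rw [map_sub, dT_tm h h1 hpq' rfl (by omega) (by omega),
      dT_tm h h2 rfl hqt' (by omega) (by omega),
      S.d_mul hpq hpq' rfl rfl (by omega) (by omega),
      A.d_smul hqt hqt' rfl rfl (by omega) (by omega), ← ψ.map_d]
    have e1 := rel_mem ψ (show p + 1 + q = pq' by omega) hqt (show pq' + t = j by omega)
      (by omega) (S.d rfl f) r a
    have e2 := rel_mem ψ (show p + (q + 1) = pq' by omega) (show q + 1 + t = qt' by omega)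
      (show pq' + t = j by omega) (by omega) f (R.d rfl r) a
    have e3 := rel_mem ψ hpq (show q + (t + 1) = qt' by omega)
      (show pq + (t + 1) = j by omega) (by omega) f r (A.d rfl a)
    convert add_mem e1 (add_mem (Submodule.smul_mem _ (sg K p) e2)
      (Submodule.smul_mem _ (sg K pq) e3)) using 1
    simp only [map_add, map_smul, LinearMap.add_apply, LinearMap.smul_apply]
    subst hpq
    simp only [sg_add]
    module

theorem anch_rel {i j k : ℤ} (h : i + j = k) (u : T S A i) (hu : u ∈ relT ψ A i) (x : R.C j) :
    anchT ψ h u x = 0 := by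
  induction hu using Submodule.span_induction with
  | zero => simp
  | add u v _ _ hu hv => rw [map_add, LinearMap.add_apply, hu, hv, add_zero]
  | smul c u _ hu => rw [map_smul, LinearMap.smul_apply, hu, smul_zero]
  | mem u hu =>
    obtain ⟨p, q, t, pq, qt, hpq, hqt, h1, h2, f, r, a, rfl⟩ := hu
    rw [map_sub, LinearMap.sub_apply, anchT_tm ψ h h1 rfl (by omega),
      anchT_tm ψ h h2 rfl (by omega), A.anch_smul hqt rfl rfl (by omega), ψ.map_mul,
      S.mul_assoc hpq _ (show q + (t + j) = qt + j by omega) (by omega), sub_self]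

theorem br_rel_aux {i k l p q s pq qs pk ps : ℤ} (h : i + k = l) (hpq : p + q = pq)
    (hqs : q + s = qs) (h1 : pq + s = k) (h2 : p + qs = k) (hx : i + q = pk) (hy : p + pk = ps)
    (h3 : ps + s = l) (u : T S A i) (f : S.C p) (r : R.C q) (a : A.C s) :
    brT h u (tm (K := K) h1 (S.mul hpq f (ψ.map q r)) a - tm h2 f (A.smul hqs r a)) +
      sg K (i * p) • tm h3 (S.mul hy f (anchT ψ hx u r)) a ∈ relT ψ A l := by
  induction u using W_induction with
  | h0 => simp
  | ha u v hu hv =>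
    convert add_mem hu hv using 1
    simp only [map_add, LinearMap.add_apply]
    module
  | @ht p' q' e f' a' =>
    obtain ⟨pp, hpp⟩ : ∃ x, p' + p = x := ⟨_, rfl⟩
    obtain ⟨ppq, hppq⟩ : ∃ x, pp + q = x := ⟨_, rfl⟩
    obtain ⟨qt, hqt⟩ : ∃ x, q' + s = x := ⟨_, rfl⟩
    obtain ⟨qq, hqq⟩ : ∃ x, q' + q = x := ⟨_, rfl⟩
    obtain ⟨z, hz⟩ : ∃ x, q' + qs = x := ⟨_, rfl⟩
    rw [map_sub, brT_tm h e h1 (show p' + pq = ppq by omega) hqt (by omega),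
      brT_tm h e h2 hpp hz (by omega), anchT_tm ψ hx e hqq (by omega),
      A.leibniz hqq hqt hqs hz (show qq + s = z by omega) (show q + qt = z by omega),
      ← S.mul_assoc hpp hppq hpq, ← S.mul_assoc (show p + p' = pp by omega) (show pp + qq = ps by omega),
      S.mul_comm (show p + p' = pp by omega) hpp]
    have e1 := rel_mem ψ hppq (show q + qt = z by omega) (show ppq + qt = l by omega)
      (by omega) (S.mul hpp f' f) r (A.br hqt a' a)
    have e2 := rel_mem ψ (show pp + qq = ps by omega) (show qq + s = z by omega) h3
      (by omega) (S.mul hpp f' f) (A.anch hqq a' r) a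
    convert add_mem (Submodule.smul_mem _ (sg K (q' * pq)) e1)
      (Submodule.smul_mem _ (sg K (q' * p)) e2) using 1
    simp only [map_add, map_smul, LinearMap.smul_apply, ← hpq, ← e, mul_add, add_mul,
      sg_add, mul_comm p p']
    rcases sg_cases (K := K) (p' * p) with h4 | h4 <;> rw [h4] <;> module

theorem br_rel {i k l : ℤ} (h : i + k = l) (u : T S A i) (ξ : Der S i)
    (hu : ∀ {p q : ℤ} (h : i + p = q) (r : R.C p), anchT ψ h u r = Der.ap h ξ (ψ.map p r))
    (v : T S A k) (hv : v ∈ relT ψ A k) : brT h u v + actT h ξ v ∈ relT ψ A l := by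
  induction hv using Submodule.span_induction with
  | zero => simp
  | add v w _ _ hv hw =>
    rw [map_add, map_add]; convert add_mem hv hw using 1; abel
  | smul c v _ hv => rw [map_smul, map_smul, ← smul_add]; exact Submodule.smul_mem _ _ hv
  | mem v hv =>
    obtain ⟨p, q, t, pq, qt, hpq, hqt, h1, h2, f, r, a, rfl⟩ := hv
    obtain ⟨ip, hip⟩ : ∃ x, i + p = x := ⟨_, rfl⟩
    obtain ⟨ipq, hipq⟩ : ∃ x, ip + q = x := ⟨_, rfl⟩
    have e1 := br_rel_aux ψ h hpq hqt h1 h2 rfl (show p + (i + q) = ipq by omega)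
      (show ipq + t = l by omega) u f r a
    have e2 := rel_mem ψ hipq hqt (show ipq + t = l by omega) (by omega) (Der.ap hip ξ f) r a
    convert add_mem e1 e2 using 1
    rw [map_sub (actT h ξ), actT_tm h h1 (show i + pq = ipq by omega) (by omega),
      actT_tm h h2 hip (by omega), hu,
      Der.ap_mul ξ hpq hip rfl _ hipq (by omega)]
    simp only [map_add, map_smul, LinearMap.add_apply, LinearMap.smul_apply]
    module

variable (A)

/-- Compatible pairs: `(u, ξ)` such that `ξ ∘ ψ` is the derivation `R → S` given by `u`, i.e.
`u` and `ξ` have the same image in `S ⊗_R Der(R) → Der(R, S)`. -/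
def compat (k : ℤ) : Submodule K ((semiLR (S := S) A).C k) where
  carrier := {x | ∀ (p q : ℤ) (h : k + p = q) (r : R.C p),
    anchT ψ h x.1 r = Der.ap h x.2 (ψ.map p r)}
  zero_mem' := by
    intro p q h r
    change anchT ψ h (0 : T S A k) r = Der.ap h (0 : Der S k) _
    simp
  add_mem' := by
    intro x y hx hy p q h r
    change anchT ψ h (x.1 + y.1) r = Der.ap h (x.2 + y.2) _
    simp only [map_add, LinearMap.add_apply, hx p q h r, hy p q h r]
  smul_mem' := by
    intro c x hx p q h r
    change anchT ψ h (c • x.1) r = Der.ap h (c • x.2) _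
    simp only [map_smul, LinearMap.smul_apply, hx p q h r]

/-- The Lie-Rinehart algebra of compatible pairs. -/
def compatLR : LR S :=
  subLR (semiLR A) (compat ψ A)
    (by
      intro i j k h s x hx p q hk r
      change anchT ψ hk (smulT h s x.1) r = Der.ap hk (Der.smul h s x.2) _
      rw [anch_smulT ψ h hk rfl (by omega), hx, Der.ap_smul h s _ hk rfl (by omega)])
    (by
      intro i j h x hx p q hk r
      change anchT ψ hk (dT h x.1) r = Der.ap hk (Der.d h x.2) _
      rw [anch_dT ψ rfl (show i + p + 1 = q by omega) h rfl hk (by omega), hx, hx,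
        Der.ap_d h _ hk rfl (by omega) rfl (by omega), ψ.map_d])
    (by
      intro i j k h x hx y hy p q hk r
      change anchT ψ hk (brT h x.1 y.1 + actT h x.2 y.1 -
        sg K (i * j) • actT (show j + i = k by omega) y.2 x.1) r = Der.ap hk (Der.br h x.2 y.2) _
      rw [Der.ap_br h _ _ hk rfl (show i + (j + p) = q by omega) rfl
        (show j + (i + p) = q by omega), ← hy _ _ rfl r, ← hx _ _ rfl r,
        act_anchT ψ h hk rfl _ x.1 x.2 (fun h r => hx _ _ h r) y.1 r,
        act_anchT ψ (show j + i = k by omega) hk rfl _ y.1 y.2 (fun h r => hy _ _ h r) x.1 r]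
      simp only [map_add, map_sub, map_smul, LinearMap.add_apply, LinearMap.sub_apply,
        LinearMap.smul_apply]
      rw [anch_brT ψ h (show j + i = k by omega) hk]
      module)

/-- The ideal of compatible pairs `(u, 0)` with `u` vanishing in `S ⊗_R A`. -/
def relIdeal (k : ℤ) : Submodule K ((compatLR ψ A).C k) where
  carrier := {x | x.1.1 ∈ relT ψ A k ∧ x.1.2 = 0}
  zero_mem' := ⟨zero_mem _, rfl⟩
  add_mem' := by
    intro x y hx hy
    refine ⟨add_mem hx.1 hy.1, ?_⟩
    change x.1.2 + y.1.2 = 0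
    rw [hx.2, hy.2, add_zero]
  smul_mem' := by
    intro c x hx
    refine ⟨Submodule.smul_mem _ c hx.1, ?_⟩
    change c • x.1.2 = 0
    rw [hx.2, smul_zero]

/-- The inverse image `ψ⁺ A` of a Lie-Rinehart algebra, that is, the pairs `(u, ξ)` with
`u ∈ S ⊗_R A` and `ξ ∈ Der S` having the same image in `Der(R, S)`. -/
def pullLR : LR S :=
  quotLR (compatLR ψ A) (relIdeal ψ A)
    (by
      intro i j k h s x hx
      refine ⟨smul_rel ψ h s x.1.1 hx.1, ?_⟩
      change Der.smul h s x.1.2 = 0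
      rw [hx.2, map_zero])
    (by
      intro i j h x hx
      refine ⟨d_rel ψ h x.1.1 hx.1, ?_⟩
      change Der.d h x.1.2 = 0
      rw [hx.2, map_zero])
    (by
      intro i j k h x y hy
      constructor
      · change brT h x.1.1 y.1.1 + actT h x.1.2 y.1.1 -
          sg K (i * j) • actT (show j + i = k by omega) y.1.2 x.1.1 ∈ _
        rw [hy.2, map_zero, LinearMap.zero_apply, smul_zero, sub_zero]
        exact br_rel ψ h _ _ (fun h r => x.2 _ _ h r) _ hy.1
      · change Der.br h x.1.2 y.1.2 = 0
        rw [hy.2, map_zero])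
    (by
      intro i j k h x hx f
      change Der.ap h x.1.2 f = 0
      rw [hx.2, map_zero, LinearMap.zero_apply])

end Pull

/-! ### Sheaves

A sheaf is presented by its espace étalé: a family of stalks `F x`, together with, for every point
`x`, the submodule `sec x` of those families `s : ∀ z, F z` which form a section of the sheaf in
some neighbourhood of `x` (and are arbitrary outside of it). -/

/-- A sheaf of families of elements of `F`, i.e. a subsheaf of the sheaf of all families. -/
structure LocalSec (K : Type w) [Field K] {X : Type u} [TopologicalSpace X] (F : X → Type u)
    [∀ x, AddCommGroup (F x)] [∀ x, Module K (F x)] where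
  sec : ∀ _ : X, Submodule K (∀ z, F z)
  eventually_mem : ∀ {x : X} {s : ∀ z, F z}, s ∈ sec x → ∀ᶠ z in 𝓝 x, s ∈ sec z
  congr : ∀ {x : X} {s t : ∀ z, F z}, s ∈ sec x → (∀ᶠ z in 𝓝 x, s z = t z) → t ∈ sec x

/-- A sheaf with stalks `F`: germs of sections correspond bijectively to elements of stalks. -/
structure Etale (K : Type w) [Field K] {X : Type u} [TopologicalSpace X] (F : X → Type u)
    [∀ x, AddCommGroup (F x)] [∀ x, Module K (F x)] extends LocalSec K F where
  germ : ∀ (x : X) (a : F x), ∃ s ∈ sec x, s x = a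
  eq_zero : ∀ {x : X} {s : ∀ z, F z}, s ∈ sec x → s x = 0 → ∀ᶠ z in 𝓝 x, s z = 0

/-- A topological space with a sheaf of commutative differential graded algebras. -/
structure DGSpace (K : Type w) [Field K] where
  X : Type u
  [top : TopologicalSpace X]
  O : X → CDGA.{u} K
  S : ∀ i : ℤ, Etale K (fun x => (O x).C i)
  one_sec : ∀ x : X, (fun z => (O z).one) ∈ (S 0).sec x
  mul_sec : ∀ {x : X} {i j k : ℤ} (h : i + j = k), ∀ f ∈ (S i).sec x, ∀ g ∈ (S j).sec x,
    (fun z => (O z).mul h (f z) (g z)) ∈ (S k).sec x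
  d_sec : ∀ {x : X} {i j : ℤ} (h : i + 1 = j), ∀ f ∈ (S i).sec x,
    (fun z => (O z).d h (f z)) ∈ (S j).sec x

attribute [instance] DGSpace.top

/-- A sheaf of families of elements of Lie-Rinehart algebras, closed under all operations. -/
structure PreLieAlgebroid (𝔛 : DGSpace.{u} K) where
  L : ∀ x : 𝔛.X, LR (𝔛.O x)
  S : ∀ i : ℤ, LocalSec K (fun x => (L x).C i)
  smul_sec : ∀ {x : 𝔛.X} {i j k : ℤ} (h : i + j = k), ∀ f ∈ (𝔛.S i).sec x, ∀ a ∈ (S j).sec x,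
    (fun z => (L z).smul h (f z) (a z)) ∈ (S k).sec x
  d_sec : ∀ {x : 𝔛.X} {i j : ℤ} (h : i + 1 = j), ∀ a ∈ (S i).sec x,
    (fun z => (L z).d h (a z)) ∈ (S j).sec x
  br_sec : ∀ {x : 𝔛.X} {i j k : ℤ} (h : i + j = k), ∀ a ∈ (S i).sec x, ∀ b ∈ (S j).sec x,
    (fun z => (L z).br h (a z) (b z)) ∈ (S k).sec x
  anch_sec : ∀ {x : 𝔛.X} {i j k : ℤ} (h : i + j = k), ∀ a ∈ (S i).sec x, ∀ f ∈ (𝔛.S j).sec x,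
    (fun z => (L z).anch h (a z) (f z)) ∈ (𝔛.S k).sec x

/-- A differential graded Lie algebroid on `𝔛`: a sheaf of Lie-Rinehart algebras, whose stalks are
the `L x`. -/
structure LieAlgebroid (𝔛 : DGSpace.{u} K) extends PreLieAlgebroid 𝔛 where
  germ : ∀ {i : ℤ} (x : 𝔛.X) (a : (L x).C i), ∃ s ∈ (S i).sec x, s x = a
  eq_zero : ∀ {i : ℤ} {x : 𝔛.X} {s : ∀ z, (L z).C i}, s ∈ (S i).sec x → s x = 0 →
    ∀ᶠ z in 𝓝 x, s z = 0

/-- Morphisms: families of morphisms of Lie-Rinehart algebras taking sections to sections. -/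
@[ext]
structure PreLieAlgebroid.Hom {𝔛 : DGSpace.{u} K} (A B : PreLieAlgebroid 𝔛) where
  map : ∀ x : 𝔛.X, LRHom (A.L x) (B.L x)
  map_sec : ∀ {x : 𝔛.X} {i : ℤ}, ∀ s ∈ (A.S i).sec x, (fun z => (map z).map i (s z)) ∈ (B.S i).sec x

theorem LRHom.ext' {R : CDGA.{u} K} {A B : LR R} {f g : LRHom A B}
    (h : ∀ i a, f.map i a = g.map i a) : f = g := by
  obtain ⟨f, _, _, _, _⟩ := f
  obtain ⟨g, _, _, _, _⟩ := g
  have : f = g := by funext i; ext a; exact h i a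
  subst this; rfl

/-- The identity morphism. -/
def LRHom.id {R : CDGA.{u} K} (A : LR R) : LRHom A A where
  map _ := LinearMap.id
  map_smul _ _ _ := rfl
  map_d _ _ := rfl
  map_br _ _ _ := rfl
  map_anch _ _ _ := rfl

/-- Composition of morphisms (first `f`, then `g`). -/
def LRHom.comp {R : CDGA.{u} K} {A B C : LR R} (f : LRHom A B) (g : LRHom B C) : LRHom A C where
  map i := (g.map i).comp (f.map i)
  map_smul h s a := by simp [f.map_smul, g.map_smul]
  map_d h a := by simp [f.map_d, g.map_d]
  map_br h a b := by simp [f.map_br, g.map_br]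
  map_anch h a s := by simp [f.map_anch, g.map_anch]

namespace PreLieAlgebroid

variable {𝔛 : DGSpace.{u} K}

/-- The identity morphism. -/
def Hom.id (A : PreLieAlgebroid 𝔛) : Hom A A := ⟨fun _ => LRHom.id _, fun _ hs => hs⟩

/-- Composition of morphisms (first `f`, then `g`). -/
def Hom.comp {A B C : PreLieAlgebroid 𝔛} (f : Hom A B) (g : Hom B C) : Hom A C :=
  ⟨fun x => (f.map x).comp (g.map x), fun s hs => g.map_sec _ (f.map_sec s hs)⟩

variable (P : PreLieAlgebroid 𝔛)

/-! The Lie algebroid with the same sections as `P`, whose stalks are the germs of sections. -/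

/-- Sections near `x` which vanish near `x`. -/
def evZero (i : ℤ) (x : 𝔛.X) : Submodule K ((P.S i).sec x) where
  carrier := {s | ∀ᶠ z in 𝓝 x, s.1 z = 0}
  zero_mem' := Filter.Eventually.of_forall fun _ => rfl
  add_mem' {s t} hs ht := by
    filter_upwards [hs, ht] with z h1 h2
    change s.1 z + t.1 z = 0
    rw [h1, h2, add_zero]
  smul_mem' c s hs := by
    filter_upwards [hs] with z h1
    change c • s.1 z = 0
    rw [h1, smul_zero]

/-- Germs of sections at `x`. -/
abbrev Germ (i : ℤ) (x : 𝔛.X) : Type u := (P.S i).sec x ⧸ P.evZero i x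

variable {P} in
/-- The germ of a section. -/
def toGerm {i : ℤ} {x : 𝔛.X} (s : ∀ z, (P.L z).C i) (hs : s ∈ (P.S i).sec x) : P.Germ i x :=
  Submodule.Quotient.mk ⟨s, hs⟩

variable {P}

theorem toGerm_eq {i : ℤ} {x : 𝔛.X} {s t : ∀ z, (P.L z).C i} (hs : s ∈ (P.S i).sec x)
    (ht : t ∈ (P.S i).sec x) (h : ∀ᶠ z in 𝓝 x, s z = t z) : toGerm s hs = toGerm t ht := by
  refine (Submodule.Quotient.eq _).2 ?_
  filter_upwards [h] with z hz
  change s z - t z = 0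
  rw [hz, sub_self]

theorem toGerm_eq_iff {i : ℤ} {x : 𝔛.X} {s t : ∀ z, (P.L z).C i} (hs : s ∈ (P.S i).sec x)
    (ht : t ∈ (P.S i).sec x) : toGerm s hs = toGerm t ht ↔ ∀ᶠ z in 𝓝 x, s z = t z := by
  refine ⟨fun h => ?_, toGerm_eq hs ht⟩
  have := (Submodule.Quotient.eq _).1 h
  filter_upwards [this] with z hz
  exact sub_eq_zero.1 hz

theorem exists_toGerm {i : ℤ} {x : 𝔛.X} (a : P.Germ i x) : ∃ s, ∃ hs, a = toGerm s hs := by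
  obtain ⟨⟨s, hs⟩, rfl⟩ := Submodule.Quotient.mk_surjective _ a
  exact ⟨s, hs, rfl⟩

/-- Multiplication by a section. -/
def smulGerm {i j k : ℤ} (h : i + j = k) {x : 𝔛.X} (f : ∀ z, (𝔛.O z).C i)
    (hf : f ∈ (𝔛.S i).sec x) : P.Germ j x →ₗ[K] P.Germ k x :=
  (P.evZero j x).mapQ (P.evZero k x)
    { toFun := fun s => ⟨_, P.smul_sec h f hf s.1 s.2⟩
      map_add' := by
        intro s t; apply Subtype.ext; funext z; exact map_add _ _ _
      map_smul' := by
        intro c t; apply Subtype.ext; funext z; exact map_smul _ _ _ }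
    (by
      intro s hs
      filter_upwards [hs] with z hz
      change (P.L z).smul h (f z) (s.1 z) = 0
      rw [hz, map_zero])

theorem smulGerm_congr {i j k : ℤ} (h : i + j = k) {x : 𝔛.X} (f g : ∀ z, (𝔛.O z).C i)
    (hf : f ∈ (𝔛.S i).sec x) (hg : g ∈ (𝔛.S i).sec x) (hfg : f x = g x) (a : P.Germ j x) :
    smulGerm h f hf a = smulGerm h g hg a := by
  obtain ⟨s, hs, rfl⟩ := exists_toGerm a
  apply toGerm_eq
  have := (𝔛.S i).eq_zero (sub_mem hf hg) (show f x - g x = 0 by rw [hfg, sub_self])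
  filter_upwards [this] with z hz
  have hz' : f z = g z := sub_eq_zero.1 hz
  change (P.L z).smul h (f z) (s z) = (P.L z).smul h (g z) (s z)
  rw [hz']

/-- Multiplication by an element of the stalk of the structure sheaf. -/
def smulStalk {i j k : ℤ} (h : i + j = k) (x : 𝔛.X) :
    (𝔛.O x).C i →ₗ[K] P.Germ j x →ₗ[K] P.Germ k x where
  toFun f := smulGerm h _ ((𝔛.S i).germ x f).choose_spec.1
  map_add' f g := by
    refine LinearMap.ext fun a => ?_
    obtain ⟨s, hs, rfl⟩ := exists_toGerm a
    have h1 := ((𝔛.S i).germ x f).choose_spec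
    have h2 := ((𝔛.S i).germ x g).choose_spec
    have h3 := ((𝔛.S i).germ x (f + g)).choose_spec
    refine (smulGerm_congr h _ _ h3.1 (add_mem h1.1 h2.1)
      (by rw [h3.2, Pi.add_apply, h1.2, h2.2]) _).trans ?_
    exact toGerm_eq _ (add_mem (P.smul_sec h _ h1.1 s hs) (P.smul_sec h _ h2.1 s hs))
      (Filter.Eventually.of_forall fun z => LinearMap.map_add₂ _ _ _ _)
  map_smul' c f := by
    refine LinearMap.ext fun a => ?_
    obtain ⟨s, hs, rfl⟩ := exists_toGerm a
    have h1 := ((𝔛.S i).germ x f).choose_spec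
    have h3 := ((𝔛.S i).germ x (c • f)).choose_spec
    refine (smulGerm_congr h _ _ h3.1 (Submodule.smul_mem _ c h1.1)
      (by rw [h3.2, Pi.smul_apply, h1.2]) _).trans ?_
    exact toGerm_eq _ (Submodule.smul_mem _ c (P.smul_sec h _ h1.1 s hs))
      (Filter.Eventually.of_forall fun z => LinearMap.map_smul₂ _ _ _ _)

theorem smulStalk_toGerm {i j k : ℤ} (h : i + j = k) {x : 𝔛.X} {f : ∀ z, (𝔛.O z).C i}
    (hf : f ∈ (𝔛.S i).sec x) {s : ∀ z, (P.L z).C j} (hs : s ∈ (P.S j).sec x) :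
    smulStalk h x (f x) (toGerm s hs) = toGerm _ (P.smul_sec h f hf s hs) :=
  smulGerm_congr h _ _ ((𝔛.S i).germ x (f x)).choose_spec.1 hf
    ((𝔛.S i).germ x (f x)).choose_spec.2 _

variable (P) in
/-- The differential on germs. -/
def dStalk {i j : ℤ} (h : i + 1 = j) (x : 𝔛.X) : P.Germ i x →ₗ[K] P.Germ j x :=
  (P.evZero i x).mapQ (P.evZero j x)
    { toFun := fun s => ⟨_, P.d_sec h s.1 s.2⟩
      map_add' := by
        intro s t; apply Subtype.ext; funext z; exact map_add _ _ _
      map_smul' := by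
        intro c t; apply Subtype.ext; funext z; exact map_smul _ _ _ }
    (by
      intro s hs
      filter_upwards [hs] with z hz
      change (P.L z).d h (s.1 z) = 0
      rw [hz, map_zero])

theorem dStalk_toGerm {i j : ℤ} (h : i + 1 = j) {x : 𝔛.X} {s : ∀ z, (P.L z).C i}
    (hs : s ∈ (P.S i).sec x) : P.dStalk h x (toGerm s hs) = toGerm _ (P.d_sec h s hs) := rfl

variable (P) in
/-- The bracket on germs. -/
def brStalk {i j k : ℤ} (h : i + j = k) (x : 𝔛.X) :
    P.Germ i x →ₗ[K] P.Germ j x →ₗ[K] P.Germ k x :=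
  desc₂ (LinearMap.mk₂ K (fun (s : (P.S i).sec x) (t : (P.S j).sec x) =>
        (⟨_, P.br_sec h s.1 s.2 t.1 t.2⟩ : (P.S k).sec x))
      (by intros; apply Subtype.ext; funext z; exact LinearMap.map_add₂ _ _ _ _)
      (by intros; apply Subtype.ext; funext z; exact LinearMap.map_smul₂ _ _ _ _)
      (by intros; apply Subtype.ext; funext z; exact map_add _ _ _)
      (by intros; apply Subtype.ext; funext z; exact map_smul _ _ _)) _ _ _
    (by
      intro s hs t
      filter_upwards [hs] with z hz
      change (P.L z).br h (s.1 z) (t.1 z) = 0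
      rw [hz, map_zero, LinearMap.zero_apply])
    (by
      intro s t ht
      filter_upwards [ht] with z hz
      change (P.L z).br h (s.1 z) (t.1 z) = 0
      rw [hz, map_zero])

theorem brStalk_toGerm {i j k : ℤ} (h : i + j = k) {x : 𝔛.X} {s : ∀ z, (P.L z).C i}
    (hs : s ∈ (P.S i).sec x) {t : ∀ z, (P.L z).C j} (ht : t ∈ (P.S j).sec x) :
    P.brStalk h x (toGerm s hs) (toGerm t ht) = toGerm _ (P.br_sec h s hs t ht) := rfl

variable (P) in
/-- The action of germs on functions. -/
def anchStalk {i j k : ℤ} (h : i + j = k) (x : 𝔛.X) :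
    P.Germ i x →ₗ[K] (𝔛.O x).C j →ₗ[K] (𝔛.O x).C k :=
  (P.evZero i x).liftQ
    { toFun := fun s => (P.L x).anch h (s.1 x)
      map_add' := by
        intro s t; exact map_add _ _ _
      map_smul' := by
        intro c s; exact map_smul _ _ _ }
    (by
      intro s hs
      change (P.L x).anch h (s.1 x) = 0
      rw [hs.self_of_nhds, map_zero])

theorem anchStalk_toGerm {i j k : ℤ} (h : i + j = k) {x : 𝔛.X} {s : ∀ z, (P.L z).C i}
    (hs : s ∈ (P.S i).sec x) : P.anchStalk h x (toGerm s hs) = (P.L x).anch h (s x) := rfl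

theorem add_toGerm {i : ℤ} {x : 𝔛.X} {s t : ∀ z, (P.L z).C i} (hs : s ∈ (P.S i).sec x)
    (ht : t ∈ (P.S i).sec x) : toGerm s hs + toGerm t ht = toGerm _ (add_mem hs ht) := rfl

theorem neg_toGerm {i : ℤ} {x : 𝔛.X} {s : ∀ z, (P.L z).C i} (hs : s ∈ (P.S i).sec x) :
    -toGerm s hs = toGerm _ (neg_mem hs) := rfl

theorem const_smul_toGerm {i : ℤ} {x : 𝔛.X} (c : K) {s : ∀ z, (P.L z).C i}
    (hs : s ∈ (P.S i).sec x) : c • toGerm s hs = toGerm _ (Submodule.smul_mem _ c hs) := rfl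

theorem zero_toGerm {i : ℤ} {x : 𝔛.X} :
    (0 : P.Germ i x) = toGerm _ (zero_mem ((P.S i).sec x)) := rfl

theorem toGerm_eq' {i : ℤ} {x : 𝔛.X} {s t : ∀ z, (P.L z).C i} {hs : s ∈ (P.S i).sec x}
    {ht : t ∈ (P.S i).sec x} (h : ∀ z, s z = t z) : toGerm s hs = toGerm t ht :=
  toGerm_eq hs ht (Filter.Eventually.of_forall h)

variable (P) in
/-- The Lie-Rinehart algebra of germs at `x`. -/
def stalkLR (x : 𝔛.X) : LR (𝔛.O x) where
  C i := P.Germ i x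
  smul h := smulStalk h x
  d h := P.dStalk h x
  br h := P.brStalk h x
  anch h := P.anchStalk h x
  one_smul h a := by
    obtain ⟨s, hs, rfl⟩ := exists_toGerm a
    rw [smulStalk_toGerm h (𝔛.one_sec x) hs]
    exact toGerm_eq' fun z => (P.L z).one_smul h _
  mul_smul {i j k ij jk n} h1 h2 h3 h4 f g a := by
    obtain ⟨s, hs, rfl⟩ := exists_toGerm a
    obtain ⟨f, hf, rfl⟩ := (𝔛.S i).germ x f
    obtain ⟨g, hg, rfl⟩ := (𝔛.S j).germ x g
    rw [smulStalk_toGerm h3 hg hs, smulStalk_toGerm h4 hf,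
      smulStalk_toGerm h2 (𝔛.mul_sec h1 f hf g hg) hs]
    exact toGerm_eq' fun z => (P.L z).mul_smul h1 h2 h3 h4 _ _ _
  d_d h h' a := by
    obtain ⟨s, hs, rfl⟩ := exists_toGerm a
    rw [dStalk_toGerm, dStalk_toGerm, zero_toGerm]
    exact toGerm_eq' fun z => (P.L z).d_d h h' _
  d_smul {i j k i' j' k'} h hk hi hj h1 h2 f a := by
    obtain ⟨s, hs, rfl⟩ := exists_toGerm a
    obtain ⟨f, hf, rfl⟩ := (𝔛.S i).germ x f
    rw [smulStalk_toGerm h hf hs, smulStalk_toGerm h1 (𝔛.d_sec hi f hf) hs, dStalk_toGerm,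
      dStalk_toGerm, smulStalk_toGerm h2 hf, const_smul_toGerm, add_toGerm]
    exact toGerm_eq' fun z => (P.L z).d_smul h hk hi hj h1 h2 _ _
  skew h h' a b := by
    obtain ⟨s, hs, rfl⟩ := exists_toGerm a
    obtain ⟨t, ht, rfl⟩ := exists_toGerm b
    rw [brStalk_toGerm, brStalk_toGerm, const_smul_toGerm, neg_toGerm]
    exact toGerm_eq' fun z => (P.L z).skew h h' _ _
  jacobi hij hik hjk h1 h2 h3 a b c := by
    obtain ⟨s, hs, rfl⟩ := exists_toGerm a
    obtain ⟨t, ht, rfl⟩ := exists_toGerm b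
    obtain ⟨r, hr, rfl⟩ := exists_toGerm c
    rw [brStalk_toGerm, brStalk_toGerm, brStalk_toGerm, brStalk_toGerm, brStalk_toGerm,
      brStalk_toGerm, const_smul_toGerm, add_toGerm]
    exact toGerm_eq' fun z => (P.L z).jacobi hij hik hjk h1 h2 h3 _ _ _
  d_br h hk hi hj h1 h2 a b := by
    obtain ⟨s, hs, rfl⟩ := exists_toGerm a
    obtain ⟨t, ht, rfl⟩ := exists_toGerm b
    rw [brStalk_toGerm, dStalk_toGerm, dStalk_toGerm, dStalk_toGerm, brStalk_toGerm,
      brStalk_toGerm, const_smul_toGerm, add_toGerm]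
    exact toGerm_eq' fun z => (P.L z).d_br h hk hi hj h1 h2 _ _
  anch_mul hij hik hjk h1 h2 h3 a f g := by
    obtain ⟨s, hs, rfl⟩ := exists_toGerm a
    exact (P.L x).anch_mul hij hik hjk h1 h2 h3 (s x) f g
  anch_smul {i j k ij jk n} h1 h2 h3 h4 f a g := by
    obtain ⟨s, hs, rfl⟩ := exists_toGerm a
    obtain ⟨f, hf, rfl⟩ := (𝔛.S i).germ x f
    rw [smulStalk_toGerm h1 hf hs]
    exact (P.L x).anch_smul h1 h2 h3 h4 (f x) (s x) g
  anch_br hij hik hjk h1 h2 h3 a b f := by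
    obtain ⟨s, hs, rfl⟩ := exists_toGerm a
    obtain ⟨t, ht, rfl⟩ := exists_toGerm b
    exact (P.L x).anch_br hij hik hjk h1 h2 h3 (s x) (t x) f
  anch_d h hk hi hj h1 h2 a f := by
    obtain ⟨s, hs, rfl⟩ := exists_toGerm a
    exact (P.L x).anch_d h hk hi hj h1 h2 (s x) f
  leibniz {i j k ij ik jk n} hij hik hjk h1 h2 h3 a f b := by
    obtain ⟨s, hs, rfl⟩ := exists_toGerm a
    obtain ⟨t, ht, rfl⟩ := exists_toGerm b
    obtain ⟨f, hf, rfl⟩ := (𝔛.S j).germ x f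
    rw [smulStalk_toGerm hjk hf ht, brStalk_toGerm, brStalk_toGerm, smulStalk_toGerm h3 hf,
      anchStalk_toGerm, smulStalk_toGerm h2 (P.anch_sec hij s hs f hf) ht, const_smul_toGerm,
      add_toGerm]
    exact toGerm_eq' fun z => (P.L z).leibniz hij hik hjk h1 h2 h3 _ _ _

variable (P) in
/-- The families of germs which are locally the germs of a section of `P`. -/
def germSec (i : ℤ) : LocalSec K (fun x => P.Germ i x) where
  sec x :=
    { carrier := {t | ∃ s, ∀ᶠ z in 𝓝 x, ∃ hs : s ∈ (P.S i).sec z, t z = toGerm s hs}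
      zero_mem' := ⟨0, Filter.Eventually.of_forall fun _ => ⟨zero_mem _, rfl⟩⟩
      add_mem' := by
        rintro t t' ⟨s, hs⟩ ⟨s', hs'⟩
        refine ⟨s + s', ?_⟩
        filter_upwards [hs, hs'] with z ⟨h1, h2⟩ ⟨h3, h4⟩
        refine ⟨add_mem h1 h3, ?_⟩
        rw [Pi.add_apply, h2, h4]; rfl
      smul_mem' := by
        rintro c t ⟨s, hs⟩
        refine ⟨c • s, ?_⟩
        filter_upwards [hs] with z ⟨h1, h2⟩
        refine ⟨Submodule.smul_mem _ c h1, ?_⟩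
        rw [Pi.smul_apply, h2]; rfl }
  eventually_mem := by
    rintro x t ⟨s, hs⟩
    filter_upwards [eventually_eventually_nhds.2 hs] with z hz
    exact ⟨s, hz⟩
  congr := by
    rintro x t t' ⟨s, hs⟩ h
    refine ⟨s, ?_⟩
    filter_upwards [hs, h] with z ⟨h1, h2⟩ h3
    exact ⟨h1, h3 ▸ h2⟩

variable (P) in
/-- The Lie algebroid with the same sections as `P`. -/
def toLieAlgebroid : LieAlgebroid 𝔛 where
  L := P.stalkLR
  S := P.germSec
  smul_sec := by
    rintro x i j k h f hf t ⟨s, hs⟩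
    refine ⟨fun z => (P.L z).smul h (f z) (s z), ?_⟩
    filter_upwards [hs, (𝔛.S i).eventually_mem hf] with z ⟨h1, h2⟩ h3
    refine ⟨P.smul_sec h f h3 s h1, ?_⟩
    rw [h2]
    exact smulStalk_toGerm h h3 h1
  d_sec := by
    rintro x i j h t ⟨s, hs⟩
    refine ⟨fun z => (P.L z).d h (s z), ?_⟩
    filter_upwards [hs] with z ⟨h1, h2⟩
    refine ⟨P.d_sec h s h1, ?_⟩
    rw [h2]; rfl
  br_sec := by
    rintro x i j k h t ⟨s, hs⟩ t' ⟨s', hs'⟩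
    refine ⟨fun z => (P.L z).br h (s z) (s' z), ?_⟩
    filter_upwards [hs, hs'] with z ⟨h1, h2⟩ ⟨h3, h4⟩
    refine ⟨P.br_sec h s h1 s' h3, ?_⟩
    rw [h2, h4]; rfl
  anch_sec := by
    rintro x i j k h t ⟨s, hs⟩ f hf
    obtain ⟨h1, -⟩ := hs.self_of_nhds
    refine (𝔛.S k).congr (P.anch_sec h s h1 f hf) ?_
    filter_upwards [hs] with z ⟨h3, h4⟩
    rw [h4]; rfl
  germ := by
    intro i x a
    obtain ⟨s, hs, rfl⟩ := exists_toGerm a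
    classical
    refine ⟨fun z => if h : s ∈ (P.S i).sec z then toGerm s h else 0, ⟨s, ?_⟩, dif_pos hs⟩
    filter_upwards [(P.S i).eventually_mem hs] with z hz
    exact ⟨hz, dif_pos hz⟩
  eq_zero := by
    rintro i x t ⟨s, hs⟩ h0
    obtain ⟨h1, h2⟩ := hs.self_of_nhds
    rw [h0] at h2
    have h3 := (toGerm_eq_iff (zero_mem _) h1).1 h2
    filter_upwards [hs, eventually_eventually_nhds.2 h3] with z ⟨h4, h5⟩ h6
    rw [h5]
    exact toGerm_eq _ (zero_mem _) (h6.mono fun _ h => h.symm)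

/-- Functoriality of the passage to germs. -/
def Hom.toLieAlgebroid {P Q : PreLieAlgebroid 𝔛} (f : Hom P Q) :
    Hom P.toLieAlgebroid.toPreLieAlgebroid Q.toLieAlgebroid.toPreLieAlgebroid where
  map x :=
    { map := fun i => (P.evZero i x).mapQ (Q.evZero i x)
        { toFun := fun s => ⟨_, f.map_sec s.1 s.2⟩
          map_add' := by
            intro s t; apply Subtype.ext; funext z; exact map_add _ _ _
          map_smul' := by
            intro c t; apply Subtype.ext; funext z; exact ((f.map z).map i).map_smul c _ }
        (by
          intro s hs
          filter_upwards [hs] with z hz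
          change (f.map z).map i (s.1 z) = 0
          rw [hz, map_zero])
      map_smul := by
        intro i j k h g a
        obtain ⟨s, hs, rfl⟩ := exists_toGerm a
        obtain ⟨g, hg, rfl⟩ := (𝔛.S i).germ x g
        change Submodule.mapQ _ _ _ _ (smulStalk h x (g x) (toGerm s hs)) =
          smulStalk h x (g x) (toGerm _ (f.map_sec s hs))
        rw [smulStalk_toGerm h hg, smulStalk_toGerm h hg]
        exact toGerm_eq (f.map_sec _ (P.smul_sec h g hg s hs)) _
          (Filter.Eventually.of_forall fun z => (f.map z).map_smul h _ _)
      map_d := by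
        intro i j h a
        obtain ⟨s, hs, rfl⟩ := exists_toGerm a
        exact toGerm_eq (f.map_sec _ (P.d_sec h s hs)) (Q.d_sec h _ (f.map_sec s hs))
          (Filter.Eventually.of_forall fun z => (f.map z).map_d h _)
      map_br := by
        intro i j k h a b
        obtain ⟨s, hs, rfl⟩ := exists_toGerm a
        obtain ⟨t, ht, rfl⟩ := exists_toGerm b
        exact toGerm_eq (f.map_sec _ (P.br_sec h s hs t ht))
          (Q.br_sec h _ (f.map_sec s hs) _ (f.map_sec t ht))
          (Filter.Eventually.of_forall fun z => (f.map z).map_br h _ _)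
      map_anch := by
        intro i j k h a g
        obtain ⟨s, hs, rfl⟩ := exists_toGerm a
        exact (f.map x).map_anch h (s x) g }
  map_sec := by
    rintro x i t ⟨s, hs⟩
    refine ⟨fun z => (f.map z).map i (s z), ?_⟩
    filter_upwards [hs] with z ⟨h1, h2⟩
    refine ⟨f.map_sec s h1, ?_⟩
    rw [h2]; rfl

theorem Hom.toLieAlgebroid_toGerm {P Q : PreLieAlgebroid 𝔛} (f : Hom P Q) {i : ℤ} {x : 𝔛.X}
    {s : ∀ z, (P.L z).C i} (hs : s ∈ (P.S i).sec x) :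
    (f.toLieAlgebroid.map x).map i (toGerm s hs) = toGerm _ (f.map_sec s hs) := rfl

end PreLieAlgebroid

/-! ### Morphisms and inverse image -/

/-- A morphism of spaces with sheaves of commutative differential graded algebras. -/
structure DGSpace.Hom (𝔜 𝔛 : DGSpace.{u} K) where
  base : 𝔜.X → 𝔛.X
  cont : Continuous base
  ψ : ∀ y : 𝔜.X, CDGAHom (𝔛.O (base y)) (𝔜.O y)
  ψ_sec : ∀ {y : 𝔜.X} {i : ℤ}, ∀ s ∈ (𝔛.S i).sec (base y),
    (fun z => (ψ z).map i (s (base z))) ∈ (𝔜.S i).sec y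

namespace Pull

variable {𝔜 𝔛 : DGSpace.{u} K} (φ : DGSpace.Hom 𝔜 𝔛) (A : LieAlgebroid 𝔛)

/-- The derivations of the structure sheaf: families of derivations of the stalks which take
sections to sections. -/
def secDer (𝔜 : DGSpace.{u} K) (n : ℤ) : LocalSec K (fun y : 𝔜.X => Der (𝔜.O y) n) where
  sec y :=
    { carrier := {ξ | ∀ᶠ z in 𝓝 y, ∀ (i j : ℤ) (h : n + i = j), ∀ f ∈ (𝔜.S i).sec z,
        (fun x => Der.ap h (ξ x) (f x)) ∈ (𝔜.S j).sec z}
      zero_mem' := by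
        refine Filter.Eventually.of_forall fun z i j h f _ => ?_
        simp only [Pi.zero_apply, map_zero, LinearMap.zero_apply]
        exact zero_mem _
      add_mem' := by
        intro ξ η hξ hη
        filter_upwards [hξ, hη] with z h1 h2 i j h f hf
        simp only [Pi.add_apply, map_add, LinearMap.add_apply]
        exact add_mem (h1 i j h f hf) (h2 i j h f hf)
      smul_mem' := by
        intro c ξ hξ
        filter_upwards [hξ] with z h1 i j h f hf
        simp only [Pi.smul_apply, map_smul, LinearMap.smul_apply]
        exact Submodule.smul_mem _ c (h1 i j h f hf) }
  eventually_mem h := eventually_eventually_nhds.2 h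
  congr := by
    intro y ξ η hξ h
    filter_upwards [hξ, eventually_eventually_nhds.2 h] with z h1 h2 i j hij f hf
    refine (𝔜.S j).congr (h1 i j hij f hf) ?_
    filter_upwards [h2] with x hx
    rw [hx]

/-- Sections of `S ⊗ A`: locally, finite sums of tensors of sections. -/
def secT (k : ℤ) (y : 𝔜.X) : Submodule K (∀ z, T (𝔜.O z) (A.L (φ.base z)) k) :=
  Submodule.span K {w | ∃ (i j : ℤ) (h : i + j = k), ∃ f ∈ (𝔜.S i).sec y,
    ∃ a ∈ (A.S j).sec (φ.base y), w = fun z => tm h (f z) (a (φ.base z))}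

variable {φ A}

theorem tm_mem_secT {i j k : ℤ} (h : i + j = k) {y : 𝔜.X} {f : ∀ z, (𝔜.O z).C i}
    (hf : f ∈ (𝔜.S i).sec y) {a : ∀ x, (A.L x).C j} (ha : a ∈ (A.S j).sec (φ.base y)) :
    (fun z => tm (K := K) h (f z) (a (φ.base z))) ∈ secT φ A k y :=
  Submodule.subset_span ⟨i, j, h, f, hf, a, ha, rfl⟩

theorem secT_le {k : ℤ} {y : 𝔜.X} {Q : Submodule K (∀ z, T (𝔜.O z) (A.L (φ.base z)) k)}
    (h : ∀ {i j : ℤ} (h : i + j = k) {f : ∀ z, (𝔜.O z).C i} (_ : f ∈ (𝔜.S i).sec y)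
      {a : ∀ x, (A.L x).C j} (_ : a ∈ (A.S j).sec (φ.base y)),
      (fun z => tm (K := K) h (f z) (a (φ.base z))) ∈ Q) : secT φ A k y ≤ Q := by
  refine Submodule.span_le.2 ?_
  rintro _ ⟨i, j, hij, f, hf, a, ha, rfl⟩
  exact h hij hf ha

/-- Families of linear maps between stalks act on families of elements. -/
def famMap {X : Type u} {F G : X → Type u} [∀ x, AddCommGroup (F x)] [∀ x, Module K (F x)]
    [∀ x, AddCommGroup (G x)] [∀ x, Module K (G x)] (α : ∀ x, F x →ₗ[K] G x) :
    (∀ x, F x) →ₗ[K] ∀ x, G x where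
  toFun s x := α x (s x)
  map_add' _ _ := funext fun _ => map_add _ _ _
  map_smul' _ _ := funext fun _ => map_smul _ _ _

theorem secT_eventually {k : ℤ} {y : 𝔜.X} {w : ∀ z, T (𝔜.O z) (A.L (φ.base z)) k}
    (hw : w ∈ secT φ A k y) : ∀ᶠ z in 𝓝 y, w ∈ secT φ A k z := by
  induction hw using Submodule.span_induction with
  | zero => exact Filter.Eventually.of_forall fun z => zero_mem _
  | add u v _ _ hu hv =>
    filter_upwards [hu, hv] with z h1 h2
    exact add_mem h1 h2
  | smul c u _ hu =>
    filter_upwards [hu] with z h1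
    exact Submodule.smul_mem _ c h1
  | mem u hu =>
    obtain ⟨i, j, h, f, hf, a, ha, rfl⟩ := hu
    filter_upwards [(𝔜.S i).eventually_mem hf,
      φ.cont.continuousAt.eventually ((A.S j).eventually_mem ha)] with z h1 h2
    exact tm_mem_secT h h1 h2

theorem smulT_mem {i j k : ℤ} (h : i + j = k) {y : 𝔜.X} {s : ∀ z, (𝔜.O z).C i}
    (hs : s ∈ (𝔜.S i).sec y) {w : ∀ z, T (𝔜.O z) (A.L (φ.base z)) j} (hw : w ∈ secT φ A j y) :
    (fun z => smulT h (s z) (w z)) ∈ secT φ A k y := by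
  suffices secT φ A j y ≤ (secT φ A k y).comap (famMap fun z => smulT h (s z)) from this hw
  refine secT_le fun {p q} e {f} hf {a} ha => ?_
  have := tm_mem_secT (φ := φ) (show (i + p) + q = k by omega) (𝔜.mul_sec rfl s hs f hf) ha
  rw [Submodule.mem_comap]
  convert this using 1
  funext z
  exact smulT_tm h e rfl (by omega) _ _ _

theorem dT_mem {i j : ℤ} (h : i + 1 = j) {y : 𝔜.X}
    {w : ∀ z, T (𝔜.O z) (A.L (φ.base z)) i} (hw : w ∈ secT φ A i y) :
    (fun z => dT h (w z)) ∈ secT φ A j y := by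
  suffices secT φ A i y ≤ (secT φ A j y).comap (famMap fun z => dT h) from this hw
  refine secT_le fun {p q} e {f} hf {a} ha => ?_
  have e1 := tm_mem_secT (φ := φ) (show (p + 1) + q = j by omega) (𝔜.d_sec rfl f hf) ha
  have e2 := tm_mem_secT (φ := φ) (show p + (q + 1) = j by omega) hf (A.d_sec rfl a ha)
  rw [Submodule.mem_comap]
  convert add_mem e1 (Submodule.smul_mem _ (sg K p) e2) using 1
  funext z
  exact dT_tm h e rfl rfl _ _ _ _

theorem brT_mem {i j k : ℤ} (h : i + j = k) {y : 𝔜.X}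
    {v : ∀ z, T (𝔜.O z) (A.L (φ.base z)) i} (hv : v ∈ secT φ A i y)
    {w : ∀ z, T (𝔜.O z) (A.L (φ.base z)) j} (hw : w ∈ secT φ A j y) :
    (fun z => brT h (v z) (w z)) ∈ secT φ A k y := by
  suffices secT φ A j y ≤ (secT φ A k y).comap (famMap fun z => brT h (v z)) from this hw
  refine secT_le fun {p q} e {f} hf {a} ha => ?_
  suffices secT φ A i y ≤ (secT φ A k y).comap
    (famMap fun z => (brT h).flip (tm e (f z) (a (φ.base z)))) from this hv
  refine secT_le fun {p' q'} e' {f'} hf' {a'} ha' => ?_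
  have e1 := tm_mem_secT (φ := φ) (show (p' + p) + (q' + q) = k by omega)
    (𝔜.mul_sec rfl f' hf' f hf) (A.br_sec rfl a' ha' a ha)
  rw [Submodule.mem_comap]
  convert Submodule.smul_mem _ (sg K (q' * p)) e1 using 1
  funext z
  exact brT_tm h e' e rfl rfl _ _ _ _ _

theorem actT_mem {i j k : ℤ} (h : i + j = k) {y : 𝔜.X} {ξ : ∀ z, Der (𝔜.O z) i}
    (hξ : ξ ∈ (secDer 𝔜 i).sec y) {w : ∀ z, T (𝔜.O z) (A.L (φ.base z)) j}
    (hw : w ∈ secT φ A j y) : (fun z => actT h (ξ z) (w z)) ∈ secT φ A k y := by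
  suffices secT φ A j y ≤ (secT φ A k y).comap (famMap fun z => actT h (ξ z)) from this hw
  refine secT_le fun {p q} e {f} hf {a} ha => ?_
  have := tm_mem_secT (φ := φ) (show (i + p) + q = k by omega)
    (hξ.self_of_nhds p _ rfl f hf) ha
  rw [Submodule.mem_comap]
  convert this using 1
  funext z
  exact actT_tm h e rfl (by omega) _ _ _

theorem der_smul_mem {i j k : ℤ} (h : i + j = k) {y : 𝔜.X} {s : ∀ z, (𝔜.O z).C i}
    (hs : s ∈ (𝔜.S i).sec y) {ξ : ∀ z, Der (𝔜.O z) j} (hξ : ξ ∈ (secDer 𝔜 j).sec y) :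
    (fun z => Der.smul h (s z) (ξ z)) ∈ (secDer 𝔜 k).sec y := by
  filter_upwards [hξ, (𝔜.S i).eventually_mem hs] with z h1 h2 l m hm f hf
  have := 𝔜.mul_sec (show i + (j + l) = m by omega) s h2 _ (h1 l _ rfl f hf)
  exact this

theorem der_d_mem {i j : ℤ} (h : i + 1 = j) {y : 𝔜.X} {ξ : ∀ z, Der (𝔜.O z) i}
    (hξ : ξ ∈ (secDer 𝔜 i).sec y) : (fun z => Der.d h (ξ z)) ∈ (secDer 𝔜 j).sec y := by
  filter_upwards [hξ] with z h1 l m hm f hf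
  exact sub_mem (𝔜.d_sec (show (i + l) + 1 = m by omega) _ (h1 l _ rfl f hf))
    (Submodule.smul_mem _ (sg K i) (h1 (l + 1) m (by omega) _ (𝔜.d_sec rfl f hf)))

theorem der_br_mem {i j k : ℤ} (h : i + j = k) {y : 𝔜.X} {ξ : ∀ z, Der (𝔜.O z) i}
    (hξ : ξ ∈ (secDer 𝔜 i).sec y) {η : ∀ z, Der (𝔜.O z) j} (hη : η ∈ (secDer 𝔜 j).sec y) :
    (fun z => Der.br h (ξ z) (η z)) ∈ (secDer 𝔜 k).sec y := by
  filter_upwards [hξ, hη] with z h1 h2 l m hm f hf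
  exact sub_mem (h1 (j + l) m (by omega) _ (h2 l _ rfl f hf))
    (Submodule.smul_mem _ (sg K (i * j)) (h2 (i + l) m (by omega) _ (h1 l _ rfl f hf)))

variable (φ A)

/-- The sections of the inverse image: pairs of a section `w` of `S ⊗ A` and a derivation `ξ` of
the structure sheaf which are compatible. -/
def secPull (k : ℤ) : LocalSec K (fun y => (pullLR (φ.ψ y) (A.L (φ.base y))).C k) where
  sec y :=
    { carrier := {p | ∃ w ∈ secT φ A k y, ∃ ξ ∈ (secDer 𝔜 k).sec y, ∀ᶠ z in 𝓝 y,
        ∃ h : (w z, ξ z) ∈ compat (φ.ψ z) (A.L (φ.base z)) k,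
          p z = Submodule.Quotient.mk ⟨(w z, ξ z), h⟩}
      zero_mem' := ⟨0, zero_mem _, 0, zero_mem _, Filter.Eventually.of_forall fun z =>
        ⟨zero_mem (compat (φ.ψ z) (A.L (φ.base z)) k), rfl⟩⟩
      add_mem' := by
        rintro p p' ⟨w, hw, ξ, hξ, h⟩ ⟨w', hw', ξ', hξ', h'⟩
        refine ⟨w + w', add_mem hw hw', ξ + ξ', add_mem hξ hξ', ?_⟩
        filter_upwards [h, h'] with z ⟨h1, h2⟩ ⟨h3, h4⟩
        exact ⟨add_mem h1 h3, by rw [Pi.add_apply, h2, h4]; rfl⟩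
      smul_mem' := by
        rintro c p ⟨w, hw, ξ, hξ, h⟩
        refine ⟨c • w, Submodule.smul_mem _ c hw, c • ξ, Submodule.smul_mem _ c hξ, ?_⟩
        filter_upwards [h] with z ⟨h1, h2⟩
        exact ⟨Submodule.smul_mem _ c h1, by rw [Pi.smul_apply, h2]; rfl⟩ }
  eventually_mem := by
    rintro y p ⟨w, hw, ξ, hξ, h⟩
    filter_upwards [secT_eventually hw, (secDer 𝔜 k).eventually_mem hξ,
      eventually_eventually_nhds.2 h] with z h1 h2 h3
    exact ⟨w, h1, ξ, h2, h3⟩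
  congr := by
    rintro y p p' ⟨w, hw, ξ, hξ, h⟩ h'
    refine ⟨w, hw, ξ, hξ, ?_⟩
    filter_upwards [h, h'] with z ⟨h1, h2⟩ h3
    exact ⟨h1, h3 ▸ h2⟩

/-- The sections of the inverse image, with their values in the inverse images of stalks. -/
def prePull : PreLieAlgebroid 𝔜 where
  L y := pullLR (φ.ψ y) (A.L (φ.base y))
  S := secPull φ A
  smul_sec := by
    rintro y i j k h f hf p ⟨w, hw, ξ, hξ, hp⟩
    refine ⟨_, smulT_mem h hf hw, _, der_smul_mem h hf hξ, ?_⟩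
    filter_upwards [hp] with z ⟨h1, h2⟩
    exact ⟨((compatLR (φ.ψ z) (A.L (φ.base z))).smul h (f z) ⟨_, h1⟩).2, by rw [h2]; rfl⟩
  d_sec := by
    rintro y i j h p ⟨w, hw, ξ, hξ, hp⟩
    refine ⟨_, dT_mem h hw, _, der_d_mem h hξ, ?_⟩
    filter_upwards [hp] with z ⟨h1, h2⟩
    exact ⟨((compatLR (φ.ψ z) (A.L (φ.base z))).d h ⟨_, h1⟩).2, by rw [h2]; rfl⟩
  br_sec := by
    rintro y i j k h p ⟨w, hw, ξ, hξ, hp⟩ p' ⟨w', hw', ξ', hξ', hp'⟩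
    refine ⟨_, sub_mem (add_mem (brT_mem h hw hw') (actT_mem h hξ hw'))
      (Submodule.smul_mem _ (sg K (i * j)) (actT_mem (show j + i = k by omega) hξ' hw)), _,
      der_br_mem h hξ hξ', ?_⟩
    filter_upwards [hp, hp'] with z ⟨h1, h2⟩ ⟨h3, h4⟩
    exact ⟨((compatLR (φ.ψ z) (A.L (φ.base z))).br h ⟨_, h1⟩ ⟨_, h3⟩).2, by rw [h2, h4]; rfl⟩
  anch_sec := by
    rintro y i j k h p ⟨w, hw, ξ, hξ, hp⟩ f hf
    refine (𝔜.S k).congr (hξ.self_of_nhds j k h f hf) ?_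
    filter_upwards [hp] with z ⟨h1, h2⟩
    rw [h2]; rfl

end Pull

/-- The inverse image of a Lie algebroid. -/
def inverseImage {𝔜 𝔛 : DGSpace.{u} K} (φ : DGSpace.Hom 𝔜 𝔛) (A : LieAlgebroid 𝔛) :
    LieAlgebroid 𝔜 :=
  (Pull.prePull φ A).toLieAlgebroid

namespace Pull

variable {R S : CDGA.{u} K} (ψ : CDGAHom R S) {A B C : LR R} (g : LRHom A B)

/-- `1 ⊗ g` -/
def mapT (S : CDGA.{u} K) {R : CDGA.{u} K} {A B : LR R} (g : LRHom A B) (k : ℤ) :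
    T S A k →ₗ[K] T S B k :=
  liftW fun _ q h => (tm h).compl₂ (g.map q)

@[simp] theorem mapT_tm {k p q : ℤ} (h : p + q = k) (f : S.C p) (a : A.C q) :
    mapT S g k (tm h f a) = tm (K := K) h f (g.map q a) := by
  simp [mapT]

theorem mapT_smulT {i j k : ℤ} (h : i + j = k) (s : S.C i) (u : T S A j) :
    mapT S g k (smulT h s u) = smulT h s (mapT S g j u) := by
  induction u using W_induction with
  | h0 => simp
  | ha u v hu hv => simp only [map_add, hu, hv]
  | ht e f a =>
    rw [mapT_tm, smulT_tm h e rfl (by omega), smulT_tm h e rfl (by omega), mapT_tm]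

theorem mapT_dT {i j : ℤ} (h : i + 1 = j) (u : T S A i) :
    mapT S g j (dT h u) = dT h (mapT S g i u) := by
  induction u using W_induction with
  | h0 => simp
  | ha u v hu hv => simp only [map_add, hu, hv]
  | ht e f a =>
    rw [mapT_tm, dT_tm h e rfl rfl (by omega) (by omega), dT_tm h e rfl rfl (by omega) (by omega),
      map_add, map_smul, mapT_tm, mapT_tm, g.map_d]

theorem mapT_actT {i j k : ℤ} (h : i + j = k) (ξ : Der S i) (u : T S A j) :
    mapT S g k (actT h ξ u) = actT h ξ (mapT S g j u) := by
  induction u using W_induction with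
  | h0 => simp
  | ha u v hu hv => simp only [map_add, hu, hv]
  | ht e f a =>
    rw [mapT_tm, actT_tm h e rfl (by omega), actT_tm h e rfl (by omega), mapT_tm]

theorem mapT_brT {i j k : ℤ} (h : i + j = k) (u : T S A i) (v : T S A j) :
    mapT S g k (brT h u v) = brT h (mapT S g i u) (mapT S g j v) := by
  induction u using W_induction with
  | h0 => simp
  | ha u u' hu hv => simp only [map_add, LinearMap.add_apply, hu, hv]
  | ht e f a =>
  induction v using W_induction with
  | h0 => simp
  | ha v v' hu hv => simp only [map_add, hu, hv]
  | ht e' f' a' =>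
    rw [mapT_tm, mapT_tm, brT_tm h e e' rfl rfl (by omega), brT_tm h e e' rfl rfl (by omega),
      map_smul, mapT_tm, g.map_br]

theorem anchT_mapT {i j k : ℤ} (h : i + j = k) (u : T S A i) (r : R.C j) :
    anchT ψ h (mapT S g i u) r = anchT ψ h u r := by
  induction u using W_induction with
  | h0 => simp
  | ha u u' hu hv => simp only [map_add, LinearMap.add_apply, hu, hv]
  | ht e f a =>
    rw [mapT_tm, anchT_tm ψ h e rfl (by omega), anchT_tm ψ h e rfl (by omega), g.map_anch]

theorem mapT_rel {k : ℤ} (u : T S A k) (hu : u ∈ relT ψ A k) : mapT S g k u ∈ relT ψ B k := by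
  induction hu using Submodule.span_induction with
  | zero => simp
  | add u v _ _ hu hv => rw [map_add]; exact add_mem hu hv
  | smul c u _ hu => rw [map_smul]; exact Submodule.smul_mem _ _ hu
  | mem u hu =>
    obtain ⟨p, q, t, pq, qt, hpq, hqt, h1, h2, f, r, a, rfl⟩ := hu
    rw [map_sub, mapT_tm, mapT_tm, g.map_smul]
    exact rel_mem ψ _ _ _ _ _ _ _

/-- The action of `g` on compatible pairs. -/
def compatMap (k : ℤ) : (compatLR ψ A).C k →ₗ[K] (compatLR ψ B).C k :=
  LinearMap.restrict ((mapT S g k).prodMap LinearMap.id) fun x hx p q h r => by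
    change anchT ψ h (mapT S g k x.1) r = _
    rw [anchT_mapT]
    exact hx p q h r

/-- Functoriality of the inverse image of Lie-Rinehart algebras. -/
def pullMap : LRHom (pullLR ψ A) (pullLR ψ B) where
  map k := (relIdeal ψ A k).mapQ (relIdeal ψ B k) (compatMap ψ g k)
    fun x hx => ⟨mapT_rel ψ g _ hx.1, hx.2⟩
  map_smul h f a := by
    obtain ⟨a, rfl⟩ := Submodule.Quotient.mk_surjective _ a
    exact congrArg Submodule.Quotient.mk (Subtype.ext (Prod.ext (mapT_smulT g h f a.1.1) rfl))
  map_d h a := by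
    obtain ⟨a, rfl⟩ := Submodule.Quotient.mk_surjective _ a
    exact congrArg Submodule.Quotient.mk (Subtype.ext (Prod.ext (mapT_dT g h a.1.1) rfl))
  map_br {i j k} h a b := by
    obtain ⟨a, rfl⟩ := Submodule.Quotient.mk_surjective _ a
    obtain ⟨b, rfl⟩ := Submodule.Quotient.mk_surjective _ b
    refine congrArg Submodule.Quotient.mk (Subtype.ext (Prod.ext ?_ rfl))
    change mapT S g k (brT h a.1.1 b.1.1 + actT h a.1.2 b.1.1 -
      sg K (i * j) • actT _ b.1.2 a.1.1) = brT h (mapT S g i a.1.1) (mapT S g j b.1.1) +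
      actT h a.1.2 (mapT S g j b.1.1) - sg K (i * j) • actT _ b.1.2 (mapT S g i a.1.1)
    rw [map_sub, map_add, map_smul, mapT_brT, mapT_actT, mapT_actT]
  map_anch h a f := by
    obtain ⟨a, rfl⟩ := Submodule.Quotient.mk_surjective _ a
    rfl

theorem mapT_id (k : ℤ) : mapT S (LRHom.id A) k = LinearMap.id :=
  W_hom_ext fun h f a => by simp [LRHom.id]

theorem mapT_comp (f : LRHom A B) (g : LRHom B C) (k : ℤ) :
    mapT S (f.comp g) k = (mapT S g k).comp (mapT S f k) :=
  W_hom_ext fun h s a => by simp [LRHom.comp]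

theorem pullMap_id : pullMap ψ (LRHom.id A) = LRHom.id (pullLR ψ A) := by
  apply LRHom.ext'
  intro k a
  obtain ⟨a, rfl⟩ := Submodule.Quotient.mk_surjective _ a
  exact congrArg Submodule.Quotient.mk
    (Subtype.ext (Prod.ext (LinearMap.congr_fun (mapT_id k) a.1.1) rfl))

theorem pullMap_comp (f : LRHom A B) (g : LRHom B C) :
    pullMap ψ (f.comp g) = (pullMap ψ f).comp (pullMap ψ g) := by
  apply LRHom.ext'
  intro k a
  obtain ⟨a, rfl⟩ := Submodule.Quotient.mk_surjective _ a
  exact congrArg Submodule.Quotient.mk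
    (Subtype.ext (Prod.ext (LinearMap.congr_fun (mapT_comp f g k) a.1.1) rfl))

variable {𝔜 𝔛 : DGSpace.{u} K} (φ : DGSpace.Hom 𝔜 𝔛) {A B C : LieAlgebroid 𝔛}

/-- The action of a morphism on sections of the inverse image. -/
def prePullMap (f : PreLieAlgebroid.Hom A.toPreLieAlgebroid B.toPreLieAlgebroid) :
    PreLieAlgebroid.Hom (prePull φ A) (prePull φ B) where
  map y := pullMap (φ.ψ y) (f.map (φ.base y))
  map_sec := by
    rintro y k p ⟨w, hw, ξ, hξ, hp⟩
    refine ⟨fun z => mapT _ (f.map (φ.base z)) k (w z), ?_, ξ, hξ, ?_⟩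
    · suffices secT φ A k y ≤ (secT φ B k y).comap
        (famMap fun z => mapT _ (f.map (φ.base z)) k) from this hw
      refine secT_le fun {p q} e {s} hs {a} ha => ?_
      rw [Submodule.mem_comap]
      convert tm_mem_secT (φ := φ) e hs (f.map_sec a ha) using 1
      funext z
      exact mapT_tm _ e _ _
    · filter_upwards [hp] with z ⟨h1, h2⟩
      exact ⟨(compatMap (φ.ψ z) (f.map (φ.base z)) k ⟨_, h1⟩).2, by rw [h2]; rfl⟩

end Pull

/-- Functoriality of the inverse image of Lie algebroids. -/
def inverseImageMap {𝔜 𝔛 : DGSpace.{u} K} (φ : DGSpace.Hom 𝔜 𝔛) {A B : LieAlgebroid 𝔛}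
    (f : PreLieAlgebroid.Hom A.toPreLieAlgebroid B.toPreLieAlgebroid) :
    PreLieAlgebroid.Hom (inverseImage φ A).toPreLieAlgebroid (inverseImage φ B).toPreLieAlgebroid :=
  (Pull.prePullMap φ f).toLieAlgebroid

theorem PreLieAlgebroid.Hom.ext_map {𝔛 : DGSpace.{u} K} {A B : PreLieAlgebroid 𝔛}
    {f g : PreLieAlgebroid.Hom A B} (h : ∀ x i a, (f.map x).map i a = (g.map x).map i a) : f = g :=
  PreLieAlgebroid.Hom.ext (funext fun x => LRHom.ext' (h x))

theorem inverseImageMap_id {𝔜 𝔛 : DGSpace.{u} K} (φ : DGSpace.Hom 𝔜 𝔛) (A : LieAlgebroid 𝔛) :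
    inverseImageMap φ (PreLieAlgebroid.Hom.id A.toPreLieAlgebroid) =
      PreLieAlgebroid.Hom.id (inverseImage φ A).toPreLieAlgebroid := by
  apply PreLieAlgebroid.Hom.ext_map
  intro y i a
  obtain ⟨s, hs, rfl⟩ := PreLieAlgebroid.exists_toGerm a
  refine (PreLieAlgebroid.Hom.toLieAlgebroid_toGerm _ hs).trans ?_
  refine PreLieAlgebroid.toGerm_eq' fun z => ?_
  exact congrArg (fun t : LRHom _ _ => t.map i (s z)) (Pull.pullMap_id (φ.ψ z))

theorem inverseImageMap_comp {𝔜 𝔛 : DGSpace.{u} K} (φ : DGSpace.Hom 𝔜 𝔛) {A B C : LieAlgebroid 𝔛}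
    (f : PreLieAlgebroid.Hom A.toPreLieAlgebroid B.toPreLieAlgebroid)
    (g : PreLieAlgebroid.Hom B.toPreLieAlgebroid C.toPreLieAlgebroid) :
    inverseImageMap φ (f.comp g) = (inverseImageMap φ f).comp (inverseImageMap φ g) := by
  apply PreLieAlgebroid.Hom.ext_map
  intro y i a
  obtain ⟨s, hs, rfl⟩ := PreLieAlgebroid.exists_toGerm a
  refine (PreLieAlgebroid.Hom.toLieAlgebroid_toGerm _ hs).trans ?_
  refine PreLieAlgebroid.toGerm_eq' fun z => ?_
  exact congrArg (fun t : LRHom _ _ => t.map i (s z))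
    (Pull.pullMap_comp (φ.ψ z) (f.map (φ.base z)) (g.map (φ.base z)))

/-! ### Extensions -/

/-- A marked Lie algebroid `(A, c)`, `c` of degree `-n` closed and central (so that multiplication
by `c` is a morphism `O[n] → A`), together with a morphism `p : A → B` which vanishes on `c`. -/
structure MarkedOver {𝔛 : DGSpace.{u} K} (B : LieAlgebroid 𝔛) (n : ℤ) where
  A : LieAlgebroid 𝔛
  c : ∀ x, (A.L x).C (-n)
  c_sec : ∀ x, c ∈ (A.S (-n)).sec x
  d_c : ∀ (x) {j : ℤ} (h : -n + 1 = j), (A.L x).d h (c x) = 0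
  central : ∀ (x) {j k : ℤ} (h : -n + j = k) (a : (A.L x).C j), (A.L x).br h (c x) a = 0
  p : PreLieAlgebroid.Hom A.toPreLieAlgebroid B.toPreLieAlgebroid
  p_c : ∀ x, (p.map x).map (-n) (c x) = 0

namespace MarkedOver

variable {𝔛 : DGSpace.{u} K} {B : LieAlgebroid 𝔛} {n : ℤ}

/-- Morphisms of marked Lie algebroids over `B`. -/
@[ext]
structure Hom (M N : MarkedOver B n) where
  hom : PreLieAlgebroid.Hom M.A.toPreLieAlgebroid N.A.toPreLieAlgebroid
  map_c : ∀ x, (hom.map x).map (-n) (M.c x) = N.c x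
  comp_p : hom.comp N.p = M.p

instance : Category (MarkedOver B n) where
  Hom := Hom
  id M := ⟨PreLieAlgebroid.Hom.id _, fun _ => rfl, rfl⟩
  comp f g := ⟨f.hom.comp g.hom,
    fun x => (congrArg _ (f.map_c x)).trans (g.map_c x), by
      rw [← f.comp_p, ← g.comp_p]; rfl⟩

/-- The sequence `0 → O[n] → A → B → 0` is exact. -/
structure IsExact (M : MarkedOver B n) : Prop where
  inj : ∀ (x) {i j : ℤ} (h : i + -n = j) (α : (𝔛.O x).C i), (M.A.L x).smul h α (M.c x) = 0 → α = 0
  ker : ∀ (x) {i j : ℤ} (h : i + -n = j) (a : (M.A.L x).C j), (M.p.map x).map j a = 0 →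
    ∃ α : (𝔛.O x).C i, (M.A.L x).smul h α (M.c x) = a
  surj : ∀ (x) (j : ℤ), Function.Surjective ((M.p.map x).map j)

end MarkedOver

/-- The category of `O[n]`-extensions of `B`. -/
abbrev OExt {𝔛 : DGSpace.{u} K} (B : LieAlgebroid 𝔛) (n : ℤ) : Type (max w (u + 1)) :=
  ObjectProperty.FullSubcategory (fun M : MarkedOver B n => M.IsExact)

/-! Inverse image of marked Lie algebroids -/

theorem CDGA.d_one (S : CDGA.{u} K) {j : ℤ} (h : 0 + 1 = j) : S.d h S.one = 0 := by
  have h1 := S.d_mul (add_zero 0) h h h (show j + 0 = j by omega) (show 0 + j = j by omega)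
    S.one S.one
  rw [S.mul_comm (show j + 0 = j by omega) (show 0 + j = j by omega), S.one_mul, S.one_mul,
    mul_zero, sg_zero, _root_.one_smul] at h1
  simpa using h1

theorem Der.ap_one {S : CDGA.{u} K} {n j : ℤ} (h : n + 0 = j) (ξ : Der S n) :
    Der.ap h ξ S.one = 0 := by
  have h1 := Der.ap_mul ξ (add_zero 0) h h h (show j + 0 = j by omega) (show 0 + j = j by omega)
    S.one S.one
  rw [S.mul_comm (show j + 0 = j by omega) (show 0 + j = j by omega), S.one_mul, S.one_mul,
    mul_zero, mul_zero, sg_zero, _root_.one_smul] at h1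
  simpa using h1

namespace MarkedOver

variable {𝔜 𝔛 : DGSpace.{u} K} (φ : DGSpace.Hom 𝔜 𝔛) {B : LieAlgebroid 𝔛} {n : ℤ}

theorem anch_c (M : MarkedOver B n) (x : 𝔛.X) {j k : ℤ} (h : -n + j = k) (f : (𝔛.O x).C j) :
    (M.A.L x).anch h (M.c x) f = 0 := by
  rw [← (M.p.map x).map_anch, M.p_c, map_zero, LinearMap.zero_apply]

/-- The section `1 ⊗ c` of `O ⊗ A`. -/
def cT (M : MarkedOver B n) (y : 𝔜.X) : Pull.T (𝔜.O y) (M.A.L (φ.base y)) (-n) :=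
  tm (zero_add (-n)) (𝔜.O y).one (M.c (φ.base y))

theorem c_compat (M : MarkedOver B n) (y : 𝔜.X) :
    (M.cT φ y, (0 : Der (𝔜.O y) (-n))) ∈ Pull.compat (φ.ψ y) (M.A.L (φ.base y)) (-n) := by
  intro p q h r
  change Pull.anchT (φ.ψ y) h (M.cT φ y) r = Der.ap h (0 : Der (𝔜.O y) (-n)) _
  rw [cT, Pull.anchT_tm (φ.ψ y) h (zero_add (-n)) h (zero_add q), anch_c, map_zero, map_zero,
    map_zero, LinearMap.zero_apply]

/-- The marking `(1 ⊗ c, 0)` of the inverse image. -/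
def cPull (M : MarkedOver B n) (y : 𝔜.X) :
    (Pull.pullLR (φ.ψ y) (M.A.L (φ.base y))).C (-n) :=
  Submodule.Quotient.mk ⟨(M.cT φ y, (0 : Der (𝔜.O y) (-n))), M.c_compat φ y⟩

theorem cPull_sec (M : MarkedOver B n) (y : 𝔜.X) :
    M.cPull φ ∈ ((Pull.prePull φ M.A).S (-n)).sec y :=
  ⟨fun z => M.cT φ z, Pull.tm_mem_secT (zero_add (-n)) (𝔜.one_sec y) (M.c_sec (φ.base y)),
    fun _ => 0, zero_mem _, Filter.Eventually.of_forall fun z => ⟨M.c_compat φ z, rfl⟩⟩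

theorem d_cPull (M : MarkedOver B n) (y : 𝔜.X) {j : ℤ} (h : -n + 1 = j) :
    (Pull.pullLR (φ.ψ y) (M.A.L (φ.base y))).d h (M.cPull φ y) = 0 := by
  refine congrArg Submodule.Quotient.mk (Subtype.ext (Prod.ext ?_ (map_zero (Der.d h))) :
    (Pull.compatLR (φ.ψ y) (M.A.L (φ.base y))).d h ⟨_, M.c_compat φ y⟩ = 0)
  change Pull.dT h (M.cT φ y) = 0
  rw [cT, Pull.dT_tm h _ rfl h (by omega) (by omega), CDGA.d_one, M.d_c, map_zero, map_zero,
    LinearMap.zero_apply, smul_zero, add_zero]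

theorem brT_cT (M : MarkedOver B n) (y : 𝔜.X) {j k : ℤ} (h : -n + j = k)
    (u : Pull.T (𝔜.O y) (M.A.L (φ.base y)) j) : Pull.brT h (M.cT φ y) u = 0 := by
  induction u using W_induction with
  | h0 => rw [map_zero]
  | ha u v hu hv => rw [map_add, hu, hv, add_zero]
  | ht e f a =>
    rw [cT, Pull.brT_tm h (zero_add (-n)) e rfl rfl (by omega), M.central, map_zero, smul_zero]

theorem cPull_central (M : MarkedOver B n) (y : 𝔜.X) {j k : ℤ} (h : -n + j = k)
    (a : (Pull.pullLR (φ.ψ y) (M.A.L (φ.base y))).C j) :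
    (Pull.pullLR (φ.ψ y) (M.A.L (φ.base y))).br h (M.cPull φ y) a = 0 := by
  obtain ⟨a, rfl⟩ := Submodule.Quotient.mk_surjective _ a
  refine congrArg Submodule.Quotient.mk (Subtype.ext (Prod.ext ?_ ?_) :
    (Pull.compatLR (φ.ψ y) (M.A.L (φ.base y))).br h ⟨_, M.c_compat φ y⟩ a = 0)
  · change Pull.brT h (M.cT φ y) a.1.1 + Pull.actT h (0 : Der (𝔜.O y) (-n)) a.1.1 -
      sg K (-n * j) • Pull.actT (show j + -n = k by omega) a.1.2 (M.cT φ y) = 0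
    rw [brT_cT, map_zero, LinearMap.zero_apply, cT,
      Pull.actT_tm _ _ (add_zero j) (by omega), Der.ap_one, map_zero, LinearMap.zero_apply,
      smul_zero, add_zero, sub_zero]
  · change Der.br h (0 : Der (𝔜.O y) (-n)) a.1.2 = 0
    rw [map_zero, LinearMap.zero_apply]

theorem map_cPull {M : MarkedOver B n} {A : LieAlgebroid 𝔛}
    (f : PreLieAlgebroid.Hom M.A.toPreLieAlgebroid A.toPreLieAlgebroid) (y : 𝔜.X)
    {c' : (A.L (φ.base y)).C (-n)} (h : (f.map (φ.base y)).map (-n) (M.c (φ.base y)) = c')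
    (hc) : (Pull.pullMap (φ.ψ y) (f.map (φ.base y))).map (-n) (M.cPull φ y) =
      Submodule.Quotient.mk ⟨(tm (zero_add (-n)) (𝔜.O y).one c', (0 : Der (𝔜.O y) (-n))), hc⟩ := by
  refine congrArg Submodule.Quotient.mk (Subtype.ext (Prod.ext ?_ rfl))
  change Pull.mapT _ (f.map (φ.base y)) (-n) (M.cT φ y) = _
  rw [cT, Pull.mapT_tm, h]

/-- The inverse image of a marked Lie algebroid over `B`. -/
def pull (M : MarkedOver B n) : MarkedOver (inverseImage φ B) n where
  A := inverseImage φ M.A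
  c y := PreLieAlgebroid.toGerm (P := Pull.prePull φ M.A) (M.cPull φ) (M.cPull_sec φ y)
  c_sec y := ⟨M.cPull φ, Filter.Eventually.of_forall fun z => ⟨M.cPull_sec φ z, rfl⟩⟩
  d_c y {j} h := PreLieAlgebroid.toGerm_eq' (ht := zero_mem _) fun z => M.d_cPull φ z h
  central y {j k} h a := by
    obtain ⟨s, hs, rfl⟩ := PreLieAlgebroid.exists_toGerm a
    exact PreLieAlgebroid.toGerm_eq' (ht := zero_mem _) fun z => M.cPull_central φ z h (s z)
  p := inverseImageMap φ M.p
  p_c y := by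
    refine PreLieAlgebroid.toGerm_eq' (ht := zero_mem _) fun z => ?_
    have h0 : (tm (zero_add (-n)) (𝔜.O z).one (0 : (B.L (φ.base z)).C (-n)) :
      Pull.T (𝔜.O z) (B.L (φ.base z)) (-n)) = 0 := map_zero _
    have hc : ((tm (zero_add (-n)) (𝔜.O z).one (0 : (B.L (φ.base z)).C (-n)) :
        Pull.T (𝔜.O z) (B.L (φ.base z)) (-n)), (0 : Der (𝔜.O z) (-n))) ∈
        Pull.compat (φ.ψ z) (B.L (φ.base z)) (-n) := by
      rw [h0]
      exact zero_mem (Pull.compat (φ.ψ z) (B.L (φ.base z)) (-n))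
    refine (map_cPull φ M.p z (M.p_c _) hc).trans ?_
    exact congrArg Submodule.Quotient.mk (Subtype.ext (Prod.ext h0 rfl))

/-- The inverse image functor on marked Lie algebroids over `B`. -/
def pullFunctor (B : LieAlgebroid 𝔛) (n : ℤ) :
    MarkedOver B n ⥤ MarkedOver (inverseImage φ B) n where
  obj M := M.pull φ
  map {_ N} f :=
    { hom := inverseImageMap φ f.hom
      map_c := fun _ => PreLieAlgebroid.toGerm_eq' fun z =>
        map_cPull φ f.hom z (f.map_c _) (N.c_compat φ z)
      comp_p := (inverseImageMap_comp φ f.hom N.p).symm.trans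
        (congrArg (inverseImageMap φ) f.comp_p) }
  map_id _ := Hom.ext (inverseImageMap_id φ _)
  map_comp f g := Hom.ext (inverseImageMap_comp φ f.hom g.hom)

/-- The inverse image functor on extensions. -/
def pullOExt (B : LieAlgebroid 𝔛) (n : ℤ)
    (h : ∀ M : MarkedOver B n, M.IsExact → (M.pull φ).IsExact) :
    OExt B n ⥤ OExt (inverseImage φ B) n :=
  ObjectProperty.lift _ (ObjectProperty.ι _ ⋙ pullFunctor φ B n) fun M => h M.1 M.2

end MarkedOver

/-! Fibre products over `B` -/

namespace FP

variable {𝔛 : DGSpace.{u} K} {B : LieAlgebroid 𝔛} {n : ℤ} {m : ℕ} (A : Fin m → MarkedOver B n)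

/-- The elements `((a_i), b)` of the fibre product: `p_i a_i = b` for all `i`. -/
def sub (x : 𝔛.X) (k : ℤ) : Submodule K ((∀ i, ((A i).A.L x).C k) × (B.L x).C k) where
  carrier := {a | ∀ i, ((A i).p.map x).map k (a.1 i) = a.2}
  zero_mem' _ := map_zero _
  add_mem' ha hb i := (map_add _ _ _).trans (by rw [ha i, hb i]; rfl)
  smul_mem' c a ha i := (map_smul _ c _).trans (by rw [ha i]; rfl)

theorem sub_ext {x : 𝔛.X} {k : ℤ} {a b : sub A x k} (h1 : ∀ i, a.1.1 i = b.1.1 i)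
    (h2 : a.1.2 = b.1.2) : a = b := Subtype.ext (Prod.ext (funext h1) h2)

theorem anch_eq {x : 𝔛.X} {k l m' : ℤ} (a : sub A x k) (i : Fin m) (h : k + l = m')
    (f : (𝔛.O x).C l) : (B.L x).anch h a.1.2 f = ((A i).A.L x).anch h (a.1.1 i) f := by
  rw [← a.2 i, ((A i).p.map x).map_anch]

/-- The action of the structure sheaf. -/
def smul (x : 𝔛.X) {i j k : ℤ} (h : i + j = k) : (𝔛.O x).C i →ₗ[K] sub A x j →ₗ[K] sub A x k :=
  LinearMap.mk₂ K (fun f a =>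
      ⟨(fun i => ((A i).A.L x).smul h f (a.1.1 i), (B.L x).smul h f a.1.2), fun i =>
        (((A i).p.map x).map_smul h f _).trans (by rw [a.2 i])⟩)
    (fun f g a => sub_ext A (fun i => LinearMap.map_add₂ _ f g _) (LinearMap.map_add₂ _ f g _))
    (fun c f a => sub_ext A (fun i => LinearMap.map_smul₂ _ c f _) (LinearMap.map_smul₂ _ c f _))
    (fun f a b => sub_ext A (fun i => map_add _ _ _) (map_add _ _ _))
    (fun c f a => sub_ext A (fun i => map_smul _ _ _) (map_smul _ _ _))

/-- The differential. -/
def d (x : 𝔛.X) {i j : ℤ} (h : i + 1 = j) : sub A x i →ₗ[K] sub A x j where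
  toFun a := ⟨(fun i => ((A i).A.L x).d h (a.1.1 i), (B.L x).d h a.1.2), fun i =>
    (((A i).p.map x).map_d h _).trans (by rw [a.2 i])⟩
  map_add' a b := sub_ext A (fun i => map_add _ _ _) (map_add _ _ _)
  map_smul' c a := sub_ext A (fun i => map_smul _ _ _) (map_smul _ _ _)

/-- The bracket. -/
def br (x : 𝔛.X) {i j k : ℤ} (h : i + j = k) : sub A x i →ₗ[K] sub A x j →ₗ[K] sub A x k :=
  LinearMap.mk₂ K (fun a b =>
      ⟨(fun i => ((A i).A.L x).br h (a.1.1 i) (b.1.1 i), (B.L x).br h a.1.2 b.1.2), fun i =>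
        (((A i).p.map x).map_br h _ _).trans (by rw [a.2 i, b.2 i])⟩)
    (fun f g a => sub_ext A (fun i => LinearMap.map_add₂ _ _ _ _) (LinearMap.map_add₂ _ _ _ _))
    (fun c f a => sub_ext A (fun i => LinearMap.map_smul₂ _ _ _ _) (LinearMap.map_smul₂ _ _ _ _))
    (fun f a b => sub_ext A (fun i => map_add _ _ _) (map_add _ _ _))
    (fun c f a => sub_ext A (fun i => map_smul _ _ _) (map_smul _ _ _))

/-- The stalk of the fibre product. -/
def stalk (x : 𝔛.X) : LR (𝔛.O x) where
  C k := sub A x k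
  smul h := smul A x h
  d h := d A x h
  br h := br A x h
  anch h := ((B.L x).anch h).comp ((LinearMap.snd K _ _).comp (sub A x _).subtype)
  one_smul h a := sub_ext A (fun i => ((A i).A.L x).one_smul h _) ((B.L x).one_smul h _)
  mul_smul h1 h2 h3 h4 f g a := sub_ext A (fun i => ((A i).A.L x).mul_smul h1 h2 h3 h4 f g _)
    ((B.L x).mul_smul h1 h2 h3 h4 f g _)
  d_d h h' a := sub_ext A (fun i => ((A i).A.L x).d_d h h' _) ((B.L x).d_d h h' _)
  d_smul h hk hi hj h1 h2 f a := sub_ext A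
    (fun i => ((A i).A.L x).d_smul h hk hi hj h1 h2 f _) ((B.L x).d_smul h hk hi hj h1 h2 f _)
  skew h h' a b := sub_ext A (fun i => ((A i).A.L x).skew h h' _ _) ((B.L x).skew h h' _ _)
  jacobi hij hik hjk h1 h2 h3 a b c := sub_ext A
    (fun i => ((A i).A.L x).jacobi hij hik hjk h1 h2 h3 _ _ _)
    ((B.L x).jacobi hij hik hjk h1 h2 h3 _ _ _)
  d_br h hk hi hj h1 h2 a b := sub_ext A
    (fun i => ((A i).A.L x).d_br h hk hi hj h1 h2 _ _) ((B.L x).d_br h hk hi hj h1 h2 _ _)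
  anch_mul hij hik hjk h1 h2 h3 a f g := (B.L x).anch_mul hij hik hjk h1 h2 h3 a.1.2 f g
  anch_smul h1 h2 h3 h4 f a g := (B.L x).anch_smul h1 h2 h3 h4 f a.1.2 g
  anch_br hij hik hjk h1 h2 h3 a b f := (B.L x).anch_br hij hik hjk h1 h2 h3 a.1.2 b.1.2 f
  anch_d h hk hi hj h1 h2 a f := (B.L x).anch_d h hk hi hj h1 h2 a.1.2 f
  leibniz hij hik hjk h1 h2 h3 a f b := sub_ext A
    (fun i => (((A i).A.L x).leibniz hij hik hjk h1 h2 h3 _ _ _).trans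
      (by rw [← anch_eq A a i]; rfl))
    ((B.L x).leibniz hij hik hjk h1 h2 h3 _ _ _)

/-- The sections of the fibre product. -/
def secFP (k : ℤ) : LocalSec K (fun x => sub A x k) where
  sec x :=
    { carrier := {s | (∀ i, (fun z => (s z).1.1 i) ∈ ((A i).A.S k).sec x) ∧
        (fun z => (s z).1.2) ∈ (B.S k).sec x}
      zero_mem' := ⟨fun i => zero_mem _, zero_mem _⟩
      add_mem' := fun ha hb => ⟨fun i => add_mem (ha.1 i) (hb.1 i), add_mem ha.2 hb.2⟩
      smul_mem' := fun c _ ha =>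
        ⟨fun i => Submodule.smul_mem _ c (ha.1 i), Submodule.smul_mem _ c ha.2⟩ }
  eventually_mem := by
    rintro x s ⟨h1, h2⟩
    filter_upwards [Filter.eventually_all.2 fun i => ((A i).A.S k).eventually_mem (h1 i),
      (B.S k).eventually_mem h2] with z h3 h4
    exact ⟨h3, h4⟩
  congr := by
    rintro x s t ⟨h1, h2⟩ h
    exact ⟨fun i => ((A i).A.S k).congr (h1 i) (h.mono fun z hz => by rw [hz]),
      (B.S k).congr h2 (h.mono fun z hz => by rw [hz])⟩

end FP

/-- The fibre product `A_1 ×_B … ×_B A_m` of Lie algebroids over `B`. -/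
def FP {𝔛 : DGSpace.{u} K} {B : LieAlgebroid 𝔛} {n : ℤ} {m : ℕ} (A : Fin m → MarkedOver B n) :
    LieAlgebroid 𝔛 where
  L := FP.stalk A
  S := FP.secFP A
  smul_sec h f hf a ha :=
    ⟨fun i => (A i).A.smul_sec h f hf _ (ha.1 i), B.smul_sec h f hf _ ha.2⟩
  d_sec h a ha := ⟨fun i => (A i).A.d_sec h _ (ha.1 i), B.d_sec h _ ha.2⟩
  br_sec h a ha b hb :=
    ⟨fun i => (A i).A.br_sec h _ (ha.1 i) _ (hb.1 i), B.br_sec h _ ha.2 _ hb.2⟩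
  anch_sec h a ha f hf := B.anch_sec h _ ha.2 f hf
  germ {k} x a := by
    choose s hs hsx using fun i => (A i).A.germ x (a.1.1 i)
    obtain ⟨b, hb, hbx⟩ := B.germ x a.1.2
    have key : ∀ᶠ z in 𝓝 x, ∀ i, ((A i).p.map z).map k (s i z) = b z := by
      refine Filter.eventually_all.2 fun i => ?_
      have h1 := B.eq_zero (sub_mem ((A i).p.map_sec _ (hs i)) hb)
        (show ((A i).p.map x).map k (s i x) - b x = 0 by rw [hsx, hbx, a.2 i, sub_self])
      exact h1.mono fun z hz => sub_eq_zero.1 hz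
    classical
    let t : ∀ z, FP.sub A z k := fun z =>
      if h : ∀ i, ((A i).p.map z).map k (s i z) = b z then ⟨(fun i => s i z, b z), h⟩ else 0
    have ht : ∀ᶠ z in 𝓝 x, (∀ i, s i z = (t z).1.1 i) ∧ b z = (t z).1.2 := by
      filter_upwards [key] with z hz
      simp only [t, dif_pos hz, implies_true, and_self]
    refine ⟨t, ⟨fun i => ((A i).A.S k).congr (hs i) (ht.mono fun z hz => hz.1 i),
      (B.S k).congr hb (ht.mono fun z hz => hz.2)⟩, ?_⟩
    exact FP.sub_ext A (fun i => (ht.self_of_nhds.1 i).symm.trans (hsx i))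
      (ht.self_of_nhds.2.symm.trans hbx)
  eq_zero {k x s} hs h0 := by
    filter_upwards [Filter.eventually_all.2 fun i => (A i).A.eq_zero (hs.1 i)
      (congrArg (fun a : FP.sub A x k => a.1.1 i) h0),
      B.eq_zero hs.2 (congrArg (fun a : FP.sub A x k => a.1.2) h0)] with z h1 h2
    exact FP.sub_ext A h1 h2

namespace FP

variable {𝔛 : DGSpace.{u} K} {B : LieAlgebroid 𝔛} {n : ℤ} {m : ℕ} (A : Fin m → MarkedOver B n)

/-- The projections. -/
def pr (i : Fin m) :
    PreLieAlgebroid.Hom (FP A).toPreLieAlgebroid (A i).A.toPreLieAlgebroid where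
  map x :=
    { map := fun k => (LinearMap.proj i).comp ((LinearMap.fst K _ _).comp (sub A x k).subtype)
      map_smul := fun _ _ _ => rfl
      map_d := fun _ _ => rfl
      map_br := fun _ _ _ => rfl
      map_anch := fun h a f => (anch_eq A a i h f).symm }
  map_sec _ hs := hs.1 i

/-- The projection to `B`. -/
def toB : PreLieAlgebroid.Hom (FP A).toPreLieAlgebroid B.toPreLieAlgebroid where
  map x :=
    { map := fun k => (LinearMap.snd K _ _).comp (sub A x k).subtype
      map_smul := fun _ _ _ => rfl
      map_d := fun _ _ => rfl
      map_br := fun _ _ _ => rfl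
      map_anch := fun _ _ _ => rfl }
  map_sec _ hs := hs.2

end FP

/-! ### Vector spaces in categories -/

universe v₁ u₁ v₂ u₂

/-- An `R`-linear structure on a category `C`, or `R`-module in categories (an `R`-vector space in
categories if `R` is a field): `C` is a groupoid with linear combination functors
`λ_1 X_1 ∔ … ∔ λ_m X_m` and coherent isomorphisms `0 ∔ … ∔ 1 X_i ∔ … ∔ 0 ≅ X_i` and
`∔_i λ_i (∔_j μ_ij X_j) ≅ ∔_j (∑_i λ_i μ_ij) X_j`. -/
structure LinearStructure (R : Type v) [CommRing R] (C : Type u₁) [Category.{v₁} C] where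
  isIso : ∀ {X Y : C} (f : X ⟶ Y), IsIso f
  comb : ∀ {m : ℕ}, (Fin m → R) → (Fin m → C) ⥤ C
  proj : ∀ {m : ℕ} (i : Fin m) (X : Fin m → C), (comb (Pi.single i 1)).obj X ≅ X i
  proj_nat : ∀ {m : ℕ} (i : Fin m) {X Y : Fin m → C} (f : X ⟶ Y),
    (comb (Pi.single i 1)).map f ≫ (proj i Y).hom = (proj i X).hom ≫ f i
  subst : ∀ {m k : ℕ} (lam : Fin m → R) (mu : Fin m → Fin k → R) (nu : Fin k → R)
    (_ : ∀ j, nu j = ∑ i, lam i * mu i j) (X : Fin k → C),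
    (comb lam).obj (fun i => (comb (mu i)).obj X) ≅ (comb nu).obj X
  subst_nat : ∀ {m k : ℕ} (lam : Fin m → R) (mu : Fin m → Fin k → R) (nu : Fin k → R)
    (h : ∀ j, nu j = ∑ i, lam i * mu i j) {X Y : Fin k → C} (f : X ⟶ Y),
    (comb lam).map (X := fun i => (comb (mu i)).obj X) (Y := fun i => (comb (mu i)).obj Y)
      (fun i => (comb (mu i)).map f) ≫ (subst lam mu nu h Y).hom =
      (subst lam mu nu h X).hom ≫ (comb nu).map f
  subst_assoc : ∀ {m k l : ℕ} (lam : Fin m → R) (mu : Fin m → Fin k → R) (nu : Fin k → R)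
    (h : ∀ j, nu j = ∑ i, lam i * mu i j) (rho : Fin k → Fin l → R) (sig : Fin m → Fin l → R)
    (h' : ∀ i j, sig i j = ∑ a, mu i a * rho a j) (tau : Fin l → R)
    (h₁ : ∀ j, tau j = ∑ a, nu a * rho a j) (h₂ : ∀ j, tau j = ∑ i, lam i * sig i j)
    (X : Fin l → C),
    (subst lam mu nu h (fun a => (comb (rho a)).obj X)).hom ≫ (subst nu rho tau h₁ X).hom =
      (comb lam).map
        (X := fun i => (comb (mu i)).obj (fun a => (comb (rho a)).obj X))
        (Y := fun i => (comb (sig i)).obj X)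
        (fun i => (subst (mu i) rho (sig i) (h' i) X).hom) ≫ (subst lam sig tau h₂ X).hom
  proj_subst : ∀ {m k : ℕ} (i : Fin m) (mu : Fin m → Fin k → R)
    (h : ∀ j, mu i j = ∑ a, Pi.single (M := fun _ => R) i 1 a * mu a j) (X : Fin k → C),
    (subst (Pi.single i 1) mu (mu i) h X).hom = (proj i fun a => (comb (mu a)).obj X).hom
  subst_proj : ∀ {m : ℕ} (lam : Fin m → R)
    (h : ∀ j, lam j = ∑ i, lam i * Pi.single (M := fun _ => R) i 1 j) (X : Fin m → C),
    (subst lam (fun i => Pi.single i 1) lam h X).hom =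
      (comb lam).map (X := fun i => (comb (Pi.single i 1)).obj X) (Y := X)
        (fun i => (proj i X).hom)

/-- A morphism of `R`-modules in categories: a functor with coherent isomorphisms
`∔_i λ_i F(X_i) ≅ F(∔_i λ_i X_i)`. -/
@[ext]
structure LinearFunctor {R : Type v} [CommRing R] {C : Type u₁} [Category.{v₁} C] {D : Type u₂}
    [Category.{v₂} D] (V : LinearStructure R C) (W : LinearStructure R D) (F : C ⥤ D) where
  iso : ∀ {m : ℕ} (lam : Fin m → R) (X : Fin m → C),
    (W.comb lam).obj (fun i => F.obj (X i)) ≅ F.obj ((V.comb lam).obj X)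
  iso_nat : ∀ {m : ℕ} (lam : Fin m → R) {X Y : Fin m → C} (f : X ⟶ Y),
    (W.comb lam).map (X := fun i => F.obj (X i)) (Y := fun i => F.obj (Y i))
      (fun i => F.map (f i)) ≫ (iso lam Y).hom = (iso lam X).hom ≫ F.map ((V.comb lam).map f)
  iso_proj : ∀ {m : ℕ} (i : Fin m) (X : Fin m → C),
    (iso (Pi.single i 1) X).hom ≫ F.map (V.proj i X).hom = (W.proj i fun i => F.obj (X i)).hom
  iso_subst : ∀ {m k : ℕ} (lam : Fin m → R) (mu : Fin m → Fin k → R) (nu : Fin k → R)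
    (h : ∀ j, nu j = ∑ i, lam i * mu i j) (X : Fin k → C),
    (W.comb lam).map
        (X := fun i => (W.comb (mu i)).obj fun j => F.obj (X j))
        (Y := fun i => F.obj ((V.comb (mu i)).obj X))
        (fun i => (iso (mu i) X).hom) ≫
      (iso lam fun i => (V.comb (mu i)).obj X).hom ≫ F.map (V.subst lam mu nu h X).hom =
    (W.subst lam mu nu h fun j => F.obj (X j)).hom ≫ (iso nu X).hom

namespace LinearStructure

variable {R : Type v} [CommRing R] {C : Type u₁} [Category.{v₁} C] (V : LinearStructure R C)

/-! The underlying Picard groupoid of an `R`-module in categories. Its structure isomorphisms are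
obtained by comparing both sides with a linear combination. -/

/-- An identification of `O` with a linear combination of the `X j`. -/
structure NF {k : ℕ} (X : Fin k → C) (O : C) where
  nu : Fin k → R
  iso : O ≅ (V.comb nu).obj X

variable {V}

/-- The comparison of two identifications with the same linear combination. -/
def can {k : ℕ} {X : Fin k → C} {O O' : C} (t : V.NF X O) (s : V.NF X O') (h : t.nu = s.nu) :
    O ≅ O' :=
  t.iso ≪≫ eqToIso (by rw [h]) ≪≫ s.iso.symm

theorem can_self {k : ℕ} {X : Fin k → C} {O : C} (t : V.NF X O) (h : t.nu = t.nu) :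
    (can t t h).hom = 𝟙 O := by simp [can]

theorem can_trans {k : ℕ} {X : Fin k → C} {O O' O'' : C} (t : V.NF X O) (s : V.NF X O')
    (r : V.NF X O'') (h : t.nu = s.nu) (h' : s.nu = r.nu) :
    (can t s h).hom ≫ (can s r h').hom = (can t r (h.trans h')).hom := by simp [can]

theorem can_symm {k : ℕ} {X : Fin k → C} {O O' : C} (t : V.NF X O) (s : V.NF X O')
    (h : t.nu = s.nu) : (can t s h).inv = (can s t h.symm).hom := by simp [can]

/-- Transport along an isomorphism. -/
def NF.pre {k : ℕ} {X : Fin k → C} {O O' : C} (t : V.NF X O) (g : O' ≅ O) : V.NF X O' :=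
  ⟨t.nu, g ≪≫ t.iso⟩

theorem can_pre {k : ℕ} {X : Fin k → C} {O O' P P' : C} (t : V.NF X O) (s : V.NF X O')
    (g : P ≅ O) (g' : P' ≅ O') (h : t.nu = s.nu) :
    (can (t.pre g) (s.pre g') h).hom ≫ g'.hom = g.hom ≫ (can t s h).hom := by
  simp only [can, NF.pre, Iso.trans_hom, Iso.symm_hom, Iso.trans_symm,
    Category.assoc, Iso.inv_hom_id, Category.comp_id]

/-- The variable `X j`. -/
def NF.var {k : ℕ} (X : Fin k → C) (j : Fin k) : V.NF X (X j) :=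
  ⟨Pi.single j 1, (V.proj j X).symm⟩

/-- A linear combination of linear combinations. -/
def NF.comb' {k m : ℕ} {X : Fin k → C} {O : Fin m → C} (lam : Fin m → R)
    (t : ∀ i, V.NF X (O i)) (nu : Fin k → R) (h : ∀ j, nu j = ∑ i, lam i * (t i).nu j) :
    V.NF X ((V.comb lam).obj O) where
  nu := nu
  iso := (V.comb lam).mapIso (X := O) (Y := fun i => (V.comb (t i).nu).obj X)
    (Pi.isoMk fun i => (t i).iso) ≪≫ V.subst lam (fun i => (t i).nu) nu h X

/-- A linear combination of linear combinations. -/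
def NF.comb {k m : ℕ} {X : Fin k → C} {O : Fin m → C} (lam : Fin m → R)
    (t : ∀ i, V.NF X (O i)) : V.NF X ((V.comb lam).obj O) :=
  NF.comb' lam t (fun j => ∑ i, lam i * (t i).nu j) fun _ => rfl

theorem NF.comb'_eq {k m : ℕ} {X : Fin k → C} {O : Fin m → C} (lam : Fin m → R)
    (t : ∀ i, V.NF X (O i)) (nu : Fin k → R) (h : ∀ j, nu j = ∑ i, lam i * (t i).nu j) :
    NF.comb' lam t nu h = NF.comb lam t := by
  obtain rfl : nu = fun j => ∑ i, lam i * (t i).nu j := funext h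
  rfl

/-- Substitution of linear combinations for the variables. -/
def NF.bind {k l : ℕ} {Y : Fin k → C} {X : Fin l → C} {O : C} (t : V.NF Y O)
    (r : ∀ j, V.NF X (Y j)) : V.NF X O :=
  (NF.comb t.nu r).pre t.iso

theorem NF.mk_congr {k : ℕ} {X : Fin k → C} {O : C} {nu : Fin k → R}
    {i j : O ≅ (V.comb nu).obj X} (h : i.hom = j.hom) :
    (⟨nu, i⟩ : V.NF X O) = ⟨nu, j⟩ := by
  rw [Iso.ext h]

theorem can_mk {k : ℕ} {X : Fin k → C} {O O' : C} (nu : Fin k → R) (i : O ≅ (V.comb nu).obj X)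
    (j : O' ≅ (V.comb nu).obj X) (h : (⟨nu, i⟩ : V.NF X O).nu = (⟨nu, j⟩ : V.NF X O').nu) :
    (can ⟨nu, i⟩ ⟨nu, j⟩ h).hom = i.hom ≫ j.inv := by
  simp [can]

theorem can_congr {k : ℕ} {X : Fin k → C} {O O' : C} {t t' : V.NF X O} {s s' : V.NF X O'}
    (h₁ : t = t') (h₂ : s = s') (h : t.nu = s.nu) (h' : t'.nu = s'.nu) :
    (can t s h).hom = (can t' s' h').hom := by
  subst h₁ h₂; rfl

theorem var_bind {k l : ℕ} {Y : Fin k → C} {X : Fin l → C} (r : ∀ j, V.NF X (Y j)) (j : Fin k) :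
    (NF.var Y j).bind r = r j := by
  have hnu : ∀ a, (r j).nu a = ∑ i, Pi.single (M := fun _ => R) j 1 i * (r i).nu a := by
    intro a; simp [Pi.single_apply]
  change (NF.comb (Pi.single j 1) r).pre (V.proj j Y).symm = r j
  rw [← NF.comb'_eq _ _ _ hnu]
  refine NF.mk_congr ?_
  have := V.proj_nat j (X := Y) (Y := fun i => (V.comb (r i).nu).obj X) fun i => (r i).iso.hom
  change (V.proj j Y).inv ≫ (V.comb (Pi.single j 1)).map (fun i => (r i).iso.hom) ≫
    (V.subst (Pi.single j 1) _ _ hnu X).hom = _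
  rw [V.proj_subst, this, Iso.inv_hom_id_assoc]

theorem comb_bind {k l m : ℕ} {Y : Fin k → C} {X : Fin l → C} {O : Fin m → C} (lam : Fin m → R)
    (t : ∀ i, V.NF Y (O i)) (r : ∀ j, V.NF X (Y j)) :
    (NF.comb lam t).bind r = NF.comb lam fun i => (t i).bind r := by
  have hnu : ∀ a, ((NF.comb lam t).bind r).nu a =
      ∑ i, lam i * ((t i).bind r).nu a := by
    intro a
    change ∑ j, (∑ i, lam i * (t i).nu j) * (r j).nu a =
      ∑ i, lam i * ∑ j, (t i).nu j * (r j).nu a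
    simp only [Finset.sum_mul, Finset.mul_sum, mul_assoc]
    exact Finset.sum_comm
  rw [← NF.comb'_eq _ _ _ hnu]
  refine NF.mk_congr ?_
  have h1 := V.subst_nat lam (fun i => (t i).nu) _ (fun _ => rfl) (X := Y)
    (Y := fun i => (V.comb (r i).nu).obj X) fun i => (r i).iso.hom
  have h2 := V.subst_assoc lam (fun i => (t i).nu) _ (fun _ => rfl) (fun j => (r j).nu)
    (fun i => ((t i).bind r).nu) (fun _ _ => rfl) _ (fun _ => rfl) hnu X
  change ((V.comb lam).map (fun i => (t i).iso.hom) ≫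
    (V.subst lam (fun i => (t i).nu) _ (fun _ => rfl) Y).hom) ≫
    (V.comb fun j => ∑ i, lam i * (t i).nu j).map (fun i => (r i).iso.hom) ≫
    (V.subst _ (fun j => (r j).nu) _ (fun _ => rfl) X).hom = (V.comb lam).map (fun i =>
      (t i).iso.hom ≫ (V.comb (t i).nu).map (fun i => (r i).iso.hom) ≫
      (V.subst (t i).nu (fun j => (r j).nu) _ (fun _ => rfl) X).hom) ≫
    (V.subst lam _ _ hnu X).hom
  rw [Category.assoc, ← reassoc_of% h1, h2, ← Functor.map_comp_assoc, ← Functor.map_comp_assoc]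
  refine congrArg (fun q => (V.comb lam).map q ≫ (V.subst lam _ _ hnu X).hom)
    (funext fun i => ?_)
  exact Category.assoc _ _ _

theorem can_bind {k l : ℕ} {Y : Fin k → C} {X : Fin l → C} {O O' : C} (t : V.NF Y O)
    (s : V.NF Y O') (r : ∀ j, V.NF X (Y j)) (h : t.nu = s.nu) (h' : (t.bind r).nu = (s.bind r).nu) :
    (can (t.bind r) (s.bind r) h').hom = (can t s h).hom := by
  obtain ⟨nu, i⟩ := t
  obtain ⟨nu', i'⟩ := s
  obtain rfl : nu = nu' := h
  refine (can_mk _ _ _ h').trans ?_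
  rw [can_mk]
  simp

theorem can_comb {k m : ℕ} {X : Fin k → C} {O O' : Fin m → C} (lam : Fin m → R)
    (t : ∀ i, V.NF X (O i)) (s : ∀ i, V.NF X (O' i)) (h : ∀ i, (t i).nu = (s i).nu)
    (h' : (NF.comb lam t).nu = (NF.comb lam s).nu) :
    (V.comb lam).map (X := O) (Y := O') (fun i => (can (t i) (s i) (h i)).hom) =
      (can (NF.comb lam t) (NF.comb lam s) h').hom := by
  obtain ⟨e, rfl⟩ : ∃ e : ∀ i, O' i ≅ (V.comb (t i).nu).obj X, s = fun i => ⟨(t i).nu, e i⟩ := by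
    have : ∀ i, ∃ e : O' i ≅ (V.comb (t i).nu).obj X, s i = ⟨(t i).nu, e⟩ := fun i => by
      have hi := h i
      generalize (t i).nu = nu at hi ⊢
      subst hi
      exact ⟨(s i).iso, rfl⟩
    choose e he using this
    exact ⟨e, funext he⟩
  refine Eq.trans ?_ (can_mk _ _ _ h').symm
  have h1 : ∀ i, (can (t i) ⟨(t i).nu, e i⟩ (h i)).hom = (t i).iso.hom ≫ (e i).inv :=
    fun i => can_mk _ _ _ _
  simp only [h1, Iso.trans_hom, Iso.trans_inv, Category.assoc, Iso.hom_inv_id_assoc,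
    Functor.mapIso_hom, Functor.mapIso_inv]
  refine Eq.trans ?_ (Functor.map_comp _ _ _)
  rfl

theorem comb_pre {k m : ℕ} {X : Fin k → C} {O O' : Fin m → C} (lam : Fin m → R)
    (t : ∀ i, V.NF X (O i)) (g : ∀ i, O' i ≅ O i) :
    NF.comb lam (fun i => (t i).pre (g i)) =
      (NF.comb lam t).pre ((V.comb lam).mapIso (X := O') (Y := O) (Pi.isoMk g)) := by
  refine NF.mk_congr ?_
  refine Eq.trans ?_ (Category.assoc _ _ _)
  exact congrArg (fun q => q ≫ (V.subst lam (fun i => (t i).nu) _ (fun _ => rfl) X).hom)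
    (Functor.map_comp (V.comb lam) (X := O') (Y := O)
    (Z := fun i => (V.comb (t i).nu).obj X) (fun i => (g i).hom) (fun i => (t i).iso.hom))

/-! The symmetric monoidal structure -/

/-- A pair of objects. -/
def pair {α : Type*} (a b : α) : Fin 2 → α := Fin.cases a fun _ => b

/-- A pair of morphisms. -/
def pairHom {X X' Y Y' : C} (f : X ⟶ X') (g : Y ⟶ Y') : ∀ i, pair X Y i ⟶ pair X' Y' i :=
  Fin.cases f fun i => Fin.cases g (fun i => i.elim0) i

variable (V)

/-- The sum of two objects. -/
def add (X Y : C) : C := (V.comb fun _ : Fin 2 => 1).obj (pair X Y)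

/-- The sum of two morphisms. -/
def addHom {X X' Y Y' : C} (f : X ⟶ X') (g : Y ⟶ Y') : V.add X Y ⟶ V.add X' Y' :=
  (V.comb fun _ : Fin 2 => 1).map (X := pair X Y) (Y := pair X' Y') (pairHom f g)

/-- The empty sum. -/
def zero : C := (V.comb (fun _ : Fin 0 => 1)).obj fun i => i.elim0

variable {V}

theorem addHom_id (X Y : C) : V.addHom (𝟙 X) (𝟙 Y) = 𝟙 (V.add X Y) := by
  refine Eq.trans ?_ ((V.comb fun _ : Fin 2 => 1).map_id (pair X Y))
  refine congrArg _ (funext fun i => ?_)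
  fin_cases i <;> rfl

theorem addHom_comp {X X' X'' Y Y' Y'' : C} (f : X ⟶ X') (f' : X' ⟶ X'') (g : Y ⟶ Y')
    (g' : Y' ⟶ Y'') :
    V.addHom f g ≫ V.addHom f' g' = V.addHom (f ≫ f') (g ≫ g') := by
  refine (Functor.map_comp _ _ _).symm.trans ?_
  refine congrArg _ (funext fun i => ?_)
  fin_cases i <;> rfl

/-- The family of two identifications. -/
def NF.pair {k : ℕ} {X : Fin k → C} {O O' : C} (t : V.NF X O) (s : V.NF X O') :
    ∀ i, V.NF X (LinearStructure.pair O O' i) :=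
  Fin.cases t fun i => Fin.cases s (fun i => i.elim0) i

/-- The sum of two identifications. -/
def NF.add {k : ℕ} {X : Fin k → C} {O O' : C} (t : V.NF X O) (s : V.NF X O') :
    V.NF X (V.add O O') := NF.comb (fun _ => 1) (NF.pair t s)

/-- The empty sum as an empty linear combination. -/
def NF.zero {k : ℕ} (X : Fin k → C) : V.NF X V.zero := NF.comb (fun _ => 1) fun i => i.elim0

theorem NF.add_nu {k : ℕ} {X : Fin k → C} {O O' : C} (t : V.NF X O) (s : V.NF X O') :
    (t.add s).nu = t.nu + s.nu := by
  funext j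
  change ∑ i : Fin 2, 1 * (NF.pair t s i).nu j = _
  rw [Fin.sum_univ_two, one_mul, one_mul]
  rfl

theorem NF.zero_nu {k : ℕ} (X : Fin k → C) : (NF.zero X : V.NF X V.zero).nu = 0 := by
  funext j
  simp [NF.zero, NF.comb, NF.comb']

theorem NF.add_bind {k l : ℕ} {Y : Fin k → C} {X : Fin l → C} {O O' : C} (t : V.NF Y O)
    (s : V.NF Y O') (r : ∀ j, V.NF X (Y j)) :
    (t.add s).bind r = (t.bind r).add (s.bind r) := by
  refine (comb_bind _ _ r).trans (congrArg _ (funext fun i => ?_))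
  fin_cases i <;> rfl

theorem NF.zero_bind {k l : ℕ} {Y : Fin k → C} {X : Fin l → C} (r : ∀ j, V.NF X (Y j)) :
    (NF.zero Y : V.NF Y V.zero).bind r = NF.zero X :=
  (comb_bind _ _ r).trans (congrArg _ (funext fun i => i.elim0))

theorem NF.add_pre {k : ℕ} {X : Fin k → C} {O O' P P' : C} (t : V.NF X O)
    (s : V.NF X O') (g : P ≅ O) (g' : P' ≅ O') (e : V.add P P' ≅ V.add O O')
    (he : e.hom = V.addHom g.hom g'.hom) :
    (t.pre g).add (s.pre g') = (t.add s).pre e := by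
  let gg : ∀ i, LinearStructure.pair P P' i ≅ LinearStructure.pair O O' i :=
    Fin.cases g fun i => Fin.cases g' (fun i => i.elim0) i
  refine Eq.trans (congrArg (NF.comb (fun _ => 1)) (funext fun i => ?_))
    ((comb_pre _ (NF.pair t s) gg).trans ?_)
  · fin_cases i <;> rfl
  · refine congrArg (NF.comb (fun _ => 1) (NF.pair t s)).pre (Iso.ext (Eq.trans ?_ he.symm))
    refine congrArg (V.comb fun _ : Fin 2 => 1).map (funext fun i => ?_)
    fin_cases i <;> rfl

theorem addHom_can {k : ℕ} {X : Fin k → C} {O O' P P' : C} (t : V.NF X O) (t' : V.NF X O')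
    (s : V.NF X P) (s' : V.NF X P') (h : t.nu = t'.nu) (h' : s.nu = s'.nu) (h'') :
    V.addHom (can t t' h).hom (can s s' h').hom = (can (t.add s) (t'.add s') h'').hom := by
  refine Eq.trans (congrArg (V.comb fun _ : Fin 2 => 1).map (funext fun i => ?_))
    (can_comb (fun _ => 1) (NF.pair t s) (NF.pair t' s') (fun i => ?_) h'')
  · fin_cases i <;> rfl
  · fin_cases i <;> assumption

theorem assoc_nu {k : ℕ} {A : Fin k → C} {X Y Z : C} (a : V.NF A X) (b : V.NF A Y)
    (c : V.NF A Z) : ((a.add b).add c).nu = (a.add (b.add c)).nu := by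
  simp only [NF.add_nu, add_assoc]

theorem comm_nu {k : ℕ} {A : Fin k → C} {X Y : C} (a : V.NF A X) (b : V.NF A Y) :
    (a.add b).nu = (b.add a).nu := by
  simp only [NF.add_nu, add_comm]

theorem zero_add_nu {k : ℕ} {A : Fin k → C} {X : C} (a : V.NF A X) :
    ((NF.zero A).add a).nu = a.nu := by
  simp only [NF.add_nu, NF.zero_nu, zero_add]

theorem add_zero_nu {k : ℕ} {A : Fin k → C} {X : C} (a : V.NF A X) :
    (a.add (NF.zero A)).nu = a.nu := by
  simp only [NF.add_nu, NF.zero_nu, add_zero]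

/-- A triple of objects. -/
def triple (X Y Z : C) : Fin 3 → C := Fin.cases X (pair Y Z)

/-- A family of three identifications. -/
def NF.triple {k : ℕ} {A : Fin k → C} {X Y Z : C} (a : V.NF A X) (b : V.NF A Y)
    (c : V.NF A Z) : ∀ i, V.NF A (LinearStructure.triple X Y Z i) :=
  Fin.cases a (NF.pair b c)

/-- The associativity isomorphism. -/
def assoc (X Y Z : C) : V.add (V.add X Y) Z ≅ V.add X (V.add Y Z) :=
  can (((NF.var (triple X Y Z) 0).add (NF.var (triple X Y Z) 1)).add (NF.var (triple X Y Z) 2))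
    ((NF.var (triple X Y Z) 0).add ((NF.var (triple X Y Z) 1).add (NF.var (triple X Y Z) 2)))
    (assoc_nu _ _ _)

theorem assoc_aux {k : ℕ} {A : Fin k → C} (v : Fin 3 → C) (r : ∀ j, V.NF A (v j)) :
    (can (((NF.var v 0).add (NF.var v 1)).add (NF.var v 2))
      ((NF.var v 0).add ((NF.var v 1).add (NF.var v 2))) (assoc_nu _ _ _) :
        V.add (V.add (v 0) (v 1)) (v 2) ≅ V.add (v 0) (V.add (v 1) (v 2))).hom =
      (can (((r 0).add (r 1)).add (r 2)) ((r 0).add ((r 1).add (r 2))) (assoc_nu _ _ _)).hom := by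
  have h1 : (((NF.var v 0).add (NF.var v 1)).add (NF.var v 2)).bind r =
      ((r 0).add (r 1)).add (r 2) := by
    rw [NF.add_bind, NF.add_bind, var_bind, var_bind, var_bind]
  have h2 : ((NF.var v 0).add ((NF.var v 1).add (NF.var v 2))).bind r =
      (r 0).add ((r 1).add (r 2)) := by
    rw [NF.add_bind, NF.add_bind, var_bind, var_bind, var_bind]
  have h3 := (congrArg NF.nu h1).trans ((assoc_nu _ _ _).trans (congrArg NF.nu h2).symm)
  exact (can_bind _ _ r _ h3).symm.trans (can_congr h1 h2 _ _)

theorem assoc_eq {k : ℕ} {A : Fin k → C} {X Y Z : C} (a : V.NF A X) (b : V.NF A Y)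
    (c : V.NF A Z) : (assoc X Y Z).hom =
      (can ((a.add b).add c) (a.add (b.add c)) (assoc_nu a b c)).hom :=
  assoc_aux (triple X Y Z) (NF.triple a b c)

/-- The left unit isomorphism. -/
def lunit (X : C) : V.add V.zero X ≅ X :=
  can ((NF.zero fun _ : Fin 1 => X).add (NF.var (fun _ : Fin 1 => X) 0))
    (NF.var (fun _ : Fin 1 => X) 0) (zero_add_nu _)

theorem lunit_aux {k : ℕ} {A : Fin k → C} (v : Fin 1 → C) (r : ∀ j, V.NF A (v j)) :
    (can ((NF.zero v).add (NF.var v 0)) (NF.var v 0) (zero_add_nu _) :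
        V.add V.zero (v 0) ≅ v 0).hom =
      (can ((NF.zero A).add (r 0)) (r 0) (zero_add_nu _)).hom := by
  have h1 : ((NF.zero v).add (NF.var v 0)).bind r = (NF.zero A).add (r 0) := by
    rw [NF.add_bind, NF.zero_bind, var_bind]
  have h2 : (NF.var v 0).bind r = r 0 := var_bind _ _
  have h3 := (congrArg NF.nu h1).trans ((zero_add_nu _).trans (congrArg NF.nu h2).symm)
  exact (can_bind _ _ r _ h3).symm.trans (can_congr h1 h2 _ _)

theorem lunit_eq {k : ℕ} {A : Fin k → C} {X : C} (a : V.NF A X) :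
    (lunit X).hom = (can ((NF.zero A).add a) a (zero_add_nu a)).hom :=
  lunit_aux (fun _ => X) fun _ => a

/-- The right unit isomorphism. -/
def runit (X : C) : V.add X V.zero ≅ X :=
  can ((NF.var (fun _ : Fin 1 => X) 0).add (NF.zero fun _ : Fin 1 => X))
    (NF.var (fun _ : Fin 1 => X) 0) (add_zero_nu _)

theorem runit_aux {k : ℕ} {A : Fin k → C} (v : Fin 1 → C) (r : ∀ j, V.NF A (v j)) :
    (can ((NF.var v 0).add (NF.zero v)) (NF.var v 0) (add_zero_nu _) :
        V.add (v 0) V.zero ≅ v 0).hom =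
      (can ((r 0).add (NF.zero A)) (r 0) (add_zero_nu _)).hom := by
  have h1 : ((NF.var v 0).add (NF.zero v)).bind r = (r 0).add (NF.zero A) := by
    rw [NF.add_bind, NF.zero_bind, var_bind]
  have h2 : (NF.var v 0).bind r = r 0 := var_bind _ _
  have h3 := (congrArg NF.nu h1).trans ((add_zero_nu _).trans (congrArg NF.nu h2).symm)
  exact (can_bind _ _ r _ h3).symm.trans (can_congr h1 h2 _ _)

theorem runit_eq {k : ℕ} {A : Fin k → C} {X : C} (a : V.NF A X) :
    (runit X).hom = (can (a.add (NF.zero A)) a (add_zero_nu a)).hom :=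
  runit_aux (fun _ => X) fun _ => a

/-- The commutativity isomorphism. -/
def braid (X Y : C) : V.add X Y ≅ V.add Y X :=
  can ((NF.var (LinearStructure.pair X Y) 0).add (NF.var (LinearStructure.pair X Y) 1))
    ((NF.var (LinearStructure.pair X Y) 1).add (NF.var (LinearStructure.pair X Y) 0))
    (comm_nu _ _)

theorem braid_aux {k : ℕ} {A : Fin k → C} (v : Fin 2 → C) (r : ∀ j, V.NF A (v j)) :
    (can ((NF.var v 0).add (NF.var v 1)) ((NF.var v 1).add (NF.var v 0)) (comm_nu _ _) :
        V.add (v 0) (v 1) ≅ V.add (v 1) (v 0)).hom =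
      (can ((r 0).add (r 1)) ((r 1).add (r 0)) (comm_nu _ _)).hom := by
  have h1 : ((NF.var v 0).add (NF.var v 1)).bind r = (r 0).add (r 1) := by
    rw [NF.add_bind, var_bind, var_bind]
  have h2 : ((NF.var v 1).add (NF.var v 0)).bind r = (r 1).add (r 0) := by
    rw [NF.add_bind, var_bind, var_bind]
  have h3 := (congrArg NF.nu h1).trans ((comm_nu _ _).trans (congrArg NF.nu h2).symm)
  exact (can_bind _ _ r _ h3).symm.trans (can_congr h1 h2 _ _)

theorem braid_eq {k : ℕ} {A : Fin k → C} {X Y : C} (a : V.NF A X) (b : V.NF A Y) :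
    (braid X Y).hom = (can (a.add b) (b.add a) (comm_nu a b)).hom :=
  braid_aux (LinearStructure.pair X Y) (NF.pair a b)

/-- A morphism as an isomorphism. -/
def toIso (V : LinearStructure R C) {X Y : C} (f : X ⟶ Y) : X ≅ Y :=
  haveI := V.isIso f
  asIso f

/-- The sum of two isomorphisms. -/
def addIso {X X' Y Y' : C} (f : X ⟶ X') (g : Y ⟶ Y') : V.add X Y ≅ V.add X' Y' :=
  V.toIso (V.addHom f g)

theorem pre_add {k : ℕ} {A : Fin k → C} {X X' Y Y' : C} (a : V.NF A X') (b : V.NF A Y')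
    (f : X ⟶ X') (g : Y ⟶ Y') : (a.pre (V.toIso f)).add (b.pre (V.toIso g)) =
      (a.add b).pre (addIso f g) :=
  NF.add_pre _ _ _ _ _ rfl

theorem can_nat {k : ℕ} {A : Fin k → C} {O O' P P' : C} (t : V.NF A O) (s : V.NF A O')
    (t' : V.NF A P) (s' : V.NF A P') (g : P ≅ O) (g' : P' ≅ O') (h : t.nu = s.nu)
    (h' : t'.nu = s'.nu) (ht : t' = t.pre g) (hs : s' = s.pre g') :
    g.hom ≫ (can t s h).hom = (can t' s' h').hom ≫ g'.hom := by
  subst ht hs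
  exact (can_pre t s g g' h).symm

theorem assoc_nat {k : ℕ} {A : Fin k → C} {X X' Y Y' Z Z' : C} (a : V.NF A X') (b : V.NF A Y')
    (c : V.NF A Z') (f : X ⟶ X') (g : Y ⟶ Y') (q : Z ⟶ Z') :
    V.addHom (V.addHom f g) q ≫ (assoc X' Y' Z').hom =
      (assoc X Y Z).hom ≫ V.addHom f (V.addHom g q) := by
  rw [assoc_eq a b c, assoc_eq (a.pre (V.toIso f)) (b.pre (V.toIso g)) (c.pre (V.toIso q))]
  refine can_nat _ _ _ _ (addIso (V.addHom f g) q) (addIso f (V.addHom g q)) _ _ ?_ ?_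
  · rw [pre_add]; exact pre_add _ _ _ _
  · rw [pre_add]; exact pre_add _ _ _ _

theorem lunit_nat {k : ℕ} {A : Fin k → C} {X X' : C} (a : V.NF A X') (f : X ⟶ X') :
    V.addHom (𝟙 V.zero) f ≫ (lunit X').hom = (lunit X : V.add V.zero X ≅ X).hom ≫ f := by
  rw [lunit_eq a, lunit_eq (a.pre (V.toIso f))]
  refine can_nat _ _ _ _ (addIso (𝟙 V.zero) f) (V.toIso f) _ _ ?_ rfl
  refine Eq.trans ?_ (pre_add (NF.zero A) a (𝟙 V.zero) f)
  refine congrArg (fun t => NF.add t _) (NF.mk_congr (Category.id_comp _).symm)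

theorem runit_nat {k : ℕ} {A : Fin k → C} {X X' : C} (a : V.NF A X') (f : X ⟶ X') :
    V.addHom f (𝟙 V.zero) ≫ (runit X').hom = (runit X : V.add X V.zero ≅ X).hom ≫ f := by
  rw [runit_eq a, runit_eq (a.pre (V.toIso f))]
  refine can_nat _ _ _ _ (addIso f (𝟙 V.zero)) (V.toIso f) _ _ ?_ rfl
  refine Eq.trans ?_ (pre_add a (NF.zero A) f (𝟙 V.zero))
  refine congrArg (NF.add _) (NF.mk_congr (Category.id_comp _).symm)

theorem braid_nat {k : ℕ} {A : Fin k → C} {X X' Y Y' : C} (a : V.NF A X') (b : V.NF A Y')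
    (f : X ⟶ X') (g : Y ⟶ Y') :
    V.addHom f g ≫ (braid X' Y').hom = (braid X Y).hom ≫ V.addHom g f := by
  rw [braid_eq a b, braid_eq (a.pre (V.toIso f)) (b.pre (V.toIso g))]
  exact can_nat _ _ _ _ (addIso f g) (addIso g f) _ _ (pre_add _ _ _ _) (pre_add _ _ _ _)

theorem addHom_can_id {k : ℕ} {X : Fin k → C} {O O' P : C} (t : V.NF X O) (t' : V.NF X O')
    (s : V.NF X P) (h : t.nu = t'.nu) :
    V.addHom (can t t' h).hom (𝟙 P) = (can (t.add s) (t'.add s)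
      (by simp only [NF.add_nu, h])).hom := by
  rw [← can_self s rfl]
  exact addHom_can _ _ _ _ _ _ _

theorem addHom_id_can {k : ℕ} {X : Fin k → C} {O O' P : C} (t : V.NF X O) (t' : V.NF X O')
    (s : V.NF X P) (h : t.nu = t'.nu) :
    V.addHom (𝟙 P) (can t t' h).hom = (can (s.add t) (s.add t')
      (by simp only [NF.add_nu, h])).hom := by
  rw [← can_self s rfl]
  exact addHom_can _ _ _ _ _ _ _

theorem pentagon_aux {k : ℕ} {A : Fin k → C} {W X Y Z : C} (w : V.NF A W) (x : V.NF A X)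
    (y : V.NF A Y) (z : V.NF A Z) :
    V.addHom (assoc W X Y).hom (𝟙 Z) ≫ (assoc W (V.add X Y) Z).hom ≫
      V.addHom (𝟙 W) (assoc X Y Z).hom =
      (assoc (V.add W X) Y Z).hom ≫ (assoc W X (V.add Y Z)).hom := by
  rw [assoc_eq w x y, assoc_eq w (x.add y) z, assoc_eq x y z, assoc_eq (w.add x) y z,
    assoc_eq w x (y.add z), addHom_can_id _ _ z, addHom_id_can _ _ w, can_trans, can_trans,
    can_trans]

theorem triangle_aux {k : ℕ} {A : Fin k → C} {X Y : C} (x : V.NF A X) (y : V.NF A Y) :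
    (assoc X V.zero Y).hom ≫ V.addHom (𝟙 X) (lunit Y).hom =
      V.addHom (runit X).hom (𝟙 Y) := by
  rw [assoc_eq x (NF.zero A) y, lunit_eq y, runit_eq x, addHom_can_id _ _ y, addHom_id_can _ _ x,
    can_trans]

theorem hexagon_aux {k : ℕ} {A : Fin k → C} {X Y Z : C} (x : V.NF A X) (y : V.NF A Y)
    (z : V.NF A Z) :
    (assoc X Y Z).hom ≫ (braid X (V.add Y Z)).hom ≫ (assoc Y Z X).hom =
      V.addHom (braid X Y).hom (𝟙 Z) ≫ (assoc Y X Z).hom ≫ V.addHom (𝟙 Y) (braid X Z).hom := by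
  rw [assoc_eq x y z, assoc_eq y z x, assoc_eq y x z, braid_eq x y, braid_eq x z,
    braid_eq x (y.add z), addHom_can_id _ _ z, addHom_id_can _ _ y, can_trans, can_trans,
    can_trans, can_trans]

theorem hexagon_aux' {k : ℕ} {A : Fin k → C} {X Y Z : C} (x : V.NF A X) (y : V.NF A Y)
    (z : V.NF A Z) :
    (assoc X Y Z).inv ≫ (braid (V.add X Y) Z).hom ≫ (assoc Z X Y).inv =
      V.addHom (𝟙 X) (braid Y Z).hom ≫ (assoc X Z Y).inv ≫ V.addHom (braid X Z).hom (𝟙 Y) := by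
  rw [Iso.inv_comp_eq, ← Category.assoc, Iso.comp_inv_eq]
  have h : (assoc X Z Y).inv = (can (x.add (z.add y)) ((x.add z).add y)
      (assoc_nu x z y).symm).hom := by
    rw [Iso.inv_eq_inv (f := assoc X Z Y) (g := can _ _ (assoc_nu x z y)) |>.2 (assoc_eq x z y),
      can_symm]
  rw [h, assoc_eq x y z, assoc_eq z x y, braid_eq y z, braid_eq x z,
    braid_eq (x.add y) z, addHom_can_id _ _ y, addHom_id_can _ _ x]
  simp only [can_trans]

theorem symm_aux {k : ℕ} {A : Fin k → C} {X Y : C} (x : V.NF A X) (y : V.NF A Y) :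
    (braid X Y : V.add X Y ≅ V.add Y X).hom ≫ (braid Y X).hom = 𝟙 (V.add X Y) := by
  rw [braid_eq x y, braid_eq y x, can_trans, can_self]

theorem neg_nu {k : ℕ} {A : Fin k → C} {X : C} (a : V.NF A X) :
    ((NF.comb (fun _ : Fin 1 => -1) fun _ => a).add a).nu = (NF.zero A : V.NF A V.zero).nu := by
  rw [NF.add_nu, NF.zero_nu]
  funext j
  simp [NF.comb, NF.comb']

variable (V)

/-- The monoidal structure given by the sum. -/
@[reducible]
def monoidal : MonoidalCategory C :=
  letI : MonoidalCategoryStruct C :=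
    { tensorObj := V.add
      tensorUnit := V.zero
      tensorHom := fun f g => V.addHom f g
      whiskerLeft := fun X _ _ f => V.addHom (𝟙 X) f
      whiskerRight := fun f X => V.addHom f (𝟙 X)
      associator := fun X Y Z => assoc X Y Z
      leftUnitor := fun X => lunit X
      rightUnitor := fun X => runit X }
  MonoidalCategory.ofTensorHom
    (id_tensorHom_id := fun X Y => addHom_id X Y)
    (id_tensorHom := fun _ _ _ _ => rfl)
    (tensorHom_id := fun _ _ => rfl)
    (tensorHom_comp_tensorHom := fun f g f' g' => addHom_comp f f' g g')
    (associator_naturality := fun {_ _ _ X Y Z} f g q => assoc_nat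
      (NF.var (triple X Y Z) 0) (NF.var (triple X Y Z) 1) (NF.var (triple X Y Z) 2) f g q)
    (leftUnitor_naturality := fun {_ Y} f => lunit_nat (NF.var (fun _ : Fin 1 => Y) 0) f)
    (rightUnitor_naturality := fun {_ Y} f => runit_nat (NF.var (fun _ : Fin 1 => Y) 0) f)
    (pentagon := fun W X Y Z =>
      let v : Fin 4 → C := Fin.cases W (triple X Y Z)
      pentagon_aux (NF.var v 0) (NF.var v 1) (NF.var v 2) (NF.var v 3))
    (triangle := fun X Y => triangle_aux (NF.var (LinearStructure.pair X Y) 0)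
      (NF.var (LinearStructure.pair X Y) 1))

/-- The symmetry of the sum. -/
@[reducible]
def symmetric : letI := V.monoidal; SymmetricCategory C :=
  letI := V.monoidal
  { braiding := fun X Y => braid X Y
    braiding_naturality_right := fun X {_ Z} f => braid_nat (NF.var (LinearStructure.pair X Z) 0)
      (NF.var (LinearStructure.pair X Z) 1) (𝟙 X) f
    braiding_naturality_left := fun {_ Y} f Z => braid_nat (NF.var (LinearStructure.pair Y Z) 0)
      (NF.var (LinearStructure.pair Y Z) 1) f (𝟙 Z)
    hexagon_forward := fun X Y Z => hexagon_aux
      (NF.var (triple X Y Z) 0) (NF.var (triple X Y Z) 1) (NF.var (triple X Y Z) 2)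
    hexagon_reverse := fun X Y Z => hexagon_aux'
      (NF.var (triple X Y Z) 0) (NF.var (triple X Y Z) 1) (NF.var (triple X Y Z) 2)
    symmetry := fun X Y => symm_aux (NF.var (LinearStructure.pair X Y) 0)
      (NF.var (LinearStructure.pair X Y) 1) }

end LinearStructure

/-- A Picard groupoid: a symmetric monoidal groupoid all of whose objects are invertible. -/
structure PicardGroupoid (C : Type u₁) [Category.{v₁} C] where
  monoidal : MonoidalCategory C
  symmetric : SymmetricCategory C
  isIso : ∀ {X Y : C} (f : X ⟶ Y), IsIso f
  invertible : ∀ X : C, ∃ Y : C, Nonempty (MonoidalCategory.tensorObj Y X ≅ MonoidalCategory.tensorUnit C)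

/-- A morphism of Picard groupoids: a symmetric monoidal functor. -/
abbrev PicardGroupoid.Functor {C : Type u₁} [Category.{v₁} C] {D : Type u₂} [Category.{v₂} D]
    (P : PicardGroupoid C) (Q : PicardGroupoid D) (F : C ⥤ D) :=
  letI := P.monoidal
  letI := P.symmetric
  letI := Q.monoidal
  letI := Q.symmetric
  F.Braided

namespace LinearStructure

variable {R : Type v} [CommRing R] {C : Type u₁} [Category.{v₁} C] {D : Type u₂}
  [Category.{v₂} D] (V : LinearStructure R C) (W : LinearStructure R D)

/-- The Picard groupoid underlying an `R`-module in categories. The tensor product is the linear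
combination with coefficients `1, 1`. -/
def picard : PicardGroupoid C where
  monoidal := V.monoidal
  symmetric := V.symmetric
  isIso := V.isIso
  invertible X := ⟨(V.comb fun _ : Fin 1 => -1).obj fun _ => X,
    ⟨can _ _ (neg_nu (NF.var (fun _ : Fin 1 => X) 0))⟩⟩

end LinearStructure

/-- The additivity isomorphism `F(X) + F(Y) → F(X + Y)` of a morphism of `R`-modules in
categories. -/
def LinearFunctor.addIso {R : Type v} [CommRing R] {C : Type u₁} [Category.{v₁} C] {D : Type u₂}
    [Category.{v₂} D] {V : LinearStructure R C} {W : LinearStructure R D} {F : C ⥤ D}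
    (θ : LinearFunctor V W F) (X Y : C) : W.add (F.obj X) (F.obj Y) ⟶ F.obj (V.add X Y) :=
  (W.comb fun _ : Fin 2 => 1).map (X := LinearStructure.pair (F.obj X) (F.obj Y))
    (Y := fun i => F.obj (LinearStructure.pair X Y i))
    (Fin.cases (𝟙 (F.obj X)) fun i => Fin.cases (𝟙 (F.obj Y)) (fun i => i.elim0) i) ≫
    (θ.iso (fun _ => 1) (LinearStructure.pair X Y)).hom

/-- `β` is the monoidal structure on `F` given by `F(X) + F(Y) ≅ F(X + Y)`. -/
def LinearFunctor.Induces {R : Type v} [CommRing R] {C : Type u₁} [Category.{v₁} C] {D : Type u₂}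
    [Category.{v₂} D] {V : LinearStructure R C} {W : LinearStructure R D} {F : C ⥤ D}
    (θ : LinearFunctor V W F) (β : PicardGroupoid.Functor V.picard W.picard F) : Prop :=
  letI := V.monoidal
  letI := V.symmetric
  letI := W.monoidal
  letI := W.symmetric
  letI : F.Braided := β
  ∀ X Y : C, Functor.LaxMonoidal.μ F X Y = θ.addIso X Y

/-! ### Linear combinations of extensions -/

section LinearCombinations

variable {𝔛 : DGSpace.{u} K} {B : LieAlgebroid 𝔛} {n : ℤ}

/-- The element `(α_i c_i)_i` of the fibre product. -/
def FP.mark {m : ℕ} (A : Fin m → MarkedOver B n) (x : 𝔛.X) {i j : ℤ} (h : i + -n = j)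
    (α : Fin m → (𝔛.O x).C i) : FP.sub A x j :=
  ⟨(fun a => ((A a).A.L x).smul h (α a) ((A a).c x), 0), fun a => by
    rw [((A a).p.map x).map_smul, (A a).p_c, map_zero]⟩

/-- `L` is the linear combination `λ_1 A_1 ∔ … ∔ λ_m A_m`: there is a morphism of Lie algebroids
`A_1 ×_B … ×_B A_m → L` over `B` such that the square formed by it,
`O[n]^m → A_1 ×_B … ×_B A_m`, `(α_i) ↦ ∑ λ_i α_i : O[n]^m → O[n]` and `O[n] → L` is
commutative and a push-out. -/
structure LinMap {m : ℕ} (lam : Fin m → K) (A : Fin m → OExt B n) (L : OExt B n) where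
  hom : PreLieAlgebroid.Hom (FP fun i => (A i).obj).toPreLieAlgebroid L.obj.A.toPreLieAlgebroid
  comp_p : hom.comp L.obj.p = FP.toB fun i => (A i).obj
  comm : ∀ (x) {i j : ℤ} (h : i + -n = j) (α : Fin m → (𝔛.O x).C i),
    (hom.map x).map j (FP.mark (fun i => (A i).obj) x h α) =
      (L.obj.A.L x).smul h (∑ a, lam a • α a) (L.obj.c x)
  pushout_surj : ∀ (x) {i j : ℤ} (h : i + -n = j) (l : (L.obj.A.L x).C j),
    ∃ (β : (𝔛.O x).C i) (a : FP.sub (fun i => (A i).obj) x j),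
      l = (L.obj.A.L x).smul h β (L.obj.c x) + (hom.map x).map j a
  pushout_inj : ∀ (x) {i j : ℤ} (h : i + -n = j) (β : (𝔛.O x).C i)
    (a : FP.sub (fun i => (A i).obj) x j),
    (L.obj.A.L x).smul h β (L.obj.c x) + (hom.map x).map j a = 0 →
    ∃ α : Fin m → (𝔛.O x).C i, a = FP.mark (fun i => (A i).obj) x h α ∧
      β = - ∑ a, lam a • α a

/-- The action of a morphism of extensions on the stalks. -/
def OExt.ap {M N : OExt B n} (f : M ⟶ N) (x : 𝔛.X) (k : ℤ) :
    (M.obj.A.L x).C k →ₗ[K] (N.obj.A.L x).C k := (f.hom.hom.map x).map k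

/-- The canonical structure of a vector space in categories on the category of `O[n]`-extensions
of `B`: the linear combinations are the push-outs above, and the functoriality and the structure
isomorphisms are those induced by the universal properties. -/
structure Canonical (B : LieAlgebroid 𝔛) (n : ℤ) extends LinearStructure K (OExt B n) where
  q : ∀ {m : ℕ} (lam : Fin m → K) (A : Fin m → OExt B n), LinMap lam A ((comb lam).obj A)
  q_nat : ∀ {m : ℕ} (lam : Fin m → K) {A A' : Fin m → OExt B n} (f : A ⟶ A') (x) (k : ℤ)
    (a : FP.sub (fun i => (A i).obj) x k) (a' : FP.sub (fun i => (A' i).obj) x k),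
    (∀ i, OExt.ap (f i) x k (a.1.1 i) = a'.1.1 i) → a.1.2 = a'.1.2 →
    OExt.ap ((comb lam).map f) x k (((q lam A).hom.map x).map k a) =
      ((q lam A').hom.map x).map k a'
  q_proj : ∀ {m : ℕ} (i : Fin m) (A : Fin m → OExt B n) (x) (k : ℤ)
    (a : FP.sub (fun i => (A i).obj) x k),
    OExt.ap (proj i A).hom x k (((q (Pi.single i 1) A).hom.map x).map k a) = a.1.1 i
  q_subst : ∀ {m l : ℕ} (lam : Fin m → K) (mu : Fin m → Fin l → K) (nu : Fin l → K)
    (h : ∀ j, nu j = ∑ i, lam i * mu i j) (A : Fin l → OExt B n) (x) (k : ℤ)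
    (a : FP.sub (fun i => (A i).obj) x k)
    (a' : FP.sub (fun i => ((comb (mu i)).obj A).obj) x k),
    (∀ i, a'.1.1 i = ((q (mu i) A).hom.map x).map k a) → a'.1.2 = a.1.2 →
    OExt.ap (subst lam mu nu h A).hom x k
      (((q lam fun i => (comb (mu i)).obj A).hom.map x).map k a') =
      ((q nu A).hom.map x).map k a

/-- The structure isomorphisms `λ_1 φ⁺A_1 ∔ … ∔ λ_m φ⁺A_m → φ⁺(λ_1 A_1 ∔ … ∔ λ_m A_m)` are those
induced by the identification `φ⁺A_1 ×_{φ⁺B} … ×_{φ⁺B} φ⁺A_m ≅ φ⁺(A_1 ×_B … ×_B A_m)` and the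
universal property of the push-out. -/
def IsInduced {𝔜 𝔛 : DGSpace.{u} K} (φ : DGSpace.Hom 𝔜 𝔛) {B : LieAlgebroid 𝔛} {n : ℤ}
    (h : ∀ M : MarkedOver B n, M.IsExact → (M.pull φ).IsExact)
    (V : Canonical B n) (W : Canonical (inverseImage φ B) n)
    (θ : LinearFunctor V.toLinearStructure W.toLinearStructure
      (MarkedOver.pullOExt φ B n h)) : Prop :=
  ∀ {m : ℕ} (lam : Fin m → K) (A : Fin m → OExt B n) (y) (k : ℤ)
    (t : ((inverseImage φ (FP fun i => (A i).obj)).L y).C k)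
    (a : FP.sub (fun i => ((MarkedOver.pullOExt φ B n h).obj (A i)).obj) y k),
    (∀ i, a.1.1 i = ((inverseImageMap φ (FP.pr (fun i => (A i).obj) i)).map y).map k t) →
    a.1.2 = ((inverseImageMap φ (FP.toB fun i => (A i).obj)).map y).map k t →
    OExt.ap (θ.iso lam A).hom y k (((W.q lam fun i =>
      (MarkedOver.pullOExt φ B n h).obj (A i)).hom.map y).map k a) =
      ((inverseImageMap φ (V.q lam A).hom).map y).map k t

end LinearCombinations

/-! ### DG manifolds -/

section Manifolds

/-- `f` is of class `r` near `z`. -/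
def SmoothNear {𝕜 : Type} [RCLike 𝕜] {K : Type} [RCLike K] [NormedAlgebra 𝕜 K] (r : WithTop ℕ∞)
    (E : Type u) [NormedAddCommGroup E] [NormedSpace 𝕜 E] {X : Type u} [TopologicalSpace X]
    [ChartedSpace E X] (f : X → K) (z : X) : Prop :=
  ∀ᶠ w in 𝓝 z, ContMDiffAt 𝓘(𝕜, E) 𝓘(𝕜, K) r f w

/-- The ordered product of the generators listed in `l`. -/
def CDGA.monomial {K : Type w} [Field K] (R : CDGA.{u} K) {m : ℕ} {deg : Fin m → ℤ}
    (e : ∀ a, R.C (deg a)) : ∀ l : List (Fin m), R.C (l.map deg).sum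
  | [] => R.one
  | a :: l => R.mul (by rw [List.map_cons, List.sum_cons]) (e a) (R.monomial e l)

/-- The basis monomials of degree `k` in graded commuting generators `e_1, …, e_m` of degrees
`deg a`: weakly increasing lists in which the generators of odd degree are not repeated. -/
def MonomialIndex {m : ℕ} (deg : Fin m → ℤ) (k : ℤ) : Type :=
  {l : List (Fin m) // l.Pairwise (fun a b => a < b ∨ (a = b ∧ Even (deg a))) ∧
    (l.map deg).sum = k}

/-- An isomorphism of sheaves of graded algebras on an open set `U` between `O_X ⊗ Sym(V)` and the
structure sheaf, where `V` is a graded vector space with homogeneous basis `e_1, …, e_m`. The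
inclusion of the functions `f ∈ O_X` is `j`. -/
structure LocalModel (𝕜 : Type) [RCLike 𝕜] {K : Type} [RCLike K] [NormedAlgebra 𝕜 K]
    (r : WithTop ℕ∞) (E : Type u) [NormedAddCommGroup E] [NormedSpace 𝕜 E] (𝔛 : DGSpace.{u} K)
    [ChartedSpace E 𝔛.X] where
  U : Set 𝔛.X
  isOpen : IsOpen U
  m : ℕ
  deg : Fin m → ℤ
  e : ∀ (a : Fin m) (z : 𝔛.X), (𝔛.O z).C (deg a)
  e_sec : ∀ z ∈ U, ∀ a, e a ∈ (𝔛.S (deg a)).sec z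
  j : (𝔛.X → K) → ∀ z : 𝔛.X, (𝔛.O z).C 0
  j_sec : ∀ z ∈ U, ∀ f, SmoothNear (𝕜 := 𝕜) r E f z → j f ∈ (𝔛.S 0).sec z
  j_congr : ∀ z ∈ U, ∀ f g, SmoothNear (𝕜 := 𝕜) r E f z → f =ᶠ[𝓝 z] g → j f z = j g z
  j_add : ∀ z ∈ U, ∀ f g, SmoothNear (𝕜 := 𝕜) r E f z → SmoothNear (𝕜 := 𝕜) r E g z →
    j (f + g) z = j f z + j g z
  j_smul : ∀ z ∈ U, ∀ (c : K) (f), SmoothNear (𝕜 := 𝕜) r E f z → j (c • f) z = c • j f z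
  j_mul : ∀ z ∈ U, ∀ f g, SmoothNear (𝕜 := 𝕜) r E f z → SmoothNear (𝕜 := 𝕜) r E g z →
    j (f * g) z = (𝔛.O z).mul (add_zero 0) (j f z) (j g z)
  j_one : ∀ z ∈ U, j 1 z = (𝔛.O z).one
  span : ∀ z ∈ U, ∀ (k : ℤ) (a : (𝔛.O z).C k),
    ∃ (s : Finset (MonomialIndex deg k)) (f : MonomialIndex deg k → 𝔛.X → K),
      (∀ l, SmoothNear (𝕜 := 𝕜) r E (f l) z) ∧
      a = ∑ l ∈ s, (𝔛.O z).mul (by rw [zero_add, l.2.2]) (j (f l) z)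
        ((𝔛.O z).monomial (fun a => e a z) l.1)
  indep : ∀ z ∈ U, ∀ (k : ℤ) (s : Finset (MonomialIndex deg k))
    (f : MonomialIndex deg k → 𝔛.X → K), (∀ l, SmoothNear (𝕜 := 𝕜) r E (f l) z) →
    ∑ l ∈ s, (𝔛.O z).mul (show 0 + (l.1.map deg).sum = k by rw [zero_add, l.2.2]) (j (f l) z)
      ((𝔛.O z).monomial (fun a => e a z) l.1) = 0 →
    ∀ l ∈ s, f l =ᶠ[𝓝 z] 0

/-- A DG manifold of class `r` over `𝕜`: a manifold `X` with a sheaf of commutative differential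
graded `K`-algebras locally isomorphic, as a sheaf of graded algebras, to `O_X ⊗ Sym(V)`, for `O_X`
the sheaf of `K`-valued functions of class `r` and `V` a finite-dimensional graded vector space. -/
structure DGManifold (𝕜 : Type) [RCLike 𝕜] (K : Type) [RCLike K] [NormedAlgebra 𝕜 K]
    (r : WithTop ℕ∞) where
  space : DGSpace.{u} K
  E : Type u
  [normed : NormedAddCommGroup E]
  [normedSpace : NormedSpace 𝕜 E]
  [finite : FiniteDimensional 𝕜 E]
  [charted : ChartedSpace E space.X]
  [manifold : IsManifold 𝓘(𝕜, E) r space.X]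
  [hausdorff : T2Space space.X]
  [countable : SecondCountableTopology space.X]
  locallyFree : ∀ x : space.X, ∃ M : LocalModel 𝕜 r E space, x ∈ M.U

attribute [instance] DGManifold.normed DGManifold.normedSpace DGManifold.finite
  DGManifold.charted DGManifold.manifold DGManifold.hausdorff DGManifold.countable

/-- Powers of elements of degree zero. -/
def CDGA.pow {K : Type w} [Field K] (R : CDGA.{u} K) (a : R.C 0) : ℕ → R.C 0
  | 0 => R.one
  | N + 1 => R.mul (add_zero 0) a (R.pow a N)

/-- A morphism of DG manifolds: a map of manifolds of class `r` and a morphism of sheaves of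
differential graded algebras, which is compatible with the composition of functions (the inclusion
of `O_X` in the structure sheaf is canonical up to nilpotents). -/
structure DGManifold.Hom {𝕜 : Type} [RCLike 𝕜] {K : Type} [RCLike K] [NormedAlgebra 𝕜 K]
    {r : WithTop ℕ∞} (𝔜 𝔛 : DGManifold.{u} 𝕜 K r) extends DGSpace.Hom 𝔜.space 𝔛.space where
  smooth : ContMDiff 𝓘(𝕜, 𝔜.E) 𝓘(𝕜, 𝔛.E) r base
  compat : ∀ (M : LocalModel 𝕜 r 𝔛.E 𝔛.space) (N : LocalModel 𝕜 r 𝔜.E 𝔜.space)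
    (y : 𝔜.space.X), base y ∈ M.U → y ∈ N.U → ∀ f : 𝔛.space.X → K,
    SmoothNear (𝕜 := 𝕜) r 𝔛.E f (base y) →
    ∃ k : ℕ, (𝔜.space.O y).pow ((ψ y).map 0 (M.j f (base y)) - N.j (f ∘ base) y) k = 0

end Manifolds

/-- `B` is locally free: near each point there are homogeneous sections `e_i` (`i` in some index
set) which form a basis of the stalks over the structure sheaf. -/
def LieAlgebroid.IsLocallyFree {𝔛 : DGSpace.{u} K} (B : LieAlgebroid 𝔛) : Prop :=
  ∀ x : 𝔛.X, ∃ U ∈ 𝓝 x, ∃ (ι : Type u) (deg : ι → ℤ) (e : ∀ i z, (B.L z).C (deg i)),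
    (∀ z ∈ U, ∀ i, e i ∈ (B.S (deg i)).sec z) ∧
    ∀ z ∈ U, ∀ k : ℤ,
      (∀ b : (B.L z).C k, ∃ (s : Finset ι) (f : ∀ i, (𝔛.O z).C (k - deg i)),
        b = ∑ i ∈ s, (B.L z).smul (sub_add_cancel k (deg i)) (f i) (e i z)) ∧
      ∀ (s : Finset ι) (f : ∀ i, (𝔛.O z).C (k - deg i)),
        ∑ i ∈ s, (B.L z).smul (sub_add_cancel k (deg i)) (f i) (e i z) = 0 → ∀ i ∈ s, f i = 0

/-- The inverse image along `φ` takes `O[n]`-extensions of `B` to `O[n]`-extensions of `φ⁺B`. -/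
abbrev PreservesExtensions {𝔜 𝔛 : DGSpace.{u} K} (φ : DGSpace.Hom 𝔜 𝔛) (B : LieAlgebroid 𝔛)
    (n : ℤ) : Prop :=
  ∀ M : MarkedOver B n, M.IsExact → (M.pull φ).IsExact

end

end DGLie

/-!
The inverse image is compatible with linear combinations of extensions because it is right exact.

*Linear combinations.* The push-out `λ_1 A_1 ∔ … ∔ λ_m A_m` is the quotient of the semidirect product
`O[n] ⋊ (A_1 ×_B … ×_B A_m)` by the sheaf of ideals of the elements `(-∑ λ_i α_i, (α_i c_i)_i)`
(`LinComb.marked`, `linCombMap`). A morphism of extensions of `B` is an isomorphism (`OExt.isIso`), and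
two of them agree if they agree on a set of elements mapped onto `B` (`OExt.hom_ext`). So the structure
isomorphisms follow from the universal property (`MarkedOver.exists_desc`), and their coherence has to
be checked only on the image of the fibre product, where it is immediate (`canonical`).

*Right exactness.* An element of a stalk of `φ⁺A` is represented by a section `w` of `O_𝔜 ⊗ A` and a
derivation `ξ` near the point (`Pull.IsRep`). A section of `O_𝔜 ⊗_{O_𝔛} A` which vanishes in the stalk
at a point vanishes nearby (`Pull.secT_eventually_rel`), so such an element is zero if `w` vanishes at
the point and `ξ` vanishes near it. Hence `φ⁺` preserves surjections
(`Pull.inverseImageMap_surjective`), and if `c_1, …, c_m` span the kernel of a surjection `P → B`, then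
the elements `(1 ⊗ c_i, 0)` span the kernel of `φ⁺P → φ⁺B` (`Pull.exists_eq_sum_smul`). For an extension
of `B` only the injectivity of the marking can fail after `φ⁺`; if `B` is locally free, the stalks of
the extension split, and the splitting survives the tensor product
(`preservesExtensions_of_isLocallyFree`).

*The comparison.* Right exactness is applied to the fibre product `P = A_1 ×_B … ×_B A_m`, the kernel
of which over `B` is spanned by the `m` markings. If an element of `φ⁺P` is sent to a multiple `β c` of
the marking in `λ_1 φ⁺A_1 ∔ … ∔ λ_m φ⁺A_m`, then it is zero in `φ⁺B`, so it is a combination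
`∑ α_i c_i` of the markings with `β = ∑ λ_i α_i`, and its image in `φ⁺(λ_1 A_1 ∔ … ∔ λ_m A_m)` is `β c`
too. Hence the push-out map `φ⁺P → φ⁺(λ_1 A_1 ∔ … ∔ λ_m A_m)` descends to
`λ_1 φ⁺A_1 ∔ … ∔ λ_m φ⁺A_m` (`PullLinear.exists_hom`). As `φ⁺P` maps onto `φ⁺B`, the resulting
isomorphism is the only one compatible with the push-out maps, and its compatibilities are checked on
the image of `φ⁺P`.

*Picard groupoids.* The structure isomorphisms of the Picard groupoid underlying a vector space in
categories are comparisons of two identifications of an object with the same linear combination. A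
morphism `θ` of vector spaces in categories carries such comparisons to such comparisons
(`LinearFunctor.map_can`), and `F(X) + F(Y) ≅ F(X + Y)` is one of them (`LinearFunctor.muIso_hom`);
this gives the coherence of the symmetric monoidal functor `LinearFunctor.toPicard`.
-/

namespace DGLie

noncomputable section

/-! ### Morphisms of extensions -/

section

variable {K : Type w} [Field K]

/-- Over a field, a linear map which vanishes on the kernel of a surjective map factors
through it. -/
theorem exists_factor_of_surjective {M N Q : Type*} [AddCommGroup M] [AddCommGroup N]
    [AddCommGroup Q] [Module K M] [Module K N] [Module K Q] (s : M →ₗ[K] N) (t : M →ₗ[K] Q)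
    (hs : Function.Surjective s) (h : ∀ z, s z = 0 → t z = 0) :
    ∃ f : N →ₗ[K] Q, ∀ z, f (s z) = t z := by
  obtain ⟨σ, hσ⟩ := s.exists_rightInverse_of_surjective (LinearMap.range_eq_top.2 hs)
  refine ⟨t.comp σ, fun z => ?_⟩
  have h1 : s (σ (s z) - z) = 0 := by
    rw [map_sub, sub_eq_zero]
    exact LinearMap.congr_fun hσ (s z)
  have h2 := h _ h1
  rw [map_sub, sub_eq_zero] at h2
  exact h2

namespace MarkedOver

variable {𝔛 : DGSpace.{u} K} {B : LieAlgebroid 𝔛} {n : ℤ} (M : MarkedOver B n)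

theorem d_cmul (x : 𝔛.X) {i j i' j' : ℤ} (h : i + -n = j) (hi : i + 1 = i') (hj : j + 1 = j')
    (h' : i' + -n = j') (α : (𝔛.O x).C i) :
    (M.A.L x).d hj ((M.A.L x).smul h α (M.c x)) = (M.A.L x).smul h' ((𝔛.O x).d hi α) (M.c x) := by
  rw [(M.A.L x).d_smul h hj hi rfl h' (by omega), M.d_c, map_zero, smul_zero, add_zero]

theorem smul_cmul (x : 𝔛.X) {i j k l m : ℤ} (h : i + -n = j) (hk : k + j = l) (hm : k + i = m)
    (h' : m + -n = l) (f : (𝔛.O x).C k) (α : (𝔛.O x).C i) :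
    (M.A.L x).smul hk f ((M.A.L x).smul h α (M.c x)) =
      (M.A.L x).smul h' ((𝔛.O x).mul hm f α) (M.c x) :=
  ((M.A.L x).mul_smul hm h' h hk f α _).symm

theorem anch_cmul (x : 𝔛.X) {i j k l : ℤ} (h : i + -n = j) (hk : j + k = l) (α : (𝔛.O x).C i)
    (f : (𝔛.O x).C k) : (M.A.L x).anch hk ((M.A.L x).smul h α (M.c x)) f = 0 := by
  rw [(M.A.L x).anch_smul h hk rfl (by omega), M.anch_c, map_zero]

theorem p_cmul (x : 𝔛.X) {i j : ℤ} (h : i + -n = j) (α : (𝔛.O x).C i) :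
    (M.p.map x).map j ((M.A.L x).smul h α (M.c x)) = 0 := by
  rw [(M.p.map x).map_smul, M.p_c, map_zero]

theorem br_cmul (x : 𝔛.X) {i j k l m : ℤ} (h : i + -n = j) (hk : k + j = l) (hm : k + i = m)
    (h' : m + -n = l) (a : (M.A.L x).C k) (α : (𝔛.O x).C i) :
    (M.A.L x).br hk a ((M.A.L x).smul h α (M.c x)) =
      (M.A.L x).smul h' ((M.A.L x).anch hm a α) (M.c x) := by
  rw [(M.A.L x).leibniz hm rfl h hk h' (by omega),
    (M.A.L x).skew (i := k) rfl (show -n + k = k + -n by omega), M.central]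
  simp

theorem cmul_br (x : 𝔛.X) {i j k l m : ℤ} (h : i + -n = j) (hk : j + k = l) (hm : k + i = m)
    (h' : m + -n = l) (a : (M.A.L x).C k) (α : (𝔛.O x).C i) :
    (M.A.L x).br hk ((M.A.L x).smul h α (M.c x)) a =
      -(sg K (j * k) • (M.A.L x).smul h' ((M.A.L x).anch hm a α) (M.c x)) := by
  rw [(M.A.L x).skew hk (show k + j = l by omega), M.br_cmul x h _ hm h']

/-- The map `(β, t) ↦ β c + r(t)`. -/
def combine {P : PreLieAlgebroid 𝔛} (r : PreLieAlgebroid.Hom P M.A.toPreLieAlgebroid) (x : 𝔛.X)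
    {i j : ℤ} (h : i + -n = j) : (𝔛.O x).C i × (P.L x).C j →ₗ[K] (M.A.L x).C j :=
  (((M.A.L x).smul h).flip (M.c x)).coprod ((r.map x).map j)

theorem combine_apply {P : PreLieAlgebroid 𝔛} (r : PreLieAlgebroid.Hom P M.A.toPreLieAlgebroid)
    (x : 𝔛.X) {i j : ℤ} (h : i + -n = j) (z : (𝔛.O x).C i × (P.L x).C j) :
    M.combine r x h z = (M.A.L x).smul h z.1 (M.c x) + (r.map x).map j z.2 := rfl

/-- If `P` maps onto `B` then `A` is generated by the marking and the image of `P`. -/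
theorem combine_surjective {M : MarkedOver B n} (hM : M.IsExact) {P : PreLieAlgebroid 𝔛}
    (r : PreLieAlgebroid.Hom P M.A.toPreLieAlgebroid)
    (hr : ∀ x k (b : (B.L x).C k), ∃ t, (M.p.map x).map k ((r.map x).map k t) = b)
    (x : 𝔛.X) {i j : ℤ} (h : i + -n = j) : Function.Surjective (M.combine r x h) := by
  intro l
  obtain ⟨t, ht⟩ := hr x j ((M.p.map x).map j l)
  obtain ⟨β, hβ⟩ := hM.ker x h (l - (r.map x).map j t) (by rw [map_sub, ht, sub_self])
  exact ⟨(β, t), by rw [combine_apply, hβ, sub_add_cancel]⟩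

/-- Sections of an extension are locally of the form `β c + r(t)` for sections `β`, `t`. -/
theorem exists_sec_combine {M : MarkedOver B n} (hM : M.IsExact) {P : LieAlgebroid 𝔛}
    (r : PreLieAlgebroid.Hom P.toPreLieAlgebroid M.A.toPreLieAlgebroid)
    (hr : ∀ x k (b : (B.L x).C k), ∃ t, (M.p.map x).map k ((r.map x).map k t) = b)
    {x : 𝔛.X} {i j : ℤ} (h : i + -n = j) {s : ∀ z, (M.A.L z).C j} (hs : s ∈ (M.A.S j).sec x) :
    ∃ β ∈ (𝔛.S i).sec x, ∃ t ∈ (P.S j).sec x, ∀ᶠ z in 𝓝 x, s z = M.combine r z h (β z, t z) := by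
  obtain ⟨⟨β, t⟩, hl⟩ := combine_surjective hM r hr x h (s x)
  obtain ⟨β', hβ', rfl⟩ := (𝔛.S i).germ x β
  obtain ⟨t', ht', rfl⟩ := P.germ x t
  refine ⟨β', hβ', t', ht', ?_⟩
  have h1 := sub_mem hs (add_mem (M.A.smul_sec h _ hβ' _ (M.c_sec x)) (r.map_sec _ ht'))
  refine (M.A.eq_zero h1 (sub_eq_zero.2 hl.symm)).mono fun z hz => sub_eq_zero.1 hz

set_option maxHeartbeats 800000 in
/-- The universal property of an extension `L` generated over its marking by the image of `P`:
a morphism `P → N` over `B` which agrees with `P → L` on the elements mapped to `O c` factors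
through `L`. -/
theorem exists_desc {L N : MarkedOver B n} (hL : L.IsExact) {P : LieAlgebroid 𝔛}
    (r : PreLieAlgebroid.Hom P.toPreLieAlgebroid L.A.toPreLieAlgebroid)
    (g : PreLieAlgebroid.Hom P.toPreLieAlgebroid N.A.toPreLieAlgebroid)
    (hr : ∀ x k (b : (B.L x).C k), ∃ t, (L.p.map x).map k ((r.map x).map k t) = b)
    (hp : ∀ x k t, (N.p.map x).map k ((g.map x).map k t) = (L.p.map x).map k ((r.map x).map k t))
    (hc : ∀ (x) {i j : ℤ} (h : i + -n = j) (β : (𝔛.O x).C i) (t),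
      (r.map x).map j t = (L.A.L x).smul h β (L.c x) →
      (g.map x).map j t = (N.A.L x).smul h β (N.c x)) :
    ∃ f : L ⟶ N, ∀ x k t, (f.hom.map x).map k ((r.map x).map k t) = (g.map x).map k t := by
  have hs := fun x {i j} (h : i + -n = j) => combine_surjective hL r hr x h
  -- On stalks, `β c + r(t) ↦ β c + g(t)` is well defined by `hc`; the compatibility with the
  -- algebraic structure is then checked on elements of this form.
  have key : ∀ x j, ∃ f : (L.A.L x).C j →ₗ[K] (N.A.L x).C j,
      ∀ z, f (L.combine r x (show j + n + -n = j by omega) z) = N.combine g x (by omega) z := by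
    intro x j
    refine exists_factor_of_surjective _ _ (hs x _) fun z hz => ?_
    rw [combine_apply] at hz
    have h1 := hc x (show j + n + -n = j by omega) (-z.1) z.2
      (by rw [map_neg, LinearMap.neg_apply]; exact eq_neg_of_add_eq_zero_right hz)
    rw [combine_apply, h1, map_neg, LinearMap.neg_apply, add_neg_cancel]
  choose f hf' using key
  have hf : ∀ x {i j : ℤ} (h : i + -n = j) β t,
      f x j ((L.A.L x).smul h β (L.c x) + (r.map x).map j t) =
        (N.A.L x).smul h β (N.c x) + (g.map x).map j t := by
    intro x i j h β t
    obtain rfl : i = j + n := by omega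
    exact hf' x j (β, t)
  have hfc : ∀ x {i j : ℤ} (h : i + -n = j) β,
      f x j ((L.A.L x).smul h β (L.c x)) = (N.A.L x).smul h β (N.c x) := by
    intro x i j h β
    simpa using hf x h β 0
  have hfr : ∀ x j t, f x j ((r.map x).map j t) = (g.map x).map j t := by
    intro x j t
    simpa using hf x (show j + n + -n = j by omega) 0 t
  have hfa : ∀ x {i j k : ℤ} (h : i + j = k) l (a : (𝔛.O x).C j),
      (N.A.L x).anch h (f x i l) a = (L.A.L x).anch h l a := by
    intro x i j k h l a
    obtain ⟨⟨β, t⟩, rfl⟩ := hs x (show i + n + -n = i by omega) l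
    rw [combine_apply, hf, map_add, map_add, LinearMap.add_apply, LinearMap.add_apply, L.anch_cmul,
      N.anch_cmul, (r.map x).map_anch, (g.map x).map_anch]
  refine ⟨{
    hom :=
      { map := fun x =>
          { map := f x, map_smul := ?_, map_d := ?_, map_br := ?_, map_anch := ?_ }
        map_sec := ?_ }
    map_c := ?_
    comp_p := ?_ }, hfr⟩
  · intro i j k h a l
    obtain ⟨⟨β, t⟩, rfl⟩ := hs x (show j + n + -n = j by omega) l
    rw [combine_apply, map_add, L.smul_cmul x _ h rfl (by omega), ← (r.map x).map_smul, hf, hf,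
      map_add, N.smul_cmul x _ h rfl (by omega), ← (g.map x).map_smul]
  · intro i j h l
    obtain ⟨⟨β, t⟩, rfl⟩ := hs x (show i + n + -n = i by omega) l
    rw [combine_apply, map_add, L.d_cmul x _ rfl h (by omega), ← (r.map x).map_d, hf, hf,
      map_add, N.d_cmul x _ rfl h (by omega), ← (g.map x).map_d]
  · intro i j k h l l'
    obtain ⟨⟨β, t⟩, rfl⟩ := hs x (show i + n + -n = i by omega) l
    obtain ⟨⟨β', t'⟩, rfl⟩ := hs x (show j + n + -n = j by omega) l'
    have hcb : ∀ {i j k : ℤ} (h : i + j = k) (β : (𝔛.O x).C (i + n)) l,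
        f x k ((L.A.L x).br h ((L.A.L x).smul (show i + n + -n = i by omega) β (L.c x)) l) =
          (N.A.L x).br h (f x i ((L.A.L x).smul (by omega) β (L.c x))) (f x j l) := by
      intro i j k h β l
      rw [hfc, L.cmul_br x _ h rfl (by omega), N.cmul_br x _ h rfl (by omega), map_neg, map_smul,
        hfc, hfa]
    have hbc : ∀ {i j k : ℤ} (h : i + j = k) l (β : (𝔛.O x).C (j + n)),
        f x k ((L.A.L x).br h l ((L.A.L x).smul (show j + n + -n = j by omega) β (L.c x))) =
          (N.A.L x).br h (f x i l) (f x j ((L.A.L x).smul (by omega) β (L.c x))) := by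
      intro i j k h l β
      rw [hfc, L.br_cmul x _ h rfl (by omega), N.br_cmul x _ h rfl (by omega), hfc, hfa]
    simp only [combine_apply, map_add, LinearMap.add_apply]
    rw [hbc h, hbc h, hcb h, ← (r.map x).map_br]
    simp only [hfc, hfr]
    rw [(g.map x).map_br]
  · exact hfa x
  · intro x j s h
    obtain ⟨β, hβ, t, ht, hz⟩ := exists_sec_combine hL r hr (show j + n + -n = j by omega) h
    refine (N.A.S j).congr (add_mem (N.A.smul_sec (show j + n + -n = j by omega) _ hβ _
      (N.c_sec x)) (g.map_sec _ ht))
      (hz.mono fun z hz => ?_)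
    change _ = f z j (s z)
    rw [hz]
    exact (hf' z j (β z, t z)).symm
  · intro x
    have := hfc x (zero_add (-n)) (𝔛.O x).one
    rwa [(L.A.L x).one_smul, (N.A.L x).one_smul] at this
  · refine PreLieAlgebroid.Hom.ext_map fun x j l => ?_
    obtain ⟨⟨β, t⟩, rfl⟩ := hs x (show j + n + -n = j by omega) l
    change (N.p.map x).map j (f x j _) = _
    rw [hf', combine_apply, combine_apply, map_add, map_add, p_cmul, p_cmul, hp]

end MarkedOver

namespace OExt

variable {𝔛 : DGSpace.{u} K} {B : LieAlgebroid 𝔛} {n : ℤ}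

theorem id_ap (M : OExt B n) (x : 𝔛.X) (k : ℤ) (a) : OExt.ap (𝟙 M) x k a = a := rfl

theorem comp_ap {M N L : OExt B n} (f : M ⟶ N) (g : N ⟶ L) (x : 𝔛.X) (k : ℤ) (a) :
    OExt.ap (f ≫ g) x k a = OExt.ap g x k (OExt.ap f x k a) := rfl

theorem p_ap {M N : OExt B n} (f : M ⟶ N) (x : 𝔛.X) (k : ℤ) (a) :
    (N.obj.p.map x).map k (OExt.ap f x k a) = (M.obj.p.map x).map k a := by
  rw [← f.hom.comp_p]; rfl

theorem ap_cmul {M N : OExt B n} (f : M ⟶ N) (x : 𝔛.X) {i j : ℤ} (h : i + -n = j)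
    (α : (𝔛.O x).C i) : OExt.ap f x j ((M.obj.A.L x).smul h α (M.obj.c x)) =
      (N.obj.A.L x).smul h α (N.obj.c x) := by
  refine ((f.hom.hom.map x).map_smul h α _).trans ?_
  rw [f.hom.map_c]

/-- Two morphisms of extensions which agree on a set of elements mapped onto `B` are equal. -/
theorem hom_ext {M N : OExt B n} {f g : M ⟶ N}
    (h : ∀ x k (b : (B.L x).C k), ∃ l, (M.obj.p.map x).map k l = b ∧
      OExt.ap f x k l = OExt.ap g x k l) : f = g := by
  refine ObjectProperty.hom_ext _ (MarkedOver.Hom.ext (PreLieAlgebroid.Hom.ext_map fun x k l => ?_))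
  obtain ⟨l', hl, hfg⟩ := h x k ((M.obj.p.map x).map k l)
  obtain ⟨α, hα⟩ := M.property.ker x (show k + n + -n = k by omega) (l - l')
    (by rw [map_sub, hl, sub_self])
  change OExt.ap f x k l = OExt.ap g x k l
  rw [← sub_add_cancel l l', ← hα, map_add, map_add, hfg, ap_cmul, ap_cmul]

/-- The five lemma for extensions. The inverse of `f : M → N` is obtained by descending the identity
of `M` along the surjection `f`. -/
theorem isIso {M N : OExt B n} (f : M ⟶ N) : IsIso f := by
  obtain ⟨g, hg⟩ := MarkedOver.exists_desc (L := N.obj) (N := M.obj) N.property f.hom.hom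
    (PreLieAlgebroid.Hom.id M.obj.A.toPreLieAlgebroid)
    (fun x k b => by
      obtain ⟨l, rfl⟩ := M.property.surj x k b
      exact ⟨l, p_ap f x k l⟩)
    (fun x k t => (p_ap f x k t).symm)
    (fun x i j h β t ht => by
      have h1 : (M.obj.p.map x).map j t = 0 := by
        rw [← p_ap f, OExt.ap, ht, MarkedOver.p_cmul]
      obtain ⟨α, rfl⟩ := M.property.ker x h t h1
      have h2 := (ap_cmul f x h α).symm.trans ht
      rw [← sub_eq_zero, ← LinearMap.sub_apply, ← map_sub] at h2
      rw [sub_eq_zero.1 (N.property.inj x h _ h2)]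
      rfl)
  refine ⟨ObjectProperty.homMk g, hom_ext fun x k b => ?_, hom_ext fun x k b => ?_⟩
  · obtain ⟨l, rfl⟩ := M.property.surj x k b
    exact ⟨l, rfl, hg x k l⟩
  · obtain ⟨l, rfl⟩ := M.property.surj x k b
    exact ⟨OExt.ap f x k l, p_ap f x k l, congrArg (OExt.ap f x k) (hg x k l)⟩

end OExt

end

/-! ### The semidirect product with `O[n]` -/

section

variable {K : Type w} [Field K]

namespace Semi

variable {R : CDGA.{u} K} (Q : LR R) (n : ℤ)

/-- Multiplication by functions on `O[n] ⊕ Q`. -/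
def smul {i j k : ℤ} (h : i + j = k) :
    R.C i →ₗ[K] (R.C (j + n) × Q.C j) →ₗ[K] (R.C (k + n) × Q.C k) :=
  LinearMap.mk₂ K (fun f x => (R.mul (show i + (j + n) = k + n by omega) f x.1, Q.smul h f x.2))
    (by intros; exact Prod.ext (by simp) (by simp)) (by intros; exact Prod.ext (by simp) (by simp))
    (by intros; exact Prod.ext (by simp) (by simp)) (by intros; exact Prod.ext (by simp) (by simp))

/-- The bracket `[(α, p), (β, q)] = (p(β) - (-1)^{p q} q(α), [p, q])` on `O[n] ⊕ Q`. -/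
def br {i j k : ℤ} (h : i + j = k) :
    (R.C (i + n) × Q.C i) →ₗ[K] (R.C (j + n) × Q.C j) →ₗ[K] (R.C (k + n) × Q.C k) :=
  LinearMap.mk₂ K (fun x y =>
    (Q.anch (show i + (j + n) = k + n by omega) x.2 y.1 -
      sg K (i * j) • Q.anch (show j + (i + n) = k + n by omega) y.2 x.1, Q.br h x.2 y.2))
    (by intros; exact Prod.ext (by simp; module) (by simp))
    (by intros; exact Prod.ext (by simp; module) (by simp))
    (by intros; exact Prod.ext (by simp; module) (by simp))
    (by intros; exact Prod.ext (by simp; module) (by simp))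

variable {n}

theorem br_skew {i j k : ℤ} (h : i + j = k) (h' : j + i = k) (x : R.C (i + n) × Q.C i)
    (y : R.C (j + n) × Q.C j) : br Q n h x y = -(sg K (i * j) • br Q n h' y x) := by
  refine Prod.ext ?_ (Q.skew h h' x.2 y.2)
  change _ - _ = -(sg K (i * j) • (_ - sg K (j * i) • _))
  rw [mul_comm j i]
  rcases sg_cases (K := K) (i * j) with h3 | h3 <;> rw [h3] <;> module

theorem br_jacobi {i j k ij ik jk m : ℤ} (hij : i + j = ij) (hik : i + k = ik) (hjk : j + k = jk)
    (h1 : i + jk = m) (h2 : ij + k = m) (h3 : j + ik = m) (x : R.C (i + n) × Q.C i)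
    (y : R.C (j + n) × Q.C j) (z : R.C (k + n) × Q.C k) :
    br Q n h1 x (br Q n hjk y z) =
      br Q n h2 (br Q n hij x y) z + sg K (i * j) • br Q n h3 y (br Q n hik x z) := by
  refine Prod.ext ?_ (Q.jacobi hij hik hjk h1 h2 h3 x.2 y.2 z.2)
  change Q.anch _ x.2 (Q.anch _ y.2 z.1 - sg K (j * k) • Q.anch _ z.2 y.1) -
      sg K (i * jk) • Q.anch _ (Q.br hjk y.2 z.2) x.1 =
    Q.anch _ (Q.br hij x.2 y.2) z.1 -
      sg K (ij * k) • Q.anch _ z.2 (Q.anch _ x.2 y.1 - sg K (i * j) • Q.anch _ y.2 x.1) +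
    sg K (i * j) • (Q.anch _ y.2 (Q.anch _ x.2 z.1 - sg K (i * k) • Q.anch _ z.2 x.1) -
      sg K (j * ik) • Q.anch _ (Q.br hik x.2 z.2) y.1)
  rw [Q.anch_br hjk (show j + (i + n) = ij + n by omega) (show k + (i + n) = ik + n by omega)
      (by omega) _ (by omega),
    Q.anch_br hij (show i + (k + n) = ik + n by omega) (show j + (k + n) = jk + n by omega)
      (by omega) _ (by omega),
    Q.anch_br hik (show i + (j + n) = ij + n by omega) (show k + (j + n) = jk + n by omega)
      (by omega) _ (by omega)]
  subst hij hik hjk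
  simp only [map_sub, map_smul, mul_add, add_mul, sg_add, mul_comm j i]
  rcases sg_cases (K := K) (i * j) with h4 | h4 <;>
  rcases sg_cases (K := K) (i * k) with h5 | h5 <;>
  rcases sg_cases (K := K) (j * k) with h6 | h6 <;> rw [h4, h5, h6] <;> module

theorem br_d {i j k i' j' k' : ℤ} (h : i + j = k) (hk : k + 1 = k') (hi : i + 1 = i')
    (hj : j + 1 = j') (h1 : i' + j = k') (h2 : i + j' = k') (x : R.C (i + n) × Q.C i)
    (y : R.C (j + n) × Q.C j) :
    ((R.d (show k + n + 1 = k' + n by omega)).prodMap (Q.d hk)) (br Q n h x y) =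
      br Q n h1 (R.d (by omega) x.1, Q.d hi x.2) y +
        sg K i • br Q n h2 x (R.d (by omega) y.1, Q.d hj y.2) := by
  refine Prod.ext ?_ (Q.d_br h hk hi hj h1 h2 x.2 y.2)
  change R.d (i := k + n) (j := k' + n) _
      (Q.anch _ x.2 y.1 - sg K (i * j) • Q.anch _ y.2 x.1) =
    Q.anch _ (Q.d hi x.2) y.1 - sg K (i' * j) • Q.anch (j := i' + n) _ y.2 (R.d _ x.1) +
    sg K i • (Q.anch (j := j' + n) _ x.2 (R.d _ y.1) - sg K (i * j') • Q.anch _ (Q.d hj y.2) x.1)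
  rw [Q.anch_d (show i + (j + n) = k + n by omega) (by omega) hi
      (show j + n + 1 = j' + n by omega) _ (by omega),
    Q.anch_d (show j + (i + n) = k + n by omega) (by omega) hj
      (show i + n + 1 = i' + n by omega) _ (by omega)]
  subst hi hj
  simp only [map_sub, map_smul, mul_add, add_mul, sg_add, mul_one, one_mul]
  rcases sg_cases (K := K) i with h4 | h4 <;>
  rcases sg_cases (K := K) j with h5 | h5 <;>
  rcases sg_cases (K := K) (i * j) with h6 | h6 <;> rw [h4, h5, h6] <;> module

theorem br_leibniz {i j k ij ik jk m : ℤ} (hij : i + j = ij) (hik : i + k = ik)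
    (hjk : j + k = jk) (h1 : i + jk = m) (h2 : ij + k = m) (h3 : j + ik = m)
    (x : R.C (i + n) × Q.C i) (f : R.C j) (y : R.C (k + n) × Q.C k) :
    br Q n h1 x (smul Q n hjk f y) =
      smul Q n h2 (Q.anch hij x.2 f) y + sg K (i * j) • smul Q n h3 f (br Q n hik x y) := by
  refine Prod.ext ?_ (Q.leibniz hij hik hjk h1 h2 h3 x.2 f y.2)
  change Q.anch _ x.2 (R.mul _ f y.1) - sg K (i * jk) • Q.anch _ (Q.smul hjk f y.2) x.1 =
    R.mul _ (Q.anch hij x.2 f) y.1 +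
      sg K (i * j) • R.mul _ f (Q.anch _ x.2 y.1 - sg K (i * k) • Q.anch _ y.2 x.1)
  rw [Q.anch_mul hij (show i + (k + n) = ik + n by omega) _ _ (by omega) (by omega),
    Q.anch_smul hjk _ (show k + (i + n) = ik + n by omega) (by omega)]
  subst hjk
  simp only [map_sub, map_smul, mul_add, sg_add]
  module

variable (n)

/-- The semidirect product `O[n] ⋊ Q`, in which `Q` acts on `O[n]` through its anchor. -/
def semiO : LR R where
  C j := R.C (j + n) × Q.C j
  smul := smul Q n
  d {i j} h := (R.d (show i + n + 1 = j + n by omega)).prodMap (Q.d h)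
  br := br Q n
  anch h := (Q.anch h).comp (LinearMap.snd K _ _)
  one_smul {i} h x := by
    refine Prod.ext ?_ (Q.one_smul h x.2)
    exact R.one_mul (show 0 + (i + n) = i + n by omega) x.1
  mul_smul {i j k ij jk m} h1 h2 h3 h4 f g x :=
    Prod.ext (R.mul_assoc h1 (show ij + (k + n) = m + n by omega)
      (show j + (k + n) = jk + n by omega) (by omega) f g x.1) (Q.mul_smul h1 h2 h3 h4 f g x.2)
  d_d {i j k} h h' x := Prod.ext (R.d_d (show i + n + 1 = j + n by omega) (by omega) x.1)
    (Q.d_d h h' x.2)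
  d_smul {i j k i' j' k'} h hk hi hj h1 h2 f x :=
    Prod.ext (R.d_mul (show i + (j + n) = k + n by omega) (by omega) hi
      (show j + n + 1 = j' + n by omega) (by omega) (by omega) f x.1)
      (Q.d_smul h hk hi hj h1 h2 f x.2)
  skew := br_skew Q
  jacobi := br_jacobi Q
  d_br := br_d Q
  anch_mul hij hik hjk h1 h2 h3 x f g := Q.anch_mul hij hik hjk h1 h2 h3 x.2 f g
  anch_smul h1 h2 h3 h4 f x g := Q.anch_smul h1 h2 h3 h4 f x.2 g
  anch_br hij hik hjk h1 h2 h3 x y f := Q.anch_br hij hik hjk h1 h2 h3 x.2 y.2 f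
  anch_d h hk hi hj h1 h2 x f := Q.anch_d h hk hi hj h1 h2 x.2 f
  leibniz := br_leibniz Q

end Semi

variable {𝔛 : DGSpace.{u} K}

/-- The Lie algebroid `O[n] ⋊ P`. -/
def LieAlgebroid.semiO (P : LieAlgebroid 𝔛) (n : ℤ) : LieAlgebroid 𝔛 where
  L x := Semi.semiO (P.L x) n
  S j :=
    { sec := fun x =>
        { carrier := {s | (fun z => (s z).1) ∈ (𝔛.S (j + n)).sec x ∧
            (fun z => (s z).2) ∈ (P.S j).sec x}
          zero_mem' := ⟨zero_mem _, zero_mem _⟩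
          add_mem' := fun hs ht => ⟨add_mem hs.1 ht.1, add_mem hs.2 ht.2⟩
          smul_mem' := fun c _ hs =>
            ⟨Submodule.smul_mem _ c hs.1, Submodule.smul_mem _ c hs.2⟩ }
      eventually_mem := fun hs =>
        ((𝔛.S (j + n)).eventually_mem hs.1).and ((P.S j).eventually_mem hs.2)
      congr := fun hs h => ⟨(𝔛.S (j + n)).congr hs.1 (h.mono fun z hz => congrArg Prod.fst hz),
        (P.S j).congr hs.2 (h.mono fun z hz => congrArg Prod.snd hz)⟩ }
  smul_sec h f hf a ha := ⟨𝔛.mul_sec _ f hf _ ha.1, P.smul_sec h f hf _ ha.2⟩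
  d_sec h a ha := ⟨𝔛.d_sec _ _ ha.1, P.d_sec h _ ha.2⟩
  br_sec {x i j k} h a ha b hb := ⟨sub_mem (P.anch_sec _ _ ha.2 _ hb.1)
    (Submodule.smul_mem _ (sg K (i * j)) (P.anch_sec _ _ hb.2 _ ha.1)), P.br_sec h _ ha.2 _ hb.2⟩
  anch_sec h a ha f hf := P.anch_sec h _ ha.2 f hf
  germ x a := by
    obtain ⟨α, hα, h1⟩ := (𝔛.S _).germ x a.1
    obtain ⟨p, hp, h2⟩ := P.germ x a.2
    exact ⟨fun z => (α z, p z), ⟨hα, hp⟩, Prod.ext h1 h2⟩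
  eq_zero hs h := by
    filter_upwards [(𝔛.S _).eq_zero hs.1 (congrArg Prod.fst h),
      P.eq_zero hs.2 (congrArg Prod.snd h)] with z h1 h2
    exact Prod.ext h1 h2

/-! ### Quotients of Lie algebroids -/

/-- A sheaf of ideals of a Lie algebroid, contained in the kernel of the anchor: a family of graded
ideals of the stalks such that a section whose germ at a point lies in the ideal has this property
at all nearby points. -/
structure LieAlgebroid.Ideal (P : LieAlgebroid 𝔛) where
  I : ∀ (x : 𝔛.X) (k : ℤ), Submodule K ((P.L x).C k)
  smul_mem : ∀ (x) {i j k : ℤ} (h : i + j = k) (s : (𝔛.O x).C i), ∀ a ∈ I x j,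
    (P.L x).smul h s a ∈ I x k
  d_mem : ∀ (x) {i j : ℤ} (h : i + 1 = j), ∀ a ∈ I x i, (P.L x).d h a ∈ I x j
  br_mem : ∀ (x) {i j k : ℤ} (h : i + j = k) (a : (P.L x).C i), ∀ b ∈ I x j,
    (P.L x).br h a b ∈ I x k
  anch_eq_zero : ∀ (x) {i j k : ℤ} (h : i + j = k), ∀ a ∈ I x i, ∀ f : (𝔛.O x).C j,
    (P.L x).anch h a f = 0
  eventually_mem : ∀ {x : 𝔛.X} {k : ℤ} {s : ∀ z, (P.L z).C k}, s ∈ (P.S k).sec x → s x ∈ I x k →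
    ∀ᶠ z in 𝓝 x, s z ∈ I z k

namespace LieAlgebroid.Ideal

variable {P : LieAlgebroid 𝔛} (J : P.Ideal)

/-- The quotient of a Lie algebroid by a sheaf of ideals. Its sections are locally the classes of
sections. -/
def quot : LieAlgebroid 𝔛 where
  L x := quotLR (P.L x) (J.I x) (J.smul_mem x) (J.d_mem x) (J.br_mem x) (J.anch_eq_zero x)
  S k :=
    { sec := fun x =>
        { carrier := {t | ∃ s ∈ (P.S k).sec x, ∀ᶠ z in 𝓝 x, t z = Submodule.Quotient.mk (s z)}
          zero_mem' := ⟨0, zero_mem _, Filter.Eventually.of_forall fun z => rfl⟩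
          add_mem' := by
            rintro t t' ⟨s, hs, h⟩ ⟨s', hs', h'⟩
            refine ⟨s + s', add_mem hs hs', ?_⟩
            filter_upwards [h, h'] with z h1 h2
            rw [Pi.add_apply, h1, h2]; rfl
          smul_mem' := by
            rintro c t ⟨s, hs, h⟩
            refine ⟨c • s, Submodule.smul_mem _ c hs, ?_⟩
            filter_upwards [h] with z h1
            rw [Pi.smul_apply, h1]; rfl }
      eventually_mem := by
        rintro x t ⟨s, hs, h⟩
        filter_upwards [(P.S k).eventually_mem hs, eventually_eventually_nhds.2 h] with z h1 h2
        exact ⟨s, h1, h2⟩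
      congr := by
        rintro x t t' ⟨s, hs, h⟩ h'
        refine ⟨s, hs, ?_⟩
        filter_upwards [h, h'] with z h1 h2
        rw [← h2, h1] }
  smul_sec := by
    rintro x i j k h f hf t ⟨s, hs, ht⟩
    refine ⟨_, P.smul_sec h f hf s hs, ?_⟩
    filter_upwards [ht] with z hz
    rw [hz]; rfl
  d_sec := by
    rintro x i j h t ⟨s, hs, ht⟩
    refine ⟨_, P.d_sec h s hs, ?_⟩
    filter_upwards [ht] with z hz
    rw [hz]; rfl
  br_sec := by
    rintro x i j k h t ⟨s, hs, ht⟩ t' ⟨s', hs', ht'⟩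
    refine ⟨_, P.br_sec h s hs s' hs', ?_⟩
    filter_upwards [ht, ht'] with z hz hz'
    rw [hz, hz']; rfl
  anch_sec := by
    rintro x i j k h t ⟨s, hs, ht⟩ f hf
    refine (𝔛.S k).congr (P.anch_sec h s hs f hf) ?_
    filter_upwards [ht] with z hz
    rw [hz]; rfl
  germ := by
    intro k x a
    obtain ⟨a, rfl⟩ := Submodule.Quotient.mk_surjective _ a
    obtain ⟨s, hs, rfl⟩ := P.germ x a
    exact ⟨fun z => Submodule.Quotient.mk (s z), ⟨s, hs, Filter.Eventually.of_forall fun z => rfl⟩,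
      rfl⟩
  eq_zero := by
    rintro k x t ⟨s, hs, ht⟩ h0
    rw [ht.self_of_nhds] at h0
    filter_upwards [ht, J.eventually_mem hs ((Submodule.Quotient.mk_eq_zero _).1 h0)] with z hz h1
    rw [hz]
    exact (Submodule.Quotient.mk_eq_zero _).2 h1

/-- The projection to the quotient. -/
def proj : PreLieAlgebroid.Hom P.toPreLieAlgebroid J.quot.toPreLieAlgebroid where
  map x :=
    { map := fun k => (J.I x k).mkQ
      map_smul := fun _ _ _ => rfl
      map_d := fun _ _ => rfl
      map_br := fun _ _ _ => rfl
      map_anch := fun _ _ _ => rfl }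
  map_sec s hs := ⟨s, hs, Filter.Eventually.of_forall fun _ => rfl⟩

theorem proj_surjective (x : 𝔛.X) (k : ℤ) : Function.Surjective ((J.proj.map x).map k) :=
  Submodule.Quotient.mk_surjective _

theorem proj_eq_zero {x : 𝔛.X} {k : ℤ} {a : (P.L x).C k} :
    (J.proj.map x).map k a = 0 ↔ a ∈ J.I x k :=
  Submodule.Quotient.mk_eq_zero _

/-- Morphisms which vanish on the ideal descend to the quotient. -/
def desc {A : LieAlgebroid 𝔛} (f : PreLieAlgebroid.Hom P.toPreLieAlgebroid A.toPreLieAlgebroid)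
    (hf : ∀ x k, ∀ a ∈ J.I x k, (f.map x).map k a = 0) :
    PreLieAlgebroid.Hom J.quot.toPreLieAlgebroid A.toPreLieAlgebroid where
  map x :=
    { map := fun k => (J.I x k).liftQ ((f.map x).map k) (hf x k)
      map_smul := by
        intro i j k h g a
        obtain ⟨a, rfl⟩ := J.proj_surjective x j a
        exact (f.map x).map_smul h g a
      map_d := by
        intro i j h a
        obtain ⟨a, rfl⟩ := J.proj_surjective x i a
        exact (f.map x).map_d h a
      map_br := by
        intro i j k h a b
        obtain ⟨a, rfl⟩ := J.proj_surjective x i a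
        obtain ⟨b, rfl⟩ := J.proj_surjective x j b
        exact (f.map x).map_br h a b
      map_anch := by
        intro i j k h a g
        obtain ⟨a, rfl⟩ := J.proj_surjective x i a
        exact (f.map x).map_anch h a g }
  map_sec := by
    rintro x k t ⟨s, hs, h⟩
    refine (A.S k).congr (f.map_sec s hs) (h.mono fun z hz => ?_)
    rw [hz]; rfl

end LieAlgebroid.Ideal

end

/-! ### Linear combinations of extensions exist -/

section

variable {K : Type w} [Field K]

/-! The degree `e = 0 + 0` of `1 · 1` is arbitrary in the next lemmas, since the unit is needed in the
degree `-n + n`, which is equal to `0` but not by definition. -/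

theorem CDGA.mul_one_mul_one (R : CDGA.{u} K) {i e : ℤ} (he : (0 : ℤ) + 0 = e) (h : i + e = i)
    (a : R.C i) : R.mul h a (R.mul he R.one R.one) = a := by
  obtain rfl : e = 0 := by omega
  rw [R.one_mul, R.mul_comm h (by omega), mul_zero, sg_zero, R.one_mul, one_smul]

theorem CDGA.d_one_mul_one (R : CDGA.{u} K) {e j : ℤ} (he : (0 : ℤ) + 0 = e) (h : e + 1 = j) :
    R.d h (R.mul he R.one R.one) = 0 := by
  obtain rfl : e = 0 := by omega
  rw [R.one_mul, R.d_one]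

theorem LR.anch_one_mul_one {R : CDGA.{u} K} (Q : LR R) {e j k : ℤ} (he : (0 : ℤ) + 0 = e)
    (h : j + e = k) (a : Q.C j) : Q.anch h a (R.mul he R.one R.one) = 0 := by
  obtain rfl : e = 0 := by omega
  obtain rfl : j = k := by omega
  have h1 := Q.anch_mul h h (add_zero 0) h h (by omega) a R.one R.one
  rw [R.mul_comm h (by omega : 0 + j = j), R.one_mul, R.one_mul, mul_zero, sg_zero,
    one_smul] at h1
  rw [R.one_mul]
  simpa using h1

variable {𝔛 : DGSpace.{u} K}

/-- The projection `O[n] ⋊ P → P`. -/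
def LieAlgebroid.semiSnd (P : LieAlgebroid 𝔛) (n : ℤ) :
    PreLieAlgebroid.Hom (P.semiO n).toPreLieAlgebroid P.toPreLieAlgebroid where
  map _ :=
    { map := fun _ => LinearMap.snd K _ _
      map_smul := fun _ _ _ => rfl
      map_d := fun _ _ => rfl
      map_br := fun _ _ _ => rfl
      map_anch := fun _ _ _ => rfl }
  map_sec _ hs := hs.2

/-- The inclusion `P → O[n] ⋊ P`. -/
def LieAlgebroid.semiInr (P : LieAlgebroid 𝔛) (n : ℤ) :
    PreLieAlgebroid.Hom P.toPreLieAlgebroid (P.semiO n).toPreLieAlgebroid where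
  map x :=
    { map := fun _ => LinearMap.inr K _ _
      map_smul := fun h f a => Prod.ext (map_zero ((𝔛.O x).mul _ f)).symm rfl
      map_d := fun h a => Prod.ext (map_zero ((𝔛.O x).d _)).symm rfl
      map_br := fun {i j k} h a b => Prod.ext (by
        change 0 = (P.L x).anch _ a 0 - sg K (i * j) • (P.L x).anch _ b 0
        rw [map_zero, map_zero, smul_zero, sub_zero]) rfl
      map_anch := fun _ _ _ => rfl }
  map_sec _ hs := ⟨zero_mem _, hs⟩

variable {B : LieAlgebroid 𝔛} {n : ℤ}

namespace FP

variable {m : ℕ} (A : Fin m → MarkedOver B n)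

/-- The marking `O[n]^m → A_1 ×_B … ×_B A_m` as a linear map. -/
def markL (x : 𝔛.X) {i j : ℤ} (h : i + -n = j) : (Fin m → (𝔛.O x).C i) →ₗ[K] sub A x j where
  toFun α := mark A x h α
  map_add' _ _ := sub_ext A (fun _ => LinearMap.map_add₂ _ _ _ _) (add_zero _).symm
  map_smul' _ _ := sub_ext A (fun _ => LinearMap.map_smul₂ _ _ _ _) (smul_zero _).symm

theorem smul_mark (x : 𝔛.X) {i j k l m' : ℤ} (h : i + -n = j) (hk : k + j = l) (hm : k + i = m')
    (h' : m' + -n = l) (f : (𝔛.O x).C k) (α : Fin m → (𝔛.O x).C i) :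
    ((FP A).L x).smul hk f (mark A x h α) = mark A x h' fun a => (𝔛.O x).mul hm f (α a) :=
  sub_ext A (fun a => (A a).smul_cmul x h hk hm h' f (α a)) (map_zero _)

theorem d_mark (x : 𝔛.X) {i j i' j' : ℤ} (h : i + -n = j) (hi : i + 1 = i') (hj : j + 1 = j')
    (h' : i' + -n = j') (α : Fin m → (𝔛.O x).C i) :
    ((FP A).L x).d hj (mark A x h α) = mark A x h' fun a => (𝔛.O x).d hi (α a) :=
  sub_ext A (fun a => (A a).d_cmul x h hi hj h' (α a)) (map_zero _)

theorem br_mark (x : 𝔛.X) {i j k l m' : ℤ} (h : i + -n = j) (hk : k + j = l) (hm : k + i = m')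
    (h' : m' + -n = l) (t : ((FP A).L x).C k) (α : Fin m → (𝔛.O x).C i) :
    ((FP A).L x).br hk t (mark A x h α) =
      mark A x h' fun a => ((FP A).L x).anch hm t (α a) := by
  refine sub_ext A (fun a => ?_) (map_zero _)
  refine ((A a).br_cmul x h hk hm h' _ (α a)).trans ?_
  rw [← anch_eq A t a]; rfl

theorem anch_mark (x : 𝔛.X) {i j k l : ℤ} (h : i + -n = j) (hk : j + k = l)
    (α : Fin m → (𝔛.O x).C i) (f : (𝔛.O x).C k) :
    ((FP A).L x).anch hk (mark A x h α) f = 0 := by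
  change (B.L x).anch hk 0 f = 0
  rw [map_zero, LinearMap.zero_apply]

theorem mark_mem_sec {x : 𝔛.X} {i j : ℤ} (h : i + -n = j) {α : Fin m → ∀ z, (𝔛.O z).C i}
    (hα : ∀ a, α a ∈ (𝔛.S i).sec x) : (fun z => mark A z h fun a => α a z) ∈ ((FP A).S j).sec x :=
  ⟨fun a => (A a).A.smul_sec h _ (hα a) _ ((A a).c_sec x), zero_mem _⟩

variable {A}

theorem mark_injective (hA : ∀ a, (A a).IsExact) (x : 𝔛.X) {i j : ℤ} (h : i + -n = j) :
    Function.Injective (mark A x h) := by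
  intro α β hab
  funext a
  have h1 : ((A a).A.L x).smul h (α a) ((A a).c x) = ((A a).A.L x).smul h (β a) ((A a).c x) :=
    congrArg (fun t : sub A x j => t.1.1 a) hab
  rw [← sub_eq_zero, ← LinearMap.sub_apply, ← map_sub] at h1
  exact sub_eq_zero.1 ((hA a).inj x h _ h1)

theorem exists_eq_mark (hA : ∀ a, (A a).IsExact) (x : 𝔛.X) {i j : ℤ} (h : i + -n = j)
    (t : sub A x j) (ht : t.1.2 = 0) : ∃ α, t = mark A x h α := by
  choose α hα using fun a => (hA a).ker x h (t.1.1 a) ((t.2 a).trans ht)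
  exact ⟨α, sub_ext A (fun a => (hα a).symm) ht⟩

theorem toB_surjective (hA : ∀ a, (A a).IsExact) (x : 𝔛.X) (k : ℤ) (b : (B.L x).C k) :
    ∃ t : sub A x k, t.1.2 = b := by
  choose s hs using fun a => (hA a).surj x k b
  exact ⟨⟨(s, b), hs⟩, rfl⟩

end FP

namespace LinComb

variable {m : ℕ} (lam : Fin m → K) (A : Fin m → OExt B n)

/-- The relations `(-∑ λ_i α_i, (α_i c_i)_i)` in the stalk of `O[n] ⋊ (A_1 ×_B … ×_B A_m)`. -/
def relSub (x : 𝔛.X) (k : ℤ) : Submodule K ((((FP fun i => (A i).obj).semiO n).L x).C k) where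
  carrier := {y | ∃ α, y.2 = FP.mark (fun i => (A i).obj) x (show k + n + -n = k by omega) α ∧
    y.1 = -∑ a, lam a • α a}
  zero_mem' := ⟨0, (map_zero (FP.markL (fun i => (A i).obj) x _)).symm, by simp; rfl⟩
  add_mem' := by
    rintro y y' ⟨α, h1, h2⟩ ⟨α', h1', h2'⟩
    refine ⟨α + α', Eq.trans ?_ (map_add (FP.markL (fun i => (A i).obj) x _) α α').symm, ?_⟩
    · exact congrArg₂ (fun a b : FP.sub (fun i => (A i).obj) x k => a + b) h1 h1'
    · refine (congrArg₂ (fun a b : (𝔛.O x).C (k + n) => a + b) h2 h2').trans ?_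
      simp only [Pi.add_apply, smul_add, Finset.sum_add_distrib]
      exact (neg_add _ _).symm
  smul_mem' := by
    rintro c y ⟨α, h1, h2⟩
    refine ⟨c • α, Eq.trans ?_ (map_smul (FP.markL (fun i => (A i).obj) x _) c α).symm, ?_⟩
    · exact congrArg (fun a : FP.sub (fun i => (A i).obj) x k => c • a) h1
    · refine (congrArg (fun a : (𝔛.O x).C (k + n) => c • a) h2).trans ?_
      simp only [Pi.smul_apply, smul_comm _ c, ← Finset.smul_sum, smul_neg]

/-- The relations form a sheaf of ideals. -/
def rel : ((FP fun i => (A i).obj).semiO n).Ideal where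
  I := relSub lam A
  smul_mem := by
    rintro x i j k h s ⟨_, _⟩ ⟨α, rfl, rfl⟩
    refine ⟨fun a => (𝔛.O x).mul (show i + (j + n) = k + n by omega) s (α a),
      FP.smul_mark _ x _ h (by omega) _ s α, ?_⟩
    change (𝔛.O x).mul _ s _ = _
    simp
  d_mem := by
    rintro x i j h ⟨_, _⟩ ⟨α, rfl, rfl⟩
    refine ⟨fun a => (𝔛.O x).d (show i + n + 1 = j + n by omega) (α a),
      ?_, ?_⟩
    · exact FP.d_mark (fun i => (A i).obj) x (show i + n + -n = i by omega) (by omega) h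
        (show j + n + -n = j by omega) α
    change (𝔛.O x).d _ _ = _
    simp
  br_mem := by
    rintro x i j k h ⟨γ, t⟩ ⟨_, _⟩ ⟨α, rfl, rfl⟩
    refine ⟨fun a => ((FP fun i => (A i).obj).L x).anch (show i + (j + n) = k + n by omega) t
      (α a), ?_, ?_⟩
    · exact FP.br_mark (fun i => (A i).obj) x (show j + n + -n = j by omega) h (by omega)
        (show k + n + -n = k by omega) t α
    change ((FP fun i => (A i).obj).L x).anch _ t _ - sg K (i * j) •
      ((FP fun i => (A i).obj).L x).anch _ (FP.mark _ x _ α) γ = _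
    rw [FP.anch_mark]
    simp
  anch_eq_zero := by
    rintro x i j k h ⟨_, _⟩ ⟨α, rfl, rfl⟩ f
    exact FP.anch_mark _ x _ h α f
  eventually_mem := by
    rintro x k s hs ⟨α, hα1, hα2⟩
    choose α' hα' hα'x using fun a => (𝔛.S (k + n)).germ x (α a)
    obtain rfl : (fun a => α' a x) = α := funext hα'x
    have h1 := sub_mem hs.2
      (FP.mark_mem_sec (fun i => (A i).obj) (show k + n + -n = k by omega) hα')
    have h2 := add_mem hs.1 (Submodule.sum_mem _ fun a (_ : a ∈ Finset.univ) =>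
      Submodule.smul_mem ((𝔛.S (k + n)).sec x) (lam a) (hα' a))
    filter_upwards [(FP fun i => (A i).obj).eq_zero h1 (sub_eq_zero.2 hα1),
      (𝔛.S (k + n)).eq_zero h2 (by
        refine (congrArg (· + _) hα2).trans ?_
        simp)] with z h3 h4
    refine ⟨fun a => α' a z, sub_eq_zero.1 h3, ?_⟩
    refine (eq_neg_of_add_eq_zero_left h4).trans ?_
    simp

/-- The linear combination `λ_1 A_1 ∔ … ∔ λ_m A_m` as a marked Lie algebroid: the push-out is the
quotient of `O[n] ⋊ (A_1 ×_B … ×_B A_m)` by the elements `(-∑ λ_i α_i, (α_i c_i)_i)`. -/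
def marked : MarkedOver B n where
  A := (rel lam A).quot
  -- The marking is the class of `(1, 0)`; the product `1 · 1` is the unit in degree `-n + n`.
  c x := ((rel lam A).proj.map x).map (-n)
    ((𝔛.O x).mul (show (0 : ℤ) + 0 = -n + n by omega) (𝔛.O x).one (𝔛.O x).one, 0)
  c_sec x := (rel lam A).proj.map_sec _ ⟨𝔛.mul_sec _ _ (𝔛.one_sec x) _ (𝔛.one_sec x), zero_mem _⟩
  d_c x j h := by
    refine (((rel lam A).proj.map x).map_d h _).symm.trans ?_
    refine (congrArg _ (Prod.ext ?_
      (map_zero (((FP fun i => (A i).obj).L x).d h)))).trans (map_zero _)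
    exact (𝔛.O x).d_one_mul_one _ _
  central x j k h a := by
    obtain ⟨a, rfl⟩ := (rel lam A).proj_surjective x j a
    refine (((rel lam A).proj.map x).map_br h _ _).symm.trans ?_
    refine (congrArg _ (Prod.ext ?_ (LinearMap.map_zero₂ _ _))).trans (map_zero _)
    change ((FP fun i => (A i).obj).L x).anch _ 0 _ - sg K (-n * j) •
      ((FP fun i => (A i).obj).L x).anch _ a.2 _ = 0
    rw [LR.anch_one_mul_one, LinearMap.map_zero₂, smul_zero, sub_zero]
  p := (rel lam A).desc (((FP fun i => (A i).obj).semiSnd n).comp (FP.toB fun i => (A i).obj))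
    (by rintro x k ⟨_, _⟩ ⟨α, rfl, rfl⟩; rfl)
  p_c x := rfl

/-- The canonical map from the fibre product to the linear combination. -/
def hom : PreLieAlgebroid.Hom (FP fun i => (A i).obj).toPreLieAlgebroid
    (marked lam A).A.toPreLieAlgebroid :=
  ((FP fun i => (A i).obj).semiInr n).comp (rel lam A).proj

theorem cmul_add_hom (x : 𝔛.X) {k : ℤ} (β : (𝔛.O x).C (k + n))
    (t : FP.sub (fun i => (A i).obj) x k) :
    ((marked lam A).A.L x).smul (show k + n + -n = k by omega) β ((marked lam A).c x) +
      ((hom lam A).map x).map k t = ((rel lam A).proj.map x).map k (β, t) := by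
  have h1 : ((marked lam A).A.L x).smul (show k + n + -n = k by omega) β ((marked lam A).c x) =
      ((rel lam A).proj.map x).map k (β, 0) := by
    refine (((rel lam A).proj.map x).map_smul (show k + n + -n = k by omega) β _).symm.trans
      (congrArg _ (Prod.ext ?_ (map_zero _)))
    exact (𝔛.O x).mul_one_mul_one _ _ β
  rw [h1]
  refine (map_add _ _ _).symm.trans (congrArg _ (Prod.ext ?_ ?_))
  · exact add_zero β
  · exact zero_add t

theorem cmul_add_hom_eq_zero (x : 𝔛.X) {i j : ℤ} (h : i + -n = j) (β : (𝔛.O x).C i)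
    (t : FP.sub (fun i => (A i).obj) x j) :
    ((marked lam A).A.L x).smul h β ((marked lam A).c x) + ((hom lam A).map x).map j t = 0 ↔
      ∃ α, t = FP.mark (fun i => (A i).obj) x h α ∧ β = -∑ a, lam a • α a := by
  obtain rfl : i = j + n := by omega
  rw [cmul_add_hom]
  exact LieAlgebroid.Ideal.proj_eq_zero (rel lam A)

theorem hom_mark (x : 𝔛.X) {i j : ℤ} (h : i + -n = j) (α : Fin m → (𝔛.O x).C i) :
    ((hom lam A).map x).map j (FP.mark (fun i => (A i).obj) x h α) =
      ((marked lam A).A.L x).smul h (∑ a, lam a • α a) ((marked lam A).c x) := by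
  have := (cmul_add_hom_eq_zero lam A x h (-∑ a, lam a • α a) _).2 ⟨α, rfl, rfl⟩
  rw [map_neg, LinearMap.neg_apply, neg_add_eq_zero] at this
  exact this.symm

theorem isExact : (marked lam A).IsExact where
  inj x i j h α hα := by
    obtain ⟨β, h2, rfl⟩ := (cmul_add_hom_eq_zero lam A x h α 0).1 ((congrArg₂ _ hα
      (((hom lam A).map x).map j).map_zero).trans (add_zero _))
    obtain rfl : β = 0 := FP.mark_injective (fun a => (A a).property) x h
      (h2.symm.trans (map_zero (FP.markL (fun i => (A i).obj) x h)).symm)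
    simp
  ker x i j h a ha := by
    obtain ⟨⟨β, t⟩, rfl⟩ := (rel lam A).proj_surjective x j a
    obtain ⟨α, rfl⟩ := FP.exists_eq_mark (fun a => (A a).property) x h t ha
    obtain rfl : i = j + n := by omega
    refine ⟨β + ∑ a, lam a • α a, ?_⟩
    rw [← cmul_add_hom, map_add, LinearMap.add_apply]
    exact congrArg _ (hom_mark lam A x h α).symm
  surj x j b := by
    obtain ⟨t, rfl⟩ := FP.toB_surjective (fun a => (A a).property) x j b
    exact ⟨((hom lam A).map x).map j t, rfl⟩

end LinComb

/-- The linear combination `λ_1 A_1 ∔ … ∔ λ_m A_m`. -/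
def linComb {m : ℕ} (lam : Fin m → K) (A : Fin m → OExt B n) : OExt B n :=
  ⟨LinComb.marked lam A, LinComb.isExact lam A⟩

/-- The canonical map exhibits `linComb` as a linear combination. -/
def linCombMap {m : ℕ} (lam : Fin m → K) (A : Fin m → OExt B n) :
    LinMap lam A (linComb lam A) where
  hom := LinComb.hom lam A
  comp_p := rfl
  comm := LinComb.hom_mark lam A
  pushout_surj x i j h l := by
    obtain ⟨⟨β, t⟩, rfl⟩ := (LinComb.rel lam A).proj_surjective x j l
    obtain rfl : i = j + n := by omega
    exact ⟨β, t, (LinComb.cmul_add_hom lam A x β t).symm⟩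
  pushout_inj x i j h β a := (LinComb.cmul_add_hom_eq_zero lam A x h β a).1

end

/-! ### The canonical linear structure on extensions -/

section

variable {K : Type w} [Field K] {𝔛 : DGSpace.{u} K} {B : LieAlgebroid 𝔛} {n : ℤ}

namespace FP

variable {m : ℕ} {A : Fin m → MarkedOver B n}

/-- The morphism to a fibre product given by its components. -/
def lift {P : PreLieAlgebroid 𝔛} (b : PreLieAlgebroid.Hom P B.toPreLieAlgebroid)
    (f : ∀ i, PreLieAlgebroid.Hom P (A i).A.toPreLieAlgebroid)
    (h : ∀ i x k t, ((A i).p.map x).map k (((f i).map x).map k t) = (b.map x).map k t) :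
    PreLieAlgebroid.Hom P (FP A).toPreLieAlgebroid where
  map x :=
    { map := fun k =>
        { toFun := fun t => ⟨(fun i => ((f i).map x).map k t, (b.map x).map k t),
            fun i => h i x k t⟩
          map_add' := fun _ _ => sub_ext A (fun _ => map_add _ _ _) (map_add _ _ _)
          map_smul' := fun _ _ => sub_ext A (fun _ => map_smul _ _ _) (map_smul _ _ _) }
      map_smul := fun h g t =>
        sub_ext A (fun i => ((f i).map x).map_smul h g t) ((b.map x).map_smul h g t)
      map_d := fun h t => sub_ext A (fun i => ((f i).map x).map_d h t) ((b.map x).map_d h t)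
      map_br := fun h s t =>
        sub_ext A (fun i => ((f i).map x).map_br h s t) ((b.map x).map_br h s t)
      map_anch := fun h t g => (b.map x).map_anch h t g }
  map_sec s hs := ⟨fun i => (f i).map_sec s hs, b.map_sec s hs⟩

end FP

namespace LinMap

variable {m : ℕ} {lam : Fin m → K} {A : Fin m → OExt B n} {L : OExt B n}

theorem p_hom (q : LinMap lam A L) (x : 𝔛.X) (k : ℤ) (a : FP.sub (fun i => (A i).obj) x k) :
    (L.obj.p.map x).map k ((q.hom.map x).map k a) = a.1.2 :=
  congrArg (fun f : PreLieAlgebroid.Hom (FP fun i => (A i).obj).toPreLieAlgebroid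
    B.toPreLieAlgebroid => (f.map x).map k a) q.comp_p

/-- The universal property of the push-out. -/
theorem exists_desc (q : LinMap lam A L) {N : OExt B n}
    (g : PreLieAlgebroid.Hom (FP fun i => (A i).obj).toPreLieAlgebroid N.obj.A.toPreLieAlgebroid)
    (hp : ∀ x k (a : FP.sub (fun i => (A i).obj) x k),
      (N.obj.p.map x).map k ((g.map x).map k a) = a.1.2)
    (hg : ∀ (x) {i j : ℤ} (h : i + -n = j) (α : Fin m → (𝔛.O x).C i),
      (g.map x).map j (FP.mark (fun i => (A i).obj) x h α) =
        (N.obj.A.L x).smul h (∑ a, lam a • α a) (N.obj.c x)) :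
    ∃ f : L ⟶ N, ∀ x k (a : FP.sub (fun i => (A i).obj) x k),
      OExt.ap f x k ((q.hom.map x).map k a) = (g.map x).map k a := by
  obtain ⟨f, hf⟩ := MarkedOver.exists_desc L.property q.hom g
    (fun x k b => by
      obtain ⟨t, rfl⟩ := FP.toB_surjective (fun a => (A a).property) x k b
      exact ⟨t, q.p_hom x k t⟩)
    (fun x k t => (hp x k t).trans (q.p_hom x k t).symm)
    (fun x i j h β t ht => by
      obtain ⟨α, rfl, h2⟩ := q.pushout_inj x h (-β) t (by
        rw [map_neg, LinearMap.neg_apply, neg_add_eq_zero]; exact ht.symm)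
      rw [hg, neg_inj.1 h2])
  exact ⟨ObjectProperty.homMk f, hf⟩

end LinMap

theorem OExt.comp_ap_eq {L M N : OExt B n} {f : L ⟶ M} {g : M ⟶ N} {x : 𝔛.X} {k : ℤ}
    {r : (L.obj.A.L x).C k} {s : (M.obj.A.L x).C k} {t : (N.obj.A.L x).C k}
    (h : OExt.ap f x k r = s) (h' : OExt.ap g x k s = t) : OExt.ap (f ≫ g) x k r = t :=
  (congrArg (OExt.ap g x k) h).trans h'

/-- The element of the fibre product of linear combinations `∔_j μ_ij A_j` defined by an element of
the fibre product of the `A_j`. -/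
def FP.el {m l : ℕ} {mu : Fin m → Fin l → K} {A : Fin l → OExt B n} {L : Fin m → OExt B n}
    (q : ∀ i, LinMap (mu i) A (L i)) {x : 𝔛.X} {k : ℤ} (a : FP.sub (fun i => (A i).obj) x k) :
    FP.sub (fun i => (L i).obj) x k :=
  ⟨(fun i => ((q i).hom.map x).map k a, a.1.2), fun i => (q i).p_hom x k a⟩

/-- The image of an element of the fibre product under morphisms of the factors. -/
def FP.mapEl {m : ℕ} {A A' : Fin m → OExt B n} (f : ∀ i, A i ⟶ A' i) {x : 𝔛.X} {k : ℤ}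
    (a : FP.sub (fun i => (A i).obj) x k) : FP.sub (fun i => (A' i).obj) x k :=
  ⟨(fun i => OExt.ap (f i) x k (a.1.1 i), a.1.2), fun i => (OExt.p_ap (f i) x k _).trans (a.2 i)⟩

namespace LinComb

variable {m : ℕ} (lam : Fin m → K)

theorem exists_map {A A' : Fin m → OExt B n} (f : ∀ i, A i ⟶ A' i) :
    ∃ g : linComb lam A ⟶ linComb lam A', ∀ x k (a : FP.sub (fun i => (A i).obj) x k),
      OExt.ap g x k (((linCombMap lam A).hom.map x).map k a) =
        ((linCombMap lam A').hom.map x).map k (FP.mapEl f a) := by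
  have hp : ∀ i x k (a : FP.sub (fun i => (A i).obj) x k),
      ((A' i).obj.p.map x).map k (OExt.ap (f i) x k (a.1.1 i)) = a.1.2 :=
    fun i x k a => (FP.mapEl f a).2 i
  refine (linCombMap lam A).exists_desc
    ((FP.lift (A := fun i => (A' i).obj) (FP.toB fun i => (A i).obj)
      (fun i => (FP.pr (fun i => (A i).obj) i).comp (f i).hom.hom) hp).comp
        (linCombMap lam A').hom) (fun x k a => (linCombMap lam A').p_hom x k (FP.mapEl f a))
    fun x i j h α => ?_
  have e : FP.mapEl f (FP.mark (fun i => (A i).obj) x h α) =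
      FP.mark (fun i => (A' i).obj) x h α :=
    FP.sub_ext _ (fun a => OExt.ap_cmul (f a) x h (α a)) rfl
  exact (congrArg (((linCombMap lam A').hom.map x).map j) e).trans
    ((linCombMap lam A').comm x h α)

theorem exists_proj (i : Fin m) (A : Fin m → OExt B n) :
    ∃ g : linComb (Pi.single i 1) A ⟶ A i, ∀ x k (a : FP.sub (fun i => (A i).obj) x k),
      OExt.ap g x k (((linCombMap (Pi.single i 1) A).hom.map x).map k a) = a.1.1 i := by
  refine (linCombMap (Pi.single i 1) A).exists_desc (FP.pr (fun i => (A i).obj) i)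
    (fun x k a => a.2 i) fun x i' j h α => ?_
  change ((A i).obj.A.L x).smul h (α i) _ = _
  congr 2
  simp [Pi.single_apply, ite_smul]

theorem exists_subst {l : ℕ} (mu : Fin m → Fin l → K) (nu : Fin l → K)
    (h : ∀ j, nu j = ∑ i, lam i * mu i j) (A : Fin l → OExt B n) :
    ∃ g : linComb nu A ⟶ linComb lam fun i => linComb (mu i) A,
      ∀ x k (a : FP.sub (fun i => (A i).obj) x k),
      OExt.ap g x k (((linCombMap nu A).hom.map x).map k a) =
        ((linCombMap lam fun i => linComb (mu i) A).hom.map x).map k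
          (FP.el (fun i => linCombMap (mu i) A) a) := by
  refine (linCombMap nu A).exists_desc
    ((FP.lift (A := fun i => (linComb (mu i) A).obj) (FP.toB fun i => (A i).obj)
      (fun i => (linCombMap (mu i) A).hom) fun i x k a => (linCombMap (mu i) A).p_hom x k a).comp
        (linCombMap lam fun i => linComb (mu i) A).hom)
    (fun x k a => (linCombMap lam fun i => linComb (mu i) A).p_hom x k
      (FP.el (fun i => linCombMap (mu i) A) a)) fun x i j h' α => ?_
  have e : FP.el (fun i => linCombMap (mu i) A) (FP.mark (fun i => (A i).obj) x h' α) =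
      FP.mark (fun i => (linComb (mu i) A).obj) x h' fun i => ∑ j, mu i j • α j :=
    FP.sub_ext _ (fun a => (linCombMap (mu a) A).comm x h' α) rfl
  refine (congrArg (((linCombMap lam fun i => linComb (mu i) A).hom.map x).map j) e).trans
    (((linCombMap lam fun i => linComb (mu i) A).comm x h' _).trans ?_)
  congr 2
  simp only [h, Finset.sum_smul, Finset.smul_sum, mul_smul]
  exact Finset.sum_comm

/-- The functoriality of linear combinations. -/
def map {A A' : Fin m → OExt B n} (f : ∀ i, A i ⟶ A' i) : linComb lam A ⟶ linComb lam A' :=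
  (exists_map lam f).choose

theorem ap_map {A A' : Fin m → OExt B n} (f : ∀ i, A i ⟶ A' i) (x : 𝔛.X) (k : ℤ)
    (a : FP.sub (fun i => (A i).obj) x k) (a' : FP.sub (fun i => (A' i).obj) x k)
    (h : ∀ i, OExt.ap (f i) x k (a.1.1 i) = a'.1.1 i) (h' : a.1.2 = a'.1.2) :
    OExt.ap (map lam f) x k (((linCombMap lam A).hom.map x).map k a) =
      ((linCombMap lam A').hom.map x).map k a' := by
  obtain rfl : FP.mapEl f a = a' := FP.sub_ext _ h h'
  exact (exists_map lam f).choose_spec x k a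

/-- The isomorphism `0 ∔ … ∔ 1 A_i ∔ … ∔ 0 ≅ A_i`. -/
def proj (i : Fin m) (A : Fin m → OExt B n) : linComb (Pi.single i 1) A ≅ A i :=
  haveI := OExt.isIso (exists_proj i A).choose
  asIso (exists_proj i A).choose

theorem ap_proj (i : Fin m) (A : Fin m → OExt B n) (x : 𝔛.X) (k : ℤ)
    (a : FP.sub (fun i => (A i).obj) x k) :
    OExt.ap (proj i A).hom x k (((linCombMap (Pi.single i 1) A).hom.map x).map k a) = a.1.1 i :=
  (exists_proj i A).choose_spec x k a

/-- The isomorphism `∔_i λ_i (∔_j μ_ij A_j) ≅ ∔_j (∑_i λ_i μ_ij) A_j`. The universal property gives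
its inverse, as the target of this inverse is an iterated push-out. -/
def subst {l : ℕ} (mu : Fin m → Fin l → K) (nu : Fin l → K)
    (h : ∀ j, nu j = ∑ i, lam i * mu i j) (A : Fin l → OExt B n) :
    (linComb lam fun i => linComb (mu i) A) ≅ linComb nu A :=
  haveI := OExt.isIso (exists_subst lam mu nu h A).choose
  (asIso (exists_subst lam mu nu h A).choose).symm

theorem ap_subst {l : ℕ} (mu : Fin m → Fin l → K) (nu : Fin l → K)
    (h : ∀ j, nu j = ∑ i, lam i * mu i j) (A : Fin l → OExt B n) (x : 𝔛.X) (k : ℤ)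
    (a : FP.sub (fun i => (A i).obj) x k)
    (a' : FP.sub (fun i => (linComb (mu i) A).obj) x k)
    (h1 : ∀ i, a'.1.1 i = ((linCombMap (mu i) A).hom.map x).map k a) (h2 : a'.1.2 = a.1.2) :
    OExt.ap (subst lam mu nu h A).hom x k
      (((linCombMap lam fun i => linComb (mu i) A).hom.map x).map k a') =
      ((linCombMap nu A).hom.map x).map k a := by
  obtain rfl : FP.el (fun i => linCombMap (mu i) A) a = a' :=
    FP.sub_ext _ (fun i => (h1 i).symm) h2.symm
  rw [← (exists_subst lam mu nu h A).choose_spec x k a, ← OExt.comp_ap]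
  have : (exists_subst lam mu nu h A).choose ≫ (subst lam mu nu h A).hom = 𝟙 _ :=
    (subst lam mu nu h A).inv_hom_id
  rw [this, OExt.id_ap]

/-- Linear combinations as functors. -/
def comb : (Fin m → OExt B n) ⥤ OExt B n where
  obj := linComb lam
  map f := map lam f
  map_id A := OExt.hom_ext fun x k b => by
    obtain ⟨a, rfl⟩ := FP.toB_surjective (fun a => (A a).property) x k b
    exact ⟨_, (linCombMap lam A).p_hom x k a,
      ap_map lam (fun i => 𝟙 (A i)) x k a a (fun i => rfl) rfl⟩
  map_comp {A A' A''} f g := OExt.hom_ext fun x k b => by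
    obtain ⟨a, rfl⟩ := FP.toB_surjective (fun a => (A a).property) x k b
    refine ⟨_, (linCombMap lam A).p_hom x k a,
      (ap_map lam (f ≫ g) x k a (FP.mapEl g (FP.mapEl f a)) (fun i => rfl) rfl).trans ?_⟩
    rw [OExt.comp_ap, ap_map lam f x k a (FP.mapEl f a) (fun i => rfl) rfl,
      ap_map lam g x k _ (FP.mapEl g (FP.mapEl f a)) (fun i => rfl) rfl]

/-! The coherence conditions. Morphisms out of an iterated linear combination are compared on the
elements which come from the fibre product of the variables, since these elements map onto `B`. -/

theorem proj_nat (i : Fin m) {A A' : Fin m → OExt B n} (f : ∀ i, A i ⟶ A' i) :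
    map (Pi.single i 1) f ≫ (proj i A').hom = (proj i A).hom ≫ f i :=
  OExt.hom_ext fun x k b => by
    obtain ⟨a, rfl⟩ := FP.toB_surjective (fun a => (A a).property) x k b
    exact ⟨_, (linCombMap (Pi.single i 1) A).p_hom x k a,
      (OExt.comp_ap_eq (ap_map _ f x k a (FP.mapEl f a) (fun i => rfl) rfl)
        (ap_proj i A' x k (FP.mapEl f a))).trans
      (OExt.comp_ap_eq (ap_proj i A x k a) rfl).symm⟩

theorem subst_nat {l : ℕ} (mu : Fin m → Fin l → K) (nu : Fin l → K)
    (h : ∀ j, nu j = ∑ i, lam i * mu i j) {A A' : Fin l → OExt B n} (f : ∀ i, A i ⟶ A' i) :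
    map lam (fun i => map (mu i) f) ≫ (subst lam mu nu h A').hom =
      (subst lam mu nu h A).hom ≫ map nu f :=
  OExt.hom_ext fun x k b => by
    obtain ⟨a, rfl⟩ := FP.toB_surjective (fun a => (A a).property) x k b
    exact ⟨_, (linCombMap lam _).p_hom x k (FP.el (fun i => linCombMap (mu i) A) a),
      (OExt.comp_ap_eq (ap_map lam (fun i => map (mu i) f) x k
        (FP.el (fun i => linCombMap (mu i) A) a)
        (FP.el (fun i => linCombMap (mu i) A') (FP.mapEl f a))
        (fun i => ap_map (mu i) f x k a (FP.mapEl f a) (fun i => rfl) rfl) rfl)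
        (ap_subst lam mu nu h A' x k (FP.mapEl f a) _ (fun i => rfl) rfl)).trans
      (OExt.comp_ap_eq (ap_subst lam mu nu h A x k a
        (FP.el (fun i => linCombMap (mu i) A) a) (fun i => rfl) rfl)
        (ap_map nu f x k a (FP.mapEl f a) (fun i => rfl) rfl)).symm⟩

theorem subst_assoc {k' l : ℕ} (mu : Fin m → Fin k' → K) (nu : Fin k' → K)
    (h : ∀ j, nu j = ∑ i, lam i * mu i j) (rho : Fin k' → Fin l → K) (sig : Fin m → Fin l → K)
    (h' : ∀ i j, sig i j = ∑ a, mu i a * rho a j) (tau : Fin l → K)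
    (h₁ : ∀ j, tau j = ∑ a, nu a * rho a j) (h₂ : ∀ j, tau j = ∑ i, lam i * sig i j)
    (A : Fin l → OExt B n) :
    (subst lam mu nu h fun a => linComb (rho a) A).hom ≫ (subst nu rho tau h₁ A).hom =
      map lam (fun i => (subst (mu i) rho (sig i) (h' i) A).hom) ≫
        (subst lam sig tau h₂ A).hom :=
  OExt.hom_ext fun x k b => by
    obtain ⟨a, rfl⟩ := FP.toB_surjective (fun a => (A a).property) x k b
    exact ⟨_, (linCombMap lam _).p_hom x k (FP.el (fun i => linCombMap (mu i) _)
        (FP.el (fun i => linCombMap (rho i) A) a)),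
      (OExt.comp_ap_eq (ap_subst lam mu nu h (fun i => linComb (rho i) A) x k
        (FP.el (fun i => linCombMap (rho i) A) a) (FP.el (fun i => linCombMap (mu i) _)
          (FP.el (fun i => linCombMap (rho i) A) a)) (fun i => rfl) rfl)
        (ap_subst nu rho tau h₁ A x k a _ (fun i => rfl) rfl)).trans
      (OExt.comp_ap_eq (ap_map lam
        (fun i => (subst (mu i) rho (sig i) (h' i) A).hom) x k
        (FP.el (fun i => linCombMap (mu i) _) (FP.el (fun i => linCombMap (rho i) A) a))
        (FP.el (fun i => linCombMap (sig i) A) a)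
        (fun i => ap_subst (mu i) rho (sig i) (h' i) A x k a
          (FP.el (fun i => linCombMap (rho i) A) a) (fun i => rfl) rfl) rfl)
        (ap_subst lam sig tau h₂ A x k a _ (fun i => rfl) rfl)).symm⟩

theorem proj_subst {l : ℕ} (i : Fin m) (mu : Fin m → Fin l → K)
    (h : ∀ j, mu i j = ∑ a, Pi.single (M := fun _ => K) i 1 a * mu a j) (A : Fin l → OExt B n) :
    (subst (Pi.single i 1) mu (mu i) h A).hom = (proj i fun a => linComb (mu a) A).hom :=
  OExt.hom_ext fun x k b => by
    obtain ⟨a, rfl⟩ := FP.toB_surjective (fun a => (A a).property) x k b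
    exact ⟨_, (linCombMap (Pi.single i 1) _).p_hom x k
        (FP.el (fun i => linCombMap (mu i) A) a),
      (ap_subst _ mu (mu i) h A x k a _ (fun i => rfl) rfl).trans
      (ap_proj i _ x k (FP.el (fun i => linCombMap (mu i) A) a)).symm⟩

theorem subst_proj (h : ∀ j, lam j = ∑ i, lam i * Pi.single (M := fun _ => K) i 1 j)
    (A : Fin m → OExt B n) :
    (subst lam (fun i => Pi.single i 1) lam h A).hom = map lam fun i => (proj i A).hom :=
  OExt.hom_ext fun x k b => by
    obtain ⟨a, rfl⟩ := FP.toB_surjective (fun a => (A a).property) x k b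
    exact ⟨_, (linCombMap lam _).p_hom x k
        (FP.el (fun i => linCombMap (Pi.single i 1) A) a),
      (ap_subst lam _ lam h A x k a _ (fun i => rfl) rfl).trans
      (ap_map lam (fun i => (proj i A).hom) x k
        (FP.el (fun i => linCombMap (Pi.single i 1) A) a) a (fun i => ap_proj i A x k a) rfl).symm⟩

end LinComb

/-- The canonical linear structure on the category of extensions. -/
def canonical (B : LieAlgebroid 𝔛) (n : ℤ) : Canonical B n where
  isIso f := OExt.isIso f
  comb := LinComb.comb
  proj := LinComb.proj
  proj_nat := LinComb.proj_nat
  subst lam mu nu h A := LinComb.subst lam mu nu h A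
  subst_nat lam mu nu h _ _ f := LinComb.subst_nat lam mu nu h f
  subst_assoc lam mu nu h rho sig h' tau h₁ h₂ A :=
    LinComb.subst_assoc lam mu nu h rho sig h' tau h₁ h₂ A
  proj_subst i mu h A := LinComb.proj_subst i mu h A
  subst_proj lam h A := LinComb.subst_proj lam h A
  q := linCombMap
  q_nat lam _ _ f := LinComb.ap_map lam f
  q_proj := LinComb.ap_proj
  q_subst lam mu nu h A x k a a' h1 h2 := LinComb.ap_subst lam mu nu h A x k a a' h1 h2

end

/-! ### Germs of sections of the inverse image -/

section

variable {K : Type w} [Field K] {𝔜 𝔛 : DGSpace.{u} K} {φ : DGSpace.Hom 𝔜 𝔛}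

namespace Pull

section Germs

variable (φ) in
/-- The families which near `y` vanish in `O_𝔜 ⊗_{O_𝔛} A`. -/
def famRel (A : LieAlgebroid 𝔛) (k : ℤ) (y : 𝔜.X) :
    Submodule K (∀ z, T (𝔜.O z) (A.L (φ.base z)) k) where
  carrier := {w | ∀ᶠ z in 𝓝 y, w z ∈ relT (φ.ψ z) (A.L (φ.base z)) k}
  zero_mem' := Filter.Eventually.of_forall fun z => zero_mem (relT (φ.ψ z) (A.L (φ.base z)) k)
  add_mem' hv hw := by
    filter_upwards [hv, hw] with z h1 h2
    exact add_mem h1 h2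
  smul_mem' c w hw := by
    filter_upwards [hw] with z h
    exact Submodule.smul_mem _ c h

variable {A : LieAlgebroid 𝔛} {k : ℤ} {y : 𝔜.X}

theorem mk_tm_congr {i j : ℤ} (h : i + j = k) {f f' : ∀ z, (𝔜.O z).C i} (hf : f ∈ (𝔜.S i).sec y)
    (hf' : f' ∈ (𝔜.S i).sec y) (e : f y = f' y) {a a' : ∀ x, (A.L x).C j}
    (ha : a ∈ (A.S j).sec (φ.base y)) (ha' : a' ∈ (A.S j).sec (φ.base y))
    (e' : a (φ.base y) = a' (φ.base y)) :
    (famRel φ A k y).mkQ (fun z => tm (K := K) h (f z) (a (φ.base z))) =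
      (famRel φ A k y).mkQ (fun z => tm (K := K) h (f' z) (a' (φ.base z))) := by
  refine (Submodule.Quotient.eq _).2 ?_
  have h1 := (𝔜.S i).eq_zero (sub_mem hf hf') (sub_eq_zero.2 e)
  have h2 := φ.cont.continuousAt.eventually (A.eq_zero (sub_mem ha ha') (sub_eq_zero.2 e'))
  filter_upwards [h1, h2] with z h1 h2
  have e1 : f z = f' z := sub_eq_zero.1 h1
  have e2 : a (φ.base z) = a' (φ.base z) := sub_eq_zero.1 h2
  change tm (K := K) h (f z) (a (φ.base z)) - tm (K := K) h (f' z) (a' (φ.base z)) ∈ _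
  rw [e1, e2, sub_self]
  exact zero_mem _

variable (φ A k y) in
/-- The extension of an element of `O_{𝔜, y} ⊗ A_{φ(y)}` to a family near `y`, which is well defined
up to families vanishing in `O_𝔜 ⊗_{O_𝔛} A`. -/
def extT : T (𝔜.O y) (A.L (φ.base y)) k →ₗ[K]
    (∀ z, T (𝔜.O z) (A.L (φ.base z)) k) ⧸ famRel φ A k y :=
  liftW fun i j h => LinearMap.mk₂ K
    (fun f a => (famRel φ A k y).mkQ fun z =>
      tm (K := K) h (((𝔜.S i).germ y f).choose z) ((A.germ (φ.base y) a).choose (φ.base z)))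
    (fun f f' a => by
      have hf := ((𝔜.S i).germ y f).choose_spec
      have hf' := ((𝔜.S i).germ y f').choose_spec
      have hg := ((𝔜.S i).germ y (f + f')).choose_spec
      have ha := (A.germ (φ.base y) a).choose_spec
      rw [mk_tm_congr h hg.1 (add_mem hf.1 hf'.1) (by rw [hg.2, Pi.add_apply, hf.2, hf'.2])
        ha.1 ha.1 rfl, ← map_add]
      exact congrArg _ (funext fun z => LinearMap.map_add₂ _ _ _ _))
    (fun c f a => by
      have hf := ((𝔜.S i).germ y f).choose_spec
      have hg := ((𝔜.S i).germ y (c • f)).choose_spec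
      have ha := (A.germ (φ.base y) a).choose_spec
      rw [mk_tm_congr h hg.1 (Submodule.smul_mem _ c hf.1) (by rw [hg.2, Pi.smul_apply, hf.2])
        ha.1 ha.1 rfl, ← map_smul]
      exact congrArg _ (funext fun z => LinearMap.map_smul₂ _ _ _ _))
    (fun f a a' => by
      have hf := ((𝔜.S i).germ y f).choose_spec
      have ha := (A.germ (φ.base y) a).choose_spec
      have ha' := (A.germ (φ.base y) a').choose_spec
      have hb := (A.germ (φ.base y) (a + a')).choose_spec
      rw [mk_tm_congr h hf.1 hf.1 rfl hb.1 (add_mem ha.1 ha'.1)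
        (by rw [hb.2, Pi.add_apply, ha.2, ha'.2]), ← map_add]
      exact congrArg _ (funext fun z => map_add _ _ _))
    (fun c f a => by
      have hf := ((𝔜.S i).germ y f).choose_spec
      have ha := (A.germ (φ.base y) a).choose_spec
      have hb := (A.germ (φ.base y) (c • a)).choose_spec
      rw [mk_tm_congr h hf.1 hf.1 rfl hb.1 (Submodule.smul_mem _ c ha.1)
        (by rw [hb.2, Pi.smul_apply, ha.2]), ← map_smul]
      exact congrArg _ (funext fun z => map_smul _ _ _))

theorem extT_apply {w : ∀ z, T (𝔜.O z) (A.L (φ.base z)) k} (hw : w ∈ secT φ A k y) :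
    extT φ A k y (w y) = (famRel φ A k y).mkQ w := by
  suffices secT φ A k y ≤ LinearMap.eqLocus ((extT φ A k y).comp (LinearMap.proj y))
    (famRel φ A k y).mkQ from LinearMap.mem_eqLocus.1 (this hw)
  refine secT_le fun {i j} h {f} hf {a} ha => ?_
  have hg := ((𝔜.S i).germ y (f y)).choose_spec
  have hb := (A.germ (φ.base y) (a (φ.base y))).choose_spec
  have e : extT φ A k y (tm h (f y) (a (φ.base y))) = (famRel φ A k y).mkQ fun z =>
      tm (K := K) h (((𝔜.S i).germ y (f y)).choose z)
        ((A.germ (φ.base y) (a (φ.base y))).choose (φ.base z)) := by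
    rw [extT, liftW_tm, LinearMap.mk₂_apply]
  exact LinearMap.mem_eqLocus.2 (e.trans (mk_tm_congr h hg.1 hf hg.2 hb.1 ha hb.2))

theorem extT_rel {u : T (𝔜.O y) (A.L (φ.base y)) k}
    (hu : u ∈ relT (φ.ψ y) (A.L (φ.base y)) k) : extT φ A k y u = 0 := by
  suffices relT (φ.ψ y) (A.L (φ.base y)) k ≤ LinearMap.ker (extT φ A k y) from this hu
  refine Submodule.span_le.2 ?_
  rintro _ ⟨p, q, s, pq, qs, hpq, hqs, h1, h2, f, r, a, rfl⟩
  obtain ⟨f, hf, rfl⟩ := (𝔜.S p).germ y f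
  obtain ⟨r, hr, rfl⟩ := (𝔛.S q).germ (φ.base y) r
  obtain ⟨a, ha, rfl⟩ := A.germ (φ.base y) a
  have h3 := tm_mem_secT (φ := φ) h1 (𝔜.mul_sec hpq f hf _ (φ.ψ_sec r hr)) ha
  have h4 := tm_mem_secT (φ := φ) h2 hf (A.smul_sec hqs r hr a ha)
  refine (extT_apply (sub_mem h3 h4)).trans ((Submodule.Quotient.mk_eq_zero _).2 ?_)
  exact Filter.Eventually.of_forall fun z => rel_mem (φ.ψ z) hpq hqs h1 h2 _ _ _

/-- The vanishing of a section of `O_𝔜 ⊗_{O_𝔛} A` at a point implies its vanishing nearby. -/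
theorem secT_eventually_rel {w : ∀ z, T (𝔜.O z) (A.L (φ.base z)) k} (hw : w ∈ secT φ A k y)
    (h : w y ∈ relT (φ.ψ y) (A.L (φ.base y)) k) :
    ∀ᶠ z in 𝓝 y, w z ∈ relT (φ.ψ z) (A.L (φ.base z)) k :=
  (Submodule.Quotient.mk_eq_zero (famRel φ A k y)).1 ((extT_apply hw).symm.trans (extT_rel h))

end Germs

/-- The element `p` of the stalk of `φ⁺A` at `y` is given by the section `w` of `O_𝔜 ⊗ A` and the
derivation `ξ`. -/
structure IsRep {A : LieAlgebroid 𝔛} {k : ℤ} {y : 𝔜.X} (p : ((inverseImage φ A).L y).C k)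
    (w : ∀ z, T (𝔜.O z) (A.L (φ.base z)) k) (ξ : ∀ z, Der (𝔜.O z) k) : Prop where
  mem_secT : w ∈ secT φ A k y
  mem_secDer : ξ ∈ (secDer 𝔜 k).sec y
  exists_eq : ∃ s, ∃ hs, p = PreLieAlgebroid.toGerm (P := prePull φ A) s hs ∧
    ∀ᶠ z in 𝓝 y, ∃ h : (w z, ξ z) ∈ compat (φ.ψ z) (A.L (φ.base z)) k,
      s z = Submodule.Quotient.mk ⟨(w z, ξ z), h⟩

namespace IsRep

variable {A B : LieAlgebroid 𝔛} {k : ℤ} {y : 𝔜.X}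

theorem exists_rep (p : ((inverseImage φ A).L y).C k) : ∃ w ξ, IsRep p w ξ := by
  obtain ⟨s, hs, rfl⟩ := PreLieAlgebroid.exists_toGerm p
  obtain ⟨w, hw, ξ, hξ, h⟩ := id hs
  exact ⟨w, ξ, hw, hξ, s, hs, rfl, h⟩

theorem exists_germ {w : ∀ z, T (𝔜.O z) (A.L (φ.base z)) k} {ξ : ∀ z, Der (𝔜.O z) k}
    (hw : w ∈ secT φ A k y) (hξ : ξ ∈ (secDer 𝔜 k).sec y)
    (h : ∀ᶠ z in 𝓝 y, (w z, ξ z) ∈ compat (φ.ψ z) (A.L (φ.base z)) k) :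
    ∃ p : ((inverseImage φ A).L y).C k, IsRep p w ξ := by
  classical
  let s : ∀ z, ((prePull φ A).L z).C k := fun z =>
    if h : (w z, ξ z) ∈ compat (φ.ψ z) (A.L (φ.base z)) k then
      Submodule.Quotient.mk ⟨(w z, ξ z), h⟩ else 0
  have e : ∀ᶠ z in 𝓝 y, ∃ h : (w z, ξ z) ∈ compat (φ.ψ z) (A.L (φ.base z)) k,
      s z = Submodule.Quotient.mk ⟨(w z, ξ z), h⟩ := h.mono fun z hz => ⟨hz, dif_pos hz⟩
  exact ⟨PreLieAlgebroid.toGerm s ⟨w, hw, ξ, hξ, e⟩, hw, hξ, s, _, rfl, e⟩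

theorem map {p : ((inverseImage φ A).L y).C k} {w ξ} (h : IsRep p w ξ)
    (f : PreLieAlgebroid.Hom A.toPreLieAlgebroid B.toPreLieAlgebroid) :
    IsRep (((inverseImageMap φ f).map y).map k p)
      (fun z => mapT (𝔜.O z) (f.map (φ.base z)) k (w z)) ξ := by
  obtain ⟨hw, hξ, s, hs, rfl, e⟩ := h
  refine ⟨?_, hξ, _, (prePullMap φ f).map_sec s hs,
    PreLieAlgebroid.Hom.toLieAlgebroid_toGerm (prePullMap φ f) hs, ?_⟩
  · suffices secT φ A k y ≤ (secT φ B k y).comap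
        (famMap fun z => mapT (𝔜.O z) (f.map (φ.base z)) k) from this hw
    refine secT_le fun {i j} e {g} hg {a} ha => ?_
    refine (congrArg (· ∈ secT φ B k y) (funext fun z => ?_)).mpr
      (tm_mem_secT (φ := φ) e hg (f.map_sec a ha))
    exact mapT_tm _ e _ _
  · filter_upwards [e] with z ⟨h1, h2⟩
    exact ⟨(compatMap (φ.ψ z) (f.map (φ.base z)) k ⟨_, h1⟩).2, by rw [h2]; rfl⟩

theorem sub {p p' : ((inverseImage φ A).L y).C k} {w w' ξ ξ'} (h : IsRep p w ξ)
    (h' : IsRep p' w' ξ') : IsRep (p - p') (w - w') (ξ - ξ') := by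
  obtain ⟨hw, hξ, s, hs, rfl, e⟩ := h
  obtain ⟨hw', hξ', s', hs', rfl, e'⟩ := h'
  refine ⟨sub_mem hw hw', sub_mem hξ hξ', s - s', sub_mem hs hs', rfl, ?_⟩
  filter_upwards [e, e'] with z ⟨h1, h2⟩ ⟨h3, h4⟩
  exact ⟨sub_mem h1 h3, by rw [Pi.sub_apply, h2, h4]; rfl⟩

theorem add {p p' : ((inverseImage φ A).L y).C k} {w w' ξ ξ'} (h : IsRep p w ξ)
    (h' : IsRep p' w' ξ') : IsRep (p + p') (w + w') (ξ + ξ') := by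
  obtain ⟨hw, hξ, s, hs, rfl, e⟩ := h
  obtain ⟨hw', hξ', s', hs', rfl, e'⟩ := h'
  refine ⟨add_mem hw hw', add_mem hξ hξ', s + s', add_mem hs hs', rfl, ?_⟩
  filter_upwards [e, e'] with z ⟨h1, h2⟩ ⟨h3, h4⟩
  exact ⟨add_mem h1 h3, by rw [Pi.add_apply, h2, h4]; rfl⟩

theorem zero : IsRep (0 : ((inverseImage φ A).L y).C k) 0 0 :=
  ⟨zero_mem _, zero_mem _, 0, zero_mem _, rfl, Filter.Eventually.of_forall fun z =>
    ⟨zero_mem (compat (φ.ψ z) (A.L (φ.base z)) k), rfl⟩⟩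

theorem sum {ι : Type*} (s : Finset ι) {p : ι → ((inverseImage φ A).L y).C k}
    {w : ι → ∀ z, T (𝔜.O z) (A.L (φ.base z)) k} {ξ : ι → ∀ z, Der (𝔜.O z) k}
    (h : ∀ i, IsRep (p i) (w i) (ξ i)) :
    IsRep (∑ i ∈ s, p i) (∑ i ∈ s, w i) (∑ i ∈ s, ξ i) := by
  classical
  induction s using Finset.induction_on with
  | empty => simpa only [Finset.sum_empty] using zero
  | insert i s hi ih => simpa only [Finset.sum_insert hi] using (h i).add ih

theorem const_smul {p : ((inverseImage φ A).L y).C k} {w ξ} (h : IsRep p w ξ) (c : K) :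
    IsRep (c • p) (c • w) (c • ξ) := by
  obtain ⟨hw, hξ, s, hs, rfl, e⟩ := h
  refine ⟨Submodule.smul_mem _ c hw, Submodule.smul_mem _ c hξ, c • s,
    Submodule.smul_mem _ c hs, rfl, ?_⟩
  filter_upwards [e] with z ⟨h1, h2⟩
  exact ⟨Submodule.smul_mem _ c h1, by rw [Pi.smul_apply, h2]; rfl⟩

theorem smul {i l : ℤ} {p : ((inverseImage φ A).L y).C k} {w ξ} (h : IsRep p w ξ)
    (e : i + k = l) {f : ∀ z, (𝔜.O z).C i} (hf : f ∈ (𝔜.S i).sec y) :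
    IsRep (((inverseImage φ A).L y).smul e (f y) p) (fun z => smulT e (f z) (w z))
      (fun z => Der.smul e (f z) (ξ z)) := by
  obtain ⟨hw, hξ, s, hs, rfl, h⟩ := h
  refine ⟨smulT_mem e hf hw, der_smul_mem e hf hξ, _, (prePull φ A).smul_sec e f hf s hs,
    PreLieAlgebroid.smulStalk_toGerm e hf hs, ?_⟩
  filter_upwards [h] with z ⟨h1, h2⟩
  exact ⟨((compatLR (φ.ψ z) (A.L (φ.base z))).smul e (f z) ⟨_, h1⟩).2, by rw [h2]; rfl⟩

/-- Equality of germs is tested at the point for the component in `O_𝔜 ⊗_{O_𝔛} A`, and near the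
point for the derivation. -/
theorem eq_zero {p : ((inverseImage φ A).L y).C k} {w ξ} (h : IsRep p w ξ)
    (hw : w y ∈ relT (φ.ψ y) (A.L (φ.base y)) k) (hξ : ∀ᶠ z in 𝓝 y, ξ z = 0) : p = 0 := by
  obtain ⟨h1, h2, s, hs, rfl, e⟩ := h
  refine PreLieAlgebroid.toGerm_eq hs (zero_mem _) ?_
  filter_upwards [e, hξ, secT_eventually_rel h1 hw] with z ⟨h3, h4⟩ h5 h6
  rw [h4]
  exact (Submodule.Quotient.mk_eq_zero _).2 ⟨h6, h5⟩

theorem of_eq_zero {p : ((inverseImage φ A).L y).C k} {w ξ} (h : IsRep p w ξ) (hp : p = 0) :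
    ∀ᶠ z in 𝓝 y, w z ∈ relT (φ.ψ z) (A.L (φ.base z)) k ∧ ξ z = 0 := by
  obtain ⟨h1, h2, s, hs, rfl, e⟩ := h
  filter_upwards [e, (PreLieAlgebroid.toGerm_eq_iff hs (zero_mem _)).1 hp] with z ⟨h3, h4⟩ h5
  exact (Submodule.Quotient.mk_eq_zero _).1 (h4.symm.trans h5)

theorem eq {p p' : ((inverseImage φ A).L y).C k} {w ξ} (h : IsRep p w ξ) (h' : IsRep p' w ξ) :
    p = p' := by
  refine sub_eq_zero.1 ((h.sub h').eq_zero ?_ (Filter.Eventually.of_forall fun z => sub_self _))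
  rw [Pi.sub_apply, sub_self]
  exact zero_mem _

/-- The marking of the inverse image is `(1 ⊗ c, 0)`. -/
theorem pull_c {n : ℤ} (M : MarkedOver B n) (y : 𝔜.X) :
    IsRep ((M.pull φ).c y) (fun z => M.cT φ z) 0 :=
  ⟨tm_mem_secT (zero_add (-n)) (𝔜.one_sec y) (M.c_sec (φ.base y)), zero_mem _, M.cPull φ,
    M.cPull_sec φ y, rfl, Filter.Eventually.of_forall fun z => ⟨M.c_compat φ z, rfl⟩⟩

end IsRep

/-- The inverse image preserves surjections. -/
theorem inverseImageMap_surjective {P B : LieAlgebroid 𝔛}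
    (g : PreLieAlgebroid.Hom P.toPreLieAlgebroid B.toPreLieAlgebroid)
    (hg : ∀ x k, Function.Surjective ((g.map x).map k)) (y : 𝔜.X) (k : ℤ) :
    Function.Surjective (((inverseImageMap φ g).map y).map k) := by
  intro p
  obtain ⟨w, ξ, h⟩ := IsRep.exists_rep p
  have key : ∀ w ∈ secT φ B k y, ∃ v ∈ secT φ P k y,
      ∀ᶠ z in 𝓝 y, mapT (𝔜.O z) (g.map (φ.base z)) k (v z) = w z := by
    intro w hw
    induction hw using Submodule.span_induction with
    | zero => exact ⟨0, zero_mem _, Filter.Eventually.of_forall fun z => map_zero _⟩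
    | add w w' _ _ hw hw' =>
      obtain ⟨v, hv, e⟩ := hw
      obtain ⟨v', hv', e'⟩ := hw'
      refine ⟨v + v', add_mem hv hv', ?_⟩
      filter_upwards [e, e'] with z h1 h2
      rw [Pi.add_apply, map_add, h1, h2, Pi.add_apply]
    | smul c w _ hw =>
      obtain ⟨v, hv, e⟩ := hw
      refine ⟨c • v, Submodule.smul_mem _ c hv, ?_⟩
      filter_upwards [e] with z h1
      rw [Pi.smul_apply, map_smul, h1, Pi.smul_apply]
    | mem w hw =>
      obtain ⟨i, j, e, f, hf, b, hb, rfl⟩ := hw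
      obtain ⟨a', ha'⟩ := hg (φ.base y) j (b (φ.base y))
      obtain ⟨a, ha, rfl⟩ := P.germ (φ.base y) a'
      refine ⟨_, tm_mem_secT e hf ha, ?_⟩
      have := φ.cont.continuousAt.eventually
        (B.eq_zero (sub_mem (g.map_sec a ha) hb) (sub_eq_zero.2 ha'))
      filter_upwards [this] with z hz
      rw [mapT_tm]
      exact congrArg _ (sub_eq_zero.1 hz)
  obtain ⟨v, hv, e⟩ := key w h.mem_secT
  obtain ⟨_, _, s, hs, rfl, e'⟩ := id h
  have hc : ∀ᶠ z in 𝓝 y, (v z, ξ z) ∈ compat (φ.ψ z) (P.L (φ.base z)) k := by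
    filter_upwards [e, e'] with z h1 ⟨h2, _⟩ p q hpq r
    refine (anchT_mapT (φ.ψ z) (g.map (φ.base z)) hpq (v z) r).symm.trans ?_
    rw [h1]
    exact h2 p q hpq r
  obtain ⟨p', hp'⟩ := IsRep.exists_germ hv h.mem_secDer hc
  refine ⟨p', sub_eq_zero.1 (((hp'.map g).sub h).eq_zero ?_
    (Filter.Eventually.of_forall fun z => sub_self _))⟩
  rw [Pi.sub_apply, e.self_of_nhds, sub_self]
  exact zero_mem _

end Pull

end

/-! ### Right exactness of the inverse image -/

section

variable {K : Type w} [Field K]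

namespace Pull

section Stalk

variable {R S : CDGA.{u} K} (ψ : CDGAHom R S) {P B : LR R} (g : LRHom P B) {n : ℤ} {m : ℕ}

/-- If the kernel of `g : P → B` is spanned by `c_1, …, c_m`, then the kernel of
`S ⊗_R P → S ⊗_R B` is spanned by `1 ⊗ c_1, …, 1 ⊗ c_m`. -/
theorem exists_sub_mem_relT (hg : ∀ k, Function.Surjective (g.map k)) (c : Fin m → P.C (-n))
    (hc : ∀ {i j : ℤ} (h : i + -n = j) (t : P.C j), g.map j t = 0 →
      ∃ α : Fin m → R.C i, t = ∑ a, P.smul h (α a) (c a))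
    {i k : ℤ} (h : i + -n = k) (u : T S P k) (hu : mapT S g k u ∈ relT ψ B k) :
    ∃ α : Fin m → S.C i, u - ∑ a, tm h (α a) (c a) ∈ relT ψ P k := by
  let Λ : (Fin m → S.C i) →ₗ[K] T S P k :=
    ∑ a, ((tm (K := K) h).flip (c a)).comp (LinearMap.proj a)
  have hΛ : ∀ α, Λ α = ∑ a, tm h (α a) (c a) := fun α => by
    simp only [Λ, LinearMap.sum_apply, LinearMap.comp_apply, LinearMap.proj_apply,
      LinearMap.flip_apply]
  -- Modulo `N` the map `S ⊗ P → S ⊗ B` becomes invertible: the inverse `τ` sends `f ⊗ b` to the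
  -- class of `f ⊗ t` for any preimage `t` of `b`.
  let N : Submodule K (T S P k) := relT ψ P k ⊔ LinearMap.range Λ
  have key : ∀ (p q : ℤ) (e : p + q = k), ∃ β : B.C q →ₗ[K] S.C p →ₗ[K] T S P k ⧸ N,
      ∀ t, β (g.map q t) = (((tm (K := K) e).compr₂ N.mkQ).flip) t := by
    intro p q e
    refine exists_factor_of_surjective (g.map q) _ (hg q) fun t ht => ?_
    obtain ⟨α, rfl⟩ := hc (show q + n + -n = q by omega) t ht
    refine LinearMap.ext fun f => (Submodule.Quotient.mk_eq_zero N).2 ?_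
    rw [map_sum]
    refine Submodule.sum_mem _ fun a _ => ?_
    have h1 := rel_mem ψ (show p + (q + n) = i by omega) (show q + n + -n = q by omega) h e f
      (α a) (c a)
    have h2 : tm (K := K) h (S.mul (show p + (q + n) = i by omega) f (ψ.map (q + n) (α a))) (c a) ∈
        LinearMap.range Λ := by
      refine ⟨Pi.single a (S.mul (show p + (q + n) = i by omega) f (ψ.map (q + n) (α a))), ?_⟩
      rw [hΛ, Finset.sum_eq_single a]
      · rw [Pi.single_eq_same]
      · intro b _ hb
        rw [Pi.single_eq_of_ne hb, map_zero, LinearMap.zero_apply]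
      · exact fun h => absurd (Finset.mem_univ a) h
    have h3 := sub_mem (Submodule.mem_sup_right (S := relT ψ P k) h2) (Submodule.mem_sup_left h1)
    rwa [sub_sub_cancel] at h3
  choose β hβ using key
  let τ : T S B k →ₗ[K] T S P k ⧸ N := liftW fun p q e => (β p q e).flip
  have hτ : ∀ v, τ (mapT S g k v) = N.mkQ v := fun v => by
    refine LinearMap.congr_fun (f := τ.comp (mapT S g k)) (g := N.mkQ) (W_hom_ext ?_) v
    intro p q e f t
    rw [LinearMap.comp_apply, mapT_tm, liftW_tm, LinearMap.flip_apply, hβ]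
    rfl
  have hrel : relT ψ B k ≤ LinearMap.ker τ := by
    refine Submodule.span_le.2 ?_
    rintro _ ⟨p, q, s, pq, qs, hpq, hqs, h1, h2, f, r, b, rfl⟩
    obtain ⟨t, rfl⟩ := hg s b
    have e : tm (K := K) h1 (S.mul hpq f (ψ.map q r)) (g.map s t) -
        tm h2 f (B.smul hqs r (g.map s t)) =
        mapT S g k (tm (K := K) h1 (S.mul hpq f (ψ.map q r)) t - tm h2 f (P.smul hqs r t)) := by
      rw [map_sub, mapT_tm, mapT_tm, g.map_smul]
    rw [e]
    refine (hτ _).trans ((Submodule.Quotient.mk_eq_zero N).2 ?_)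
    exact Submodule.mem_sup_left (rel_mem ψ hpq hqs h1 h2 f r t)
  have hN : u ∈ N := (Submodule.Quotient.mk_eq_zero N).1 ((hτ u).symm.trans (hrel hu))
  obtain ⟨v, hv, _, ⟨α, rfl⟩, rfl⟩ := Submodule.mem_sup.1 hN
  refine ⟨α, ?_⟩
  rw [hΛ, add_sub_cancel_right]
  exact hv

end Stalk

section Sheaf

variable {𝔜 𝔛 : DGSpace.{u} K} {φ : DGSpace.Hom 𝔜 𝔛}

/-- If the kernel of `g : P → B` is spanned by sections `c_1, …, c_m`, then the kernel of
`φ⁺P → φ⁺B` is spanned by `(1 ⊗ c_1, 0), …, (1 ⊗ c_m, 0)`. -/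
theorem exists_eq_sum_smul {P B : LieAlgebroid 𝔛}
    (g : PreLieAlgebroid.Hom P.toPreLieAlgebroid B.toPreLieAlgebroid)
    (hg : ∀ x k, Function.Surjective ((g.map x).map k)) {n : ℤ} {m : ℕ}
    (c : Fin m → ∀ x, (P.L x).C (-n))
    (hc : ∀ (x) {i j : ℤ} (h : i + -n = j) (t : (P.L x).C j), (g.map x).map j t = 0 →
      ∃ α : Fin m → (𝔛.O x).C i, t = ∑ a, (P.L x).smul h (α a) (c a x))
    {y : 𝔜.X} (M : Fin m → ((inverseImage φ P).L y).C (-n))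
    (hM : ∀ a, IsRep (M a)
      (fun z => tm (zero_add (-n)) (𝔜.O z).one (c a (φ.base z))) 0)
    {i k : ℤ} (h : i + -n = k) (p : ((inverseImage φ P).L y).C k)
    (hp : ((inverseImageMap φ g).map y).map k p = 0) :
    ∃ α : Fin m → (𝔜.O y).C i, p = ∑ a, ((inverseImage φ P).L y).smul h (α a) (M a) := by
  obtain ⟨w, ξ, hw⟩ := IsRep.exists_rep p
  have h0 := (hw.map g).of_eq_zero hp
  obtain ⟨α, hα⟩ := exists_sub_mem_relT (φ.ψ y) (g.map (φ.base y)) (hg _) (fun a => c a (φ.base y))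
    (fun h t => hc _ h t) h (w y) h0.self_of_nhds.1
  choose f hf hfα using fun a => (𝔜.S i).germ y (α a)
  refine ⟨α, sub_eq_zero.1 ?_⟩
  have e := hw.sub (IsRep.sum Finset.univ fun a => (hM a).smul h (hf a))
  simp only [hfα] at e
  refine e.eq_zero ?_ (h0.mono fun z hz => ?_)
  · refine (congrArg (· ∈ relT (φ.ψ y) (P.L (φ.base y)) k) ?_).mpr hα
    rw [Pi.sub_apply, Finset.sum_apply]
    refine congrArg _ (Finset.sum_congr rfl fun a _ => ?_)
    rw [smulT_tm h (zero_add (-n)) (add_zero i) h, hfα, CDGA.mul_comm _ _ (zero_add i),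
      CDGA.one_mul, mul_zero, sg_zero, one_smul]
  · rw [Pi.sub_apply, hz.2, Finset.sum_apply, zero_sub, neg_eq_zero]
    exact Finset.sum_eq_zero fun a _ => map_zero _

end Sheaf

end Pull

namespace MarkedOver

variable {𝔜 𝔛 : DGSpace.{u} K} (φ : DGSpace.Hom 𝔜 𝔛) {B : LieAlgebroid 𝔛} {n : ℤ}

/-- The inverse image of an extension can only fail to be an extension at the marking. -/
theorem pull_isExact_of_injective {M : MarkedOver B n} (hM : M.IsExact)
    (h : ∀ (y) {i j : ℤ} (h : i + -n = j) (α : (𝔜.O y).C i),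
      ((M.pull φ).A.L y).smul h α ((M.pull φ).c y) = 0 → α = 0) : (M.pull φ).IsExact where
  inj := h
  ker y {i j} h p hp := by
    obtain ⟨α, hα⟩ := Pull.exists_eq_sum_smul (m := 1) M.p hM.surj (fun _ => M.c)
      (fun x {i j} h t ht => by
        obtain ⟨α, rfl⟩ := hM.ker x h t ht
        exact ⟨fun _ => α, (Fin.sum_univ_one fun _ => (M.A.L x).smul h α (M.c x)).symm⟩)
      (fun _ => (M.pull φ).c y) (fun _ => Pull.IsRep.pull_c M y) h p hp
    exact ⟨α 0, (hα.trans (Fin.sum_univ_one _)).symm⟩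
  surj := Pull.inverseImageMap_surjective M.p hM.surj

/-- A section of the marking `R[n] → A_x` at one stalk which is linear over `R = O_{𝔛, x}`. -/
structure Retraction (M : MarkedOver B n) (x : 𝔛.X) where
  map : ∀ {k l : ℤ}, k + n = l → (M.A.L x).C k →ₗ[K] (𝔛.O x).C l
  map_smul : ∀ {i k l k' l' : ℤ} (h : k + n = l) (h' : k' + n = l') (e : i + k = k')
    (e' : i + l = l') (r : (𝔛.O x).C i) (a : (M.A.L x).C k),
    map h' ((M.A.L x).smul e r a) = (𝔛.O x).mul e' r (map h a)
  map_c : map (neg_add_cancel n) (M.c x) = (𝔛.O x).one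

/-- Over a free stalk of `B` the extension splits. -/
theorem exists_retraction {M : MarkedOver B n} (hM : M.IsExact) (hB : B.IsLocallyFree) (x : 𝔛.X) :
    Nonempty (M.Retraction x) := by
  classical
  obtain ⟨U, hU, ι, deg, e, -, he⟩ := hB x
  have he := he x (mem_of_mem_nhds hU)
  -- Lifts `a i` of the basis of `B_x` to `A_x` give a surjection `F : R[n] ⊕ ⨁ i, R e_i → A_x` whose
  -- kernel lies in the kernel of the first projection, so that the latter descends to `A_x`.
  choose a ha using fun i => hM.surj x (deg i) (e i x)
  let D : ℤ → Type u := fun k => (𝔛.O x).C (k + n) × ⨁ i, (𝔛.O x).C (k - deg i)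
  let G : ∀ k, (⨁ i, (𝔛.O x).C (k - deg i)) →ₗ[K] (M.A.L x).C k := fun k =>
    DirectSum.toModule K ι _ fun i => ((M.A.L x).smul (sub_add_cancel k (deg i))).flip (a i)
  have hG : ∀ k i f, G k (DirectSum.lof K ι (fun i => (𝔛.O x).C (k - deg i)) i f) =
      (M.A.L x).smul (sub_add_cancel k (deg i)) f (a i) := fun k i f => by
    simp only [G]
    rw [DirectSum.toModule_lof]
    rfl
  let F : ∀ k, D k →ₗ[K] (M.A.L x).C k := fun k =>
    LinearMap.coprod (((M.A.L x).smul (add_neg_cancel_right k n)).flip (M.c x)) (G k)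
  have hF : ∀ k α f, F k (α, f) = (M.A.L x).smul (add_neg_cancel_right k n) α (M.c x) + G k f :=
    fun k α f => rfl
  have F_surj : ∀ k, Function.Surjective (F k) := by
    intro k t
    obtain ⟨s, f, hf⟩ := (he k).1 ((M.p.map x).map k t)
    let g : ⨁ i, (𝔛.O x).C (k - deg i) :=
      ∑ i ∈ s, DirectSum.lof K ι (fun i => (𝔛.O x).C (k - deg i)) i (f i)
    obtain ⟨α, hα⟩ := hM.ker x (add_neg_cancel_right k n) (t - G k g) (by
      rw [map_sub, hf, map_sum, map_sum, sub_eq_zero]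
      refine Finset.sum_congr rfl fun i _ => ?_
      rw [hG, (M.p.map x).map_smul, ha])
    exact ⟨(α, g), by rw [hF, hα, sub_add_cancel]⟩
  have F_ker : ∀ k (d : D k), F k d = 0 → d.1 = 0 := by
    rintro k ⟨α, f⟩ h
    have hf : f = ∑ i ∈ f.support, DirectSum.lof K ι (fun i => (𝔛.O x).C (k - deg i)) i (f i) :=
      (DirectSum.sum_support_of f).symm
    have h1 : G k f = ∑ i ∈ f.support, (M.A.L x).smul (sub_add_cancel k (deg i)) (f i) (a i) := by
      conv_lhs => rw [hf]
      rw [map_sum]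
      exact Finset.sum_congr rfl fun i _ => hG k i _
    have h2 := congrArg ((M.p.map x).map k) h
    rw [hF, map_add, map_zero, h1, map_sum, (M.p.map x).map_smul, M.p_c, map_zero, zero_add] at h2
    simp only [(M.p.map x).map_smul, ha] at h2
    have h3 := (he k).2 f.support (fun i => f i) h2
    rw [hF, h1, Finset.sum_eq_zero, add_zero] at h
    · exact hM.inj x _ α h
    · intro i hi
      rw [h3 i hi, map_zero, LinearMap.zero_apply]
  have key : ∀ {k l : ℤ} (h : k + n = l), ∃ ρ : (M.A.L x).C k →ₗ[K] (𝔛.O x).C l,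
      ∀ (α : (𝔛.O x).C l) f, ρ ((M.A.L x).smul (by omega) α (M.c x) + G k f) = α := by
    rintro k _ rfl
    obtain ⟨ρ, hρ⟩ := exists_factor_of_surjective (F k) (LinearMap.fst K _ _) (F_surj k) (F_ker k)
    exact ⟨ρ, fun α f => hρ (α, f)⟩
  choose ρ hρ using @key
  refine ⟨ρ, ?_, ?_⟩
  · intro i k l k' l' h h' e e' r t
    subst h
    obtain ⟨⟨α, f⟩, rfl⟩ := F_surj k t
    have h1 : ∃ f', (M.A.L x).smul e r (G k f) = G k' f' := by
      induction f using DirectSum.induction_on with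
      | zero => exact ⟨0, by rw [map_zero, map_zero, map_zero]⟩
      | of j f =>
        refine ⟨DirectSum.lof K ι (fun i => (𝔛.O x).C (k' - deg i)) j
          ((𝔛.O x).mul (show i + (k - deg j) = k' - deg j by omega) r f), ?_⟩
        rw [hG, (M.A.L x).mul_smul _ _ (sub_add_cancel k (deg j)) e]
        exact congrArg _ (hG k j f)
      | add f f' hf hf' =>
        obtain ⟨g, hg⟩ := hf
        obtain ⟨g', hg'⟩ := hf'
        exact ⟨g + g', by rw [map_add, map_add, map_add, hg, hg']⟩
    obtain ⟨f', hf'⟩ := h1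
    rw [hF, hρ, map_add, hf', ← (M.A.L x).mul_smul e' (show l' + -n = k' by omega), hρ]
  · have := hρ (neg_add_cancel n) (𝔛.O x).one 0
    rwa [map_zero, add_zero, (M.A.L x).one_smul] at this

end MarkedOver

/-- The inverse image preserves the extensions of a locally free Lie algebroid: a retraction of
`R[n] → A_x` induces a retraction after tensoring with `S`. -/
theorem preservesExtensions_of_isLocallyFree {𝔜 𝔛 : DGSpace.{u} K} (φ : DGSpace.Hom 𝔜 𝔛)
    {B : LieAlgebroid 𝔛} (n : ℤ) (hB : B.IsLocallyFree) : PreservesExtensions φ B n := by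
  intro M hM
  refine MarkedOver.pull_isExact_of_injective φ hM fun y i j h α hα => ?_
  obtain ⟨ρ⟩ := MarkedOver.exists_retraction hM hB (φ.base y)
  obtain ⟨f, hf, rfl⟩ := (𝔜.S i).germ y α
  have h1 := ((((Pull.IsRep.pull_c M y).smul h hf).of_eq_zero hα).self_of_nhds).1
  -- The functional `s ⊗ t ↦ s ψ(ρ(t))` on `S ⊗_R A_x` sends `α ⊗ c` to `α`.
  let Λ : Pull.T (𝔜.O y) (M.A.L (φ.base y)) j →ₗ[K] (𝔜.O y).C i :=
    liftW fun p q e => ((𝔜.O y).mul (show p + (q + n) = i by omega)).compl₂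
      (((φ.ψ y).map (q + n)).comp (ρ.map rfl))
  have hΛ : ∀ {p q r : ℤ} (e : p + q = j) (e' : q + n = r) (e'' : p + r = i) s t,
      Λ (tm e s t) = (𝔜.O y).mul e'' s ((φ.ψ y).map r (ρ.map e' t)) := by
    rintro p q _ e rfl e'' s t
    exact liftW_tm _ e s t
  have hrel : Pull.relT (φ.ψ y) (M.A.L (φ.base y)) j ≤ LinearMap.ker Λ := by
    refine Submodule.span_le.2 ?_
    rintro _ ⟨p, q, s, pq, qs, hpq, hqs, h1, h2, g, r, a, rfl⟩
    change Λ _ = 0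
    rw [map_sub, hΛ h1 rfl (by omega), hΛ h2 rfl (by omega),
      ρ.map_smul rfl rfl hqs (show q + (s + n) = qs + n by omega), (φ.ψ y).map_mul,
      (𝔜.O y).mul_assoc hpq _ (show q + (s + n) = qs + n by omega) (by omega), sub_self]
  have h2 := hrel h1
  change Λ (Pull.smulT h (f y) (tm _ _ _)) = 0 at h2
  rwa [Pull.smulT_tm h (zero_add (-n)) (add_zero i) h, hΛ h (neg_add_cancel n) (add_zero i),
    ρ.map_c, (φ.ψ y).map_one, (𝔜.O y).mul_comm (add_zero i) (zero_add i) (f y) (𝔜.O y).one,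
    CDGA.one_mul, mul_zero, sg_zero, one_smul, (𝔜.O y).mul_comm (add_zero i) (zero_add i),
    CDGA.one_mul, mul_zero, sg_zero, one_smul] at h2

end

/-! ### Inverse image and linear combinations -/

section

variable {K : Type w} [Field K]

section Comparison

variable {𝔜 𝔛 : DGSpace.{u} K} (φ : DGSpace.Hom 𝔜 𝔛) {B : LieAlgebroid 𝔛} {n : ℤ}

theorem inverseImageMap_comp_apply {A A' A'' : LieAlgebroid 𝔛}
    {f : PreLieAlgebroid.Hom A.toPreLieAlgebroid A'.toPreLieAlgebroid}
    {g : PreLieAlgebroid.Hom A'.toPreLieAlgebroid A''.toPreLieAlgebroid}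
    {h : PreLieAlgebroid.Hom A.toPreLieAlgebroid A''.toPreLieAlgebroid} (e : f.comp g = h)
    (y : 𝔜.X) (k : ℤ) (t : ((inverseImage φ A).L y).C k) :
    ((inverseImageMap φ g).map y).map k (((inverseImageMap φ f).map y).map k t) =
      ((inverseImageMap φ h).map y).map k t := by
  subst e
  exact congrArg (fun f : PreLieAlgebroid.Hom (inverseImage φ A).toPreLieAlgebroid
    (inverseImage φ A'').toPreLieAlgebroid => (f.map y).map k t)
      (inverseImageMap_comp φ f g).symm

theorem MarkedOver.inverseImageMap_c {M N : MarkedOver B n} (s : K)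
    (f : PreLieAlgebroid.Hom M.A.toPreLieAlgebroid N.A.toPreLieAlgebroid)
    (h : ∀ x, (f.map x).map (-n) (M.c x) = s • N.c x) (y : 𝔜.X) :
    ((inverseImageMap φ f).map y).map (-n) ((M.pull φ).c y) = s • (N.pull φ).c y := by
  have h1 := (Pull.IsRep.pull_c (φ := φ) M y).map f
  have h2 := (Pull.IsRep.pull_c (φ := φ) N y).const_smul s
  rw [smul_zero] at h2
  refine Pull.IsRep.eq h1 ((congrArg (fun w => Pull.IsRep _ w _) (funext fun z => ?_)).mp h2)
  refine Eq.trans ?_ (Pull.mapT_tm (f.map (φ.base z)) (zero_add (-n)) (𝔜.O z).one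
    (M.c (φ.base z))).symm
  rw [h, map_smul]
  rfl

-- Only the functoriality of the inverse image matters below, not its construction.
attribute [local irreducible] inverseImage inverseImageMap

namespace FP

variable {m : ℕ} (A : Fin m → MarkedOver B n)

/-- The fibre product, marked by the marking of its factor `A_a`. -/
def markedAt (a : Fin m) : MarkedOver B n where
  A := FP A
  c x := ⟨(fun b => (Pi.single a 1 : Fin m → K) b • (A b).c x, 0), fun b => by
    rw [map_smul, (A b).p_c, smul_zero]⟩
  c_sec x := ⟨fun b => Submodule.smul_mem _ _ ((A b).c_sec x), zero_mem _⟩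
  d_c x j h := sub_ext A (fun b => by
    refine (map_smul ((A b).A.L x |>.d h) _ _).trans ?_
    rw [(A b).d_c, smul_zero]
    rfl) (map_zero _)
  central x j k h t := sub_ext A (fun b => by
    refine (LinearMap.map_smul₂ ((A b).A.L x |>.br h) _ _ _).trans ?_
    rw [(A b).central, smul_zero]
    rfl) (by
      change (B.L x).br h 0 t.1.2 = 0
      rw [map_zero, LinearMap.zero_apply])
  p := toB A
  p_c x := rfl

theorem mark_eq_sum (x : 𝔛.X) {i j : ℤ} (h : i + -n = j) (α : Fin m → (𝔛.O x).C i) :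
    mark A x h α = ∑ a, ((FP A).L x).smul h (α a) ((markedAt A a).c x) := by
  refine sub_ext A (fun b => ?_) ?_
  · refine Eq.trans ?_ (map_sum (((pr A b).map x).map j) _ _).symm
    refine Eq.trans ?_ (Finset.sum_eq_single b (fun a _ hab => ?_)
      (fun h => absurd (Finset.mem_univ b) h)).symm
    · change _ = ((A b).A.L x).smul h (α b) ((Pi.single b 1 : Fin m → K) b • (A b).c x)
      rw [Pi.single_eq_same, one_smul]
      rfl
    · change ((A b).A.L x).smul h (α a) ((Pi.single a 1 : Fin m → K) b • (A b).c x) = 0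
      rw [Pi.single_eq_of_ne hab.symm, zero_smul, map_zero]
  · refine Eq.trans ?_ (map_sum (((toB A).map x).map j) _ _).symm
    exact (Finset.sum_eq_zero fun a _ => map_zero ((B.L x).smul h (α a))).symm

theorem c_markedAt (x : 𝔛.X) (a : Fin m) : (markedAt A a).c x =
    mark A x (zero_add (-n)) fun b => (Pi.single a 1 : Fin m → K) b • (𝔛.O x).one :=
  sub_ext A (fun b => by
    refine Eq.trans ?_ (LinearMap.map_smul₂ _ _ _ _).symm
    rw [((A b).A.L x).one_smul]
    rfl) rfl

theorem pr_comp_p (i : Fin m) : (pr A i).comp (A i).p = toB A :=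
  PreLieAlgebroid.Hom.ext_map fun _ _ a => a.2 i

/-- The canonical map `φ⁺(A_1 ×_B … ×_B A_m) → φ⁺A_1 ×_{φ⁺B} … ×_{φ⁺B} φ⁺A_m`. -/
def comparison : PreLieAlgebroid.Hom (inverseImage φ (FP A)).toPreLieAlgebroid
    (FP fun i => (A i).pull φ).toPreLieAlgebroid :=
  lift (B := inverseImage φ B) (A := fun i => (A i).pull φ) (inverseImageMap φ (toB A))
    (fun i => inverseImageMap φ (pr A i))
    fun i y k t => inverseImageMap_comp_apply φ (pr_comp_p A i) y k t

theorem comparison_c (a : Fin m) (y : 𝔜.X) :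
    ((comparison φ A).map y).map (-n) (((markedAt A a).pull φ).c y) =
      (markedAt (fun i => (A i).pull φ) a).c y :=
  sub_ext _ (fun b => MarkedOver.inverseImageMap_c φ (M := markedAt A a) (N := A b) _ (pr A b)
    (fun _ => rfl) y) (((markedAt A a).pull φ).p_c y)

variable {A}

/-- The kernel of `φ⁺(A_1 ×_B … ×_B A_m) → φ⁺B` is generated by the markings. -/
theorem exists_eq_sum_of_toB (hA : ∀ a, (A a).IsExact) (y : 𝔜.X) {i k : ℤ} (h : i + -n = k)
    (t : ((inverseImage φ (FP A)).L y).C k)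
    (ht : ((inverseImageMap φ (toB A)).map y).map k t = 0) :
    ∃ α : Fin m → (𝔜.O y).C i,
      t = ∑ a, ((inverseImage φ (FP A)).L y).smul h (α a) (((markedAt A a).pull φ).c y) :=
  Pull.exists_eq_sum_smul (toB A) (fun x k b => toB_surjective hA x k b)
    (fun a x => (markedAt A a).c x) (fun x _ _ h t ht => by
      obtain ⟨α, rfl⟩ := exists_eq_mark hA x h t ht
      exact ⟨α, mark_eq_sum A x h α⟩)
    (fun a => ((markedAt A a).pull φ).c y) (fun a => Pull.IsRep.pull_c (markedAt A a) y) h t ht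

theorem comparison_sum (y : 𝔜.X) {i k : ℤ} (h : i + -n = k) (α : Fin m → (𝔜.O y).C i) :
    ((comparison φ A).map y).map k
        (∑ a, ((inverseImage φ (FP A)).L y).smul h (α a) (((markedAt A a).pull φ).c y)) =
      mark (fun i => (A i).pull φ) y h α := by
  rw [mark_eq_sum, map_sum]
  refine Finset.sum_congr rfl fun a _ => ?_
  exact (((comparison φ A).map y).map_smul h (α a) _).trans (congrArg _ (comparison_c φ A a y))

end FP

namespace LinMap

variable {m : ℕ} {lam : Fin m → K} {A : Fin m → OExt B n} {L : OExt B n}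

theorem inverseImageMap_sum (q : LinMap lam A L) (y : 𝔜.X) {i k : ℤ} (h : i + -n = k)
    (α : Fin m → (𝔜.O y).C i) :
    ((inverseImageMap φ q.hom).map y).map k
        (∑ a, ((inverseImage φ (FP fun i => (A i).obj)).L y).smul h (α a) (((FP.markedAt (fun i => (A i).obj) a).pull φ).c y)) =
      ((L.obj.pull φ).A.L y).smul h (∑ a, lam a • α a) ((L.obj.pull φ).c y) := by
  rw [map_sum, map_sum, LinearMap.sum_apply]
  refine Finset.sum_congr rfl fun a _ => ?_
  refine (((inverseImageMap φ q.hom).map y).map_smul h (α a) _).trans ?_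
  refine (congrArg _ (MarkedOver.inverseImageMap_c φ (M := FP.markedAt (fun i => (A i).obj) a)
    (N := L.obj) (lam a) q.hom (fun x => ?_) y)).trans ?_
  · refine (congrArg ((q.hom.map x).map (-n)) (FP.c_markedAt (fun i => (A i).obj) x a)).trans ?_
    refine (q.comm x _ _).trans ?_
    rw [Finset.sum_eq_single a (fun b _ hb => by
      rw [Pi.single_eq_of_ne hb, zero_smul, smul_zero]) (fun h => absurd (Finset.mem_univ a) h),
      Pi.single_eq_same, one_smul, LinearMap.map_smul₂, (L.obj.A.L x).one_smul]
  · exact (map_smul (((L.obj.pull φ).A.L y).smul h (α a)) (lam a) _).trans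
      (LinearMap.map_smul₂ _ _ _ _).symm

end LinMap

end Comparison

end

/-! ### The inverse image as a morphism of vector spaces in categories -/

section

variable {K : Type w} [Field K]

namespace PullLinear

variable {𝔜 𝔛 : DGSpace.{u} K} (φ : DGSpace.Hom 𝔜 𝔛) {B : LieAlgebroid 𝔛} {n : ℤ}
  (h : PreservesExtensions φ B n)

-- Only the functoriality of the inverse image matters here, not its construction.
attribute [local irreducible] inverseImage inverseImageMap

/-- The inverse image of an extension. -/
abbrev pullObj (M : OExt B n) : OExt (inverseImage φ B) n := ⟨M.obj.pull φ, h M.obj M.property⟩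

/-- The inverse images of a family of extensions. -/
abbrev pullFam {m : ℕ} (A : Fin m → OExt B n) : Fin m → OExt (inverseImage φ B) n :=
  fun i => pullObj φ h (A i)

/-- The inverse image of a morphism of extensions. -/
def pullMor {M N : OExt B n} (f : M ⟶ N) : pullObj φ h M ⟶ pullObj φ h N :=
  ObjectProperty.homMk ((MarkedOver.pullFunctor φ B n).map f.hom)

theorem comp_pullMor_ap {L : OExt (inverseImage φ B) n} {M N : OExt B n} {g : L ⟶ pullObj φ h M}
    {f : M ⟶ N} {y : 𝔜.X} {k : ℤ} {r : (L.obj.A.L y).C k} {s : ((inverseImage φ M.obj.A).L y).C k}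
    {t : ((inverseImage φ N.obj.A).L y).C k} (h1 : OExt.ap g y k r = s)
    (h2 : ((inverseImageMap φ f.hom.hom).map y).map k s = t) :
    OExt.ap (g ≫ pullMor φ h f) y k r = t :=
  (congrArg (((inverseImageMap φ f.hom.hom).map y).map k) h1).trans h2

/-- The image of an element of `φ⁺(A_1 ×_B … ×_B A_m)` in the fibre product of the `φ⁺A_i`. -/
def el {m : ℕ} {A : Fin m → OExt B n} {y : 𝔜.X} {k : ℤ}
    (t : ((inverseImage φ (FP fun i => (A i).obj)).L y).C k) :
    FP.sub (fun i => (A i).obj.pull φ) y k :=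
  ((FP.comparison φ fun i => (A i).obj).map y).map k t

theorem eq_el {m : ℕ} {A : Fin m → OExt B n} {y : 𝔜.X} {k : ℤ}
    (t : ((inverseImage φ (FP fun i => (A i).obj)).L y).C k)
    (a : FP.sub (fun i => (A i).obj.pull φ) y k)
    (h1 : ∀ i, a.1.1 i = ((inverseImageMap φ (FP.pr (fun i => (A i).obj) i)).map y).map k t)
    (h2 : a.1.2 = ((inverseImageMap φ (FP.toB fun i => (A i).obj)).map y).map k t) :
    a = el φ t := FP.sub_ext _ h1 h2

theorem exists_el {m : ℕ} (A : Fin m → OExt B n) (y : 𝔜.X) (k : ℤ)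
    (b : ((inverseImage φ B).L y).C k) :
    ∃ t : ((inverseImage φ (FP fun i => (A i).obj)).L y).C k, (el φ t).1.2 = b :=
  Pull.inverseImageMap_surjective (FP.toB fun i => (A i).obj)
    (fun x k b => FP.toB_surjective (fun a => (A a).property) x k b) y k b

variable {h}

/-- The comparison of `λ_1 φ⁺A_1 ∔ … ∔ λ_m φ⁺A_m` and `φ⁺(λ_1 A_1 ∔ … ∔ λ_m A_m)` for any choice of
the linear combinations. -/
theorem exists_hom {m : ℕ} {lam : Fin m → K} {A : Fin m → OExt B n} {L : OExt B n}
    {L' : OExt (inverseImage φ B) n} (q : LinMap lam A L) (q' : LinMap lam (pullFam φ h A) L') :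
    ∃ f : L' ⟶ pullObj φ h L,
      ∀ y k (t : ((inverseImage φ (FP fun i => (A i).obj)).L y).C k),
        OExt.ap f y k ((q'.hom.map y).map k (el φ t)) =
          ((inverseImageMap φ q.hom).map y).map k t := by
  have hA : ∀ a, ((A a).obj.pull φ).IsExact := fun a => h (A a).obj (A a).property
  have hp : ∀ y k (t : ((inverseImage φ (FP fun i => (A i).obj)).L y).C k),
      (L'.obj.p.map y).map k ((q'.hom.map y).map k (el φ t)) =
        ((inverseImageMap φ (FP.toB fun i => (A i).obj)).map y).map k t :=
    fun y k t => q'.p_hom y k (el φ t)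
  obtain ⟨f, hf⟩ := MarkedOver.exists_desc (L := L'.obj)
    (N := L.obj.pull φ)
    L'.property (P := inverseImage φ (FP fun i => (A i).obj))
    ((FP.comparison φ fun i => (A i).obj).comp q'.hom) (inverseImageMap φ q.hom)
    (fun y k b => by
      obtain ⟨t, ht⟩ := exists_el φ A y k b
      exact ⟨t, (hp y k t).trans ht⟩)
    (fun y k t => (inverseImageMap_comp_apply φ q.comp_p y k t).trans (hp y k t).symm)
    -- An element `t` sent to `O c` comes from the markings of the `φ⁺A_i` in the fibre product, hence,
    -- by right exactness of the inverse image, from the markings in `φ⁺(A_1 ×_B … ×_B A_m)`.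
    (fun y i j e β t ht => by
      obtain ⟨α, hα, hβ⟩ := q'.pushout_inj y e (-β) (el φ t) (by
        rw [map_neg, LinearMap.neg_apply, neg_add_eq_zero]; exact ht.symm)
      obtain ⟨α', rfl⟩ := FP.exists_eq_sum_of_toB φ (fun a => (A a).property) y e t
        (congrArg (fun a : FP.sub (fun i => (A i).obj.pull φ) y j => a.1.2) hα)
      have e' : α' = α := FP.mark_injective hA y e ((FP.comparison_sum φ y e α').symm.trans hα)
      subst e'
      rw [neg_inj.1 hβ]
      exact q.inverseImageMap_sum φ y e α')
  exact ⟨ObjectProperty.homMk f, hf⟩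

variable (V : Canonical B n) (W : Canonical (inverseImage φ B) n)

/-- The isomorphism `λ_1 φ⁺A_1 ∔ … ∔ λ_m φ⁺A_m ≅ φ⁺(λ_1 A_1 ∔ … ∔ λ_m A_m)`. -/
def iso {m : ℕ} (lam : Fin m → K) (A : Fin m → OExt B n) :
    (W.comb lam).obj (pullFam φ h A) ≅ pullObj φ h ((V.comb lam).obj A) :=
  haveI := OExt.isIso (exists_hom φ (V.q lam A) (W.q lam (pullFam φ h A))).choose
  asIso (exists_hom φ (V.q lam A) (W.q lam (pullFam φ h A))).choose

theorem ap_iso {m : ℕ} (lam : Fin m → K) (A : Fin m → OExt B n) (y : 𝔜.X) (k : ℤ)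
    (t : ((inverseImage φ (FP fun i => (A i).obj)).L y).C k) :
    OExt.ap (iso φ V W lam A).hom y k (((W.q lam (pullFam φ h A)).hom.map y).map k (el φ t)) =
      ((inverseImageMap φ (V.q lam A).hom).map y).map k t :=
  (exists_hom φ (V.q lam A) (W.q lam (pullFam φ h A))).choose_spec y k t

/-- Morphisms out of a linear combination of inverse images are equal if they agree on the image of
`φ⁺(A_1 ×_B … ×_B A_m)`. -/
theorem hom_ext {m : ℕ} {lam : Fin m → K} {A : Fin m → OExt B n} {N : OExt (inverseImage φ B) n}
    {f g : (W.comb lam).obj (pullFam φ h A) ⟶ N}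
    (e : ∀ y k (t : ((inverseImage φ (FP fun i => (A i).obj)).L y).C k),
      OExt.ap f y k (((W.q lam (pullFam φ h A)).hom.map y).map k (el φ t)) =
        OExt.ap g y k (((W.q lam (pullFam φ h A)).hom.map y).map k (el φ t))) : f = g :=
  OExt.hom_ext fun y k b => by
    obtain ⟨t, rfl⟩ := exists_el φ A y k b
    exact ⟨_, (W.q lam (pullFam φ h A)).p_hom y k (el φ t), e y k t⟩

theorem iso_nat {m : ℕ} (lam : Fin m → K) {A A' : Fin m → OExt B n} (f : ∀ i, A i ⟶ A' i) :
    (W.comb lam).map (X := pullFam φ h A) (Y := pullFam φ h A')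
        (fun i => pullMor φ h (f i)) ≫ (iso φ V W lam A').hom =
      (iso φ V W lam A).hom ≫ pullMor φ h ((V.comb lam).map f) := by
  refine hom_ext φ W fun y k t => ?_
  let F : PreLieAlgebroid.Hom (FP fun i => (A i).obj).toPreLieAlgebroid
      (FP fun i => (A' i).obj).toPreLieAlgebroid :=
    FP.lift (A := fun i => (A' i).obj) (FP.toB fun i => (A i).obj)
      (fun i => (FP.pr (fun i => (A i).obj) i).comp (f i).hom.hom)
      fun i x k a => (FP.mapEl f a).2 i
  let t' : ((inverseImage φ (FP fun i => (A' i).obj)).L y).C k :=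
    ((inverseImageMap φ F).map y).map k t
  have e1 : F.comp (V.q lam A').hom = (V.q lam A).hom.comp ((V.comb lam).map f).hom.hom :=
    PreLieAlgebroid.Hom.ext_map fun x k a =>
      (V.q_nat lam f x k a (FP.mapEl f a) (fun _ => rfl) rfl).symm
  have e2 : ∀ i, ((inverseImageMap φ (f i).hom.hom).map y).map k
      (((inverseImageMap φ (FP.pr (fun i => (A i).obj) i)).map y).map k t) =
      ((inverseImageMap φ (FP.pr (fun i => (A' i).obj) i)).map y).map k t' := fun i =>
    (inverseImageMap_comp_apply φ rfl y k t).trans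
      (inverseImageMap_comp_apply φ (f := F) (g := FP.pr (fun i => (A' i).obj) i) rfl y k t).symm
  have e3 : ((inverseImageMap φ (FP.toB fun i => (A i).obj)).map y).map k t =
      ((inverseImageMap φ (FP.toB fun i => (A' i).obj)).map y).map k t' :=
    (inverseImageMap_comp_apply φ (f := F) (g := FP.toB fun i => (A' i).obj) rfl y k t).symm
  exact (OExt.comp_ap_eq (W.q_nat lam (A := pullFam φ h A) (A' := pullFam φ h A')
      (fun i => pullMor φ h (f i)) y k (el φ t) (el φ t') e2 e3)
      (ap_iso φ V W lam A' y k t')).trans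
    ((comp_pullMor_ap φ h (ap_iso φ V W lam A y k t)
      ((inverseImageMap_comp_apply φ (h := F.comp (V.q lam A').hom) e1.symm y k t).trans
        (inverseImageMap_comp_apply φ (f := F) rfl y k t).symm)).symm)

theorem iso_proj {m : ℕ} (i : Fin m) (A : Fin m → OExt B n) :
    (iso φ V W (Pi.single i 1) A).hom ≫ pullMor φ h (V.proj i A).hom =
      (W.proj i (pullFam φ h A)).hom := by
  refine hom_ext φ W fun y k t => ?_
  have e1 : (V.q (Pi.single i 1) A).hom.comp (V.proj i A).hom.hom.hom =
      FP.pr (fun i => (A i).obj) i :=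
    PreLieAlgebroid.Hom.ext_map fun x k a => V.q_proj i A x k a
  exact (comp_pullMor_ap φ h (ap_iso φ V W (Pi.single i 1) A y k t)
    (inverseImageMap_comp_apply φ e1 y k t)).trans
      (W.q_proj i (pullFam φ h A) y k (el φ t)).symm

theorem iso_subst {m l : ℕ} (lam : Fin m → K) (mu : Fin m → Fin l → K) (nu : Fin l → K)
    (e : ∀ j, nu j = ∑ i, lam i * mu i j) (A : Fin l → OExt B n) :
    (W.comb lam).map (X := fun i => (W.comb (mu i)).obj (pullFam φ h A))
        (Y := pullFam φ h fun i => (V.comb (mu i)).obj A) (fun i => (iso φ V W (mu i) A).hom) ≫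
      (iso φ V W lam fun i => (V.comb (mu i)).obj A).hom ≫
        pullMor φ h (V.subst lam mu nu e A).hom =
    (W.subst lam mu nu e (pullFam φ h A)).hom ≫ (iso φ V W nu A).hom := by
  refine OExt.hom_ext fun y k b => ?_
  obtain ⟨t, rfl⟩ := exists_el φ A y k b
  let F : PreLieAlgebroid.Hom (FP fun i => (A i).obj).toPreLieAlgebroid
      (FP fun i => ((V.comb (mu i)).obj A).obj).toPreLieAlgebroid :=
    FP.lift (A := fun i => ((V.comb (mu i)).obj A).obj) (FP.toB fun i => (A i).obj)
      (fun i => (V.q (mu i) A).hom) fun i x k a => (V.q (mu i) A).p_hom x k a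
  let t' : ((inverseImage φ (FP fun i => ((V.comb (mu i)).obj A).obj)).L y).C k :=
    ((inverseImageMap φ F).map y).map k t
  let s : FP.sub (fun i => ((W.comb (mu i)).obj (pullFam φ h A)).obj) y k :=
    FP.el (fun i => W.q (mu i) (pullFam φ h A)) (el φ t)
  have e1 : (F.comp (V.q lam fun i => (V.comb (mu i)).obj A).hom).comp
      (V.subst lam mu nu e A).hom.hom.hom = (V.q nu A).hom :=
    PreLieAlgebroid.Hom.ext_map fun x k a => V.q_subst lam mu nu e A x k a
      (FP.el (fun i => V.q (mu i) A) a) (fun _ => rfl) rfl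
  have e2 : ∀ i, OExt.ap (iso φ V W (mu i) A).hom y k (s.1.1 i) = (el φ t').1.1 i :=
    fun i => (ap_iso φ V W (mu i) A y k t).trans (inverseImageMap_comp_apply φ (f := F)
      (g := FP.pr (fun i => ((V.comb (mu i)).obj A).obj) i) rfl y k t).symm
  have e3 : s.1.2 = (el φ t').1.2 :=
    (inverseImageMap_comp_apply φ (f := F)
      (g := FP.toB fun i => ((V.comb (mu i)).obj A).obj) rfl y k t).symm
  have s1 := W.q_nat lam (A := fun i => (W.comb (mu i)).obj (pullFam φ h A))
    (A' := pullFam φ h fun i => (V.comb (mu i)).obj A) (fun i => (iso φ V W (mu i) A).hom) y k s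
    (el φ t') e2 e3
  have s2 := ap_iso (h := h) φ V W lam (fun i => (V.comb (mu i)).obj A) y k t'
  have s3 := inverseImageMap_comp_apply φ (f := F)
    (g := (V.q lam fun i => (V.comb (mu i)).obj A).hom) rfl y k t
  have s4 := inverseImageMap_comp_apply φ e1 y k t
  have s5 := comp_pullMor_ap φ h (f := (V.subst lam mu nu e A).hom) (s2.trans s3) s4
  have s6 := W.q_subst lam mu nu e (pullFam φ h A) y k (el φ t) s (fun _ => rfl) rfl
  exact ⟨_, (W.q lam fun i => (W.comb (mu i)).obj (pullFam φ h A)).p_hom y k s,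
    (OExt.comp_ap_eq s1 s5).trans (OExt.comp_ap_eq s6 (ap_iso φ V W nu A y k t)).symm⟩

variable (h)

/-- The inverse image as a morphism of vector spaces in categories. -/
def linearFunctor : LinearFunctor V.toLinearStructure W.toLinearStructure
    (MarkedOver.pullOExt φ B n h) where
  iso lam A := iso (h := h) φ V W lam A
  iso_nat lam _ _ f := iso_nat (h := h) φ V W lam f
  iso_proj i A := iso_proj (h := h) φ V W i A
  iso_subst lam mu nu e A := iso_subst (h := h) φ V W lam mu nu e A

theorem isInduced_linearFunctor : IsInduced φ h V W (linearFunctor φ h V W) := by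
  intro m lam A y k t a h1 h2
  obtain rfl := eq_el φ t a h1 h2
  exact ap_iso (h := h) φ V W lam A y k t

theorem eq_linearFunctor {θ : LinearFunctor V.toLinearStructure W.toLinearStructure
    (MarkedOver.pullOExt φ B n h)} (hθ : IsInduced φ h V W θ) : θ = linearFunctor φ h V W := by
  refine LinearFunctor.ext ?_
  funext m lam A
  refine Iso.ext (hom_ext (h := h) φ W fun y k t => ?_)
  exact (hθ lam A y k t (el φ t) (fun _ => rfl) rfl).trans
    (ap_iso (h := h) φ V W lam A y k t).symm

end PullLinear

end

/-! ### The symmetric monoidal functor underlying a morphism of vector spaces in categories -/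

section

universe v₃ u₃ v₄ u₄

namespace LinearFunctor

open LinearStructure

variable {R : Type v} [CommRing R] {C : Type u₃} [Category.{v₃} C] {D : Type u₄}
  [Category.{v₄} D] {V : LinearStructure R C} {W : LinearStructure R D} {F : C ⥤ D}
  (θ : LinearFunctor V W F)

/-- The image of an identification of `O` with a linear combination of the `X j`, as an
identification of `F(O)` with the same linear combination of the `F(X j)`. -/
def mapNF {k : ℕ} {X : Fin k → C} {O : C} (t : V.NF X O) :
    W.NF (fun i => F.obj (X i)) (F.obj O) :=
  ⟨t.nu, F.mapIso t.iso ≪≫ (θ.iso t.nu X).symm⟩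

theorem mapNF_nu_congr {k : ℕ} {X : Fin k → C} {O O' : C} {t : V.NF X O} {s : V.NF X O'}
    (h : t.nu = s.nu) : (θ.mapNF t).nu = (θ.mapNF s).nu := h

/-- The functor carries structure isomorphisms to structure isomorphisms. -/
theorem map_can {k : ℕ} {X : Fin k → C} {O O' : C} (t : V.NF X O) (s : V.NF X O')
    (h : t.nu = s.nu) :
    F.map (can t s h).hom = (can (θ.mapNF t) (θ.mapNF s) (θ.mapNF_nu_congr h)).hom := by
  obtain ⟨nu, i⟩ := t
  obtain ⟨nu', i'⟩ := s
  obtain rfl : nu = nu' := h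
  refine (congrArg F.map (can_mk nu i i' rfl)).trans (Eq.trans ?_
    (can_mk nu (F.mapIso i ≪≫ (θ.iso nu X).symm) (F.mapIso i' ≪≫ (θ.iso nu X).symm) rfl).symm)
  simp

/-- The compatibility of `mapNF` with linear combinations, which contains the naturality of `θ.iso`
and its compatibility with substitution. -/
theorem mapNF_comb {k m : ℕ} {X : Fin k → C} {O : Fin m → C} (lam : Fin m → R)
    (t : ∀ i, V.NF X (O i)) :
    (θ.mapNF (NF.comb lam t)).pre (θ.iso lam O) =
      NF.comb (V := W) (O := fun i => F.obj (O i)) lam fun i => θ.mapNF (t i) := by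
  refine NF.mk_congr ?_
  have h1 := θ.iso_nat lam (X := O) (Y := fun i => (V.comb (t i).nu).obj X) fun i => (t i).iso.hom
  have h2 := θ.iso_subst lam (fun i => (t i).nu) _ (fun _ => rfl) X
  have h3 : (W.comb lam).map (X := fun i => F.obj (O i))
        (Y := fun i => F.obj ((V.comb (t i).nu).obj X)) (fun i => F.map (t i).iso.hom) =
      (W.comb lam).map (X := fun i => F.obj (O i))
        (Y := fun i => (W.comb (t i).nu).obj fun j => F.obj (X j))
        (fun i => F.map (t i).iso.hom ≫ (θ.iso (t i).nu X).inv) ≫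
      (W.comb lam).map (X := fun i => (W.comb (t i).nu).obj fun j => F.obj (X j))
        (Y := fun i => F.obj ((V.comb (t i).nu).obj X)) (fun i => (θ.iso (t i).nu X).hom) := by
    refine Eq.trans (congrArg _ (funext fun i => ?_)) (Functor.map_comp _ _ _)
    exact ((Category.assoc _ _ _).trans (by simp)).symm
  change (θ.iso lam O).hom ≫ F.map ((V.comb lam).map (fun i => (t i).iso.hom) ≫
      (V.subst lam (fun i => (t i).nu) _ (fun _ => rfl) X).hom) ≫ (θ.iso _ X).inv =
    (W.comb lam).map (X := fun i => F.obj (O i))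
        (Y := fun i => (W.comb (t i).nu).obj fun j => F.obj (X j))
        (fun i => F.map (t i).iso.hom ≫ (θ.iso (t i).nu X).inv) ≫
      (W.subst lam (fun i => (t i).nu) _ (fun _ => rfl) fun j => F.obj (X j)).hom
  rw [← Category.assoc, Iso.comp_inv_eq, Category.assoc, ← h2, F.map_comp, ← Category.assoc, ← h1,
    h3]
  simp only [Category.assoc]

/-- The isomorphism `F(X) + F(Y) ≅ F(X + Y)`. -/
def muIso (X Y : C) : W.add (F.obj X) (F.obj Y) ≅ F.obj (V.add X Y) := W.toIso (θ.addIso X Y)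

/-- The isomorphism `0 ≅ F(0)`. -/
def epsIso (θ : LinearFunctor V W F) : W.zero ≅ F.obj V.zero :=
  (W.comb fun _ : Fin 0 => 1).mapIso (X := fun i => i.elim0)
    (Y := fun i => F.obj (i.elim0 : C)) (Pi.isoMk fun i => i.elim0) ≪≫
    θ.iso (fun _ => 1) fun i => i.elim0

theorem pre_pre {k : ℕ} {X : Fin k → C} {O O' O'' : C} (t : V.NF X O) (g : O' ≅ O) (f : O'' ≅ O') :
    (t.pre g).pre f = t.pre (f ≪≫ g) := NF.mk_congr (Category.assoc _ _ _).symm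

theorem mapNF_add {k : ℕ} {A : Fin k → C} {X Y : C} (a : V.NF A X) (b : V.NF A Y) :
    (θ.mapNF (a.add b)).pre (θ.muIso X Y) = (θ.mapNF a).add (θ.mapNF b) := by
  let g : ∀ i, pair (F.obj X) (F.obj Y) i ≅ F.obj (pair X Y i) :=
    Fin.cases (Iso.refl _) fun i => Fin.cases (Iso.refl _) (fun i => i.elim0) i
  have h1 : NF.pair (θ.mapNF a) (θ.mapNF b) = fun i => (θ.mapNF (NF.pair a b i)).pre (g i) := by
    funext i
    fin_cases i
    · exact (NF.mk_congr (Category.id_comp _)).symm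
    · exact (NF.mk_congr (Category.id_comp _)).symm
  have h2 := comb_pre (V := W) (fun _ : Fin 2 => (1 : R)) (fun i => θ.mapNF (NF.pair a b i)) g
  refine Eq.trans ?_ ((congrArg (NF.comb fun _ => 1) h1).trans h2).symm
  rw [← mapNF_comb, pre_pre]
  refine congrArg (NF.pre _) (Iso.ext ?_)
  refine congrArg (fun q => q ≫ (θ.iso (fun _ => 1) (pair X Y)).hom) ?_
  refine congrArg (W.comb fun _ : Fin 2 => 1).map (funext fun i => ?_)
  fin_cases i <;> rfl

theorem mapNF_zero {k : ℕ} (A : Fin k → C) :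
    (θ.mapNF (NF.zero A)).pre θ.epsIso = NF.zero fun i => F.obj (A i) := by
  have h2 := comb_pre (V := W) (X := fun i => F.obj (A i))
    (O := fun i => F.obj (i.elim0 : C)) (O' := fun i => i.elim0) (fun _ : Fin 0 => (1 : R))
    (fun i => i.elim0) fun i => i.elim0
  refine Eq.trans ?_ ((congrArg (NF.comb fun _ => 1) (funext fun i => i.elim0)).trans h2).symm
  have h3 := θ.mapNF_comb (X := A) (O := fun i => i.elim0) (fun _ : Fin 0 => (1 : R))
    (fun i => i.elim0)
  have h4 : (NF.comb (V := W) (X := fun i => F.obj (A i)) (O := fun i => F.obj (i.elim0 : C))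
      (fun _ : Fin 0 => (1 : R)) fun i => i.elim0) = _ :=
    (congrArg (NF.comb fun _ => 1) (funext fun i => i.elim0)).trans h3.symm
  rw [h4, pre_pre]
  refine congrArg (NF.pre _) (Iso.ext ?_)
  refine congrArg (fun q => q ≫ (θ.iso (fun _ => 1) _).hom) ?_
  exact congrArg (W.comb fun _ : Fin 0 => 1).map (funext fun i => i.elim0)

theorem can_pre_left {k : ℕ} {X : Fin k → C} {O O' : C} (t : V.NF X O) (g : O' ≅ O)
    (h : (t.pre g).nu = t.nu) : (can (t.pre g) t h).hom = g.hom := by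
  refine (can_mk _ _ _ h).trans ?_
  simp

theorem mapNF_add_nu {k : ℕ} {A : Fin k → C} {X Y : C} (a : V.NF A X) (b : V.NF A Y) :
    ((θ.mapNF a).add (θ.mapNF b)).nu = (θ.mapNF (a.add b)).nu :=
  (congrArg NF.nu (θ.mapNF_add a b)).symm

theorem mapNF_zero_nu {k : ℕ} (A : Fin k → C) :
    (NF.zero fun i => F.obj (A i) : W.NF _ W.zero).nu = (θ.mapNF (NF.zero A)).nu :=
  (congrArg NF.nu (θ.mapNF_zero A)).symm

/-! The isomorphisms `F(X) + F(Y) ≅ F(X + Y)` and `0 ≅ F(0)` are comparisons of two identifications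
with the same linear combination. So are the structure isomorphisms of both Picard groupoids and, by
`map_can`, their images under `F`. Both sides of every coherence condition are then composites of such
comparisons, which are determined by their source and target (`can_trans`). -/

theorem muIso_hom {k : ℕ} {A : Fin k → C} {X Y : C} (a : V.NF A X) (b : V.NF A Y) :
    (θ.muIso X Y).hom = (can ((θ.mapNF a).add (θ.mapNF b)) (θ.mapNF (a.add b))
      (θ.mapNF_add_nu a b)).hom :=
  (can_pre_left (θ.mapNF (a.add b)) (θ.muIso X Y) rfl).symm.trans
    (can_congr (θ.mapNF_add a b) rfl _ _)

theorem epsIso_hom {k : ℕ} (A : Fin k → C) :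
    θ.epsIso.hom = (can (NF.zero fun i => F.obj (A i)) (θ.mapNF (NF.zero A))
      (θ.mapNF_zero_nu A)).hom :=
  (can_pre_left (θ.mapNF (NF.zero A)) θ.epsIso rfl).symm.trans
    (can_congr (θ.mapNF_zero A) rfl _ _)

theorem muIso_nat {X X' Y Y' : C} (f : X ⟶ X') (g : Y ⟶ Y') :
    W.addHom (F.map f) (F.map g) ≫ (θ.muIso X' Y').hom =
      (θ.muIso X Y).hom ≫ F.map (V.addHom f g) := by
  let p : ∀ X Y : C, W.add (F.obj X) (F.obj Y) ⟶
      (W.comb fun _ : Fin 2 => 1).obj fun i => F.obj (pair X Y i) := fun X Y =>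
    (W.comb fun _ : Fin 2 => 1).map (X := pair (F.obj X) (F.obj Y))
      (Y := fun i => F.obj (pair X Y i))
      (Fin.cases (𝟙 (F.obj X)) fun i => Fin.cases (𝟙 (F.obj Y)) (fun i => i.elim0) i)
  have h : W.addHom (F.map f) (F.map g) ≫ p X' Y' = p X Y ≫
      (W.comb fun _ : Fin 2 => 1).map (X := fun i => F.obj (pair X Y i))
        (Y := fun i => F.obj (pair X' Y' i)) fun i => F.map (pairHom f g i) := by
    refine (Functor.map_comp _ _ _).symm.trans
      (Eq.trans (congrArg _ (funext fun i => ?_)) (Functor.map_comp _ _ _))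
    fin_cases i
    · exact (Category.comp_id _).trans (Category.id_comp _).symm
    · exact (Category.comp_id _).trans (Category.id_comp _).symm
  change W.addHom (F.map f) (F.map g) ≫ p X' Y' ≫ (θ.iso (fun _ => 1) (pair X' Y')).hom =
    (p X Y ≫ (θ.iso (fun _ => 1) (pair X Y)).hom) ≫
      F.map ((V.comb fun _ : Fin 2 => 1).map (pairHom f g))
  rw [← Category.assoc, h, Category.assoc, Category.assoc]
  exact congrArg (fun q => p X Y ≫ q) (θ.iso_nat (fun _ => 1) (pairHom f g))

theorem associativity_aux {k : ℕ} {A : Fin k → C} {X Y Z : C} (a : V.NF A X) (b : V.NF A Y)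
    (c : V.NF A Z) :
    W.addHom (θ.muIso X Y).hom (𝟙 (F.obj Z)) ≫ (θ.muIso (V.add X Y) Z).hom ≫
        F.map (assoc X Y Z : V.add (V.add X Y) Z ≅ _).hom =
      (assoc (F.obj X) (F.obj Y) (F.obj Z)).hom ≫ W.addHom (𝟙 (F.obj X)) (θ.muIso Y Z).hom ≫
        (θ.muIso X (V.add Y Z)).hom := by
  rw [assoc_eq a b c, assoc_eq (θ.mapNF a) (θ.mapNF b) (θ.mapNF c), θ.map_can, θ.muIso_hom a b,
    θ.muIso_hom b c, θ.muIso_hom (a.add b) c, θ.muIso_hom a (b.add c),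
    addHom_can_id _ _ (θ.mapNF c), addHom_id_can _ _ (θ.mapNF a)]
  simp only [can_trans]

theorem left_unitality_aux {k : ℕ} {A : Fin k → C} {X : C} (a : V.NF A X) :
    (lunit (F.obj X) : W.add W.zero (F.obj X) ≅ F.obj X).hom =
      W.addHom θ.epsIso.hom (𝟙 (F.obj X)) ≫ (θ.muIso V.zero X).hom ≫
      F.map (lunit X : V.add V.zero X ≅ X).hom := by
  rw [lunit_eq a, lunit_eq (θ.mapNF a), θ.map_can, θ.muIso_hom (NF.zero A) a, θ.epsIso_hom A,
    addHom_can_id _ _ (θ.mapNF a)]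
  simp only [can_trans]

theorem right_unitality_aux {k : ℕ} {A : Fin k → C} {X : C} (a : V.NF A X) :
    (runit (F.obj X) : W.add (F.obj X) W.zero ≅ F.obj X).hom =
      W.addHom (𝟙 (F.obj X)) θ.epsIso.hom ≫ (θ.muIso X V.zero).hom ≫
      F.map (runit X : V.add X V.zero ≅ X).hom := by
  rw [runit_eq a, runit_eq (θ.mapNF a), θ.map_can, θ.muIso_hom a (NF.zero A), θ.epsIso_hom A,
    addHom_id_can _ _ (θ.mapNF a)]
  simp only [can_trans]

theorem braided_aux {k : ℕ} {A : Fin k → C} {X Y : C} (a : V.NF A X) (b : V.NF A Y) :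
    (θ.muIso X Y).hom ≫ F.map (braid X Y : V.add X Y ≅ _).hom =
      (braid (F.obj X) (F.obj Y)).hom ≫ (θ.muIso Y X).hom := by
  rw [braid_eq a b, braid_eq (θ.mapNF a) (θ.mapNF b), θ.map_can, θ.muIso_hom a b,
    θ.muIso_hom b a]
  simp only [can_trans]

/-- The symmetric monoidal functor underlying a morphism of modules in categories. -/
@[reducible]
def toPicard : PicardGroupoid.Functor V.picard W.picard F :=
  letI := V.monoidal
  letI : SymmetricCategory C := V.symmetric
  letI := W.monoidal
  letI : SymmetricCategory D := W.symmetric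
  letI M : F.Monoidal := Functor.CoreMonoidal.toMonoidal
    { εIso := θ.epsIso
      μIso := θ.muIso
      μIso_hom_natural_left := fun {X Y} f X' => by
        have := θ.muIso_nat f (𝟙 X')
        rw [F.map_id] at this
        exact this
      μIso_hom_natural_right := fun {X Y} X' f => by
        have := θ.muIso_nat (𝟙 X') f
        rw [F.map_id] at this
        exact this
      associativity := fun X Y Z => θ.associativity_aux
        (NF.var (triple X Y Z) 0) (NF.var (triple X Y Z) 1) (NF.var (triple X Y Z) 2)
      left_unitality := fun X => θ.left_unitality_aux (NF.var (fun _ : Fin 1 => X) 0)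
      right_unitality := fun X => θ.right_unitality_aux (NF.var (fun _ : Fin 1 => X) 0) }
  show F.Braided from { M with
    braided := fun X Y => θ.braided_aux (NF.var (pair X Y) 0) (NF.var (pair X Y) 1) }

theorem induces_toPicard : θ.Induces θ.toPicard := fun _ _ => rfl

end LinearFunctor

end

end

end DGLie

theorem mainTheorem7 {𝕜 : Type} [RCLike 𝕜] {K : Type} [RCLike K] [NormedAlgebra 𝕜 K]
    {r : WithTop ℕ∞} (hr : r = ∞ ∨ r = ω) (𝔜 𝔛 : DGLie.DGManifold.{u} 𝕜 K r)
    (φ : DGLie.DGManifold.Hom 𝔜 𝔛) (B : DGLie.LieAlgebroid 𝔛.space) (n : ℤ) :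
    Nonempty (DGLie.Canonical B n) ∧
    Nonempty (DGLie.Canonical (DGLie.inverseImage φ.toHom B) n) ∧
    (B.IsLocallyFree → DGLie.PreservesExtensions φ.toHom B n) ∧
    ∀ (h : DGLie.PreservesExtensions φ.toHom B n) (V : DGLie.Canonical B n)
      (W : DGLie.Canonical (DGLie.inverseImage φ.toHom B) n),
      ∃ θ : DGLie.LinearFunctor V.toLinearStructure W.toLinearStructure
          (DGLie.MarkedOver.pullOExt φ.toHom B n h),
        DGLie.IsInduced φ.toHom h V W θ ∧
        (∀ θ', DGLie.IsInduced φ.toHom h V W θ' → θ' = θ) ∧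
        ∃ β : DGLie.PicardGroupoid.Functor V.picard W.picard
            (DGLie.MarkedOver.pullOExt φ.toHom B n h),
          θ.Induces β :=
  ⟨⟨DGLie.canonical B n⟩, ⟨DGLie.canonical _ n⟩,
    DGLie.preservesExtensions_of_isLocallyFree φ.toHom n, fun h V W =>
      ⟨DGLie.PullLinear.linearFunctor φ.toHom h V W,
        DGLie.PullLinear.isInduced_linearFunctor φ.toHom h V W,
        fun _ h' => DGLie.PullLinear.eq_linearFunctor φ.toHom h V W h',
        _, DGLie.LinearFunctor.induces_toPicard _⟩⟩
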